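/- Setting. Let $V=\{0,1\}^n$, $1\le k\le n$, let $d$ be the Hamming distance and $N=\sum_{r=1}^{k}\binom nr$; call $x\ne y$ in $V$ neighbours if $d(x,y)\le k$. For an $n$-qubit pure state $|\psi\rangle$ put $\pi(x)=|\langle x|\psi\rangle|^2$ and $\operatorname{supp}\pi=\{x:\pi(x)\ne0\}$. For constants $c_u',c_u\in\mathbb R$, $c_l>0$, $\alpha>0$, a vertex $x$ is good if $\frac{c_l}{|\operatorname{supp}\pi|}\le\pi(x)\le\frac{c_u}{|\operatorname{supp}\pi|}$, and $|\psi\rangle$ satisfies the $k$-Generalized Local Escape Property ($k$-GLEP) with these constants if - (weight bound) $\pi(x)\le \frac{c_u'}{|\operatorname{supp}\pi|}$ for all $x\in V$; - (smoothness) every $x\in V$ has at least $\alpha N$ good neighbours; - (expansion) any two distinct good vertices $x,y$ with $d(x,y)\le 3k$ are joined, in the graph of neighbours, by at least $\alpha N$ pairwise internally disjoint paths of length at most $5$ all of whose internal vertices are good. The induced Markov chain on $V$ has $P(x,y)=\frac1N\frac{\pi(y)}{\pi(x)+\pi(y)}$ for neighbours $x,y$ (with $0/0:=0$), $P(x,y)=0$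 for other $y\neq x$, and $P(x,x)=1-\sum_{y\ne x}P(x,y)$. Its mixing time is $\tau=\frac1{1-\lambda_1}$, where $\lambda_0\ge\lambda_1\ge\dots$ are the eigenvalues of $P$ with multiplicity. Protocol. For each copy of an unknown state $\rho$, choose a uniformly random set $A$ of $k$ qubits, measure each qubit of $A$ in an independent uniformly random Pauli basis and the others in the $Z$ basis, with outcomes $s$ on $A$ and $z$ off $A$; let $|\Psi_{A,z}\rangle$ be the normalization of $\sum_{u\in\{0,1\}^A}\langle u\Vert z|\psi\rangle|u\rangle$ and $\omega=\langle\Psi_{A,z}|\bigotimes_{i\in A}(3|s_i\rangle\langle s_i|-I)|\Psi_{A,z}\rangle$ (with $\omega:=0$ if that vector vanishes). From $T$ copies, $\hat F$ is the median of the means of $\omega$ over $K=\lceil 2\ln(2/\delta)\rceil$ disjoint batches of size $\lfloor T/K\rfloor$. Theorem. For all $c_u',c_u$ and all $c_l,\alpha>0$ there is a constant $C>0$ such that for all $1\le k\le n$ and every $n$-qubit pure state $|\psi\rangle$ satisfying $k$-GLEP with these constants, $\lambda_1<1$ and $$\tau\le C\,\frac{n^2}{k}.$$ Consequently the fidelity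 $F=\langle\psi|\rho|\psi\rangle$ of every $n$-qubit state $\rho$ can be estimated efficiently by local Pauli measurements: the bias $b=\mathbb E[\omega]-F$ satisfies $0\le b\le(1-\frac1\tau)(1-F)$; and for all $\varepsilon,\delta\in(0,1)$ and $c_b>0$ with $\frac{c_b}{\tau}<1$ and $b\le(1-\frac{c_b}{\tau})\varepsilon$, and every $$T\ \ge\ C\,2^{2k}\,\frac{(n^2/k)^2}{(c_b\varepsilon)^2}\,\ln\frac2\delta ,$$ the protocol on $T$ copies of $\rho$ outputs $\hat F$ with $|\hat F-F|\le\varepsilon$ with probability at least $1-\delta$. -/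

import Mathlib

noncomputable section

open scoped Classical ComplexOrder

namespace GLEP

/-- The vertex set `{0,1}^n`; it also labels the computational basis of `n` qubits. -/
abbrev Vertex (n : ℕ) : Type := Fin n → Bool

/-- `|supp π|`, where `supp π = {x : π x ≠ 0}`. -/
def suppCard {n : ℕ} (π : Vertex n → ℝ) : ℕ :=
  (Finset.univ.filter fun x => π x ≠ 0).card

/-- `N = ∑_{r=1}^k C(n,r)`, the number of vertices at Hamming distance between `1` and `k`
from a given vertex. -/
def numNeighbors (n k : ℕ) : ℕ := ∑ r ∈ Finset.Icc 1 k, n.choose r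

/-- The graph on `{0,1}^n` joining distinct vertices at Hamming distance at most `k`. -/
def hypercubeGraph (n k : ℕ) : SimpleGraph (Vertex n) where
  Adj x y := x ≠ y ∧ hammingDist x y ≤ k
  symm := ⟨fun x y h => ⟨h.1.symm, by rw [hammingDist_comm]; exact h.2⟩⟩
  loopless := ⟨fun _ h => h.1 rfl⟩

/-- `(c_u, c_l)`-good vertices. -/
def IsGood {n : ℕ} (cu cl : ℝ) (π : Vertex n → ℝ) (x : Vertex n) : Prop :=
  cl / (suppCard π : ℝ) ≤ π x ∧ π x ≤ cu / (suppCard π : ℝ)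

/-- The `k`-generalized local escape property of a distribution `π` on `{0,1}^n`, with
constants `c_u'`, `c_u`, `c_l` and `α`. -/
structure HasGLEP {n : ℕ} (cu' cu cl α : ℝ) (k : ℕ) (π : Vertex n → ℝ) : Prop where
  weight_bound : ∀ x, π x ≤ cu' / (suppCard π : ℝ)
  smoothness : ∀ x, α * (numNeighbors n k : ℝ) ≤
    ((Finset.univ.filter fun y => (hypercubeGraph n k).Adj x y ∧ IsGood cu cl π y).card : ℝ)
  /-- `S` is a set of (simple) paths from `x` to `y`: short, with good internal vertices, and
  any two distinct ones share no vertex besides `x` and `y`. -/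
  expansion : ∀ x y, x ≠ y → IsGood cu cl π x → IsGood cu cl π y → hammingDist x y ≤ 3 * k →
    ∃ S : Finset ((hypercubeGraph n k).Path x y),
      α * (numNeighbors n k : ℝ) ≤ (S.card : ℝ) ∧
      (∀ p ∈ S, p.1.length ≤ 5 ∧
        ∀ v ∈ p.1.support, v ≠ x → v ≠ y → IsGood cu cl π v) ∧
      (∀ p ∈ S, ∀ q ∈ S, p ≠ q →
        ∀ v, v ∈ p.1.support → v ∈ q.1.support → v = x ∨ v = y)

/-- The rate of the move `x → y`, for `x ≠ y`. If `π x = π y = 0` the ratio `0 / 0` is read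
as `0`. -/
def moveProb {n : ℕ} (k : ℕ) (π : Vertex n → ℝ) (x y : Vertex n) : ℝ :=
  if (hypercubeGraph n k).Adj x y then 1 / (numNeighbors n k : ℝ) * (π y / (π x + π y)) else 0

/-- The transition matrix `P` of the `k`-bit-flip Markov chain induced by `π`. -/
def transitionMatrix {n : ℕ} (k : ℕ) (π : Vertex n → ℝ) : Matrix (Vertex n) (Vertex n) ℝ :=
  Matrix.of fun x y =>
    if x = y then 1 - ∑ z ∈ Finset.univ.erase x, moveProb k π x z else moveProb k π x y

/-- The second entry `λ₁` of the list `λ₀ ≥ λ₁ ≥ …` of the real eigenvalues of a real matrix,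
in decreasing order and with algebraic multiplicity. (The matrix of a reversible chain with at
least two states has only real eigenvalues, so that `λ₁` exists; the default is not used.) -/
def secondEigenvalue {ι : Type*} [Fintype ι] [DecidableEq ι] (P : Matrix ι ι ℝ) : ℝ :=
  (P.charpoly.roots.sort (fun a b => b ≤ a)).getD 1 0

/-- An `n`-qubit vector, as its amplitudes `Ψ(x) = ⟨x|ψ⟩`. -/
abbrev QVec (n : ℕ) : Type := EuclideanSpace ℂ (Vertex n)

/-- `π(x) = |⟨x|ψ⟩|²`. -/
def distribution {n : ℕ} (ψ : QVec n) (x : Vertex n) : ℝ := ‖ψ x‖ ^ 2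

/-- `λ₁` of the chain induced by `|ψ⟩`. -/
def chainLambda {n : ℕ} (k : ℕ) (ψ : QVec n) : ℝ :=
  secondEigenvalue (transitionMatrix k (distribution ψ))

/-- The mixing time `τ = 1 / (1 - λ₁)` (inverse spectral gap) of the induced chain. -/
def mixingTime {n : ℕ} (k : ℕ) (ψ : QVec n) : ℝ := 1 / (1 - chainLambda k ψ)

/-- Operators on `n` qubits, as matrices in the computational basis. -/
abbrev QOp (n : ℕ) : Type := Matrix (Vertex n) (Vertex n) ℂ

/-- Density matrices. -/
def IsDensity {n : ℕ} (ρ : QOp n) : Prop := ρ.PosSemidef ∧ ρ.trace = 1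

/-- `⟨v|ρ|v⟩`, the probability of the outcome `|v⟩` for a unit vector `v`. -/
def expectation {n : ℕ} (v : Vertex n → ℂ) (ρ : QOp n) : ℝ :=
  (∑ x, ∑ y, (starRingEnd ℂ) (v x) * ρ x y * v y).re

/-- The fidelity `F = ⟨ψ|ρ|ψ⟩`. -/
def fidelity {n : ℕ} (ψ : QVec n) (ρ : QOp n) : ℝ := expectation (fun x => ψ x) ρ

/-- The three single-qubit Pauli bases. -/
inductive Pauli where
  | X | Y | Z
  deriving DecidableEq

instance : Fintype Pauli where
  elems := {Pauli.X, Pauli.Y, Pauli.Z}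
  complete := by intro b; cases b <;> simp

/-- `basisVec b s` is the eigenvector `|s⟩` of the Pauli `b`, in computational-basis
coordinates: outcome `false` is the eigenvalue `+1`, outcome `true` the eigenvalue `-1`. -/
def basisVec : Pauli → Bool → Bool → ℂ
  | Pauli.X, s, a => (if s = true ∧ a = true then -1 else 1) / (Real.sqrt 2 : ℂ)
  | Pauli.Y, s, a =>
      (if a = true then (if s = true then -Complex.I else Complex.I) else 1) / (Real.sqrt 2 : ℂ)
  | Pauli.Z, s, a => if a = s then 1 else 0

/-- The data of one round: the set `A` of qubits measured in random Pauli bases, the basis used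
on every qubit (it is `Z` off `A`), and the outcomes (`s` on `A`, `z` off `A`). -/
abbrev Round (n : ℕ) : Type := Finset (Fin n) × (Fin n → Pauli) × (Fin n → Bool)

/-- The probability of the data `m` when one copy of `ρ` is measured: `A` is a uniformly random
`k`-subset, each qubit of `A` gets an independent uniform Pauli basis, the other qubits are
measured in the basis `Z`, and the outcomes follow the Born rule. -/
def roundProb {n : ℕ} (k : ℕ) (ρ : QOp n) (m : Round n) : ℝ :=
  if m.1.card = k ∧ ∀ i, i ∉ m.1 → m.2.1 i = Pauli.Z then
    1 / (n.choose k : ℝ) * (1 / 3 ^ k) *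
      expectation (fun x => ∏ i, basisVec (m.2.1 i) (m.2.2 i) (x i)) ρ
  else 0

/-- The bitstring equal to `u` on `A` and to `z` off `A`. -/
def insertBits {n : ℕ} (A : Finset (Fin n)) (z : Vertex n) (u : A → Bool) : Vertex n :=
  fun i => if h : i ∈ A then u ⟨i, h⟩ else z i

/-- An entry of the single-qubit classical shadow `3 |s⟩⟨s| - I`. -/
def shadowEntry (b : Pauli) (s a a' : Bool) : ℂ :=
  3 * basisVec b s a * (starRingEnd ℂ) (basisVec b s a') - (if a = a' then 1 else 0)

/-- The local overlap `ω = ⟨Ψ_{A,z}| ⊗_{i ∈ A} (3 |s_i⟩⟨s_i| - I) |Ψ_{A,z}⟩`, where `Ψ_{A,z}` is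
the normalization of the vector with amplitudes `Ψ(u ‖ z)`, `u ∈ {0,1}^A`. (If that vector
vanishes, the value is `0`.) -/
def localOverlap {n : ℕ} (ψ : QVec n) (m : Round n) : ℝ :=
  (∑ u : m.1 → Bool, ∑ v : m.1 → Bool,
      (starRingEnd ℂ) (ψ (insertBits m.1 m.2.2 u)) *
        (∏ i : m.1, shadowEntry (m.2.1 i) (m.2.2 i) (u i) (v i)) *
        ψ (insertBits m.1 m.2.2 v)).re /
    ∑ u : m.1 → Bool, ‖ψ (insertBits m.1 m.2.2 u)‖ ^ 2

/-- `𝔼[ω]`. -/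
def meanOverlap {n : ℕ} (k : ℕ) (ψ : QVec n) (ρ : QOp n) : ℝ :=
  ∑ m : Round n, roundProb k ρ m * localOverlap ψ m

/-- The median of `K` reals: the middle entry of the sorted list, or the average of the two
middle entries if `K` is even. -/
def median {K : ℕ} (v : Fin K → ℝ) : ℝ :=
  let l := (Finset.univ.val.map v).sort (fun a b => a ≤ b)
  (l.getD ((K - 1) / 2) 0 + l.getD (K / 2) 0) / 2

/-- The mean of the `j`-th of the `K` disjoint consecutive batches of size `⌊T / K⌋`. -/
def batchMean {T : ℕ} (K : ℕ) (w : Fin T → ℝ) (j : Fin K) : ℝ :=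
  (∑ t ∈ Finset.univ.filter
      (fun t : Fin T => (j : ℕ) * (T / K) ≤ (t : ℕ) ∧ (t : ℕ) < ((j : ℕ) + 1) * (T / K)), w t) /
    ((T / K : ℕ) : ℝ)

/-- The output `F̂` of the protocol on the data of `T` rounds: the median of the `K` batch means
of the local overlaps. -/
def estimate {n T : ℕ} (K : ℕ) (ψ : QVec n) (data : Fin T → Round n) : ℝ :=
  median (batchMean K fun t => localOverlap ψ (data t))

/-- The probability of an event on the data of `T` independent rounds, one copy of `ρ` each. -/
def dataProb {n : ℕ} (k T : ℕ) (ρ : QOp n) (E : (Fin T → Round n) → Prop) : ℝ :=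
  ∑ data ∈ Finset.univ.filter E, ∏ t, roundProb k ρ (data t)

end GLEP

end

noncomputable section

open scoped Classical

namespace GLEP

/-! Spectral gap. Rescaling by `√π` makes the transition matrix symmetric, so the gap is the best
`γ` with `γ ∑ w² ≤ dirichlet k π w` for all `w` orthogonal to `√π` (`gap_mul_le_dirichlet`,
`secondEigenvalue_transitionMatrix_le`). Every vertex has `α N` good neighbours, and on good
vertices `π` is of order `1 / |supp π|`; hence the weights can be removed, and
`exists_mixingTime_le` follows from an unweighted Poincaré inequality on the good vertices,
`exists_poincare`.

The good vertices may sit anywhere in the cube. A function `f` on them is therefore replaced by a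
field on the whole cube: `F v` is a median of `f` over the good neighbours of `v`. The Efron-Stein
inequality for `F` leaves single flips to be controlled, `k N ∑ (F v - F (flip {i} v))² ≤ C n²
edgeEnergy` (`exists_sum_flip_le`). Medians help because any `v`, `w` have sets of at least `α N /
2` good neighbours each such that every pair between the two sets has an increment of `f` no smaller
than that of `F`. There are three regimes.

Large `k`: two families of positive density among the sets of size at most `k` are joined by a
positive fraction of the pairs at each prescribed distance near `min k (n / 2)`, of one suitable
parity. This is a reverse hypercontractive inequality on a biased cube, moved to slices by averaging
over nested sets and by a continuity bound in the size of the intersection (`le_corr`,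
`le_sum_corr`). Such pairs are edges. Fixing the parity of the distance can cost a factor `n / k`
and the sum over coordinates costs another `n`; this is the origin of `n² / k`.

Fixed `k` and large `n`: almost all moves have size exactly `k`, and the far ends typically differ
in `2 k + z` bits with `z` equal to `k` or `k - 1`, too many for one edge. Here expansion enters.
Almost all of the disjoint paths leave the subcube to be crossed, and with at most five steps such a
path must flip a set `O`, cross in three steps, and flip `O` back (`detour_structure`). Counting
these detours bounds the jumps of `F` along `k` and `k - 1` bits, and two such jumps make a single
flip.

The finitely many remaining pairs `(n, k)` cost only a constant (`sum_flip_le_of_expands`).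

Bias. Classical shadows are unbiased, so the mean overlap averages, over `k`-sets `A`, the quadratic
form of the projection onto `√π` times functions independent of the bits in `A`. The component of
the state along `ψ` contributes exactly the fidelity. On its complement, comparing each projection
with exchanges along the moves inside `A` bounds the average by `∑ w² - dirichlet`, hence by `λ₁ ∑
w²` (`sum_blockForm_le`, `bias_bounds`).

Sampling. One overlap is at most `2 ^ k` in absolute value, so the median of means concentrates
within `c_b ε / τ` of its mean (`le_dataProb`), which is the room left by the assumption on the
bias. -/

/-! ### Bit flips and difference sets. -/

/-- The vertex obtained from `x` by flipping the bits in `A`. -/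
def flip {n : ℕ} (A : Finset (Fin n)) (x : Vertex n) : Vertex n :=
  fun i => xor (x i) (decide (i ∈ A))

lemma flip_apply {n : ℕ} (A : Finset (Fin n)) (x : Vertex n) (i : Fin n) :
    flip A x i = xor (x i) (decide (i ∈ A)) := rfl

lemma flip_flip {n : ℕ} (A B : Finset (Fin n)) (x : Vertex n) :
    flip A (flip B x) = flip (symmDiff A B) x := by
  funext i
  by_cases hA : i ∈ A <;> by_cases hB : i ∈ B <;> cases h : x i <;>
    simp [flip_apply, Finset.mem_symmDiff, hA, hB, h]

lemma flip_empty {n : ℕ} (x : Vertex n) : flip ∅ x = x := by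
  funext i; simp [flip_apply]

lemma flip_self {n : ℕ} (A : Finset (Fin n)) (x : Vertex n) : flip A (flip A x) = x := by
  rw [flip_flip, symmDiff_self]; exact flip_empty x

/-- The set of coordinates in which `x` and `y` differ. -/
def diff {n : ℕ} (x y : Vertex n) : Finset (Fin n) := Finset.univ.filter fun i => x i ≠ y i

lemma mem_diff {n : ℕ} (x y : Vertex n) (i : Fin n) : i ∈ diff x y ↔ x i ≠ y i := by
  simp [diff]

lemma flip_diff {n : ℕ} (x y : Vertex n) : flip (diff x y) x = y := by
  funext i
  by_cases h : x i = y i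
  · simp [flip_apply, mem_diff, h]
  · cases hx : x i <;> cases hy : y i <;> simp_all [flip_apply, mem_diff]

lemma diff_flip {n : ℕ} (x : Vertex n) (A : Finset (Fin n)) : diff x (flip A x) = A := by
  ext i
  by_cases h : i ∈ A <;> cases hx : x i <;> simp [mem_diff, flip_apply, h, hx]

lemma hammingDist_eq_card_diff {n : ℕ} (x y : Vertex n) : hammingDist x y = (diff x y).card := by
  simp only [hammingDist, diff]

lemma hammingDist_flip {n : ℕ} (x : Vertex n) (A : Finset (Fin n)) :
    hammingDist x (flip A x) = A.card := by
  rw [hammingDist_eq_card_diff, diff_flip]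

/-- Flipping the bits in `A` as a permutation of the vertices. -/
def flipEquiv {n : ℕ} (A : Finset (Fin n)) : Vertex n ≃ Vertex n where
  toFun := flip A
  invFun := flip A
  left_inv := flip_self A
  right_inv := flip_self A

/-- The vertices are parametrized by their difference sets from `x`. -/
def diffEquiv {n : ℕ} (x : Vertex n) : Finset (Fin n) ≃ Vertex n where
  toFun A := flip A x
  invFun y := diff x y
  left_inv A := diff_flip x A
  right_inv y := flip_diff x y

lemma sum_vertex_eq_sum_flip {n : ℕ} (x : Vertex n) (g : Vertex n → ℝ) :
    ∑ y, g y = ∑ A : Finset (Fin n), g (flip A x) :=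
  ((diffEquiv x).sum_comp g).symm

lemma sum_flip {n : ℕ} (A : Finset (Fin n)) (g : Vertex n → ℝ) :
    ∑ x, g (flip A x) = ∑ x, g x :=
  (flipEquiv A).sum_comp g

lemma adj_flip {n k : ℕ} (x : Vertex n) (A : Finset (Fin n)) :
    (hypercubeGraph n k).Adj x (flip A x) ↔ 1 ≤ A.card ∧ A.card ≤ k := by
  have h : x ≠ flip A x ↔ 1 ≤ A.card := by
    rw [← hammingDist_flip x A, Nat.one_le_iff_ne_zero, Ne, Ne, hammingDist_eq_zero]
  change x ≠ flip A x ∧ hammingDist x (flip A x) ≤ k ↔ _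
  rw [h, hammingDist_flip]

/-- The nonempty sets of at most `k` coordinates. -/
def moves (n k : ℕ) : Finset (Finset (Fin n)) :=
  Finset.univ.filter fun A => 1 ≤ A.card ∧ A.card ≤ k

lemma mem_moves {n k : ℕ} (A : Finset (Fin n)) : A ∈ moves n k ↔ 1 ≤ A.card ∧ A.card ≤ k := by
  simp [moves]

lemma card_moves (n k : ℕ) : (moves n k).card = numNeighbors n k := by
  have h : moves n k = (Finset.Icc 1 k).biUnion fun r => Finset.powersetCard r Finset.univ := by
    ext A
    simp [mem_moves, Finset.mem_powersetCard]
  rw [h, Finset.card_biUnion]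
  · simp [numNeighbors]
  · intro i _ j _ hij
    exact Finset.pairwise_disjoint_powersetCard _ hij

lemma sum_adj_eq_sum_moves {n k : ℕ} (x : Vertex n) (g : Vertex n → ℝ) :
    (∑ y, if (hypercubeGraph n k).Adj x y then g y else 0) = ∑ A ∈ moves n k, g (flip A x) := by
  rw [sum_vertex_eq_sum_flip x, moves, Finset.sum_filter]
  exact Finset.sum_congr rfl fun A _ => by simp only [adj_flip]

lemma card_filter_adj {n k : ℕ} (x : Vertex n) (p : Vertex n → Prop) :
    (Finset.univ.filter fun y => (hypercubeGraph n k).Adj x y ∧ p y).card =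
      ((moves n k).filter fun A => p (flip A x)).card := by
  symm
  apply Finset.card_bij (fun A _ => flip A x)
  · intro A hA
    simp only [Finset.mem_filter, mem_moves] at hA
    simpa [adj_flip] using hA
  · intro A _ B _ h
    exact (diffEquiv x).injective h
  · intro y hy
    refine ⟨diff x y, ?_, flip_diff x y⟩
    simp only [Finset.mem_filter, Finset.mem_univ, true_and] at hy
    have := hy.1
    rw [← flip_diff x y, adj_flip] at this
    simp only [Finset.mem_filter, mem_moves, flip_diff]
    exact ⟨this, hy.2⟩

lemma numNeighbors_pos {n k : ℕ} (hk : 1 ≤ k) (hkn : k ≤ n) : 0 < numNeighbors n k := by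
  unfold numNeighbors
  exact lt_of_lt_of_le (Nat.choose_pos (by omega : 1 ≤ n))
    (Finset.single_le_sum (f := fun r => n.choose r) (fun _ _ => Nat.zero_le _)
      (Finset.mem_Icc.2 ⟨le_rfl, hk⟩))

lemma sum_insertNth {Λ : Type*} [Fintype Λ] {m : ℕ} (i : Fin (m + 1))
    (g : (Fin (m + 1) → Λ) → ℝ) :
    ∑ v, g v = ∑ b, ∑ u : Fin m → Λ, g (i.insertNth (α := fun _ => Λ) b u) := by
  rw [← (Fin.insertNthEquiv (fun _ => Λ) i).sum_comp, Fintype.sum_prod_type]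
  rfl

/-! ### Edge energy, the Efron-Stein inequality and medians. -/

/-- The sum of the squared increments of `f` over the (ordered) edges between good vertices. -/
def edgeEnergy {n : ℕ} (k : ℕ) (good : Vertex n → Prop) (f : Vertex n → ℝ) : ℝ :=
  ∑ x, ∑ y, if (hypercubeGraph n k).Adj x y ∧ good x ∧ good y then (f x - f y) ^ 2 else 0

lemma edgeEnergy_nonneg {n : ℕ} (k : ℕ) (good : Vertex n → Prop) (f : Vertex n → ℝ) :
    0 ≤ edgeEnergy k good f :=
  Finset.sum_nonneg fun _ _ => Finset.sum_nonneg fun _ _ => by split_ifs <;> positivity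

lemma sum_sum_sub_sq {ι : Type*} (s : Finset ι) (f : ι → ℝ) :
    ∑ x ∈ s, ∑ y ∈ s, (f x - f y) ^ 2 = 2 * (s.card * ∑ x ∈ s, f x ^ 2 - (∑ x ∈ s, f x) ^ 2) := by
  have h : ∀ x ∈ s, ∑ y ∈ s, (f x - f y) ^ 2 =
      s.card * f x ^ 2 - 2 * f x * (∑ y ∈ s, f y) + ∑ y ∈ s, f y ^ 2 := by
    intro x _
    simp only [sub_sq, Finset.sum_add_distrib, Finset.sum_sub_distrib, Finset.sum_const,
      nsmul_eq_mul, Finset.mul_sum]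
  rw [Finset.sum_congr rfl h]
  simp only [Finset.sum_add_distrib, Finset.sum_sub_distrib, Finset.sum_const, nsmul_eq_mul,
    ← Finset.mul_sum, ← Finset.sum_mul]
  ring

lemma flip_singleton_insertNth {m : ℕ} (i : Fin (m + 1)) (b : Bool) (u : Vertex m) :
    flip {i} (i.insertNth (α := fun _ => Bool) b u) = i.insertNth (α := fun _ => Bool) (!b) u := by
  funext j
  refine Fin.succAboveCases i ?_ (fun l => ?_) j
  · simp [flip_apply]
  · simp [flip_apply, Fin.succAbove_ne]

/-- The Efron-Stein inequality on the discrete cube. -/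
lemma sum_sub_sq_le_sum_flip {n : ℕ} (F : Vertex n → ℝ) :
    ∑ v, ∑ w, (F v - F w) ^ 2 ≤ 2 ^ n / 2 * ∑ v, ∑ i, (F v - F (flip {i} v)) ^ 2 := by
  induction n with
  | zero =>
    have h : ∀ v w : Vertex 0, v = w := fun v w => Subsingleton.elim v w
    have h' : ∀ v w : Vertex 0, (F v - F w) ^ 2 = 0 := fun v w => by rw [h v w]; ring
    simp [h']
  | succ n ih =>
    set G : Bool → Vertex n → ℝ := fun b u => F (Fin.insertNth (α := fun _ => Bool) 0 b u) with hG
    have e1 : ∀ b : Bool, ∀ u : Vertex n,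
        ∑ i, (F (Fin.insertNth (α := fun _ => Bool) 0 b u) -
          F (flip {i} (Fin.insertNth (α := fun _ => Bool) 0 b u))) ^ 2 =
        (G b u - G (!b) u) ^ 2 + ∑ i, (G b u - G b (flip {i} u)) ^ 2 := by
      intro b u
      rw [Fin.sum_univ_succ, flip_singleton_insertNth]
      congr 1
      refine Finset.sum_congr rfl fun i _ => ?_
      have : flip {i.succ} (Fin.insertNth (α := fun _ => Bool) 0 b u) =
          Fin.insertNth (α := fun _ => Bool) 0 b (flip {i} u) := by
        funext j
        refine Fin.cases ?_ (fun l => ?_) j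
        · simp [flip_apply, (Fin.succ_ne_zero i).symm]
        · simp [flip_apply]
      rw [this]
    rw [sum_sum_sub_sq, sum_insertNth 0 (fun v => F v ^ 2), sum_insertNth 0 F,
      sum_insertNth 0 (fun v => ∑ i, (F v - F (flip {i} v)) ^ 2)]
    simp only [e1, Fintype.sum_bool, Finset.sum_add_distrib, Bool.not_true, Bool.not_false]
    -- The sum over pairs for `F` equals twice those of the two halves plus `2 (∑ G true - ∑ G
    -- false) ^ 2`; Cauchy-Schwarz turns the last term into flips of the split coordinate.
    have h0 := ih (G false)
    have h1 := ih (G true)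
    rw [sum_sum_sub_sq] at h0 h1
    have hc : ((Finset.univ : Finset (Vertex n)).card : ℝ) = 2 ^ n := by simp
    have hc' : ((Finset.univ : Finset (Vertex (n + 1))).card : ℝ) = 2 * 2 ^ n := by
      simp [pow_succ, mul_comm]
    rw [hc] at h0 h1
    rw [hc']
    have hcs : (∑ u, (G true u - G false u)) ^ 2 ≤ 2 ^ n * ∑ u, (G true u - G false u) ^ 2 := by
      have := sq_sum_le_card_mul_sum_sq (s := (Finset.univ : Finset (Vertex n)))
        (f := fun u => G true u - G false u)
      rwa [hc] at this
    rw [Finset.sum_sub_distrib] at hcs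
    have hsym : ∑ u, (G false u - G true u) ^ 2 = ∑ u, (G true u - G false u) ^ 2 :=
      Finset.sum_congr rfl fun u _ => by ring
    rw [hsym]
    change 2 * (2 * 2 ^ n * (∑ u, G true u ^ 2 + ∑ u, G false u ^ 2) -
      (∑ u, G true u + ∑ u, G false u) ^ 2) ≤ _
    rw [pow_succ' (2 : ℝ) n]
    linarith [h0, h1, hcs]

/-- The median is the least value with at least half of the points at or below it. If fewer than
half were at or above it, more than half would lie strictly below, and the largest value among those
would be a smaller candidate. -/
lemma exists_median {ι : Type*} (s : Finset ι) (f : ι → ℝ) :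
    ∃ a : ℝ, (s.card : ℝ) / 2 ≤ ((s.filter fun y => f y ≤ a).card : ℝ) ∧
      (s.card : ℝ) / 2 ≤ ((s.filter fun y => a ≤ f y).card : ℝ) := by
  rcases s.eq_empty_or_nonempty with rfl | hs
  · exact ⟨0, by simp⟩
  set T := s.filter fun x => (s.card : ℝ) / 2 ≤ ((s.filter fun y => f y ≤ f x).card : ℝ) with hT
  have hTn : T.Nonempty := by
    obtain ⟨x, hx, hmax⟩ := s.exists_max_image f hs
    refine ⟨x, Finset.mem_filter.2 ⟨hx, ?_⟩⟩
    rw [Finset.filter_true_of_mem fun y hy => hmax y hy]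
    have : (0 : ℝ) ≤ s.card := by positivity
    linarith
  obtain ⟨x, hx, hmin⟩ := T.exists_min_image f hTn
  obtain ⟨hxs, hxc⟩ := Finset.mem_filter.1 hx
  refine ⟨f x, hxc, ?_⟩
  by_contra hlt
  push Not at hlt
  have hsum : (s.filter fun y => f x ≤ f y).card + (s.filter fun y => ¬ f x ≤ f y).card = s.card :=
    Finset.card_filter_add_card_filter_not _
  have hlow : (s.card : ℝ) / 2 < ((s.filter fun y => ¬ f x ≤ f y).card : ℝ) := by
    have : ((s.filter fun y => f x ≤ f y).card : ℝ) + (s.filter fun y => ¬ f x ≤ f y).card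
      = s.card := by exact_mod_cast hsum
    linarith
  have hne : (s.filter fun y => ¬ f x ≤ f y).Nonempty := by
    rw [Finset.nonempty_iff_ne_empty]
    intro h0
    rw [h0] at hlow
    have : (0 : ℝ) ≤ s.card := by positivity
    simp at hlow
    linarith
  obtain ⟨z, hz, hzmax⟩ := Finset.exists_max_image _ f hne
  obtain ⟨hzs, hzx⟩ := Finset.mem_filter.1 hz
  have hzT : z ∈ T := by
    refine Finset.mem_filter.2 ⟨hzs, hlow.le.trans ?_⟩
    exact_mod_cast Finset.card_le_card fun y hy =>
      Finset.mem_filter.2 ⟨(Finset.mem_filter.1 hy).1, hzmax y hy⟩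
  exact hzx (hmin z hzT)

/-! ### Product weights -/

lemma sum_prod_weight {Λ : Type*} [Fintype Λ] (m : ℕ) (q : Λ → ℝ) (hq : ∑ a, q a = 1) :
    ∑ ω : Fin m → Λ, ∏ i, q (ω i) = 1 := by
  rw [← Fintype.sum_pow, hq, one_pow]

lemma prod_insertNth_zero {Λ : Type*} {m : ℕ} (q : Λ → ℝ) (a : Λ) (u : Fin m → Λ) :
    ∏ i, q ((Fin.insertNth (α := fun _ => Λ) 0 a u) i) = q a * ∏ i, q (u i) := by
  rw [Fin.prod_univ_succ]; simp

lemma sum_insertNth_zero {Λ : Type*} {m : ℕ} (φ : Λ → ℝ) (a : Λ) (u : Fin m → Λ) :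
    ∑ i, φ ((Fin.insertNth (α := fun _ => Λ) 0 a u) i) = φ a + ∑ i, φ (u i) := by
  rw [Fin.sum_univ_succ]; simp

lemma sum_prod_weight_mul_sum {Λ : Type*} [Fintype Λ] (m : ℕ) (q φ : Λ → ℝ) (hq : ∑ a, q a = 1)
    (hφ : ∑ a, q a * φ a = 0) :
    ∑ ω : Fin m → Λ, (∏ i, q (ω i)) * ∑ i, φ (ω i) = 0 := by
  induction m with
  | zero => simp
  | succ m ih =>
    rw [sum_insertNth 0]
    simp only [prod_insertNth_zero, sum_insertNth_zero]
    have : ∀ a : Λ, ∑ u : Fin m → Λ, q a * (∏ i, q (u i)) * (φ a + ∑ i, φ (u i)) =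
        q a * φ a := by
      intro a
      have h : ∀ u : Fin m → Λ, q a * (∏ i, q (u i)) * (φ a + ∑ i, φ (u i)) =
          q a * φ a * (∏ i, q (u i)) + q a * ((∏ i, q (u i)) * ∑ i, φ (u i)) := fun u => by ring
      simp only [h, Finset.sum_add_distrib, ← Finset.mul_sum, ih, sum_prod_weight m q hq]
      ring
    simp only [this, hφ]

/-- The second moment of a sum of independent centered variables. -/
lemma sum_prod_weight_mul_sum_sq {Λ : Type*} [Fintype Λ] (m : ℕ) (q φ : Λ → ℝ)
    (hq : ∑ a, q a = 1) (hφ : ∑ a, q a * φ a = 0) :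
    ∑ ω : Fin m → Λ, (∏ i, q (ω i)) * (∑ i, φ (ω i)) ^ 2 = m * ∑ a, q a * φ a ^ 2 := by
  induction m with
  | zero => simp
  | succ m ih =>
    rw [sum_insertNth 0]
    simp only [prod_insertNth_zero, sum_insertNth_zero]
    have : ∀ a : Λ, ∑ u : Fin m → Λ, q a * (∏ i, q (u i)) * (φ a + ∑ i, φ (u i)) ^ 2 =
        q a * φ a ^ 2 + q a * (m * ∑ a, q a * φ a ^ 2) := by
      intro a
      have h : ∀ u : Fin m → Λ, q a * (∏ i, q (u i)) * (φ a + ∑ i, φ (u i)) ^ 2 =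
          q a * φ a ^ 2 * (∏ i, q (u i)) + 2 * q a * φ a * ((∏ i, q (u i)) * ∑ i, φ (u i)) +
          q a * ((∏ i, q (u i)) * (∑ i, φ (u i)) ^ 2) := fun u => by ring
      simp only [h, Finset.sum_add_distrib, ← Finset.mul_sum, ih, sum_prod_weight m q hq,
        sum_prod_weight_mul_sum m q φ hq hφ]
      ring
    simp only [this, Finset.sum_add_distrib, ← Finset.sum_mul, hq]
    push_cast
    ring

/-- Cauchy-Schwarz against the probability weight: the first absolute moment is at most the root of
the second. -/
lemma sum_prod_weight_mul_abs_le {Λ : Type*} [Fintype Λ] (m : ℕ) (q φ : Λ → ℝ)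
    (hq0 : ∀ a, 0 ≤ q a) (hq : ∑ a, q a = 1) (hφ : ∑ a, q a * φ a = 0) (v : ℝ)
    (hv : ∑ a, q a * φ a ^ 2 ≤ v) :
    ∑ ω : Fin m → Λ, (∏ i, q (ω i)) * |∑ i, φ (ω i)| ≤ Real.sqrt (m * v) := by
  apply Real.le_sqrt_of_sq_le
  have hw : ∀ ω : Fin m → Λ, 0 ≤ ∏ i, q (ω i) := fun ω => Finset.prod_nonneg fun i _ => hq0 _
  have h := Finset.sum_mul_sq_le_sq_mul_sq (Finset.univ : Finset (Fin m → Λ))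
    (fun ω => Real.sqrt (∏ i, q (ω i))) (fun ω => Real.sqrt (∏ i, q (ω i)) * |∑ i, φ (ω i)|)
  have e1 : ∀ ω : Fin m → Λ, Real.sqrt (∏ i, q (ω i)) * (Real.sqrt (∏ i, q (ω i)) *
      |∑ i, φ (ω i)|) = (∏ i, q (ω i)) * |∑ i, φ (ω i)| := fun ω => by
    rw [← mul_assoc, Real.mul_self_sqrt (hw ω)]
  have e2 : ∀ ω : Fin m → Λ, (Real.sqrt (∏ i, q (ω i)) * |∑ i, φ (ω i)|) ^ 2 =
      (∏ i, q (ω i)) * (∑ i, φ (ω i)) ^ 2 := fun ω => by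
    rw [mul_pow, Real.sq_sqrt (hw ω), sq_abs]
  simp only [e1, e2, Real.sq_sqrt (hw _), sum_prod_weight m q hq, one_mul,
    sum_prod_weight_mul_sum_sq m q φ hq hφ] at h
  exact h.trans (mul_le_mul_of_nonneg_left hv (by positivity))

/-! ### Reverse hypercontractivity on the biased cube -/

/-- The biased measure on a bit. -/
def bitWeight (p : ℝ) (b : Bool) : ℝ := if b then p else 1 - p

/-- A coupling of two biased bits that are both set with probability `p / 2`. -/
def pairWeight (p : ℝ) (b : Bool × Bool) : ℝ := if b.1 || b.2 then p / 2 else 1 - 3 * p / 2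

lemma bitWeight_nonneg {p : ℝ} (h0 : 0 ≤ p) (h1 : p ≤ 1 / 2) (b : Bool) : 0 ≤ bitWeight p b := by
  unfold bitWeight; split_ifs <;> linarith

lemma pairWeight_nonneg {p : ℝ} (h0 : 0 ≤ p) (h1 : p ≤ 1 / 2) (b : Bool × Bool) :
    0 ≤ pairWeight p b := by
  unfold pairWeight; split_ifs <;> linarith

lemma sum_pairWeight (p : ℝ) : ∑ b, pairWeight p b = 1 := by
  rw [Fintype.sum_prod_type]; simp [pairWeight]; ring

lemma sum_bitWeight (p : ℝ) : ∑ b, bitWeight p b = 1 := by simp [bitWeight]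

/-- Up to the factor `1 - p`, the coupling `pairWeight` is one half of two independent bits plus `1
/ 2 - p` of two identical bits. `P` and `R` are the second moments for these two laws, and `s`, `t`
are the means. -/
lemma two_point_reverse_hypercontractivity {p : ℝ} (h0 : 0 ≤ p) (h1 : p ≤ 1 / 2)
    (a0 a1 b0 b1 : ℝ) :
    ((1 - p) * a0 + p * a1) ^ 2 * ((1 - p) * b0 + p * b1) ^ 2 ≤
      p / 2 * (a1 ^ 2 * b1 ^ 2) + p / 2 * (a1 ^ 2 * b0 ^ 2) + p / 2 * (a0 ^ 2 * b1 ^ 2) +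
        (1 - 3 * p / 2) * (a0 ^ 2 * b0 ^ 2) := by
  set s := (1 - p) * a0 + p * a1 with hs
  set t := (1 - p) * b0 + p * b1 with ht
  set P := ((1 - p) * a0 ^ 2 + p * a1 ^ 2) * ((1 - p) * b0 ^ 2 + p * b1 ^ 2) with hP
  set R := (1 - p) * (a0 ^ 2 * b0 ^ 2) + p * (a1 ^ 2 * b1 ^ 2) with hR
  set y := (1 - p) * (a0 * b0) + p * (a1 * b1) with hy
  have hpp : 0 ≤ p * (1 - p) := mul_nonneg h0 (by linarith)
  have e1 : P - (2 * (s * t) - y) ^ 2 = p * (1 - p) * (s * (b0 - b1) + t * (a0 - a1)) ^ 2 := by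
    rw [hP, hs, ht, hy]; ring
  have e2 : R - y ^ 2 = p * (1 - p) * (a0 * b0 - a1 * b1) ^ 2 := by rw [hR, hy]; ring
  have e3 : P - (s * t) ^ 2 = p * (1 - p) * ((a0 - a1) ^ 2 * ((1 - p) * b0 ^ 2 + p * b1 ^ 2) +
      s ^ 2 * (b0 - b1) ^ 2) := by rw [hP, hs, ht]; ring
  have f1 : (2 * (s * t) - y) ^ 2 ≤ P := by
    have := mul_nonneg hpp (sq_nonneg (s * (b0 - b1) + t * (a0 - a1)))
    linarith
  have f2 : y ^ 2 ≤ R := by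
    have := mul_nonneg hpp (sq_nonneg (a0 * b0 - a1 * b1))
    linarith
  have f3 : (s * t) ^ 2 ≤ P := by
    have : 0 ≤ (1 - p) * b0 ^ 2 + p * b1 ^ 2 :=
      add_nonneg (mul_nonneg (by linarith) (sq_nonneg _)) (mul_nonneg h0 (sq_nonneg _))
    have := mul_nonneg hpp (add_nonneg (mul_nonneg (sq_nonneg (a0 - a1)) this)
      (mul_nonneg (sq_nonneg s) (sq_nonneg (b0 - b1))))
    linarith
  -- `s * t` is the average of `2 * (s * t) - y` and `y`, whose squares are at most `P` and `R`.
  have f4 : (s * t) ^ 2 ≤ (P + R) / 2 := by nlinarith [sq_nonneg (2 * (s * t) - y - y)]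
  have hp1 : 0 < 1 - p := by linarith
  have hkey : (1 - p) * (s * t) ^ 2 ≤ P / 2 + (1 / 2 - p) * R := by
    have hm : (1 - 2 * p) * (s * t) ^ 2 ≤ (1 - 2 * p) * ((P + R) / 2) :=
      mul_le_mul_of_nonneg_left f4 (by linarith)
    have hm' : p * (s * t) ^ 2 ≤ p * P := mul_le_mul_of_nonneg_left f3 h0
    linarith
  have e5 : P / 2 + (1 / 2 - p) * R = (1 - p) * (p / 2 * (a1 ^ 2 * b1 ^ 2) +
      p / 2 * (a1 ^ 2 * b0 ^ 2) + p / 2 * (a0 ^ 2 * b1 ^ 2) +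
        (1 - 3 * p / 2) * (a0 ^ 2 * b0 ^ 2)) := by
    rw [hP, hR]; ring
  rw [e5] at hkey
  have := le_of_mul_le_mul_left hkey hp1
  rwa [mul_pow] at this

/-- The two-point inequality tensorizes: conditioning on the first bit, the induction hypothesis
treats the other bits, and the two-point inequality is applied to the conditional sums of the square
roots. -/
lemma reverse_hypercontractivity {p : ℝ} (h0 : 0 ≤ p) (h1 : p ≤ 1 / 2) (m : ℕ)
    (F G : (Fin m → Bool) → ℝ) (hF : ∀ ω, 0 ≤ F ω) (hG : ∀ ω, 0 ≤ G ω) :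
    (∑ ω, (∏ i, bitWeight p (ω i)) * Real.sqrt (F ω)) ^ 2 *
      (∑ ω, (∏ i, bitWeight p (ω i)) * Real.sqrt (G ω)) ^ 2 ≤
    ∑ η : Fin m → Bool × Bool, (∏ i, pairWeight p (η i)) *
      (F (fun i => (η i).1) * G (fun i => (η i).2)) := by
  induction m with
  | zero =>
    rw [Fintype.sum_unique, Fintype.sum_unique, Fintype.sum_unique]
    simp only [Finset.univ_eq_empty, Finset.prod_empty, one_mul, Real.sq_sqrt (hF _),
      Real.sq_sqrt (hG _)]
    exact le_of_eq (congrArg₂ (· * ·) (congrArg F (Subsingleton.elim _ _))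
      (congrArg G (Subsingleton.elim _ _)))
  | succ m ih =>
    have hl : ∀ H : (Fin (m + 1) → Bool) → ℝ,
        ∑ ω, (∏ i, bitWeight p (ω i)) * Real.sqrt (H ω) =
        (1 - p) * (∑ ω : Fin m → Bool, (∏ i, bitWeight p (ω i)) *
            Real.sqrt (H (Fin.insertNth (α := fun _ => Bool) 0 false ω))) +
        p * (∑ ω : Fin m → Bool, (∏ i, bitWeight p (ω i)) *
            Real.sqrt (H (Fin.insertNth (α := fun _ => Bool) 0 true ω))) := by
      intro H
      rw [sum_insertNth 0]
      simp only [prod_insertNth_zero, Fintype.sum_bool, Finset.mul_sum]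
      rw [add_comm]
      simp only [bitWeight, mul_assoc, if_true, Bool.false_eq_true, if_false]
    rw [hl F, hl G, sum_insertNth 0]
    have hp : ∀ (b : Bool × Bool) (u : Fin m → Bool × Bool),
        (fun i => ((Fin.insertNth (α := fun _ => Bool × Bool) 0 b u) i).1) =
          Fin.insertNth (α := fun _ => Bool) 0 b.1 (fun i => (u i).1) ∧
        (fun i => ((Fin.insertNth (α := fun _ => Bool × Bool) 0 b u) i).2) =
          Fin.insertNth (α := fun _ => Bool) 0 b.2 (fun i => (u i).2) := by
      intro b u
      constructor <;> funext i <;> refine Fin.cases ?_ (fun l => ?_) i <;> simp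
    have hr : ∀ b : Bool × Bool, ∑ u : Fin m → Bool × Bool,
        (∏ i, pairWeight p ((Fin.insertNth (α := fun _ => Bool × Bool) 0 b u) i)) *
        (F (fun i => ((Fin.insertNth (α := fun _ => Bool × Bool) 0 b u) i).1) *
          G (fun i => ((Fin.insertNth (α := fun _ => Bool × Bool) 0 b u) i).2)) ≥
        pairWeight p b * ((∑ ω : Fin m → Bool, (∏ i, bitWeight p (ω i)) *
            Real.sqrt (F (Fin.insertNth (α := fun _ => Bool) 0 b.1 ω))) ^ 2 *
          (∑ ω : Fin m → Bool, (∏ i, bitWeight p (ω i)) *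
            Real.sqrt (G (Fin.insertNth (α := fun _ => Bool) 0 b.2 ω))) ^ 2) := by
      intro b
      have := ih (fun ω => F (Fin.insertNth (α := fun _ => Bool) 0 b.1 ω))
        (fun ω => G (Fin.insertNth (α := fun _ => Bool) 0 b.2 ω)) (fun _ => hF _) (fun _ => hG _)
      refine (mul_le_mul_of_nonneg_left this (pairWeight_nonneg h0 h1 b)).trans_eq ?_
      rw [Finset.mul_sum]
      refine Finset.sum_congr rfl fun u _ => ?_
      rw [prod_insertNth_zero, (hp b u).1, (hp b u).2]
      ring
    refine le_trans ?_ (Finset.sum_le_sum fun b _ => hr b)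
    rw [Fintype.sum_prod_type]
    simp only [Fintype.sum_bool]
    refine (two_point_reverse_hypercontractivity h0 h1 _ _ _ _).trans_eq ?_
    simp only [pairWeight, Bool.or_true, Bool.or_false, Bool.false_eq_true, if_true, if_false]
    ring

/-! ### Averages over permutations -/

/-- The image of `A` under the permutation `σ`. -/
def img {m : ℕ} (σ : Equiv.Perm (Fin m)) (A : Finset (Fin m)) : Finset (Fin m) :=
  A.map σ.toEmbedding

lemma mem_img {m : ℕ} (σ : Equiv.Perm (Fin m)) (A : Finset (Fin m)) (i : Fin m) :
    i ∈ img σ A ↔ σ.symm i ∈ A := by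
  unfold img
  rw [Finset.mem_map_equiv]

lemma card_img {m : ℕ} (σ : Equiv.Perm (Fin m)) (A : Finset (Fin m)) : (img σ A).card = A.card :=
  Finset.card_map _

lemma img_mul {m : ℕ} (σ τ : Equiv.Perm (Fin m)) (A : Finset (Fin m)) :
    img (σ * τ) A = img σ (img τ A) := by
  ext i; simp only [mem_img]; rfl

lemma img_symm_img {m : ℕ} (σ : Equiv.Perm (Fin m)) (A : Finset (Fin m)) :
    img σ⁻¹ (img σ A) = A := by
  rw [← img_mul, inv_mul_cancel]; ext i; rw [mem_img]; rfl

lemma img_img_symm {m : ℕ} (σ : Equiv.Perm (Fin m)) (A : Finset (Fin m)) :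
    img σ (img σ⁻¹ A) = A := by
  rw [← img_mul, mul_inv_cancel]; ext i; rw [mem_img]; rfl

/-- The permutation of the subsets induced by a permutation of the ground set. -/
def imgEquiv {m : ℕ} (σ : Equiv.Perm (Fin m)) : Finset (Fin m) ≃ Finset (Fin m) where
  toFun := img σ
  invFun := img σ⁻¹
  left_inv := img_symm_img σ
  right_inv := img_img_symm σ

/-- The average of `h` over the permutations of `Fin m`. -/
def permAvg {m : ℕ} (h : Equiv.Perm (Fin m) → ℝ) : ℝ :=
  (∑ σ, h σ) / (Fintype.card (Equiv.Perm (Fin m)) : ℝ)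

lemma card_perm_pos (m : ℕ) : (0 : ℝ) < (Fintype.card (Equiv.Perm (Fin m)) : ℝ) := by
  exact_mod_cast Fintype.card_pos

lemma permAvg_mul_right {m : ℕ} (τ : Equiv.Perm (Fin m)) (h : Equiv.Perm (Fin m) → ℝ) :
    permAvg (fun σ => h (σ * τ)) = permAvg h := by
  unfold permAvg
  congr 1
  exact Fintype.sum_equiv (Equiv.mulRight τ) _ _ fun σ => rfl

lemma permAvg_const {m : ℕ} (c : ℝ) : permAvg (fun _ : Equiv.Perm (Fin m) => c) = c := by
  unfold permAvg
  rw [Finset.sum_const, nsmul_eq_mul, Finset.card_univ, mul_comm, mul_div_assoc,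
    div_self (card_perm_pos m).ne', mul_one]

lemma permAvg_mono {m : ℕ} {h h' : Equiv.Perm (Fin m) → ℝ} (H : ∀ σ, h σ ≤ h' σ) :
    permAvg h ≤ permAvg h' :=
  div_le_div_of_nonneg_right (Finset.sum_le_sum fun σ _ => H σ) (card_perm_pos m).le

lemma permAvg_add {m : ℕ} (h h' : Equiv.Perm (Fin m) → ℝ) :
    permAvg (fun σ => h σ + h' σ) = permAvg h + permAvg h' := by
  unfold permAvg; rw [Finset.sum_add_distrib, add_div]

lemma permAvg_mul_const {m : ℕ} (c : ℝ) (h : Equiv.Perm (Fin m) → ℝ) :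
    permAvg (fun σ => c * h σ) = c * permAvg h := by
  unfold permAvg; rw [← Finset.mul_sum, mul_div_assoc]

lemma permAvg_sum {m : ℕ} {ι : Type*} (s : Finset ι) (h : ι → Equiv.Perm (Fin m) → ℝ) :
    permAvg (fun σ => ∑ i ∈ s, h i σ) = ∑ i ∈ s, permAvg (h i) := by
  unfold permAvg; rw [Finset.sum_comm, Finset.sum_div]

lemma permAvg_nonneg {m : ℕ} {h : Equiv.Perm (Fin m) → ℝ} (H : ∀ σ, 0 ≤ h σ) : 0 ≤ permAvg h :=
  div_nonneg (Finset.sum_nonneg fun σ _ => H σ) (card_perm_pos m).le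

/-- From `s h h' ≤ (h² + h'²) / 2` with both signs `s`. -/
lemma permAvg_mul_le {m : ℕ} (h h' : Equiv.Perm (Fin m) → ℝ) (v : ℝ)
    (H : permAvg (fun σ => h σ ^ 2) ≤ v) (H' : permAvg (fun σ => h' σ ^ 2) ≤ v) :
    |permAvg (fun σ => h σ * h' σ)| ≤ v := by
  have e : ∀ s : ℝ, s ^ 2 = 1 → s * permAvg (fun σ => h σ * h' σ) ≤ v := by
    intro s hs
    have : permAvg (fun σ => s * (h σ * h' σ)) ≤
        permAvg (fun σ => 1 / 2 * h σ ^ 2 + 1 / 2 * h' σ ^ 2) := by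
      apply permAvg_mono
      intro σ
      nlinarith [sq_nonneg (h σ - s * h' σ), hs]
    rw [permAvg_mul_const, permAvg_add, permAvg_mul_const, permAvg_mul_const] at this
    linarith
  rw [abs_le]
  constructor
  · linarith [e (-1) (by norm_num)]
  · linarith [e 1 (by norm_num)]

/-- The correlation of `F` and `G` on a random pair of sets congruent to `(A, B)`. -/
def corr {m : ℕ} (F G : Finset (Fin m) → ℝ) (A B : Finset (Fin m)) : ℝ :=
  permAvg fun σ => F (img σ A) * G (img σ B)

/-- The three sizes determine the sizes of the four cells of the Venn diagram, so the cells can be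
matched bijectively and the bijections glued. -/
lemma exists_perm_img {m : ℕ} {A B A' B' : Finset (Fin m)} (hA : A.card = A'.card)
    (hB : B.card = B'.card) (hAB : (A ∩ B).card = (A' ∩ B').card) :
    ∃ τ : Equiv.Perm (Fin m), img τ A = A' ∧ img τ B = B' := by
  have key : ∀ c : Prop × Prop, Fintype.card {i : Fin m // ((i ∈ A), (i ∈ B)) = c} =
      Fintype.card {i : Fin m // ((i ∈ A'), (i ∈ B')) = c} := by
    rintro ⟨a, b⟩
    rw [Fintype.card_subtype, Fintype.card_subtype]
    have h1 := Finset.card_inter_add_card_sdiff A B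
    have h1' := Finset.card_inter_add_card_sdiff A' B'
    have h2 := Finset.card_inter_add_card_sdiff B A
    have h2' := Finset.card_inter_add_card_sdiff B' A'
    have h3 := Finset.card_add_card_compl (A ∪ B)
    have h3' := Finset.card_add_card_compl (A' ∪ B')
    have h4 := Finset.card_union_add_card_inter A B
    have h4' := Finset.card_union_add_card_inter A' B'
    rw [Finset.inter_comm B A] at h2
    rw [Finset.inter_comm B' A'] at h2'
    by_cases ha : a <;> by_cases hb : b
    · have e : ∀ X Y : Finset (Fin m), (Finset.univ.filter fun i => ((i ∈ X), (i ∈ Y)) = (a, b)) =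
          X ∩ Y := fun X Y => by ext i; simp [ha, hb]
      rw [e, e]; omega
    · have e : ∀ X Y : Finset (Fin m), (Finset.univ.filter fun i => ((i ∈ X), (i ∈ Y)) = (a, b)) =
          X \ Y := fun X Y => by ext i; simp [ha, hb]
      rw [e, e]; omega
    · have e : ∀ X Y : Finset (Fin m), (Finset.univ.filter fun i => ((i ∈ X), (i ∈ Y)) = (a, b)) =
          Y \ X := fun X Y => by ext i; simp [ha, hb, and_comm]
      rw [e, e]; omega
    · have e : ∀ X Y : Finset (Fin m), (Finset.univ.filter fun i => ((i ∈ X), (i ∈ Y)) = (a, b)) =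
          (X ∪ Y)ᶜ := fun X Y => by ext i; simp [ha, hb]
      rw [e, e]; omega
  let e : Fin m ≃ Fin m := Equiv.ofFiberEquiv (f := fun i => ((i ∈ A), (i ∈ B)))
    (g := fun i => ((i ∈ A'), (i ∈ B'))) fun c => Fintype.equivOfCardEq (key c)
  have he : ∀ i, ((e i ∈ A'), (e i ∈ B')) = ((i ∈ A), (i ∈ B)) := fun i =>
    Equiv.ofFiberEquiv_map (f := fun i => ((i ∈ A), (i ∈ B)))
      (g := fun i => ((i ∈ A'), (i ∈ B'))) (fun c => Fintype.equivOfCardEq (key c)) i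
  refine ⟨e, ?_, ?_⟩
  · ext i
    have := (Prod.ext_iff.1 (he (e.symm i))).1
    simp only [Equiv.apply_symm_apply] at this
    rw [mem_img, ← this]
  · ext i
    have := (Prod.ext_iff.1 (he (e.symm i))).2
    simp only [Equiv.apply_symm_apply] at this
    rw [mem_img, ← this]

/-- With the two sizes fixed, the correlation is therefore a function of one integer, the size of
the intersection. -/
lemma corr_congr {m : ℕ} (F G : Finset (Fin m) → ℝ) {A B A' B' : Finset (Fin m)}
    (hA : A.card = A'.card) (hB : B.card = B'.card) (hAB : (A ∩ B).card = (A' ∩ B').card) :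
    corr F G A B = corr F G A' B' := by
  obtain ⟨τ, rfl, rfl⟩ := exists_perm_img hA hB hAB
  unfold corr
  rw [← permAvg_mul_right τ]
  simp only [img_mul]

lemma permAvg_img_congr {m : ℕ} (F : Finset (Fin m) → ℝ) {A A' : Finset (Fin m)}
    (hA : A.card = A'.card) :
    permAvg (fun σ => F (img σ A)) = permAvg (fun σ => F (img σ A')) := by
  obtain ⟨τ, rfl, -⟩ := exists_perm_img hA hA (by simpa using hA)
  rw [← permAvg_mul_right τ]
  simp only [img_mul]

/-- A random image of a set of size `r` is a uniformly random set of size `r`. -/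
lemma permAvg_img {m : ℕ} (F : Finset (Fin m) → ℝ) (A : Finset (Fin m)) :
    permAvg (fun σ => F (img σ A)) * (m.choose A.card : ℝ) =
      ∑ X ∈ Finset.powersetCard A.card Finset.univ, F X := by
  have h : ∑ B ∈ Finset.powersetCard A.card (Finset.univ : Finset (Fin m)),
      permAvg (fun σ => F (img σ B)) = permAvg (fun σ => F (img σ A)) * (m.choose A.card : ℝ) := by
    rw [Finset.sum_congr rfl fun B hB => permAvg_img_congr F (A' := A)
      (Finset.mem_powersetCard.1 hB).2]
    simp [mul_comm]
  rw [← h, ← permAvg_sum]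
  have : ∀ σ : Equiv.Perm (Fin m), ∑ B ∈ Finset.powersetCard A.card Finset.univ, F (img σ B) =
      ∑ X ∈ Finset.powersetCard A.card Finset.univ, F X := by
    intro σ
    refine Finset.sum_equiv (imgEquiv σ) (fun B => ?_) (fun B _ => rfl)
    simp only [Finset.mem_powersetCard, Finset.subset_univ, true_and]
    change _ ↔ (img σ B).card = _
    rw [card_img]
  simp only [this, permAvg_const]

/-! ### Continuity of the correlation in the size of the intersection -/

/-- The sign `±1` of a bit. -/
def sgn (b : Bool) : ℝ := if b then -1 else 1

lemma sgn_mul_self (b : Bool) : sgn b * sgn b = 1 := by cases b <;> simp [sgn]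

lemma sgn_not (b : Bool) : sgn (!b) = -sgn b := by cases b <;> simp [sgn]

lemma sum_sgn_mul_sgn {b : ℕ} (s t : Fin b) :
    ∑ ε : Fin b → Bool, sgn (ε s) * sgn (ε t) = if s = t then 2 ^ b else 0 := by
  split_ifs with h
  · subst h
    simp [sgn_mul_self]
  · have h1 : ∑ ε : Fin b → Bool, sgn (ε s) * sgn (ε t) =
        ∑ ε : Fin b → Bool, sgn (flip {s} ε s) * sgn (flip {s} ε t) :=
      (sum_flip {s} fun ε : Vertex b => sgn (ε s) * sgn (ε t)).symm
    have h2 : ∀ ε : Fin b → Bool, sgn (flip {s} ε s) * sgn (flip {s} ε t) =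
        -(sgn (ε s) * sgn (ε t)) := by
      intro ε
      have e1 : flip {s} ε s = !(ε s) := by simp [flip_apply]
      have e2 : flip {s} ε t = ε t := by simp [flip_apply, Ne.symm h]
      rw [e1, e2, sgn_not]; ring
    simp only [h2, Finset.sum_neg_distrib] at h1
    linarith

/-- Bessel's inequality for the coordinate functions of the cube. -/
lemma sum_sq_level_one_le {b : ℕ} (H : (Fin b → Bool) → ℝ) (hH : ∀ ε, |H ε| ≤ 1) :
    ∑ t, ((∑ ε, sgn (ε t) * H ε) / 2 ^ b) ^ 2 ≤ 1 := by
  set c : Fin b → ℝ := fun t => (∑ ε, sgn (ε t) * H ε) / 2 ^ b with hc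
  have h2 : (0 : ℝ) < 2 ^ b := by positivity
  -- The squared residual of the projection of `H` to the span of the orthogonal signs.
  have h0 : 0 ≤ ∑ ε, (H ε - ∑ t, c t * sgn (ε t)) ^ 2 := Finset.sum_nonneg fun _ _ => sq_nonneg _
  have e1 : ∑ ε, H ε * ∑ t, c t * sgn (ε t) = 2 ^ b * ∑ t, c t ^ 2 := by
    simp only [Finset.mul_sum]
    rw [Finset.sum_comm]
    refine Finset.sum_congr rfl fun t _ => ?_
    have : ∑ ε, H ε * (c t * sgn (ε t)) = c t * ∑ ε, sgn (ε t) * H ε := by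
      rw [Finset.mul_sum]; exact Finset.sum_congr rfl fun ε _ => by ring
    rw [this]
    have : ∑ ε, sgn (ε t) * H ε = 2 ^ b * c t := by rw [hc]; field_simp
    rw [this]; ring
  have e2 : ∑ ε : Fin b → Bool, (∑ t, c t * sgn (ε t)) ^ 2 = 2 ^ b * ∑ t, c t ^ 2 := by
    have : ∀ ε : Fin b → Bool, (∑ t, c t * sgn (ε t)) ^ 2 =
        ∑ s, ∑ t, c s * c t * (sgn (ε s) * sgn (ε t)) := by
      intro ε
      rw [sq, Finset.sum_mul_sum]
      exact Finset.sum_congr rfl fun s _ => Finset.sum_congr rfl fun t _ => by ring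
    simp only [this]
    rw [Finset.sum_comm, Finset.mul_sum]
    refine Finset.sum_congr rfl fun s _ => ?_
    rw [Finset.sum_comm]
    simp only [← Finset.mul_sum, sum_sgn_mul_sgn, mul_ite, mul_zero, Finset.sum_ite_eq,
      Finset.mem_univ, if_true]
    ring
  have e3 : ∑ ε, H ε ^ 2 ≤ 2 ^ b := by
    calc ∑ ε, H ε ^ 2 ≤ ∑ ε : Fin b → Bool, (1 : ℝ) :=
          Finset.sum_le_sum fun ε _ => by rw [← sq_abs]; exact pow_le_one₀ (abs_nonneg _) (hH ε)
      _ = 2 ^ b := by simp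
  simp only [sub_sq, Finset.sum_add_distrib, Finset.sum_sub_distrib, mul_assoc, ← Finset.mul_sum,
    e1, e2] at h0
  have : 2 ^ b * ∑ t, c t ^ 2 ≤ 2 ^ b * 1 := by linarith
  exact le_of_mul_le_mul_left this h2

/-- The set made of `K` and of one element of each of the pairs `E (t, ·)`. -/
def transversal {b m : ℕ} (K : Finset (Fin m)) (E : Fin b × Bool ↪ Fin m) (ε : Fin b → Bool) :
    Finset (Fin m) :=
  K ∪ Finset.univ.map ⟨fun t => E (t, ε t), fun _ _ h => (Prod.ext_iff.1 (E.injective h)).1⟩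

lemma mem_transversal {b m : ℕ} (K : Finset (Fin m)) (E : Fin b × Bool ↪ Fin m) (ε : Fin b → Bool)
    (i : Fin m) : i ∈ transversal K E ε ↔ i ∈ K ∨ ∃ t, E (t, ε t) = i := by
  simp only [transversal, Finset.mem_union, Finset.mem_map, Finset.mem_univ, true_and]
  rfl

/-- Permuting the pairs extends to a permutation of the ground set that fixes `K`. An average over
permutations therefore treats all pairs alike. -/
lemma img_transversal {b m : ℕ} (K : Finset (Fin m)) (E : Fin b × Bool ↪ Fin m)
    (hK : ∀ x, E x ∉ K) (π : Equiv.Perm (Fin b)) (ε : Fin b → Bool) :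
    img (Equiv.Perm.viaEmbedding (Equiv.prodCongr π (Equiv.refl Bool)) E) (transversal K E ε) =
      transversal K E (ε ∘ π.symm) := by
  set ϖ : Equiv.Perm (Fin m) := Equiv.Perm.viaEmbedding (Equiv.prodCongr π (Equiv.refl Bool)) E
    with hϖ
  have h1 : ∀ t b, ϖ (E (t, b)) = E (π t, b) := fun t b =>
    Equiv.Perm.viaEmbedding_apply _ E (t, b)
  have h2 : ∀ i ∈ K, ϖ i = i := fun i hi =>
    Equiv.Perm.viaEmbedding_apply_of_notMem _ E i (by rintro ⟨x, rfl⟩; exact hK x hi)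
  have h3 : ∀ i, ϖ i ∈ K ↔ i ∈ K := by
    intro i
    constructor
    · intro h
      have := ϖ.injective (h2 _ h)
      rwa [this] at h
    · intro h; rwa [h2 i h]
  ext i
  obtain ⟨l, rfl⟩ := ϖ.surjective i
  rw [mem_img, Equiv.symm_apply_apply, mem_transversal, mem_transversal, h3]
  refine or_congr Iff.rfl ⟨?_, ?_⟩
  · rintro ⟨t, rfl⟩
    exact ⟨π t, by rw [h1]; simp⟩
  · rintro ⟨t, ht⟩
    refine ⟨π.symm t, ϖ.injective ?_⟩
    rw [h1, ← ht]; simp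

/-- The level-one Fourier coefficient of `F` along random transversals. -/
def levelOne {b m : ℕ} (F : Finset (Fin m) → ℝ) (K : Finset (Fin m)) (E : Fin b × Bool ↪ Fin m)
    (t : Fin b) (σ : Equiv.Perm (Fin m)) : ℝ :=
  (∑ ε, sgn (ε t) * F (img σ (transversal K E ε))) / 2 ^ b

/-- Bessel bounds the sum over the `b` pairs by one for each `σ`. After averaging, all `b` terms are
equal by symmetry. -/
lemma permAvg_levelOne_sq_le {b m : ℕ} (F : Finset (Fin m) → ℝ) (hF : ∀ A, |F A| ≤ 1)
    (K : Finset (Fin m)) (E : Fin b × Bool ↪ Fin m) (hK : ∀ x, E x ∉ K) (t : Fin b) :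
    permAvg (fun σ => levelOne F K E t σ ^ 2) ≤ 1 / b := by
  have hb : (0 : ℝ) < b := by exact_mod_cast (Nat.zero_le _).trans_lt t.2
  have hsym : ∀ s : Fin b, permAvg (fun σ => levelOne F K E s σ ^ 2) =
      permAvg (fun σ => levelOne F K E t σ ^ 2) := by
    intro s
    set π := Equiv.swap s t with hπ
    rw [← permAvg_mul_right (Equiv.Perm.viaEmbedding (Equiv.prodCongr π (Equiv.refl Bool)) E)]
    congr 1
    funext σ
    unfold levelOne
    congr 2
    rw [← (Equiv.arrowCongr π (Equiv.refl Bool)).sum_comp]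
    refine Finset.sum_congr rfl fun ε _ => ?_
    have e1 : (Equiv.arrowCongr π (Equiv.refl Bool)) ε = ε ∘ π.symm := rfl
    rw [e1, img_mul, img_transversal K E hK]
    congr 2
    · rw [Function.comp, hπ]; simp
    · congr 2
      funext x
      simp [hπ]
  have h : permAvg (fun σ => ∑ s, levelOne F K E s σ ^ 2) ≤ 1 := by
    rw [← permAvg_const (m := m) 1]
    exact permAvg_mono fun σ => sum_sq_level_one_le _ fun ε => hF _
  rw [permAvg_sum, Finset.sum_congr rfl fun s _ => hsym s, Finset.sum_const, nsmul_eq_mul,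
    Finset.card_univ, Fintype.card_fin] at h
  rw [le_div_iff₀ hb, mul_comm]
  exact h

lemma card_transversal {b m : ℕ} (K : Finset (Fin m)) (E : Fin b × Bool ↪ Fin m)
    (hK : ∀ x, E x ∉ K) (ε : Fin b → Bool) : (transversal K E ε).card = K.card + b := by
  unfold transversal
  rw [Finset.card_union_of_disjoint]
  · simp
  · rw [Finset.disjoint_left]
    intro i hi h
    obtain ⟨t, -, rfl⟩ := Finset.mem_map.1 h
    exact hK _ hi

lemma permAvg_levelOne_mul {b b' m : ℕ} (F G : Finset (Fin m) → ℝ) (K K' : Finset (Fin m))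
    (E : Fin b × Bool ↪ Fin m) (E' : Fin b' × Bool ↪ Fin m) (t : Fin b) (t' : Fin b') :
    permAvg (fun σ => levelOne F K E t σ * levelOne G K' E' t' σ) =
      (∑ ε, ∑ δ, sgn (ε t) * sgn (δ t') * corr F G (transversal K E ε) (transversal K' E' δ)) /
        (2 ^ b * 2 ^ b') := by
  have h : ∀ σ, levelOne F K E t σ * levelOne G K' E' t' σ = (1 / (2 ^ b * 2 ^ b')) *
      ∑ ε, ∑ δ, sgn (ε t) * sgn (δ t') *
        (F (img σ (transversal K E ε)) * G (img σ (transversal K' E' δ))) := by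
    intro σ
    unfold levelOne
    rw [div_mul_div_comm, Finset.sum_mul_sum, div_eq_inv_mul, one_div]
    congr 1
    exact Finset.sum_congr rfl fun ε _ => Finset.sum_congr rfl fun δ _ => by ring
  simp only [h]
  rw [permAvg_mul_const, permAvg_sum]
  simp only [permAvg_sum, permAvg_mul_const]
  rw [one_div, inv_mul_eq_div]
  rfl

lemma sum_sgn {b : ℕ} (t : Fin b) : ∑ ε : Fin b → Bool, sgn (ε t) = 0 := by
  have h1 : ∑ ε : Fin b → Bool, sgn (ε t) = ∑ ε : Fin b → Bool, sgn (flip {t} ε t) :=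
    (sum_flip {t} fun ε : Vertex b => sgn (ε t)).symm
  have h2 : ∀ ε : Fin b → Bool, sgn (flip {t} ε t) = -sgn (ε t) := fun ε => by
    rw [← sgn_not]; simp [flip_apply]
  simp only [h2, Finset.sum_neg_distrib] at h1
  linarith

/-- Take two random transversals whose families of pairs share one pair only, `t0`. Their
intersection has size `j + 1` if the choices at `t0` agree and `j` otherwise, so the product of the
two level-one coefficients at `t0` averages to half the difference of the correlations. Each
coefficient has mean square at most `1 / b`. -/
lemma abs_corr_sub_corr_le_of_succ {m : ℕ} (F G : Finset (Fin m) → ℝ) (hF : ∀ A, |F A| ≤ 1)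
    (hG : ∀ A, |G A| ≤ 1) {b r r' j : ℕ} (hb : 1 ≤ b) (hr : j + b ≤ r) (hr' : j + b ≤ r')
    (hm : r + r' + 2 * b ≤ m + j) {A B A' B' : Finset (Fin m)} (hA : A.card = r)
    (hB : B.card = r') (hAB : (A ∩ B).card = j) (hA' : A'.card = r) (hB' : B'.card = r')
    (hAB' : (A' ∩ B').card = j + 1) : |corr F G A' B' - corr F G A B| ≤ 2 / b := by
  -- Disjoint room for the common part, the two private parts and two families of `b` pairs: `r + r'
  -- - j + 2 b` points in all, which is what `hm` provides.
  obtain ⟨Ψ⟩ : Nonempty ((Fin j ⊕ Fin (r - j - b) ⊕ Fin (r' - j - b) ⊕ (Fin b × Bool) ⊕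
      (Fin b × Bool)) ↪ Fin m) := by
    apply Function.Embedding.nonempty_of_card_le
    simp only [Fintype.card_sum, Fintype.card_fin, Fintype.card_prod, Fintype.card_bool]
    omega
  set t0 : Fin b := ⟨0, hb⟩
  set T : Finset (Fin m) := Finset.univ.map (Function.Embedding.inl.trans Ψ) with hT
  set A0 : Finset (Fin m) := Finset.univ.map
    ((Function.Embedding.inl.trans Function.Embedding.inr).trans Ψ) with hA0
  set B0 : Finset (Fin m) := Finset.univ.map
    (((Function.Embedding.inl.trans Function.Embedding.inr).trans Function.Embedding.inr).trans Ψ)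
    with hB0
  have memT : ∀ i, i ∈ T ↔ ∃ a, Ψ (Sum.inl a) = i := fun i => by simp [hT]
  have memA : ∀ i, i ∈ A0 ↔ ∃ a, Ψ (Sum.inr (Sum.inl a)) = i := fun i => by simp [hA0]
  have memB : ∀ i, i ∈ B0 ↔ ∃ a, Ψ (Sum.inr (Sum.inr (Sum.inl a))) = i := fun i => by
    simp [hB0]
  have cT : T.card = j := by simp [hT]
  have cA : A0.card = r - j - b := by simp [hA0]
  have cB : B0.card = r' - j - b := by simp [hB0]
  have dTA : (T ∪ A0).card = j + (r - j - b) := by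
    rw [Finset.card_union_of_disjoint, cT, cA]
    rw [Finset.disjoint_left]
    intro i h1 h2
    obtain ⟨a, rfl⟩ := (memT i).1 h1
    obtain ⟨c, h⟩ := (memA _).1 h2
    simpa using Ψ.injective h
  have dTB : (T ∪ B0).card = j + (r' - j - b) := by
    rw [Finset.card_union_of_disjoint, cT, cB]
    rw [Finset.disjoint_left]
    intro i h1 h2
    obtain ⟨a, rfl⟩ := (memT i).1 h1
    obtain ⟨c, h⟩ := (memB _).1 h2
    simpa using Ψ.injective h
  let E : Fin b × Bool ↪ Fin m := ⟨fun x => Ψ (Sum.inr (Sum.inr (Sum.inr (Sum.inl x)))),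
    fun x y h => by simpa using Ψ.injective h⟩
  -- The second family uses its own block of pairs except at `t0`, where it reuses the pair of `E`.
  let E' : Fin b × Bool ↪ Fin m := ⟨fun x => if x.1 = t0 then
      Ψ (Sum.inr (Sum.inr (Sum.inr (Sum.inl x)))) else Ψ (Sum.inr (Sum.inr (Sum.inr (Sum.inr x)))),
    fun x y h => by
      by_cases hx : x.1 = t0 <;> by_cases hy : y.1 = t0 <;> simp only [hx, hy, if_true, if_false] at h
        <;> simpa using Ψ.injective h⟩
  have hE : ∀ x, E x = Ψ (Sum.inr (Sum.inr (Sum.inr (Sum.inl x)))) := fun x => rfl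
  have hE' : ∀ x, E' x = if x.1 = t0 then
      Ψ (Sum.inr (Sum.inr (Sum.inr (Sum.inl x)))) else
        Ψ (Sum.inr (Sum.inr (Sum.inr (Sum.inr x)))) := fun x => rfl
  have hEK : ∀ x, E x ∉ T ∪ A0 := by
    intro x h
    rw [Finset.mem_union, memT, memA] at h
    rcases h with ⟨a, h⟩ | ⟨a, h⟩ <;> simpa [hE] using h
  have hEK' : ∀ x, E' x ∉ T ∪ B0 := by
    intro x h
    rw [Finset.mem_union, memT, memB, hE'] at h
    by_cases hx : x.1 = t0 <;> simp only [hx, if_true, if_false] at h <;>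
      rcases h with ⟨a, h⟩ | ⟨a, h⟩ <;> simpa using Ψ.injective h
  have hint : ∀ ε δ : Fin b → Bool, (transversal (T ∪ A0) E ε ∩ transversal (T ∪ B0) E' δ).card =
      if ε t0 = δ t0 then j + 1 else j := by
    intro ε δ
    have : transversal (T ∪ A0) E ε ∩ transversal (T ∪ B0) E' δ =
        if ε t0 = δ t0 then insert (E (t0, ε t0)) T else T := by
      ext i
      have : i ∈ (if ε t0 = δ t0 then insert (E (t0, ε t0)) T else T) ↔
          i ∈ T ∨ (ε t0 = δ t0 ∧ i = E (t0, ε t0)) := by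
        split_ifs with h
        · simp [h, or_comm]
        · simp [h]
      rw [this, Finset.mem_inter, mem_transversal, mem_transversal, Finset.mem_union,
        Finset.mem_union]
      constructor
      · rintro ⟨(hiT | hiA) | ⟨t, ht⟩, (hiT' | hiB) | ⟨t', ht'⟩⟩
        · exact Or.inl hiT
        · exact Or.inl hiT
        · exact Or.inl hiT
        · exact Or.inl hiT'
        · obtain ⟨a, rfl⟩ := (memA i).1 hiA
          obtain ⟨c, h⟩ := (memB _).1 hiB
          simpa using Ψ.injective h
        · obtain ⟨a, rfl⟩ := (memA i).1 hiA
          rw [hE'] at ht'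
          split_ifs at ht' <;> simpa using Ψ.injective ht'
        · exact Or.inl hiT'
        · obtain ⟨a, rfl⟩ := (memB i).1 hiB
          rw [hE] at ht
          simpa using Ψ.injective ht
        · rw [hE'] at ht'
          rw [hE] at ht
          split_ifs at ht' with h0
          · right
            have h := Ψ.injective (ht.trans ht'.symm)
            simp only [Sum.inr.injEq, Sum.inl.injEq, Prod.mk.injEq] at h
            obtain ⟨h1, h2⟩ := h
            simp only at h0
            subst h0
            subst h1
            exact ⟨h2, ht.symm⟩
          · have h := Ψ.injective (ht.trans ht'.symm)
            simp at h
      · rintro (h | ⟨h, rfl⟩)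
        · exact ⟨Or.inl (Or.inl h), Or.inl (Or.inl h)⟩
        · refine ⟨Or.inr ⟨t0, rfl⟩, Or.inr ⟨t0, ?_⟩⟩
          rw [hE', hE, if_pos rfl, h]
    rw [this]
    split_ifs with h
    · rw [Finset.card_insert_of_notMem, cT]
      intro h'
      exact hEK _ (Finset.mem_union_left _ h')
    · exact cT
  have hc : ∀ ε δ : Fin b → Bool,
      corr F G (transversal (T ∪ A0) E ε) (transversal (T ∪ B0) E' δ) =
        (corr F G A' B' + corr F G A B) / 2 +
          sgn (ε t0) * sgn (δ t0) * ((corr F G A' B' - corr F G A B) / 2) := by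
    intro ε δ
    have h1 : (transversal (T ∪ A0) E ε).card = r := by
      rw [card_transversal _ _ hEK, dTA]; omega
    have h2 : (transversal (T ∪ B0) E' δ).card = r' := by
      rw [card_transversal _ _ hEK', dTB]; omega
    have h3 := hint ε δ
    by_cases h : ε t0 = δ t0
    · rw [if_pos h] at h3
      rw [corr_congr F G (h1.trans hA'.symm) (h2.trans hB'.symm) (h3.trans hAB'.symm), h,
        sgn_mul_self]
      ring
    · rw [if_neg h] at h3
      rw [corr_congr F G (h1.trans hA.symm) (h2.trans hB.symm) (h3.trans hAB.symm)]
      have : ε t0 = !(δ t0) := by cases h1 : ε t0 <;> cases h2 : δ t0 <;> simp_all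
      rw [this, sgn_not, neg_mul, sgn_mul_self]
      ring
  have hsum : permAvg (fun σ => levelOne F (T ∪ A0) E t0 σ * levelOne G (T ∪ B0) E' t0 σ) =
      (corr F G A' B' - corr F G A B) / 2 := by
    rw [permAvg_levelOne_mul, div_eq_iff (by positivity)]
    simp only [hc]
    have : ∀ ε δ : Fin b → Bool, sgn (ε t0) * sgn (δ t0) *
        ((corr F G A' B' + corr F G A B) / 2 +
          sgn (ε t0) * sgn (δ t0) * ((corr F G A' B' - corr F G A B) / 2)) =
        sgn (ε t0) * ((corr F G A' B' + corr F G A B) / 2) * sgn (δ t0) +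
          (corr F G A' B' - corr F G A B) / 2 := by
      intro ε δ
      have h1 := sgn_mul_self (ε t0)
      have h2 := sgn_mul_self (δ t0)
      linear_combination ((corr F G A' B' - corr F G A B) / 2) * (sgn (δ t0) * sgn (δ t0)) * h1
        + ((corr F G A' B' - corr F G A B) / 2) * h2
    rw [Finset.sum_congr rfl fun ε _ => Finset.sum_congr rfl fun δ _ => this ε δ]
    simp only [Finset.sum_add_distrib, ← Finset.mul_sum, sum_sgn, mul_zero,
      Finset.sum_const, Finset.card_univ, zero_add, Fintype.card_pi, Fintype.card_bool,
      Finset.prod_const, Fintype.card_fin, nsmul_eq_mul]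
    push_cast
    ring
  have := permAvg_mul_le _ _ _ (permAvg_levelOne_sq_le F hF (T ∪ A0) E hEK t0)
    (permAvg_levelOne_sq_le G hG (T ∪ B0) E' hEK' t0)
  rw [hsum, abs_div, abs_two, div_le_iff₀ (by norm_num)] at this
  calc _ ≤ _ := this
    _ = 2 / b := by ring

lemma exists_sets {m r r' j : ℕ} (hr : j ≤ r) (hr' : j ≤ r') (hm : r + r' ≤ m + j) :
    ∃ A B : Finset (Fin m), A.card = r ∧ B.card = r' ∧ (A ∩ B).card = j := by
  obtain ⟨T, hT⟩ := Finset.exists_subset_card_eq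
    (s := (Finset.univ : Finset (Fin m))) (n := r) (by simp; omega)
  obtain ⟨T1, hT1⟩ := Finset.exists_subset_card_eq (s := T) (n := j) (by omega)
  obtain ⟨T2, hT2⟩ := Finset.exists_subset_card_eq (s := Tᶜ) (n := r' - j)
    (by rw [Finset.card_compl, Fintype.card_fin]; omega)
  refine ⟨T, T1 ∪ T2, hT.2, ?_, ?_⟩
  · rw [Finset.card_union_of_disjoint, hT1.2, hT2.2]
    · omega
    · rw [Finset.disjoint_left]
      intro i h1 h2
      exact Finset.mem_compl.1 (hT2.1 h2) (hT1.1 h1)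
  · have : T ∩ (T1 ∪ T2) = T1 := by
      ext i
      simp only [Finset.mem_inter, Finset.mem_union]
      constructor
      · rintro ⟨h, h1 | h2⟩
        · exact h1
        · exact absurd h (Finset.mem_compl.1 (hT2.1 h2))
      · exact fun h => ⟨hT1.1 h, Or.inl h⟩
    rw [this, hT1.2]

lemma abs_corr_sub_corr_le {m : ℕ} (F G : Finset (Fin m) → ℝ) (hF : ∀ A, |F A| ≤ 1)
    (hG : ∀ A, |G A| ≤ 1) {b r r' j : ℕ} (hb : 1 ≤ b) (d : ℕ) (hr : j + d + b ≤ r)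
    (hr' : j + d + b ≤ r') (hm : r + r' + 2 * b ≤ m + j) {A B A' B' : Finset (Fin m)}
    (hA : A.card = r) (hB : B.card = r') (hAB : (A ∩ B).card = j) (hA' : A'.card = r)
    (hB' : B'.card = r') (hAB' : (A' ∩ B').card = j + d) :
    |corr F G A' B' - corr F G A B| ≤ 2 / b * d := by
  induction d generalizing A' B' with
  | zero =>
    rw [corr_congr F G (hA'.trans hA.symm) (hB'.trans hB.symm) (hAB'.trans hAB.symm)]
    simp
  | succ d ih =>
    obtain ⟨A1, B1, h1, h2, h3⟩ := exists_sets (m := m) (r := r) (r' := r') (j := j + d)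
      (by omega) (by omega) (by omega)
    have i1 := ih (by omega) (by omega) h1 h2 h3
    have i2 := abs_corr_sub_corr_le_of_succ F G hF hG hb (j := j + d) (by omega) (by omega)
      (by omega) h1 h2 h3 hA' hB' (by omega)
    have := abs_sub_le (corr F G A' B') (corr F G A1 B1) (corr F G A B)
    push_cast
    linarith

lemma corr_nonneg {m : ℕ} {F G : Finset (Fin m) → ℝ} (hF : ∀ A, 0 ≤ F A) (hG : ∀ A, 0 ≤ G A)
    (A B : Finset (Fin m)) : 0 ≤ corr F G A B :=
  permAvg_nonneg fun _ => mul_nonneg (hF _) (hG _)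

lemma corr_le_one {m : ℕ} {F G : Finset (Fin m) → ℝ} (hF1 : ∀ A, F A ≤ 1)
    (hG : ∀ A, 0 ≤ G A) (hG1 : ∀ A, G A ≤ 1) (A B : Finset (Fin m)) : corr F G A B ≤ 1 := by
  rw [← permAvg_const (m := m) 1]
  exact permAvg_mono fun σ => mul_le_one₀ (hF1 _) (hG _) (hG1 _)

/-- For intersections within `b` of `j`, the one-step bound is iterated. Farther away the added term
already exceeds one, which bounds any correlation, so no condition on `X ∩ Y` is needed. -/
lemma corr_le_corr_add {m : ℕ} {F G : Finset (Fin m) → ℝ} (hF : ∀ A, 0 ≤ F A)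
    (hF1 : ∀ A, F A ≤ 1) (hG : ∀ A, 0 ≤ G A) (hG1 : ∀ A, G A ≤ 1) {b r r' j : ℕ} (hb : 1 ≤ b)
    (hr : j + 2 * b ≤ r) (hr' : j + 2 * b ≤ r') (hm : r + r' + 3 * b ≤ m + j)
    {A B X Y : Finset (Fin m)} (hA : A.card = r) (hB : B.card = r') (hAB : (A ∩ B).card = j)
    (hX : X.card = r) (hY : Y.card = r') :
    corr F G X Y ≤ corr F G A B + 2 / b * |((X ∩ Y).card : ℝ) - j| := by
  have hbR : (1 : ℝ) ≤ b := by exact_mod_cast hb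
  have hF' : ∀ A, |F A| ≤ 1 := fun A => by rw [abs_of_nonneg (hF A)]; exact hF1 A
  have hG' : ∀ A, |G A| ≤ 1 := fun A => by rw [abs_of_nonneg (hG A)]; exact hG1 A
  rcases le_total j (X ∩ Y).card with h | h
  · obtain ⟨d, hd⟩ := Nat.exists_eq_add_of_le h
    have e : |((X ∩ Y).card : ℝ) - j| = d := by rw [hd]; simp
    rw [e]
    by_cases hdb : d ≤ b
    · have := abs_corr_sub_corr_le F G hF' hG' hb d (by omega) (by omega) (by omega) hA hB hAB
        hX hY hd
      linarith [le_abs_self (corr F G X Y - corr F G A B)]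
    · have h1 := corr_le_one hF1 hG hG1 X Y
      have h0 := corr_nonneg hF hG A B
      have : (1 : ℝ) ≤ 2 / b * d := by
        have : (b : ℝ) ≤ d := by exact_mod_cast (by omega : b ≤ d)
        rw [div_mul_eq_mul_div, le_div_iff₀ (by linarith)]
        linarith
      linarith
  · obtain ⟨d, hd⟩ := Nat.exists_eq_add_of_le h
    have e : |((X ∩ Y).card : ℝ) - j| = d := by
      rw [hd, abs_sub_comm]; simp
    rw [e]
    by_cases hdb : d ≤ b
    · have := abs_corr_sub_corr_le F G hF' hG' hb d (by omega) (by omega) (by omega) hX hY rfl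
        hA hB (hAB.trans hd)
      linarith [neg_abs_le (corr F G A B - corr F G X Y)]
    · have h1 := corr_le_one hF1 hG hG1 X Y
      have h0 := corr_nonneg hF hG A B
      have : (1 : ℝ) ≤ 2 / b * d := by
        have : (b : ℝ) ≤ d := by exact_mod_cast (by omega : b ≤ d)
        rw [div_mul_eq_mul_div, le_div_iff₀ (by linarith)]
        linarith
      linarith

/-! ### Averages over nested sets -/

/-- The sets of size `r` that contain `W` or are contained in `W`. -/
def nest {m : ℕ} (r : ℕ) (W : Finset (Fin m)) : Finset (Finset (Fin m)) :=
  Finset.univ.filter fun X => X.card = r ∧ (X ⊆ W ∨ W ⊆ X)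

lemma mem_nest {m r : ℕ} {W X : Finset (Fin m)} :
    X ∈ nest r W ↔ X.card = r ∧ (X ⊆ W ∨ W ⊆ X) := by simp [nest]

lemma nest_nonempty {m r : ℕ} (hr : r ≤ m) (W : Finset (Fin m)) : (nest r W).Nonempty := by
  rcases le_total r W.card with h | h
  · obtain ⟨X, hX, hc⟩ := Finset.exists_subset_card_eq h
    exact ⟨X, mem_nest.2 ⟨hc, Or.inl hX⟩⟩
  · obtain ⟨X, hX, -, hc⟩ := Finset.exists_subsuperset_card_eq (Finset.subset_univ W) h (by simpa)
    exact ⟨X, mem_nest.2 ⟨hc, Or.inr hX⟩⟩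

/-- The average of `F` over the sets of size `r` nested with `W`. -/
def nestAvg {m : ℕ} (r : ℕ) (F : Finset (Fin m) → ℝ) (W : Finset (Fin m)) : ℝ :=
  (∑ X ∈ nest r W, F X) / ((nest r W).card : ℝ)

lemma img_subset_img {m : ℕ} (σ : Equiv.Perm (Fin m)) (A B : Finset (Fin m)) :
    img σ A ⊆ img σ B ↔ A ⊆ B := Finset.map_subset_map

lemma nestAvg_img {m r : ℕ} (F : Finset (Fin m) → ℝ) (W : Finset (Fin m))
    (σ : Equiv.Perm (Fin m)) :
    nestAvg r F (img σ W) = (∑ X ∈ nest r W, F (img σ X)) / ((nest r W).card : ℝ) := by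
  have h : ∀ X, X ∈ nest r W ↔ imgEquiv σ X ∈ nest r (img σ W) := by
    intro X
    change _ ↔ img σ X ∈ _
    rw [mem_nest, mem_nest, card_img, img_subset_img, img_subset_img]
  have e1 := Finset.card_equiv (imgEquiv σ) h
  have e2 : ∑ X ∈ nest r W, F (img σ X) = ∑ Y ∈ nest r (img σ W), F Y :=
    Finset.sum_equiv (imgEquiv σ) h (fun X _ => rfl)
  unfold nestAvg
  rw [e1, e2]

/-- Every set nested with `W` becomes a uniform `r`-set under a random permutation, so `W` drops out
whatever its size. This passes from random sizes to a fixed one. -/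
lemma permAvg_nestAvg {m r : ℕ} (hr : r ≤ m) (F : Finset (Fin m) → ℝ) (W A : Finset (Fin m))
    (hA : A.card = r) :
    permAvg (fun σ => nestAvg r F (img σ W)) = permAvg (fun σ => F (img σ A)) := by
  have hc : ((nest r W).card : ℝ) ≠ 0 := by
    exact_mod_cast (Finset.card_pos.2 (nest_nonempty hr W)).ne'
  simp only [nestAvg_img, div_eq_inv_mul]
  rw [permAvg_mul_const, permAvg_sum, Finset.sum_congr rfl fun X hX =>
    permAvg_img_congr F ((mem_nest.1 hX).1.trans hA.symm), Finset.sum_const, nsmul_eq_mul,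
    ← mul_assoc, inv_mul_cancel₀ hc, one_mul]

lemma nestAvg_nonneg {m r : ℕ} {F : Finset (Fin m) → ℝ} (hF : ∀ A, 0 ≤ F A) (W : Finset (Fin m)) :
    0 ≤ nestAvg r F W := div_nonneg (Finset.sum_nonneg fun _ _ => hF _) (by positivity)

lemma nestAvg_le_one {m r : ℕ} {F : Finset (Fin m) → ℝ} (hF : ∀ A, F A ≤ 1)
    (W : Finset (Fin m)) : nestAvg r F W ≤ 1 := by
  apply div_le_one_of_le₀ _ (by positivity)
  calc ∑ X ∈ nest r W, F X ≤ ∑ X ∈ nest r W, (1 : ℝ) := Finset.sum_le_sum fun _ _ => hF _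
    _ = _ := by simp

lemma permAvg_nestAvg_mul_le {m r r' : ℕ} (hr : r ≤ m) (hr' : r' ≤ m) (F G : Finset (Fin m) → ℝ)
    (W W' : Finset (Fin m)) (c : ℝ)
    (h : ∀ X ∈ nest r W, ∀ Y ∈ nest r' W', corr F G X Y ≤ c) :
    permAvg (fun σ => nestAvg r F (img σ W) * nestAvg r' G (img σ W')) ≤ c := by
  have hc : (0 : ℝ) < ((nest r W).card : ℝ) := by
    exact_mod_cast Finset.card_pos.2 (nest_nonempty hr W)
  have hc' : (0 : ℝ) < ((nest r' W').card : ℝ) := by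
    exact_mod_cast Finset.card_pos.2 (nest_nonempty hr' W')
  have e : ∀ σ, nestAvg r F (img σ W) * nestAvg r' G (img σ W') =
      (((nest r W).card : ℝ) * (nest r' W').card)⁻¹ *
        ∑ X ∈ nest r W, ∑ Y ∈ nest r' W', F (img σ X) * G (img σ Y) := by
    intro σ
    rw [nestAvg_img, nestAvg_img, div_mul_div_comm, Finset.sum_mul_sum, div_eq_inv_mul]
  simp only [e]
  rw [permAvg_mul_const, permAvg_sum]
  simp only [permAvg_sum]
  rw [inv_mul_le_iff₀ (by positivity)]
  calc _ ≤ ∑ X ∈ nest r W, ∑ Y ∈ nest r' W', c :=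
        Finset.sum_le_sum fun X hX => Finset.sum_le_sum fun Y hY => h X hX Y hY
    _ = _ := by simp; ring

lemma abs_card_inter_sub_le {m r r' : ℕ} {W W' X Y : Finset (Fin m)} (hX : X ∈ nest r W)
    (hY : Y ∈ nest r' W') : |((X ∩ Y).card : ℝ) - ((W ∩ W').card : ℝ)| ≤
      |(W.card : ℝ) - r| + |(W'.card : ℝ) - r'| := by
  have key : ∀ {r : ℕ} {W X : Finset (Fin m)}, X ∈ nest r W →
      ((X \ W).card : ℝ) ≤ |(W.card : ℝ) - r| ∧ ((W \ X).card : ℝ) ≤ |(W.card : ℝ) - r| := by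
    intro r W X h
    obtain ⟨hc, h | h⟩ := mem_nest.1 h
    · constructor
      · rw [Finset.sdiff_eq_empty_iff_subset.2 h]; simp
      · rw [Finset.cast_card_sdiff h, hc]; exact le_abs_self _
    · constructor
      · rw [Finset.cast_card_sdiff h, hc, abs_sub_comm]; exact le_abs_self _
      · rw [Finset.sdiff_eq_empty_iff_subset.2 h]; simp
  have sub : ∀ A B C D : Finset (Fin m),
      ((A ∩ B).card : ℝ) ≤ ((C ∩ D).card : ℝ) + (A \ C).card + (B \ D).card := by
    intro A B C D
    have : A ∩ B ⊆ (C ∩ D) ∪ (A \ C) ∪ (B \ D) := by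
      intro i hi
      simp only [Finset.mem_union, Finset.mem_inter, Finset.mem_sdiff] at hi ⊢
      tauto
    have h1 := (Finset.card_le_card this).trans (Finset.card_union_le _ _)
    have h2 := Finset.card_union_le (C ∩ D) (A \ C)
    exact_mod_cast h1.trans (by omega)
  have h1 := sub X Y W W'
  have h2 := sub W W' X Y
  have := key hX
  have := key hY
  rw [abs_le]
  constructor <;> linarith

/-- The set of coordinates at which `ω` is true. -/
def trueSet {m : ℕ} (ω : Fin m → Bool) : Finset (Fin m) := Finset.univ.filter fun i => ω i = true

lemma img_trueSet {m : ℕ} (σ : Equiv.Perm (Fin m)) (ω : Fin m → Bool) :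
    img σ (trueSet ω) = trueSet (ω ∘ σ.symm) := by
  ext i; simp [mem_img, trueSet]

lemma card_trueSet {m : ℕ} (ω : Fin m → Bool) :
    ((trueSet ω).card : ℝ) = ∑ i, if ω i = true then (1 : ℝ) else 0 := by
  simp [trueSet]

/-- The product weight is exchangeable, hence unchanged by a random permutation of the coordinates.
-/
lemma sum_weight_eq_permAvg {Λ : Type*} [Fintype Λ] {m : ℕ} (q : Λ → ℝ) (g : (Fin m → Λ) → ℝ) :
    ∑ ω : Fin m → Λ, (∏ i, q (ω i)) * g ω =
      ∑ ω : Fin m → Λ, (∏ i, q (ω i)) * permAvg fun σ => g (ω ∘ σ.symm) := by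
  have h : ∀ σ : Equiv.Perm (Fin m), ∑ ω : Fin m → Λ, (∏ i, q (ω i)) * g (ω ∘ σ.symm) =
      ∑ ω : Fin m → Λ, (∏ i, q (ω i)) * g ω := by
    intro σ
    refine Fintype.sum_equiv (Equiv.arrowCongr σ (Equiv.refl Λ)) _ _ fun ω => ?_
    have : (Equiv.arrowCongr σ (Equiv.refl Λ)) ω = ω ∘ σ.symm := rfl
    rw [this]
    congr 1
    exact (σ.symm.prod_comp fun i => q (ω i)).symm
  simp only [← permAvg_mul_const]
  rw [← permAvg_sum]
  simp only [h, permAvg_const]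

/-- Two sets of `r`- and `r'`-subsets that are not small are joined by many pairs with an
intersection of the given size `j`, about half of the size of either set. -/
lemma le_corr {m : ℕ} {F G : Finset (Fin m) → ℝ} (hF : ∀ A, 0 ≤ F A)
    (hF1 : ∀ A, F A ≤ 1) (hG : ∀ A, 0 ≤ G A) (hG1 : ∀ A, G A ≤ 1) {b r r' j : ℕ} (hb : 1 ≤ b)
    (hr : j + 2 * b ≤ r) (hr' : j + 2 * b ≤ r') (hm : r + r' + 3 * b ≤ m + j)
    {A B : Finset (Fin m)} (hA : A.card = r) (hB : B.card = r') (hAB : (A ∩ B).card = j)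
    {p : ℝ} (h0 : 0 ≤ p) (h1 : p ≤ 1 / 2) :
    permAvg (fun σ => F (img σ A)) ^ 2 * permAvg (fun σ => G (img σ B)) ^ 2 -
      2 / b * (3 * Real.sqrt (m * p) + (|m * p / 2 - j| + |m * p - r| + |m * p - r'|)) ≤
      corr F G A B := by
  have hrm : r ≤ m := by rw [← hA]; simpa using Finset.card_le_univ A
  have hrm' : r' ≤ m := by rw [← hB]; simpa using Finset.card_le_univ B
  -- The mean over a slice is the mean of `nestAvg` on the biased cube, and `x ≤ √x` on `[0, 1]`
  -- yields the root required by reverse hypercontractivity.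
  have hside : ∀ (H : Finset (Fin m) → ℝ) (s : ℕ) (C : Finset (Fin m)), s ≤ m → C.card = s →
      (∀ A, 0 ≤ H A) → (∀ A, H A ≤ 1) →
      permAvg (fun σ => H (img σ C)) ^ 2 ≤
        (∑ ω, (∏ i, bitWeight p (ω i)) * Real.sqrt (nestAvg s H (trueSet ω))) ^ 2 := by
    intro H s C hs hC hH0 hH1
    have e : permAvg (fun σ => H (img σ C)) =
        ∑ ω : Fin m → Bool, (∏ i, bitWeight p (ω i)) * nestAvg s H (trueSet ω) := by
      rw [sum_weight_eq_permAvg]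
      simp only [← img_trueSet, permAvg_nestAvg hs H _ C hC]
      rw [← Finset.sum_mul, sum_prod_weight m _ (sum_bitWeight p), one_mul]
    refine pow_le_pow_left₀ (permAvg_nonneg fun _ => hH0 _) ?_ 2
    rw [e]
    refine Finset.sum_le_sum fun ω _ => mul_le_mul_of_nonneg_left ?_
      (Finset.prod_nonneg fun i _ => bitWeight_nonneg h0 h1 _)
    refine Real.le_sqrt_of_sq_le ?_
    have h2 := nestAvg_nonneg (r := s) hH0 (trueSet ω)
    have h3 := nestAvg_le_one (r := s) hH1 (trueSet ω)
    nlinarith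
  have hL := mul_le_mul (hside F r A hrm hA hF hF1) (hside G r' B hrm' hB hG hG1) (sq_nonneg _)
    (sq_nonneg _)
  have hRH := reverse_hypercontractivity h0 h1 m (fun ω => nestAvg r F (trueSet ω))
    (fun ω => nestAvg r' G (trueSet ω)) (fun _ => nestAvg_nonneg hF _)
    (fun _ => nestAvg_nonneg hG _)
  rw [sum_weight_eq_permAvg (pairWeight p)] at hRH
  have hpw : ∀ η : Fin m → Bool × Bool, 0 ≤ ∏ i, pairWeight p (η i) := fun η =>
    Finset.prod_nonneg fun i _ => pairWeight_nonneg h0 h1 _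
  -- Centred counters: under `pairWeight` both bits are set with probability `p / 2` and each bit
  -- with probability `p`. Their sums are the deviations of `|W ∩ W'|`, `|W|` and `|W'|` from `m p /
  -- 2`, `m p` and `m p`.
  set φ0 : Bool × Bool → ℝ := fun x => (if x.1 = true ∧ x.2 = true then 1 else 0) - p / 2 with hφ0
  set φ1 : Bool × Bool → ℝ := fun x => (if x.1 = true then 1 else 0) - p with hφ1
  set φ2 : Bool × Bool → ℝ := fun x => (if x.2 = true then 1 else 0) - p with hφ2
  set D : ℝ := |m * p / 2 - j| + |m * p - r| + |m * p - r'| with hD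
  have hpt : ∀ η : Fin m → Bool × Bool,
      permAvg (fun σ => nestAvg r F (trueSet fun i => ((η ∘ σ.symm) i).1) *
        nestAvg r' G (trueSet fun i => ((η ∘ σ.symm) i).2)) ≤
      corr F G A B + 2 / b * (|∑ i, φ0 (η i)| + |∑ i, φ1 (η i)| + |∑ i, φ2 (η i)| + D) := by
    intro η
    set W := trueSet fun i => (η i).1 with hW
    set W' := trueSet fun i => (η i).2 with hW'
    have e1 : ∀ σ : Equiv.Perm (Fin m), (trueSet fun i => ((η ∘ σ.symm) i).1) = img σ W :=
      fun σ => (img_trueSet σ (fun i => (η i).1)).symm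
    have e2 : ∀ σ : Equiv.Perm (Fin m), (trueSet fun i => ((η ∘ σ.symm) i).2) = img σ W' :=
      fun σ => (img_trueSet σ (fun i => (η i).2)).symm
    simp only [e1, e2]
    apply permAvg_nestAvg_mul_le hrm hrm'
    intro X hX Y hY
    refine (corr_le_corr_add hF hF1 hG hG1 hb hr hr' hm hA hB hAB (mem_nest.1 hX).1
      (mem_nest.1 hY).1).trans ?_
    have c0 : ∑ i, φ0 (η i) = ((W ∩ W').card : ℝ) - m * p / 2 := by
      have : W ∩ W' = Finset.univ.filter fun i => (η i).1 = true ∧ (η i).2 = true := by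
        ext i; simp [hW, hW', trueSet]
      rw [this, hφ0]
      simp only [Finset.sum_sub_distrib, Finset.sum_const, Finset.card_univ, Fintype.card_fin,
        nsmul_eq_mul, Finset.sum_boole]
      ring
    have c1 : ∑ i, φ1 (η i) = (W.card : ℝ) - m * p := by
      rw [hW, card_trueSet, hφ1]
      simp only [Finset.sum_sub_distrib, Finset.sum_const, Finset.card_univ, Fintype.card_fin,
        nsmul_eq_mul]
    have c2 : ∑ i, φ2 (η i) = (W'.card : ℝ) - m * p := by
      rw [hW', card_trueSet, hφ2]
      simp only [Finset.sum_sub_distrib, Finset.sum_const, Finset.card_univ, Fintype.card_fin,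
        nsmul_eq_mul]
    have h5 := abs_card_inter_sub_le hX hY
    have t1 := abs_sub_le ((X ∩ Y).card : ℝ) (W ∩ W').card j
    have t2 := abs_sub_le ((W ∩ W').card : ℝ) (m * p / 2) j
    have t3 := abs_sub_le (W.card : ℝ) (m * p) r
    have t4 := abs_sub_le (W'.card : ℝ) (m * p) r'
    rw [c0, c1, c2]
    have : |((X ∩ Y).card : ℝ) - j| ≤ |((W ∩ W').card : ℝ) - m * p / 2| + |(W.card : ℝ) - m * p| +
        |(W'.card : ℝ) - m * p| + D := by rw [hD]; linarith
    have hb0 : (0 : ℝ) ≤ 2 / b := by positivity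
    linarith [mul_le_mul_of_nonneg_left this hb0]
  have hsum := hRH.trans (Finset.sum_le_sum fun η _ => mul_le_mul_of_nonneg_left (hpt η) (hpw η))
  -- Each counter has variance at most `p` per coordinate, so each deviation is at most `√(m p)` on
  -- average.
  have hmom : ∀ φ : Bool × Bool → ℝ, ∑ x, pairWeight p x * φ x = 0 →
      ∑ x, pairWeight p x * φ x ^ 2 ≤ p →
      ∑ η : Fin m → Bool × Bool, (∏ i, pairWeight p (η i)) * |∑ i, φ (η i)| ≤
        Real.sqrt (m * p) := fun φ hφ hv =>
    sum_prod_weight_mul_abs_le m _ φ (pairWeight_nonneg h0 h1) (sum_pairWeight p) hφ p hv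
  have m0 := hmom φ0 (by rw [Fintype.sum_prod_type]; simp [pairWeight, hφ0]; ring)
    (by rw [Fintype.sum_prod_type]; simp [pairWeight, hφ0]; nlinarith)
  have m1 := hmom φ1 (by rw [Fintype.sum_prod_type]; simp [pairWeight, hφ1]; ring)
    (by rw [Fintype.sum_prod_type]; simp [pairWeight, hφ1]; nlinarith)
  have m2 := hmom φ2 (by rw [Fintype.sum_prod_type]; simp [pairWeight, hφ2]; ring)
    (by rw [Fintype.sum_prod_type]; simp [pairWeight, hφ2]; nlinarith)
  have hexp : ∑ η : Fin m → Bool × Bool, (∏ i, pairWeight p (η i)) *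
      (corr F G A B + 2 / b * (|∑ i, φ0 (η i)| + |∑ i, φ1 (η i)| + |∑ i, φ2 (η i)| + D)) =
      corr F G A B + 2 / b * (∑ η : Fin m → Bool × Bool, (∏ i, pairWeight p (η i)) *
          |∑ i, φ0 (η i)| + ∑ η : Fin m → Bool × Bool, (∏ i, pairWeight p (η i)) *
          |∑ i, φ1 (η i)| + ∑ η : Fin m → Bool × Bool, (∏ i, pairWeight p (η i)) *
          |∑ i, φ2 (η i)| + D) := by
    have h2 := sum_prod_weight m _ (sum_pairWeight p)
    have : ∀ η : Fin m → Bool × Bool, (∏ i, pairWeight p (η i)) *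
      (corr F G A B + 2 / b * (|∑ i, φ0 (η i)| + |∑ i, φ1 (η i)| + |∑ i, φ2 (η i)| + D)) =
      (∏ i, pairWeight p (η i)) * (corr F G A B + 2 / b * D) + 2 / b *
        ((∏ i, pairWeight p (η i)) * |∑ i, φ0 (η i)| + (∏ i, pairWeight p (η i)) *
          |∑ i, φ1 (η i)| + (∏ i, pairWeight p (η i)) * |∑ i, φ2 (η i)|) := fun η => by ring
    simp only [this, Finset.sum_add_distrib, ← Finset.mul_sum, ← Finset.sum_mul, h2]
    ring
  rw [hexp] at hsum
  have hb0 : (0 : ℝ) ≤ 2 / b := by positivity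
  have h6 := hL.trans hsum
  have h7 := mul_le_mul_of_nonneg_left (add_le_add (add_le_add m0 m1) m2) hb0
  linarith

/-! ### Tails of binomial sums -/

/-- At distance at least `h` below `q`, consecutive binomial coefficients grow by a factor of at
least `(q + h) / q`; Bernoulli's inequality linearizes the product of the factors. -/
lemma mul_choose_le_mul_choose_add {M q h r : ℕ} (hM : 2 * q ≤ M + 1) (i : ℕ)
    (hr : r + i + h ≤ q) : (q + i * h) * M.choose r ≤ q * M.choose (r + i) := by
  induction i with
  | zero => simp
  | succ i ih =>
    have h1 := ih (by omega)
    have h2 := Nat.choose_succ_right_eq M (r + i)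
    have h3 : (q + h) * M.choose (r + i) ≤ q * M.choose (r + i + 1) := by
      calc (q + h) * M.choose (r + i) ≤ (M - (r + i)) * M.choose (r + i) :=
            Nat.mul_le_mul_right _ (by omega)
        _ = M.choose (r + i + 1) * (r + i + 1) := by rw [h2, mul_comm]
        _ ≤ M.choose (r + i + 1) * q := Nat.mul_le_mul_left _ (by omega)
        _ = _ := mul_comm _ _
    rcases Nat.eq_zero_or_pos q with hq | hq
    · omega
    apply Nat.le_of_mul_le_mul_left _ hq
    calc q * ((q + (i + 1) * h) * M.choose r) ≤ (q + h) * ((q + i * h) * M.choose r) := by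
          have : q * (q + (i + 1) * h) ≤ (q + h) * (q + i * h) := by
            have : (q + h) * (q + i * h) = q * (q + (i + 1) * h) + h * (i * h) := by ring
            omega
          nlinarith [Nat.mul_le_mul_right (M.choose r) this]
      _ ≤ (q + h) * (q * M.choose (r + i)) := Nat.mul_le_mul_left _ h1
      _ = q * ((q + h) * M.choose (r + i)) := by ring
      _ ≤ q * (q * M.choose (r + i + 1)) := Nat.mul_le_mul_left _ h3

/-- A Chebyshev-type tail bound: shifting each tail term up by `h` multiplies it by at least `h² /
q`, and the shifted terms still lie below `q`. -/
lemma sum_choose_tail_le {M q h : ℕ} (hM : 2 * q ≤ M + 1) (hh : 1 ≤ h) :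
    h ^ 2 * ∑ r ∈ Finset.range (q - 2 * h), M.choose r ≤ q * numNeighbors M q := by
  rw [Finset.mul_sum]
  have h1 : ∀ r ∈ Finset.range (q - 2 * h), h ^ 2 * M.choose r ≤ q * M.choose (r + h) := by
    intro r hr
    have hr := Finset.mem_range.1 hr
    have := mul_choose_le_mul_choose_add hM h (r := r) (h := h) (by omega)
    nlinarith
  refine (Finset.sum_le_sum h1).trans ?_
  rw [← Finset.mul_sum]
  apply Nat.mul_le_mul_left
  unfold numNeighbors
  rw [← Finset.sum_image (f := fun s => M.choose s) (g := fun r => r + h)]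
  · apply Finset.sum_le_sum_of_subset
    intro s hs
    obtain ⟨r, hr, rfl⟩ := Finset.mem_image.1 hs
    have hr := Finset.mem_range.1 hr
    rw [Finset.mem_Icc]
    omega
  · intro a _ b _ hab
    simpa using hab

lemma numNeighbors_mono_left {m n : ℕ} (h : m ≤ n) (k : ℕ) : numNeighbors m k ≤ numNeighbors n k :=
  Finset.sum_le_sum fun r _ => Nat.choose_le_choose r h

lemma numNeighbors_mono_right (n : ℕ) {k l : ℕ} (h : k ≤ l) :
    numNeighbors n k ≤ numNeighbors n l :=
  Finset.sum_le_sum_of_subset (Finset.Icc_subset_Icc_right h)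

/-- The sizes close to `q` and at most `k`. -/
def window (k q h : ℕ) : Finset ℕ := Finset.Icc (q - 2 * h) (min k (q + 2 * h + 1))

lemma mem_window {k q h r : ℕ} :
    r ∈ window k q h ↔ q - 2 * h ≤ r ∧ r ≤ k ∧ r ≤ q + 2 * h + 1 := by
  simp [window]

/-- The lower tail is bounded directly. An upper tail occurs only if `q` is the middle, and `r ↦ m -
r` folds it into the lower one; the extra `1` in `window` absorbs the rounding in `(m + 1) / 2`. -/
lemma sum_choose_notMem_window_le {m k h : ℕ} (hh : 1 ≤ h) :
    h ^ 2 * ∑ r ∈ (Finset.range (k + 1)).filter (· ∉ window k (min k ((m + 1) / 2)) h), m.choose r ≤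
      2 * (min k ((m + 1) / 2)) * numNeighbors (m + 1) k := by
  set q := min k ((m + 1) / 2) with hq
  have hq2 : 2 * q ≤ m + 1 := by omega
  have ht := sum_choose_tail_le (M := m) hq2 hh
  have hN : numNeighbors m q ≤ numNeighbors (m + 1) k :=
    (numNeighbors_mono_left (Nat.le_succ m) q).trans (numNeighbors_mono_right _ (by omega))
  have hsub : ∑ r ∈ (Finset.range (k + 1)).filter (· ∉ window k q h), m.choose r ≤
      2 * ∑ r ∈ Finset.range (q - 2 * h), m.choose r := by
    have h1 : (Finset.range (k + 1)).filter (· ∉ window k q h) ⊆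
        Finset.range (q - 2 * h) ∪ (Finset.Icc (q + 2 * h + 2) k) := by
      intro r hr
      simp only [Finset.mem_filter, Finset.mem_range, mem_window, Finset.mem_union,
        Finset.mem_Icc] at hr ⊢
      omega
    have h2 : ∑ r ∈ Finset.Icc (q + 2 * h + 2) k, m.choose r ≤
        ∑ r ∈ Finset.range (q - 2 * h), m.choose r := by
      have h3 : ∑ r ∈ Finset.Icc (q + 2 * h + 2) k, m.choose r =
          ∑ r ∈ (Finset.Icc (q + 2 * h + 2) k).filter (· ≤ m), m.choose (m - r) := by
        rw [Finset.sum_filter]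
        refine Finset.sum_congr rfl fun r _ => ?_
        split_ifs with h4
        · rw [Nat.choose_symm h4]
        · exact Nat.choose_eq_zero_of_lt (not_le.1 h4)
      rw [h3, ← Finset.sum_image (f := fun s => m.choose s) (g := fun r => m - r)]
      · apply Finset.sum_le_sum_of_subset
        intro s hs
        obtain ⟨r, hr, rfl⟩ := Finset.mem_image.1 hs
        simp only [Finset.mem_filter, Finset.mem_Icc, Finset.mem_range] at hr ⊢
        omega
      · intro a ha b hb hab
        simp only [Finset.coe_filter, Finset.mem_Icc, Set.mem_ofPred_eq] at ha hb hab
        omega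
    have h8 := Finset.sum_le_sum_of_subset (f := fun r => m.choose r) h1
    have h9 := Finset.sum_union_inter (s₁ := Finset.range (q - 2 * h))
      (s₂ := Finset.Icc (q + 2 * h + 2) k) (f := fun r => m.choose r)
    omega
  nlinarith

/-- The mean of `F` over the sets of size `r`. -/
def layerAvg {m : ℕ} (F : Finset (Fin m) → ℝ) (r : ℕ) : ℝ :=
  (∑ X ∈ Finset.powersetCard r Finset.univ, F X) / (m.choose r : ℝ)

lemma choose_mul_layerAvg {m : ℕ} (F : Finset (Fin m) → ℝ) (r : ℕ) :
    (m.choose r : ℝ) * layerAvg F r = ∑ X ∈ Finset.powersetCard r Finset.univ, F X := by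
  unfold layerAvg
  rcases Nat.eq_zero_or_pos (m.choose r) with h | h
  · have : (Finset.powersetCard r (Finset.univ : Finset (Fin m))) = ∅ := by
      rw [← Finset.card_eq_zero, Finset.card_powersetCard, Finset.card_univ, Fintype.card_fin, h]
    rw [this]; simp
  · rw [mul_div_cancel₀]
    exact_mod_cast h.ne'

lemma permAvg_img_eq_layerAvg {m : ℕ} (F : Finset (Fin m) → ℝ) (A : Finset (Fin m)) :
    permAvg (fun σ => F (img σ A)) = layerAvg F A.card := by
  have h : 0 < m.choose A.card := Nat.choose_pos (by simpa using Finset.card_le_univ A)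
  rw [layerAvg, ← permAvg_img, mul_div_assoc, div_self, mul_one]
  exact_mod_cast h.ne'

lemma choose_mul_layerAvg_le {m : ℕ} {F : Finset (Fin m) → ℝ} (hF1 : ∀ A, F A ≤ 1) (r : ℕ) :
    (m.choose r : ℝ) * layerAvg F r ≤ m.choose r := by
  rw [choose_mul_layerAvg]
  calc _ ≤ ∑ X ∈ Finset.powersetCard r (Finset.univ : Finset (Fin m)), (1 : ℝ) :=
        Finset.sum_le_sum fun _ _ => hF1 _
    _ = _ := by simp

lemma sum_card_le_eq_sum_layerAvg {m : ℕ} (F : Finset (Fin m) → ℝ) (k : ℕ) :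
    ∑ X ∈ Finset.univ.filter (fun X : Finset (Fin m) => X.card ≤ k), F X =
      ∑ r ∈ Finset.range (k + 1), (m.choose r : ℝ) * layerAvg F r := by
  simp only [choose_mul_layerAvg]
  rw [← Finset.sum_biUnion]
  · refine Finset.sum_congr ?_ fun _ _ => rfl
    ext X
    simp
  · intro i _ j _ hij
    exact Finset.disjoint_left.2 fun X h1 h2 => hij
      ((Finset.mem_powersetCard.1 h1).2.symm.trans (Finset.mem_powersetCard.1 h2).2)

/-- A family of positive density among the sets of size at most `k` keeps positive density
on the central sizes of some parity. -/
lemma exists_parity_le_sum_layerAvg {m k h : ℕ} (hh : 1 ≤ h)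
    {F : Finset (Fin m) → ℝ} (hF1 : ∀ A, F A ≤ 1) {β : ℝ}
    (hβ : 4 * (min k ((m + 1) / 2) : ℕ) ≤ β * (h : ℝ) ^ 2)
    (hS : β * numNeighbors (m + 1) k ≤
      ∑ X ∈ Finset.univ.filter (fun X : Finset (Fin m) => X.card ≤ k), F X) :
    ∃ a : ℕ, β / 4 * numNeighbors (m + 1) k ≤
      ∑ r ∈ (window k (min k ((m + 1) / 2)) h).filter (fun r => r % 2 = a),
        (m.choose r : ℝ) * layerAvg F r := by
  set q := min k ((m + 1) / 2) with hq
  set W := window k q h with hW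
  set N : ℝ := ((numNeighbors (m + 1) k : ℕ) : ℝ) with hN
  have hN0 : 0 ≤ N := Nat.cast_nonneg _
  have hhR : (1 : ℝ) ≤ (h : ℝ) ^ 2 := by
    have : (1 : ℝ) ≤ h := by exact_mod_cast hh
    nlinarith
  rw [sum_card_le_eq_sum_layerAvg, ← Finset.sum_filter_add_sum_filter_not _ (· ∈ W)] at hS
  -- By `hβ` the sizes outside the window carry at most half of the density `β`. The better of the
  -- two parities keeps half of the rest.
  have ht : ∑ r ∈ (Finset.range (k + 1)).filter (· ∉ W), (m.choose r : ℝ) * layerAvg F r ≤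
      β / 2 * N := by
    have h1 : ∑ r ∈ (Finset.range (k + 1)).filter (· ∉ W), (m.choose r : ℝ) * layerAvg F r ≤
        ∑ r ∈ (Finset.range (k + 1)).filter (· ∉ W), (m.choose r : ℝ) :=
      Finset.sum_le_sum fun r _ => choose_mul_layerAvg_le hF1 r
    have h2 : (h : ℝ) ^ 2 * ∑ r ∈ (Finset.range (k + 1)).filter (· ∉ W), (m.choose r : ℝ) ≤
        2 * q * N := by
      rw [hN, hW, hq]
      exact_mod_cast sum_choose_notMem_window_le (m := m) (k := k) hh
    have h3 : (h : ℝ) ^ 2 * ∑ r ∈ (Finset.range (k + 1)).filter (· ∉ W), (m.choose r : ℝ) ≤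
        (h : ℝ) ^ 2 * (β / 2 * N) := by
      refine h2.trans ?_
      have := mul_le_mul_of_nonneg_right hβ hN0
      linarith
    exact h1.trans (le_of_mul_le_mul_left h3 (by linarith))
  have hWf : (Finset.range (k + 1)).filter (· ∈ W) = W := by
    ext r
    simp only [hW, Finset.mem_filter, Finset.mem_range, mem_window]
    omega
  rw [hWf, ← Finset.sum_filter_add_sum_filter_not W (fun r => r % 2 = 0)] at hS
  by_cases hc : β / 4 * N ≤
      ∑ r ∈ W.filter (fun r => r % 2 = 0), (m.choose r : ℝ) * layerAvg F r
  · exact ⟨0, hc⟩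
  · refine ⟨1, ?_⟩
    have : W.filter (fun r => r % 2 = 1) = W.filter (fun r => ¬ r % 2 = 0) :=
      Finset.filter_congr fun r _ => by omega
    rw [this]
    linarith

lemma sum_window_weight_le {m k q h : ℕ} (h0 : 1 ≤ q - 2 * h) {V : Finset ℕ}
    (hV : V ⊆ window k q h) (hN : 0 < numNeighbors (m + 1) k) :
    ∑ r ∈ V, (m.choose r : ℝ) / numNeighbors (m + 1) k ≤ 1 := by
  have hN0 : (0 : ℝ) < numNeighbors (m + 1) k := by exact_mod_cast hN
  rw [← Finset.sum_div, div_le_one hN0]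
  have : V ⊆ Finset.Icc 1 k := by
    intro r hr
    have := mem_window.1 (hV hr)
    rw [Finset.mem_Icc]
    omega
  have h1 := Finset.sum_le_sum_of_subset (f := fun r => m.choose r) this
  have h2 := numNeighbors_mono_left (Nat.le_succ m) k
  exact_mod_cast h1.trans h2

/-- Cauchy-Schwarz for weights of total mass at most one. Squared layer means are the quantities in
which `le_corr` is stated. -/
lemma sq_le_sum_sq_layerAvg {m k q h a : ℕ} (h0 : 1 ≤ q - 2 * h) {F : Finset (Fin m) → ℝ}
    {γ : ℝ} (hγ : 0 ≤ γ) (hN : 0 < numNeighbors (m + 1) k)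
    (H : γ * numNeighbors (m + 1) k ≤ ∑ r ∈ (window k q h).filter (fun r => r % 2 = a),
        (m.choose r : ℝ) * layerAvg F r) :
    γ ^ 2 ≤ ∑ r ∈ (window k q h).filter (fun r => r % 2 = a),
      (m.choose r : ℝ) / numNeighbors (m + 1) k * layerAvg F r ^ 2 := by
  set V := (window k q h).filter (fun r => r % 2 = a)
  set N : ℝ := ((numNeighbors (m + 1) k : ℕ) : ℝ) with hNdef
  have hN0 : 0 < N := by rw [hNdef]; exact_mod_cast hN
  have hw : ∑ r ∈ V, (m.choose r : ℝ) / N ≤ 1 :=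
    sum_window_weight_le h0 (Finset.filter_subset _ _) hN
  have hγ' : γ ≤ ∑ r ∈ V, (m.choose r : ℝ) / N * layerAvg F r := by
    rw [← le_div_iff₀ hN0, Finset.sum_div] at H
    refine H.trans (le_of_eq (Finset.sum_congr rfl fun r _ => by ring))
  have hcs := Finset.sum_mul_sq_le_sq_mul_sq V (fun r => Real.sqrt ((m.choose r : ℝ) / N))
    (fun r => Real.sqrt ((m.choose r : ℝ) / N) * layerAvg F r)
  have hs : ∀ r, Real.sqrt ((m.choose r : ℝ) / N) ^ 2 = (m.choose r : ℝ) / N := fun r =>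
    Real.sq_sqrt (by positivity)
  have e1 : ∀ r, Real.sqrt ((m.choose r : ℝ) / N) *
      (Real.sqrt ((m.choose r : ℝ) / N) * layerAvg F r) = (m.choose r : ℝ) / N * layerAvg F r := by
    intro r; rw [← mul_assoc, ← sq, hs]
  simp only [e1, mul_pow, hs] at hcs
  have hnn : 0 ≤ ∑ r ∈ V, (m.choose r : ℝ) / N * layerAvg F r ^ 2 :=
    Finset.sum_nonneg fun r _ => by positivity
  calc γ ^ 2 ≤ (∑ r ∈ V, (m.choose r : ℝ) / N * layerAvg F r) ^ 2 := pow_le_pow_left₀ hγ hγ' 2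
    _ ≤ _ := hcs
    _ ≤ 1 * _ := mul_le_mul_of_nonneg_right hw hnn
    _ = _ := one_mul _

lemma card_symmDiff_add {m : ℕ} (A B : Finset (Fin m)) :
    (symmDiff A B).card + 2 * (A ∩ B).card = A.card + B.card := by
  have h1 : symmDiff A B = (A \ B) ∪ (B \ A) := rfl
  rw [h1, Finset.card_union_of_disjoint (by
    rw [Finset.disjoint_left]; intro i hi hj
    exact (Finset.mem_sdiff.1 hj).2 (Finset.mem_sdiff.1 hi).1)]
  have h2 := Finset.card_sdiff_add_card_inter A B
  have h3 := Finset.card_sdiff_add_card_inter B A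
  rw [Finset.inter_comm B A] at h3
  omega

/-- The pairs `(A, B)` of sets of sizes `r`, `r'` whose symmetric difference has size `d`. -/
def IsSetPair {m : ℕ} (d r r' : ℕ) (x : Finset (Fin m) × Finset (Fin m)) : Prop :=
  x.1.card = r ∧ x.2.card = r' ∧ (symmDiff x.1 x.2).card = d

/-- A choice of a pair of sets of sizes `r`, `r'` whose symmetric difference has size `d`. -/
def setPair (m d r r' : ℕ) : Finset (Fin m) × Finset (Fin m) :=
  if h : ∃ x : Finset (Fin m) × Finset (Fin m), IsSetPair d r r' x then h.choose else (∅, ∅)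

lemma setPair_spec {m d r r' : ℕ} (h : ∃ x : Finset (Fin m) × Finset (Fin m), IsSetPair d r r' x) :
    IsSetPair d r r' (setPair m d r r') := by
  unfold setPair
  rw [dif_pos h]
  exact h.choose_spec

/-- The pairs of central sizes compatible with a symmetric difference of size `d`. -/
def sizePairs (m k q h d : ℕ) : Finset (ℕ × ℕ) :=
  (window k q h ×ˢ window k q h).filter fun x =>
    ∃ y : Finset (Fin m) × Finset (Fin m), IsSetPair d x.1 x.2 y

lemma sizes_of_mem_window {m q h b d r r' j : ℕ} (hq : 2 * q ≤ m + 1) (hh : 1 ≤ h) (hb : 1 ≤ b)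
    (hbig : 8 * h + 8 * b ≤ q) (hd1 : q ≤ d + 2 * h + 1) (hd2 : d ≤ q)
    (hj : d + 2 * j = r + r') (hr : q ≤ r + 2 * h) (hr' : q ≤ r' + 2 * h)
    (hr1 : r ≤ q + 2 * h + 1) (hr1' : r' ≤ q + 2 * h + 1) :
    j + 2 * b ≤ r ∧ j + 2 * b ≤ r' ∧ r + r' + 3 * b ≤ m + j := by
  omega

/-- For central sizes parity is the only obstruction to a prescribed symmetric difference, since `|A
∆ B| = |A| + |B| - 2 |A ∩ B|`. -/
lemma exists_isSetPair {m q h b d r r' : ℕ} (hq : 2 * q ≤ m + 1) (hb : 1 ≤ b)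
    (hbig : 8 * h + 8 * b ≤ q) (hd1 : q ≤ d + 2 * h + 1) (hd2 : d ≤ q)
    (hpar : (r + r') % 2 = d % 2) (hr : q ≤ r + 2 * h) (hr' : q ≤ r' + 2 * h)
    (hr1 : r ≤ q + 2 * h + 1) (hr1' : r' ≤ q + 2 * h + 1) :
    ∃ y : Finset (Fin m) × Finset (Fin m), IsSetPair d r r' y := by
  obtain ⟨j, hj⟩ : ∃ j, r + r' = d + 2 * j := ⟨(r + r' - d) / 2, by omega⟩
  obtain ⟨A, B, hA, hB, hAB⟩ := exists_sets (m := m) (r := r) (r' := r') (j := j)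
    (by omega) (by omega) (by omega)
  refine ⟨(A, B), hA, hB, ?_⟩
  have := card_symmDiff_add A B
  simp only
  omega

/-- The bias is taken to be `p = q / (m + 1)`. Then `m p` is within one of `q`, and `r`, `r'` and
twice the intersection are all within order `h` of it, so every deviation in `le_corr` is of order
`h + √q`. -/
lemma sub_le_corr {m q h b d r r' : ℕ} (hq : 2 * q ≤ m + 1) (hh : 1 ≤ h) (hb : 1 ≤ b)
    (hbig : 8 * h + 8 * b ≤ q) (hd1 : q ≤ d + 2 * h + 1) (hd2 : d ≤ q) (hr : q ≤ r + 2 * h)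
    (hr' : q ≤ r' + 2 * h) (hr1 : r ≤ q + 2 * h + 1) (hr1' : r' ≤ q + 2 * h + 1)
    {F G : Finset (Fin m) → ℝ} (hF : ∀ A, 0 ≤ F A)
    (hF1 : ∀ A, F A ≤ 1) (hG : ∀ A, 0 ≤ G A) (hG1 : ∀ A, G A ≤ 1) {e : ℝ}
    (he : 2 / (b : ℝ) * (3 * Real.sqrt q + (7 * h + 6)) ≤ e) {A B : Finset (Fin m)}
    (hA : A.card = r) (hB : B.card = r') (hAB : (symmDiff A B).card = d) :
    layerAvg F r ^ 2 * layerAvg G r' ^ 2 - e ≤ corr F G A B := by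
  have hc := card_symmDiff_add A B
  have hp : (q : ℝ) / (m + 1) ≤ 1 / 2 := by
    rw [div_le_div_iff₀ (by positivity) (by norm_num)]
    have : q * 2 ≤ m + 1 := by omega
    norm_cast
    omega
  rw [hA, hB, hAB] at hc
  obtain ⟨z1, z2, z3⟩ := sizes_of_mem_window hq hh hb hbig hd1 hd2 hc hr hr' hr1 hr1'
  have hp0 : (0 : ℝ) ≤ (q : ℝ) / (m + 1) := div_nonneg (Nat.cast_nonneg _) (by positivity)
  have hL := le_corr hF hF1 hG hG1 hb z1 z2 z3 hA hB rfl hp0 hp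
  rw [permAvg_img_eq_layerAvg, permAvg_img_eq_layerAvg, hA, hB] at hL
  have hb0 : 0 ≤ 2 / (b : ℝ) := by positivity
  refine le_trans ?_ hL
  have hmp1 : (m : ℝ) * (q / (m + 1)) ≤ q := by
    rw [← mul_div_assoc, div_le_iff₀ (by positivity)]
    nlinarith [Nat.cast_nonneg (α := ℝ) q]
  have hmp2 : (q : ℝ) - 1 ≤ (m : ℝ) * (q / (m + 1)) := by
    rw [← mul_div_assoc, le_div_iff₀ (by positivity)]
    have : (q : ℝ) ≤ m + 1 := by exact_mod_cast (by omega : q ≤ m + 1)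
    nlinarith
  set y := (m : ℝ) * (q / (m + 1))
  have hsq := Real.sqrt_le_sqrt hmp1
  have c1 : (q : ℝ) ≤ r + 2 * h := by exact_mod_cast hr
  have c2 : (r : ℝ) ≤ q + 2 * h + 1 := by exact_mod_cast hr1
  have c3 : (q : ℝ) ≤ r' + 2 * h := by exact_mod_cast hr'
  have c4 : (r' : ℝ) ≤ q + 2 * h + 1 := by exact_mod_cast hr1'
  have c5 : (d : ℝ) + 2 * (A ∩ B).card = r + r' := by
    exact_mod_cast hc
  have c6 : (q : ℝ) ≤ d + 2 * h + 1 := by exact_mod_cast hd1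
  have c7 : (d : ℝ) ≤ q := by exact_mod_cast hd2
  have d1 : |y / 2 - (A ∩ B).card| ≤ 3 * h + 2 := by rw [abs_le]; constructor <;> linarith
  have d2 : |y - r| ≤ 2 * h + 2 := by rw [abs_le]; constructor <;> linarith
  have d3 : |y - r'| ≤ 2 * h + 2 := by rw [abs_le]; constructor <;> linarith
  have : 2 / (b : ℝ) * (3 * Real.sqrt y + (|y / 2 - (A ∩ B).card| + |y - r| + |y - r'|)) ≤
      2 / (b : ℝ) * (3 * Real.sqrt q + (7 * h + 6)) :=
    mul_le_mul_of_nonneg_left (by linarith) hb0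
  linarith

/-- Each family keeps density `β / 4` on the central sizes of some parity, and the sum of the two
parities is the admissible parity of `d`. Bounding `corr` below for each pair of sizes and averaging
gives the product of two mean squares, `(β / 4) ^ 4`, up to `e`. -/
lemma le_sum_corr {m k q h b : ℕ} (hk : k ≤ m + 1) (hq : q = min k ((m + 1) / 2)) (hh : 1 ≤ h) (hb : 1 ≤ b)
    (hbig : 8 * h + 8 * b ≤ q) {F G : Finset (Fin m) → ℝ} (hF : ∀ A, 0 ≤ F A)
    (hF1 : ∀ A, F A ≤ 1) (hG : ∀ A, 0 ≤ G A) (hG1 : ∀ A, G A ≤ 1) {β e : ℝ} (hβ0 : 0 ≤ β)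
    (hβ : 4 * (q : ℝ) ≤ β * (h : ℝ) ^ 2)
    (he : 2 / (b : ℝ) * (3 * Real.sqrt q + (7 * h + 6)) ≤ e)
    (hFS : β * numNeighbors (m + 1) k ≤
      ∑ X ∈ Finset.univ.filter (fun X : Finset (Fin m) => X.card ≤ k), F X)
    (hGS : β * numNeighbors (m + 1) k ≤
      ∑ X ∈ Finset.univ.filter (fun X : Finset (Fin m) => X.card ≤ k), G X) :
    ∃ a : ℕ, a < 2 ∧ ∀ d, q ≤ d + 2 * h + 1 → d ≤ q → d % 2 = a →
      (β / 4) ^ 4 - e ≤ ∑ x ∈ sizePairs m k q h d,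
        (m.choose x.1 : ℝ) / numNeighbors (m + 1) k * ((m.choose x.2 : ℝ) / numNeighbors (m + 1) k) *
          corr F G (setPair m d x.1 x.2).1 (setPair m d x.1 x.2).2 := by
  have hNpos : 0 < numNeighbors (m + 1) k := numNeighbors_pos (by omega) hk
  have hqm : 2 * q ≤ m + 1 := by omega
  set N : ℝ := ((numNeighbors (m + 1) k : ℕ) : ℝ) with hN
  have hN0 : 0 < N := by rw [hN]; exact_mod_cast hNpos
  have hbR : (1 : ℝ) ≤ b := by exact_mod_cast hb
  have he0 : 0 ≤ e := le_trans (by positivity) he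
  obtain ⟨a1, ha1⟩ := exists_parity_le_sum_layerAvg hh hF1 (by rw [← hq]; exact hβ) hFS
  obtain ⟨a2, ha2⟩ := exists_parity_le_sum_layerAvg hh hG1 (by rw [← hq]; exact hβ) hGS
  rw [← hq] at ha1 ha2
  clear hq
  have hs1 := sq_le_sum_sq_layerAvg (by omega) (by positivity) hNpos ha1
  have hs2 := sq_le_sum_sq_layerAvg (by omega) (by positivity) hNpos ha2
  set V1 := (window k q h).filter (fun r => r % 2 = a1) with hV1
  set V2 := (window k q h).filter (fun r => r % 2 = a2) with hV2
  have hw1 : ∑ r ∈ V1, (m.choose r : ℝ) / N ≤ 1 :=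
    sum_window_weight_le (by omega) (Finset.filter_subset _ _) hNpos
  have hw2 : ∑ r ∈ V2, (m.choose r : ℝ) / N ≤ 1 :=
    sum_window_weight_le (by omega) (Finset.filter_subset _ _) hNpos
  have hw20 : 0 ≤ ∑ r ∈ V2, (m.choose r : ℝ) / N := Finset.sum_nonneg fun _ _ => by positivity
  refine ⟨(a1 + a2) % 2, Nat.mod_lt _ two_pos, fun d hd1 hd2 hda => ?_⟩
  have hsub : V1 ×ˢ V2 ⊆ sizePairs m k q h d := by
    rintro ⟨r, r'⟩ hx
    obtain ⟨hr, hr'⟩ := Finset.mem_product.1 hx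
    simp only [hV1, hV2, Finset.mem_filter] at hr hr'
    have w1 := mem_window.1 hr.1
    have w2 := mem_window.1 hr'.1
    exact Finset.mem_filter.2 ⟨Finset.mem_product.2 ⟨hr.1, hr'.1⟩, exists_isSetPair hqm hb hbig
      hd1 hd2 (by rw [hda, Nat.add_mod, hr.2, hr'.2]) (Nat.sub_le_iff_le_add.1 w1.1)
      (Nat.sub_le_iff_le_add.1 w2.1) w1.2.2 w2.2.2⟩
  have hterm : ∀ x ∈ V1 ×ˢ V2, (m.choose x.1 : ℝ) / N * ((m.choose x.2 : ℝ) / N) *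
      (layerAvg F x.1 ^ 2 * layerAvg G x.2 ^ 2 - e) ≤ (m.choose x.1 : ℝ) / N *
        ((m.choose x.2 : ℝ) / N) * corr F G (setPair m d x.1 x.2).1 (setPair m d x.1 x.2).2 := by
    intro x hx
    refine mul_le_mul_of_nonneg_left ?_ (by positivity)
    have hx' := Finset.mem_filter.1 (hsub hx)
    obtain ⟨hA, hB, hAB⟩ := setPair_spec hx'.2
    obtain ⟨w1, w2⟩ := Finset.mem_product.1 hx'.1
    rw [mem_window, Nat.sub_le_iff_le_add] at w1 w2
    exact sub_le_corr hqm hh hb hbig hd1 hd2 w1.1 w2.1 w1.2.2 w2.2.2 hF hF1 hG hG1 he hA hB hAB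
  calc (β / 4) ^ 4 - e
      ≤ (∑ r ∈ V1, (m.choose r : ℝ) / N * layerAvg F r ^ 2) *
          (∑ r ∈ V2, (m.choose r : ℝ) / N * layerAvg G r ^ 2) -
        (∑ r ∈ V1, (m.choose r : ℝ) / N) * (∑ r ∈ V2, (m.choose r : ℝ) / N) * e := by
        have h1 := mul_le_mul hs1 hs2 (sq_nonneg _) ((sq_nonneg _).trans hs1)
        have h2 : (∑ r ∈ V1, (m.choose r : ℝ) / N) * (∑ r ∈ V2, (m.choose r : ℝ) / N) * e ≤
            1 * e := mul_le_mul_of_nonneg_right (mul_le_one₀ hw1 hw20 hw2) he0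
        have h3 : (β / 4) ^ 2 * (β / 4) ^ 2 = (β / 4) ^ 4 := by ring
        linarith
    _ = ∑ x ∈ V1 ×ˢ V2, (m.choose x.1 : ℝ) / N * ((m.choose x.2 : ℝ) / N) *
          (layerAvg F x.1 ^ 2 * layerAvg G x.2 ^ 2 - e) := by
        rw [Finset.sum_mul_sum, Finset.sum_mul_sum, ← Finset.sum_product', ← Finset.sum_product',
          Finset.sum_mul, ← Finset.sum_sub_distrib]
        exact Finset.sum_congr rfl fun x _ => by ring
    _ ≤ _ := Finset.sum_le_sum hterm
    _ ≤ _ := Finset.sum_le_sum_of_subset_of_nonneg hsub fun x _ _ =>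
        mul_nonneg (by positivity) (corr_nonneg hF hG _ _)

/-- Admissible parameters for `le_sum_corr`. -/
lemma exists_window_parameters {β e : ℝ} (hβ : 0 < β) (he : 0 < e) :
    ∃ q₀ : ℕ, ∀ q, q₀ ≤ q → ∃ h b : ℕ, 1 ≤ h ∧ 1 ≤ b ∧ 8 * h + 8 * b ≤ q ∧
      4 * (q : ℝ) ≤ β * (h : ℝ) ^ 2 ∧
      2 / (b : ℝ) * (3 * Real.sqrt q + (7 * h + 6)) ≤ e := by
  obtain ⟨s, hs⟩ := exists_nat_ge (64 + 2000 / e)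
  have hs64 : (64 : ℝ) ≤ s := by
    have : 0 < 2000 / e := by positivity
    linarith
  have hse : 2000 ≤ s * e := by
    have : 2000 / e ≤ s := by linarith
    rwa [div_le_iff₀ he] at this
  obtain ⟨q₀, hq₀⟩ := exists_nat_ge (s + 16 * s ^ 2 / β + (1000 / e) ^ 2 + 2000 / e)
  have hp1 : 0 ≤ 16 * (s : ℝ) ^ 2 / β := by positivity
  have hp2 : 0 ≤ (1000 / e) ^ 2 := by positivity
  have hp3 : 0 ≤ 2000 / e := by positivity
  -- Both widths are linear in `q`. The small ratio `16 / s` of the two keeps the error from `h`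
  -- below `e`; a large `q` takes care of `√q / b` and makes `h²` exceed `q / β`.
  refine ⟨q₀, fun q hq => ⟨q / s, q / 16, ?_, ?_, ?_, ?_, ?_⟩⟩
  all_goals
    have hqR : (s : ℝ) + 16 * s ^ 2 / β + (1000 / e) ^ 2 + 2000 / e ≤ q :=
      hq₀.trans (by exact_mod_cast hq)
    have hsq : s ≤ q := by exact_mod_cast (by linarith : (s : ℝ) ≤ q)
    have hs64' : 64 ≤ s := by exact_mod_cast hs64
  · exact (Nat.one_le_div_iff (by omega)).2 hsq
  · omega
  · have : q / s ≤ q / 64 := Nat.div_le_div_left hs64' (by norm_num)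
    omega
  · have h1 : (q : ℝ) ≤ 2 * s * (q / s : ℕ) := by
      have h2 := Nat.div_add_mod q s
      have h3 := Nat.mod_lt q (by omega : s > 0)
      have h4 : 1 ≤ q / s := (Nat.one_le_div_iff (by omega)).2 hsq
      have : q ≤ 2 * s * (q / s) := by nlinarith
      exact_mod_cast this
    have h2 : 16 * (s : ℝ) ^ 2 ≤ β * q := by
      have : 16 * (s : ℝ) ^ 2 / β ≤ q := by linarith
      rw [div_le_iff₀ hβ] at this
      linarith
    have hq0 : (0 : ℝ) < q := by linarith
    have h3 : (q : ℝ) ^ 2 ≤ (2 * s * (q / s : ℕ)) ^ 2 := pow_le_pow_left₀ hq0.le h1 2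
    have h4 : 16 * (s : ℝ) ^ 2 * q ≤ β * (2 * s * (q / s : ℕ)) ^ 2 := by nlinarith
    have h5 : 0 < (s : ℝ) ^ 2 := by positivity
    nlinarith
  · have hq0 : (0 : ℝ) < q := by linarith
    have hb1 : (q : ℝ) ≤ 32 * (q / 16 : ℕ) := by
      have : q ≤ 32 * (q / 16) := by omega
      exact_mod_cast this
    have hbp : (0 : ℝ) < (q / 16 : ℕ) := by linarith
    have hhs : ((q / s : ℕ) : ℝ) * s ≤ q := by exact_mod_cast Nat.div_mul_le_self q s
    rw [div_mul_eq_mul_div, div_le_iff₀ hbp]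
    have h1 : 2000 * ((q / s : ℕ) : ℝ) ≤ e * q := by
      have : (0 : ℝ) ≤ ((q / s : ℕ) : ℝ) := Nat.cast_nonneg _
      nlinarith
    have h2 : 1000 * Real.sqrt q ≤ e * q := by
      have h3 : 1000 / e ≤ Real.sqrt q := Real.le_sqrt_of_sq_le (by linarith)
      rw [div_le_iff₀ he] at h3
      have h4 := Real.mul_self_sqrt hq0.le
      have h5 := Real.sqrt_nonneg (q : ℝ)
      nlinarith
    have h3 : 2000 ≤ e * q := by
      have : 2000 / e ≤ q := by linarith
      rwa [div_le_iff₀ he, mul_comm] at this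
    nlinarith

/-- The sizes above the middle are folded below it by `r ↦ n - r`. -/
lemma numNeighbors_le_two_mul {n k : ℕ} (hk : k ≤ n) :
    numNeighbors n k ≤ 2 * ∑ r ∈ Finset.range (min k (n / 2) + 1), n.choose r := by
  set q := min k (n / 2) with hq
  have h1 : Finset.Icc 1 k ⊆ Finset.range (q + 1) ∪ Finset.Icc (q + 1) k := by
    intro r hr
    simp only [Finset.mem_Icc, Finset.mem_range, Finset.mem_union] at hr ⊢
    omega
  have h2 : ∑ r ∈ Finset.Icc (q + 1) k, n.choose r ≤
      ∑ r ∈ Finset.range (q + 1), n.choose r := by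
    have h3 : ∑ r ∈ Finset.Icc (q + 1) k, n.choose r =
        ∑ r ∈ Finset.Icc (q + 1) k, n.choose (n - r) :=
      Finset.sum_congr rfl fun r hr => (Nat.choose_symm (by
        have := Finset.mem_Icc.1 hr; omega)).symm
    rw [h3, ← Finset.sum_image (f := fun s => n.choose s) (g := fun r => n - r)]
    · apply Finset.sum_le_sum_of_subset
      intro s hs
      obtain ⟨r, hr, rfl⟩ := Finset.mem_image.1 hs
      simp only [Finset.mem_Icc, Finset.mem_range] at hr ⊢
      omega
    · intro a ha b hb hab
      simp only [Finset.coe_Icc, Set.mem_Icc] at ha hb hab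
      omega
  have h8 := Finset.sum_le_sum_of_subset (f := fun r => n.choose r) h1
  have h9 := Finset.sum_union_inter (s₁ := Finset.range (q + 1))
      (s₂ := Finset.Icc (q + 1) k) (f := fun r => n.choose r)
  unfold numNeighbors
  omega

/-- Each parity class of the lower half of the window carries a fraction of order `k / n` of all
the moves. -/
lemma mul_numNeighbors_le_sum_parity {n k q h : ℕ} (hk : k ≤ n) (hq : q = min k (n / 2))
    (hh : 1 ≤ h) (hbig : 8 * h ≤ q) (hsq : 2 * q ≤ h ^ 2) (a : ℕ) (ha : a < 2) :
    k * numNeighbors n k ≤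
      36 * n * ∑ t ∈ (Finset.Icc (q - 2 * h) q).filter (fun t => t % 2 = a), n.choose t := by
  set L := q - 2 * h with hL
  set W := ∑ t ∈ (Finset.Icc L q).filter (fun t => t % 2 = a), n.choose t with hW
  have hqn : 2 * q ≤ n := by omega
  have hqk : k ≤ 3 * q := by omega
  have hL4 : k ≤ 4 * L := by omega
  have hN := numNeighbors_le_two_mul hk
  rw [← hq] at hN
  have ht := sum_choose_tail_le (M := n) (q := q) (by omega) hh
  have hNq : numNeighbors n q ≤ ∑ r ∈ Finset.range (q + 1), n.choose r :=
    Finset.sum_le_sum_of_subset fun r hr => by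
      have := Finset.mem_Icc.1 hr
      exact Finset.mem_range.2 (by omega)
  have hsplit : ∑ r ∈ Finset.range (q + 1), n.choose r =
      ∑ r ∈ Finset.range L, n.choose r + ∑ t ∈ Finset.Icc L q, n.choose t := by
    rw [← Finset.sum_union]
    · refine Finset.sum_congr ?_ fun _ _ => rfl
      ext r
      simp only [Finset.mem_range, Finset.mem_union, Finset.mem_Icc]
      omega
    · rw [Finset.disjoint_left]
      intro r h1 h2
      simp only [Finset.mem_range, Finset.mem_Icc] at h1 h2
      omega
  have hhalf : 2 * ∑ r ∈ Finset.range L, n.choose r ≤ ∑ r ∈ Finset.range (q + 1), n.choose r := by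
    apply Nat.le_of_mul_le_mul_left _ (by omega : 0 < q)
    calc q * (2 * ∑ r ∈ Finset.range L, n.choose r) = 2 * q * ∑ r ∈ Finset.range L, n.choose r := by
          ring
      _ ≤ h ^ 2 * ∑ r ∈ Finset.range L, n.choose r := Nat.mul_le_mul_right _ hsq
      _ ≤ q * numNeighbors n q := ht
      _ ≤ _ := Nat.mul_le_mul_left _ hNq
  -- Neighbouring layers differ by a factor of at most `4 n / k`, because `t + 1 ≥ L ≥ k / 4`. A
  -- wrong-parity layer is charged to the one below it; this is the loss of `n / k`.
  have hstep : ∀ t, L ≤ t → k * n.choose (t + 1) ≤ 4 * n * n.choose t := by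
    intro t ht
    have h1 := Nat.choose_succ_right_eq n t
    calc k * n.choose (t + 1) ≤ 4 * (t + 1) * n.choose (t + 1) :=
          Nat.mul_le_mul_right _ (by omega)
      _ = 4 * (n.choose (t + 1) * (t + 1)) := by ring
      _ = 4 * (n - t) * n.choose t := by rw [h1]; ring
      _ ≤ 4 * n * n.choose t := Nat.mul_le_mul_right _ (by omega)
  -- The bottom layer has no layer below it in the window and is charged upwards.
  have hlow : k * n.choose L ≤ 4 * n * n.choose (L + 1) := by
    have h1 := Nat.choose_le_succ_of_lt_half_left (n := n) (r := L) (by omega)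
    exact Nat.mul_le_mul (by omega) h1
  have hodd : k * ∑ t ∈ (Finset.Icc L q).filter (fun t => ¬ t % 2 = a), n.choose t ≤
      8 * n * W := by
    have hsub : (Finset.Icc L q).filter (fun t => ¬ t % 2 = a) ⊆
        ((Finset.Icc (L + 1) q).filter (fun t => ¬ t % 2 = a)) ∪
          ({L} : Finset ℕ).filter (fun t => ¬ t % 2 = a) := by
      intro r hr
      simp only [Finset.mem_filter, Finset.mem_Icc, Finset.mem_union, Finset.mem_singleton] at hr ⊢
      omega
    have h8 := Finset.sum_le_sum_of_subset (f := fun r => n.choose r) hsub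
    have h9 := Finset.sum_union_inter (s₁ := (Finset.Icc (L + 1) q).filter (fun t => ¬ t % 2 = a))
      (s₂ := ({L} : Finset ℕ).filter (fun t => ¬ t % 2 = a)) (f := fun r => n.choose r)
    have p1 : k * ∑ t ∈ (Finset.Icc (L + 1) q).filter (fun t => ¬ t % 2 = a), n.choose t ≤
        4 * n * W := by
      rw [Finset.mul_sum]
      have : ∀ t ∈ (Finset.Icc (L + 1) q).filter (fun t => ¬ t % 2 = a),
          k * n.choose t ≤ 4 * n * n.choose (t - 1) := by
        intro t ht
        simp only [Finset.mem_filter, Finset.mem_Icc] at ht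
        have := hstep (t - 1) (by omega)
        rwa [Nat.sub_add_cancel (by omega)] at this
      refine (Finset.sum_le_sum this).trans ?_
      rw [← Finset.mul_sum, ← Finset.sum_image (f := fun s => n.choose s) (g := fun r => r - 1)]
      · apply Nat.mul_le_mul_left
        apply Finset.sum_le_sum_of_subset
        intro s hs
        obtain ⟨r, hr, rfl⟩ := Finset.mem_image.1 hs
        simp only [Finset.mem_filter, Finset.mem_Icc] at hr ⊢
        omega
      · intro x hx y hy hxy
        simp only [Finset.coe_filter, Finset.mem_Icc, Set.mem_ofPred_eq] at hx hy hxy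
        omega
    have p2 : k * ∑ t ∈ ({L} : Finset ℕ).filter (fun t => ¬ t % 2 = a), n.choose t ≤
        4 * n * W := by
      rw [Finset.sum_filter, Finset.sum_singleton]
      by_cases hLa : L % 2 = a
      · simp [hLa]
      · rw [if_pos hLa]
        refine hlow.trans (Nat.mul_le_mul_left _ ?_)
        apply Finset.single_le_sum (f := fun t => n.choose t) (fun _ _ => Nat.zero_le _)
        simp only [Finset.mem_filter, Finset.mem_Icc]
        omega
    have p3 := Nat.mul_le_mul_left k (h8.trans (Nat.le_of_add_right_le h9.le))
    rw [Nat.mul_add] at p3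
    linarith
  have hfs := Finset.sum_filter_add_sum_filter_not (Finset.Icc L q) (fun t => t % 2 = a)
    (fun t => n.choose t)
  have hT : numNeighbors n k ≤ 4 * ∑ t ∈ Finset.Icc L q, n.choose t := by omega
  have hkW : k * W ≤ n * W := Nat.mul_le_mul_right _ hk
  calc k * numNeighbors n k ≤ k * (4 * ∑ t ∈ Finset.Icc L q, n.choose t) :=
        Nat.mul_le_mul_left _ hT
    _ = 4 * (k * W + k * ∑ t ∈ (Finset.Icc L q).filter (fun t => ¬ t % 2 = a), n.choose t) := by
        rw [← hfs]; ring
    _ ≤ 4 * (n * W + 8 * n * W) := by omega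
    _ = _ := by ring

/-! ### Splitting off a coordinate -/

/-- `E` with the coordinate `i` removed. -/
def pull {m : ℕ} (i : Fin (m + 1)) (E : Finset (Fin (m + 1))) : Finset (Fin m) :=
  Finset.univ.filter fun l => i.succAbove l ∈ E

lemma flip_map_insertNth {m : ℕ} (i : Fin (m + 1)) (D : Finset (Fin m)) (b : Bool) (u : Vertex m) :
    flip (D.map i.succAboveEmb) (i.insertNth (α := fun _ => Bool) b u) =
      i.insertNth (α := fun _ => Bool) b (flip D u) := by
  funext j
  refine Fin.succAboveCases i ?_ (fun l => ?_) j
  · simp [flip_apply, Fin.succAbove_ne]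
  · simp [flip_apply]

lemma flip_insert_map_insertNth {m : ℕ} (i : Fin (m + 1)) (D : Finset (Fin m)) (b : Bool)
    (u : Vertex m) :
    flip (insert i (D.map i.succAboveEmb)) (i.insertNth (α := fun _ => Bool) b u) =
      i.insertNth (α := fun _ => Bool) (!b) (flip D u) := by
  funext j
  refine Fin.succAboveCases i ?_ (fun l => ?_) j
  · simp [flip_apply]
  · simp [flip_apply, Fin.succAbove_ne]

/-- A set `E` of size `d` arises once from each coordinate outside it. -/
lemma sum_map_succAbove {m : ℕ} (d : ℕ) (g : Finset (Fin (m + 1)) → ℝ) :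
    ∑ i : Fin (m + 1), ∑ D ∈ Finset.powersetCard d (Finset.univ : Finset (Fin m)),
      g (D.map i.succAboveEmb) =
    ((m + 1 : ℕ) - d : ℝ) * ∑ E ∈ Finset.powersetCard d Finset.univ, g E := by
  have h : ∀ i : Fin (m + 1), ∑ D ∈ Finset.powersetCard d (Finset.univ : Finset (Fin m)),
      g (D.map i.succAboveEmb) =
      ∑ E ∈ Finset.powersetCard d Finset.univ, if i ∉ E then g E else 0 := by
    intro i
    rw [← Finset.sum_filter]
    refine Finset.sum_bij' (fun D _ => D.map i.succAboveEmb) (fun E _ => pull i E) ?_ ?_ ?_ ?_ ?_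
    · intro D hD
      simp only [Finset.mem_powersetCard, Finset.subset_univ, true_and] at hD
      simp [hD, Fin.succAbove_ne]
    · intro E hE
      simp only [Finset.mem_filter, Finset.mem_powersetCard, Finset.subset_univ, true_and] at hE ⊢
      have : (pull i E).map i.succAboveEmb = E := by
        ext j
        refine Fin.succAboveCases i ?_ (fun l => ?_) j
        · simp [pull, hE.2, Fin.succAbove_ne]
        · simp [pull]
      rw [← hE.1, ← this, Finset.card_map, this]
    · intro D hD
      ext l; simp [pull]
    · intro E hE
      simp only [Finset.mem_filter, Finset.mem_powersetCard, Finset.subset_univ, true_and] at hE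
      ext j
      refine Fin.succAboveCases i ?_ (fun l => ?_) j
      · simp [pull, hE.2, Fin.succAbove_ne]
      · simp [pull]
    · intro D hD; rfl
  rw [Finset.sum_congr rfl fun i _ => h i, Finset.sum_comm, Finset.mul_sum]
  refine Finset.sum_congr rfl fun E hE => ?_
  have hE := (Finset.mem_powersetCard.1 hE).2
  rw [← Finset.sum_filter, Finset.sum_const, nsmul_eq_mul]
  congr 1
  have : (Finset.univ.filter fun i => i ∉ E) = Eᶜ := by ext; simp
  rw [this, Finset.card_compl, Fintype.card_fin, hE, Nat.cast_sub]
  rw [← hE]; simpa using Finset.card_le_univ E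

/-- A set `E` of size `d + 1` arises once from each of its elements. -/
lemma sum_insert_map_succAbove {m : ℕ} (d : ℕ) (g : Finset (Fin (m + 1)) → ℝ) :
    ∑ i : Fin (m + 1), ∑ D ∈ Finset.powersetCard d (Finset.univ : Finset (Fin m)),
      g (insert i (D.map i.succAboveEmb)) =
    (d + 1 : ℝ) * ∑ E ∈ Finset.powersetCard (d + 1) Finset.univ, g E := by
  have hmem : ∀ (i : Fin (m + 1)) (D : Finset (Fin m)), i ∉ D.map i.succAboveEmb := by
    intro i D; simp [Fin.succAbove_ne]
  have h : ∀ i : Fin (m + 1), ∑ D ∈ Finset.powersetCard d (Finset.univ : Finset (Fin m)),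
      g (insert i (D.map i.succAboveEmb)) =
      ∑ E ∈ Finset.powersetCard (d + 1) Finset.univ, if i ∈ E then g E else 0 := by
    intro i
    rw [← Finset.sum_filter]
    have hinv : ∀ E : Finset (Fin (m + 1)), i ∈ E →
        insert i ((pull i E).map i.succAboveEmb) = E := by
      intro E hE
      ext j
      refine Fin.succAboveCases i ?_ (fun l => ?_) j
      · simp [hE]
      · simp [pull, Fin.succAbove_ne]
    refine Finset.sum_bij' (fun D _ => insert i (D.map i.succAboveEmb)) (fun E _ => pull i E)
      ?_ ?_ ?_ ?_ ?_
    · intro D hD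
      simp only [Finset.mem_powersetCard, Finset.subset_univ, true_and] at hD
      simp only [Finset.mem_filter, Finset.mem_powersetCard, Finset.subset_univ, true_and,
        Finset.mem_insert_self, and_true]
      rw [Finset.card_insert_of_notMem (hmem i D), Finset.card_map, hD]
    · intro E hE
      simp only [Finset.mem_filter, Finset.mem_powersetCard, Finset.subset_univ, true_and] at hE ⊢
      have := hE.1
      rw [← hinv E hE.2, Finset.card_insert_of_notMem (hmem i _), Finset.card_map] at this
      omega
    · intro D hD
      ext l; simp [pull, Fin.succAbove_ne]
    · intro E hE
      simp only [Finset.mem_filter, Finset.mem_powersetCard, Finset.subset_univ, true_and] at hE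
      exact hinv E hE.2
    · intro D hD; rfl
  rw [Finset.sum_congr rfl fun i _ => h i, Finset.sum_comm, Finset.mul_sum]
  refine Finset.sum_congr rfl fun E hE => ?_
  have hE := (Finset.mem_powersetCard.1 hE).2
  rw [← Finset.sum_filter, Finset.sum_const, nsmul_eq_mul]
  congr 1
  have : (Finset.univ.filter fun i => i ∈ E) = E := by ext; simp
  rw [this, hE]; push_cast; rfl

lemma img_symmDiff {m : ℕ} (σ : Equiv.Perm (Fin m)) (A B : Finset (Fin m)) :
    img σ (symmDiff A B) = symmDiff (img σ A) (img σ B) := by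
  ext i; simp [mem_img, Finset.mem_symmDiff]

lemma sum_insertNth_le_sum {m : ℕ} (i : Fin (m + 1)) (b : Bool) {g : Vertex (m + 1) → ℝ}
    (hg : ∀ x, 0 ≤ g x) :
    ∑ u, g (i.insertNth (α := fun _ => Bool) b u) ≤ ∑ x, g x := by
  rw [sum_insertNth i]
  exact Finset.single_le_sum (f := fun b => ∑ u, g (i.insertNth (α := fun _ => Bool) b u))
    (fun _ _ => Finset.sum_nonneg fun _ _ => hg _) (Finset.mem_univ b)

/-- Recentring `u` by the first set turns the two ends into a point and its flip along a uniform
`d`-set, with the bit `i` added if the sides differ. Summing over `i` counts a pair at distance `t`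
either `m + 1 - t` or `t` times; with the probability of the `d`-set, both multiplicities give `(m +
1) / (m + 1).choose t`. -/
lemma sum_permAvg_insertNth_le {m d t : ℕ} {Φ : Vertex (m + 1) → Vertex (m + 1) → ℝ}
    (hΦ : ∀ x y, 0 ≤ Φ x y) (c c' : Bool) {A B : Finset (Fin m)} (hd : (symmDiff A B).card = d)
    (ht : t = d + if c = c' then 0 else 1) :
    ∑ i : Fin (m + 1), ∑ u : Vertex m, permAvg (fun σ =>
        Φ (i.insertNth (α := fun _ => Bool) c (flip (img σ A) u))
          (i.insertNth (α := fun _ => Bool) c' (flip (img σ B) u))) ≤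
      ((m : ℝ) + 1) / ((m + 1).choose t : ℝ) *
        ∑ x, ∑ E ∈ Finset.powersetCard t Finset.univ, Φ x (flip E x) := by
  set H : Finset (Fin m) → ℝ := fun D => ∑ i : Fin (m + 1), ∑ u : Vertex m,
    Φ (i.insertNth (α := fun _ => Bool) c u) (i.insertNth (α := fun _ => Bool) c' (flip D u))
    with hH
  have hdm : d ≤ m := by rw [← hd]; simpa using Finset.card_le_univ (symmDiff A B)
  have hC : (0 : ℝ) < m.choose d := by exact_mod_cast Nat.choose_pos hdm
  have hC' : (0 : ℝ) < (m + 1).choose t := by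
    have : t ≤ m + 1 := by rw [ht]; split_ifs <;> omega
    exact_mod_cast Nat.choose_pos this
  have e1 : ∑ i : Fin (m + 1), ∑ u : Vertex m, permAvg (fun σ =>
        Φ (i.insertNth (α := fun _ => Bool) c (flip (img σ A) u))
          (i.insertNth (α := fun _ => Bool) c' (flip (img σ B) u))) =
      permAvg (fun σ => H (img σ (symmDiff A B))) := by
    simp only [← permAvg_sum, hH]
    congr 1
    funext σ
    refine Finset.sum_congr rfl fun i _ => ?_
    rw [← sum_flip (img σ A) fun u => Φ (i.insertNth (α := fun _ => Bool) c u)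
      (i.insertNth (α := fun _ => Bool) c' (flip (img σ (symmDiff A B)) u))]
    refine Finset.sum_congr rfl fun u _ => ?_
    rw [flip_flip, img_symmDiff, symmDiff_comm (img σ A), symmDiff_symmDiff_cancel_right]
  have e2 := permAvg_img H (symmDiff A B)
  rw [← e1, hd] at e2
  have e3 : (∑ D ∈ Finset.powersetCard d Finset.univ, H D) * ((m + 1).choose t : ℝ) ≤
      ((m : ℝ) + 1) * (∑ x, ∑ E ∈ Finset.powersetCard t Finset.univ, Φ x (flip E x)) *
        m.choose d := by
    simp only [hH]
    rw [Finset.sum_comm]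
    by_cases hc : c = c'
    · subst hc
      simp only [if_true, add_zero] at ht
      subst ht
      have h1 : ∀ i : Fin (m + 1), ∑ D ∈ Finset.powersetCard t Finset.univ, ∑ u : Vertex m,
          Φ (i.insertNth (α := fun _ => Bool) c u)
            (i.insertNth (α := fun _ => Bool) c (flip D u)) ≤
          ∑ D ∈ Finset.powersetCard t (Finset.univ : Finset (Fin m)),
            (fun E => ∑ x, Φ x (flip E x)) (D.map i.succAboveEmb) := by
        intro i
        refine Finset.sum_le_sum fun D _ => ?_
        simp only [← flip_map_insertNth]
        exact sum_insertNth_le_sum i c fun x => hΦ x (flip (D.map i.succAboveEmb) x)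
      have h2 := Finset.sum_le_sum fun i (_ : i ∈ Finset.univ) => h1 i
      rw [sum_map_succAbove t fun E => ∑ x, Φ x (flip E x),
        Finset.sum_comm (s := Finset.powersetCard t (Finset.univ : Finset (Fin (m + 1))))] at h2
      have h3 : (((m + 1 : ℕ) : ℝ) - t) * (m + 1).choose t = ((m : ℝ) + 1) * m.choose t := by
        have := Nat.choose_mul_succ_eq m t
        rw [← Nat.cast_sub (by omega), mul_comm, mul_comm ((m : ℝ) + 1)]
        exact_mod_cast this.symm
      set S := ∑ x, ∑ E ∈ Finset.powersetCard t Finset.univ, Φ x (flip E x)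
      calc _ ≤ (((m + 1 : ℕ) : ℝ) - t) * S * ((m + 1).choose t : ℝ) :=
            mul_le_mul_of_nonneg_right h2 hC'.le
        _ = (((m + 1 : ℕ) : ℝ) - t) * (m + 1).choose t * S := by ring
        _ = _ := by rw [h3]; ring
    · have hc' : c' = !c := by cases c <;> cases c' <;> simp_all
      subst hc'
      simp only [hc, if_false] at ht
      subst ht
      have h1 : ∀ i : Fin (m + 1), ∑ D ∈ Finset.powersetCard d Finset.univ, ∑ u : Vertex m,
          Φ (i.insertNth (α := fun _ => Bool) c u)
            (i.insertNth (α := fun _ => Bool) (!c) (flip D u)) ≤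
          ∑ D ∈ Finset.powersetCard d (Finset.univ : Finset (Fin m)),
            (fun E => ∑ x, Φ x (flip E x)) (insert i (D.map i.succAboveEmb)) := by
        intro i
        refine Finset.sum_le_sum fun D _ => ?_
        simp only [← flip_insert_map_insertNth]
        exact sum_insertNth_le_sum i c fun x => hΦ x (flip (insert i (D.map i.succAboveEmb)) x)
      have h2 := Finset.sum_le_sum fun i (_ : i ∈ Finset.univ) => h1 i
      rw [sum_insert_map_succAbove d fun E => ∑ x, Φ x (flip E x), Finset.sum_comm
        (s := Finset.powersetCard (d + 1) (Finset.univ : Finset (Fin (m + 1))))] at h2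
      have h3 : ((d : ℝ) + 1) * (m + 1).choose (d + 1) = ((m : ℝ) + 1) * m.choose d := by
        have := Nat.add_one_mul_choose_eq m d
        rw [mul_comm]
        exact_mod_cast this.symm
      set S := ∑ x, ∑ E ∈ Finset.powersetCard (d + 1) Finset.univ, Φ x (flip E x)
      calc _ ≤ ((d : ℝ) + 1) * S * ((m + 1).choose (d + 1) : ℝ) :=
            mul_le_mul_of_nonneg_right h2 hC'.le
        _ = ((d : ℝ) + 1) * (m + 1).choose (d + 1) * S := by ring
        _ = _ := by rw [h3]; ring
  rw [← e2] at e3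
  rw [div_mul_eq_mul_div, le_div_iff₀ hC']
  apply le_of_mul_le_mul_right _ hC
  linarith

/-! ### Median fields and their increments for large `k`. -/

/-- The squared increment of `f`, if both vertices are good. -/
def goodGap {n : ℕ} (good : Vertex n → Prop) (f : Vertex n → ℝ) (x y : Vertex n) : ℝ :=
  if good x ∧ good y then (f x - f y) ^ 2 else 0

lemma goodGap_nonneg {n : ℕ} (good : Vertex n → Prop) (f : Vertex n → ℝ) (x y : Vertex n) :
    0 ≤ goodGap good f x y := by
  unfold goodGap; split_ifs <;> positivity

lemma sum_goodGap_le_edgeEnergy {n k : ℕ} (good : Vertex n → Prop) (f : Vertex n → ℝ)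
    {T : Finset ℕ} (hT : T ⊆ Finset.Icc 1 k) :
    ∑ t ∈ T, ∑ x, ∑ E ∈ Finset.powersetCard t Finset.univ, goodGap good f x (flip E x) ≤
      edgeEnergy k good f := by
  rw [Finset.sum_comm]
  refine Finset.sum_le_sum fun x _ => ?_
  have h : ∀ y, (if (hypercubeGraph n k).Adj x y ∧ good x ∧ good y then (f x - f y) ^ 2 else 0) =
      if (hypercubeGraph n k).Adj x y then goodGap good f x y else 0 := by
    intro y; unfold goodGap; by_cases h1 : (hypercubeGraph n k).Adj x y <;> simp [h1]
  rw [Finset.sum_congr rfl fun y _ => h y, sum_adj_eq_sum_moves x, ← Finset.sum_biUnion]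
  · refine Finset.sum_le_sum_of_subset_of_nonneg ?_ fun _ _ _ => goodGap_nonneg _ _ _ _
    intro E hE
    simp only [Finset.mem_biUnion, Finset.mem_powersetCard, Finset.subset_univ, true_and] at hE
    obtain ⟨t, ht, hEt⟩ := hE
    have := Finset.mem_Icc.1 (hT ht)
    rw [mem_moves]
    omega
  · intro i _ j _ hij
    exact Finset.disjoint_left.2 fun X h1 h2 => hij
      ((Finset.mem_powersetCard.1 h1).2.symm.trans (Finset.mem_powersetCard.1 h2).2)

/-- `F` is a median of `f` over the good neighbours of every vertex, of which there are at least
`a`. -/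
def IsMedianField {n : ℕ} (k : ℕ) (good : Vertex n → Prop) (a : ℝ) (f F : Vertex n → ℝ) : Prop :=
  ∀ v, a / 2 ≤ ((Finset.univ.filter fun y =>
      (hypercubeGraph n k).Adj v y ∧ good y ∧ f y ≤ F v).card : ℝ) ∧
    a / 2 ≤ ((Finset.univ.filter fun y =>
      (hypercubeGraph n k).Adj v y ∧ good y ∧ F v ≤ f y).card : ℝ)

/-- Between the two vertices there are large sets of good neighbours, on either side of the gap
between the two medians. -/
lemma IsMedianField.exists_sets {n k : ℕ} {good : Vertex n → Prop} {a : ℝ} {f F : Vertex n → ℝ}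
    (hF : IsMedianField k good a f F) (v w : Vertex n) :
    ∃ S S' : Finset (Vertex n), (∀ x ∈ S, (hypercubeGraph n k).Adj v x ∧ good x) ∧
      (∀ x ∈ S', (hypercubeGraph n k).Adj w x ∧ good x) ∧ a / 2 ≤ (S.card : ℝ) ∧
      a / 2 ≤ (S'.card : ℝ) ∧ ∀ x ∈ S, ∀ y ∈ S', (F v - F w) ^ 2 ≤ (f x - f y) ^ 2 := by
  rcases le_total (F v) (F w) with h | h
  · refine ⟨_, _, ?_, ?_, (hF v).1, (hF w).2, ?_⟩
    · intro x hx; simp only [Finset.mem_filter] at hx; exact ⟨hx.2.1, hx.2.2.1⟩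
    · intro x hx; simp only [Finset.mem_filter] at hx; exact ⟨hx.2.1, hx.2.2.1⟩
    · intro x hx y hy
      simp only [Finset.mem_filter] at hx hy
      have h1 := hx.2.2.2
      have h2 := hy.2.2.2
      nlinarith
  · refine ⟨_, _, ?_, ?_, (hF v).2, (hF w).1, ?_⟩
    · intro x hx; simp only [Finset.mem_filter] at hx; exact ⟨hx.2.1, hx.2.2.1⟩
    · intro x hx; simp only [Finset.mem_filter] at hx; exact ⟨hx.2.1, hx.2.2.1⟩
    · intro x hx y hy
      simp only [Finset.mem_filter] at hx hy
      have h1 := hx.2.2.2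
      have h2 := hy.2.2.2
      nlinarith

/-- A set of neighbours of `v` is large on one of the two sides of the coordinate `i`. -/
lemma exists_side {m k : ℕ} (i : Fin (m + 1)) (b : Bool) (u : Vertex m)
    {S : Finset (Vertex (m + 1))}
    (hS : ∀ x ∈ S, (hypercubeGraph (m + 1) k).Adj (i.insertNth (α := fun _ => Bool) b u) x)
    {a : ℝ} (ha : a ≤ S.card) :
    ∃ c : Bool, a / 2 ≤ ∑ X ∈ Finset.univ.filter (fun X : Finset (Fin m) => X.card ≤ k),
      if i.insertNth (α := fun _ => Bool) c (flip X u) ∈ S then (1 : ℝ) else 0 := by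
  have h1 : (S.card : ℝ) = ∑ c : Bool, ∑ X : Finset (Fin m),
      if i.insertNth (α := fun _ => Bool) c (flip X u) ∈ S then (1 : ℝ) else 0 := by
    have : (S.card : ℝ) = ∑ x, if x ∈ S then (1 : ℝ) else 0 := by simp
    rw [this, sum_insertNth i]
    refine Finset.sum_congr rfl fun c _ => ?_
    rw [sum_vertex_eq_sum_flip u]
  have h2 : ∀ c : Bool, ∑ X : Finset (Fin m),
      (if i.insertNth (α := fun _ => Bool) c (flip X u) ∈ S then (1 : ℝ) else 0) =
      ∑ X ∈ Finset.univ.filter (fun X : Finset (Fin m) => X.card ≤ k),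
      if i.insertNth (α := fun _ => Bool) c (flip X u) ∈ S then (1 : ℝ) else 0 := by
    intro c
    rw [Finset.sum_filter]
    refine Finset.sum_congr rfl fun X _ => ?_
    by_cases hX : X.card ≤ k
    · rw [if_pos hX]
    · rw [if_neg hX, if_neg]
      intro hmem
      apply hX
      by_cases hbc : c = b
      · have h3 := hS _ hmem
        rw [hbc, ← flip_map_insertNth, adj_flip, Finset.card_map] at h3
        exact h3.2
      · have hbc' : c = !b := by cases c <;> cases b <;> simp_all
        have h3 := hS _ hmem
        rw [hbc', ← flip_insert_map_insertNth, adj_flip, Finset.card_insert_of_notMem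
          (by simp [Fin.succAbove_ne]), Finset.card_map] at h3
        omega
  simp only [h2, Fintype.sum_bool] at h1
  by_contra hcon
  push Not at hcon
  have h3 := hcon true
  have h4 := hcon false
  linarith

/-- The average of `Φ` over the links between the two sides of the coordinate `i`, centred at
`u`, whose far ends have a difference of size `d` outside `i`. -/
def linkAvg {m : ℕ} (k q h d : ℕ) (c c' : Bool) (Φ : Vertex (m + 1) → Vertex (m + 1) → ℝ)
    (i : Fin (m + 1)) (u : Vertex m) : ℝ :=
  ∑ x ∈ sizePairs m k q h d,
    (m.choose x.1 : ℝ) / numNeighbors (m + 1) k * ((m.choose x.2 : ℝ) / numNeighbors (m + 1) k) *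
      permAvg fun σ =>
        Φ (i.insertNth (α := fun _ => Bool) c (flip (img σ (setPair m d x.1 x.2).1) u))
          (i.insertNth (α := fun _ => Bool) c' (flip (img σ (setPair m d x.1 x.2).2) u))

lemma linkAvg_nonneg {m : ℕ} (k q h d : ℕ) (c c' : Bool)
    {Φ : Vertex (m + 1) → Vertex (m + 1) → ℝ} (hΦ : ∀ x y, 0 ≤ Φ x y) (i : Fin (m + 1))
    (u : Vertex m) : 0 ≤ linkAvg k q h d c c' Φ i u :=
  Finset.sum_nonneg fun _ _ => mul_nonneg (by positivity) (permAvg_nonneg fun _ => hΦ _ _)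

/-- The bound for one pair of sizes does not depend on the sizes, and the weights of the pairs sum
to at most one. -/
lemma sum_linkAvg_le {m k q h d t : ℕ} (h0 : 1 ≤ q - 2 * h) (hN : 0 < numNeighbors (m + 1) k)
    {Φ : Vertex (m + 1) → Vertex (m + 1) → ℝ} (hΦ : ∀ x y, 0 ≤ Φ x y) (c c' : Bool)
    (ht : t = d + if c = c' then 0 else 1) :
    ∑ i : Fin (m + 1), ∑ u, linkAvg k q h d c c' Φ i u ≤
      ((m : ℝ) + 1) / ((m + 1).choose t : ℝ) *
        ∑ x, ∑ E ∈ Finset.powersetCard t Finset.univ, Φ x (flip E x) := by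
  set R := ((m : ℝ) + 1) / ((m + 1).choose t : ℝ) *
        ∑ x, ∑ E ∈ Finset.powersetCard t Finset.univ, Φ x (flip E x) with hR
  have hR0 : 0 ≤ R := mul_nonneg (by positivity) (Finset.sum_nonneg fun _ _ =>
    Finset.sum_nonneg fun _ _ => hΦ _ _)
  have e : ∑ i : Fin (m + 1), ∑ u, linkAvg k q h d c c' Φ i u =
      ∑ x ∈ sizePairs m k q h d, (m.choose x.1 : ℝ) / numNeighbors (m + 1) k *
        ((m.choose x.2 : ℝ) / numNeighbors (m + 1) k) *
        ∑ i : Fin (m + 1), ∑ u : Vertex m, permAvg fun σ =>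
        Φ (i.insertNth (α := fun _ => Bool) c (flip (img σ (setPair m d x.1 x.2).1) u))
          (i.insertNth (α := fun _ => Bool) c' (flip (img σ (setPair m d x.1 x.2).2) u)) := by
    unfold linkAvg
    simp only [Finset.mul_sum]
    rw [Finset.sum_comm' (t' := Finset.univ) (s' := fun _ => Finset.univ) (by simp),
      Finset.sum_congr rfl fun u _ => Finset.sum_comm, Finset.sum_comm]
    exact Finset.sum_congr rfl fun x _ => Finset.sum_comm
  rw [e]
  calc _ ≤ ∑ x ∈ sizePairs m k q h d, (m.choose x.1 : ℝ) / numNeighbors (m + 1) k *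
        ((m.choose x.2 : ℝ) / numNeighbors (m + 1) k) * R := by
        refine Finset.sum_le_sum fun x hx => mul_le_mul_of_nonneg_left ?_ (by positivity)
        exact sum_permAvg_insertNth_le hΦ c c'
          (setPair_spec (Finset.mem_filter.1 hx).2).2.2 ht
    _ ≤ ∑ x ∈ window k q h ×ˢ window k q h, (m.choose x.1 : ℝ) / numNeighbors (m + 1) k *
        ((m.choose x.2 : ℝ) / numNeighbors (m + 1) k) * R :=
        Finset.sum_le_sum_of_subset_of_nonneg (Finset.filter_subset _ _) fun _ _ _ =>
          mul_nonneg (by positivity) hR0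
    _ = (∑ r ∈ window k q h, (m.choose r : ℝ) / numNeighbors (m + 1) k) *
        (∑ r ∈ window k q h, (m.choose r : ℝ) / numNeighbors (m + 1) k) * R := by
        rw [Finset.sum_mul_sum, ← Finset.sum_product', Finset.sum_mul]
    _ ≤ 1 * R := by
        have hw := sum_window_weight_le h0 (Finset.Subset.refl (window k q h)) hN
        exact mul_le_mul_of_nonneg_right (mul_le_one₀ hw
          (Finset.sum_nonneg fun _ _ => by positivity) hw) hR0
    _ = R := one_mul R

/-- `le_sum_corr` is applied to the indicators of the two sets given by the medians, seen from the
common centre `u`. Their density is `α / 4`: one half is lost to the median and one half to the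
choice of a side of the coordinate `i`. -/
lemma exists_le_linkAvg {m k q h b : ℕ} (hk : k ≤ m + 1) (hq : q = min k ((m + 1) / 2))
    (hh : 1 ≤ h) (hb : 1 ≤ b) (hbig : 8 * h + 8 * b ≤ q) {α e : ℝ} (hα : 0 ≤ α)
    (hβ : 4 * (q : ℝ) ≤ α / 4 * (h : ℝ) ^ 2)
    (he : 2 / (b : ℝ) * (3 * Real.sqrt q + (7 * h + 6)) ≤ e)
    {good : Vertex (m + 1) → Prop} {f F : Vertex (m + 1) → ℝ}
    (hF : IsMedianField k good (α * numNeighbors (m + 1) k) f F) (i : Fin (m + 1))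
    (u : Vertex m) :
    ∃ (c c' : Bool) (a : ℕ), a < 2 ∧ ∀ t ∈ Finset.Icc (q - 2 * h) q, t % 2 = a →
      ((α / 4 / 4) ^ 4 - e) * (F (i.insertNth (α := fun _ => Bool) false u) -
          F (i.insertNth (α := fun _ => Bool) true u)) ^ 2 ≤
        linkAvg k q h (t - if c = c' then 0 else 1) c c' (goodGap good f) i u := by
  obtain ⟨S, S', hS, hS', hSc, hSc', hΔ⟩ := hF.exists_sets
    (i.insertNth (α := fun _ => Bool) false u) (i.insertNth (α := fun _ => Bool) true u)
  set Δ := (F (i.insertNth (α := fun _ => Bool) false u) -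
          F (i.insertNth (α := fun _ => Bool) true u)) ^ 2 with hΔdef
  obtain ⟨c, hc⟩ := exists_side i false u (fun x hx => (hS x hx).1) hSc
  obtain ⟨c', hc'⟩ := exists_side i true u (fun x hx => (hS' x hx).1) hSc'
  have hind : ∀ (T : Finset (Vertex (m + 1))) (c : Bool) (A : Finset (Fin m)),
      (0 : ℝ) ≤ (if i.insertNth (α := fun _ => Bool) c (flip A u) ∈ T then 1 else 0) ∧
      (if i.insertNth (α := fun _ => Bool) c (flip A u) ∈ T then (1 : ℝ) else 0) ≤ 1 := by
    intro T c A; split_ifs <;> norm_num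
  have e4 : α * numNeighbors (m + 1) k / 2 / 2 = α / 4 * numNeighbors (m + 1) k := by ring
  rw [e4] at hc hc'
  obtain ⟨a, ha2, ha⟩ := le_sum_corr hk hq hh hb hbig (fun A => (hind S c A).1)
    (fun A => (hind S c A).2) (fun A => (hind S' c' A).1) (fun A => (hind S' c' A).2)
    (by positivity : 0 ≤ α / 4) hβ he hc hc'
  set δ := if c = c' then 0 else 1 with hδ
  have hδ1 : δ ≤ 1 := by rw [hδ]; split_ifs <;> norm_num
  -- A link between different sides also flips `i`, so the total distance `t` exceeds the distance
  -- `t - δ` outside `i` by `δ`, which shifts the parity.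
  refine ⟨c, c', (a + δ) % 2, Nat.mod_lt _ two_pos, fun t ht hta => ?_⟩
  have htI := Finset.mem_Icc.1 ht
  change _ ≤ linkAvg k q h (t - δ) c c' (goodGap good f) i u
  clear_value δ
  have h1 : ((α / 4 / 4) ^ 4 - e) ≤ _ := ha (t - δ) (by clear hq; omega) (by clear hq; omega)
    (by clear hq; omega)
  have hΔ0 : 0 ≤ Δ := sq_nonneg _
  refine (mul_le_mul_of_nonneg_right h1 hΔ0).trans ?_
  unfold linkAvg
  rw [Finset.sum_mul]
  refine Finset.sum_le_sum fun x _ => ?_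
  rw [mul_assoc]
  refine mul_le_mul_of_nonneg_left ?_ (by positivity)
  unfold corr
  rw [mul_comm, ← permAvg_mul_const]
  refine permAvg_mono fun σ => ?_
  beta_reduce
  by_cases p1 : i.insertNth (α := fun _ => Bool) c
      (flip (img σ (setPair m (t - δ) x.1 x.2).1) u) ∈ S
  · by_cases p2 : i.insertNth (α := fun _ => Bool) c'
      (flip (img σ (setPair m (t - δ) x.1 x.2).2) u) ∈ S'
    · rw [if_pos p1, if_pos p2]
      unfold goodGap
      rw [if_pos ⟨(hS _ p1).2, (hS' _ p2).2⟩]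
      simpa using hΔ _ p1 _ p2
    · rw [if_neg p2, mul_zero, mul_zero]
      exact goodGap_nonneg _ _ _ _
  · rw [if_neg p1, zero_mul, mul_zero]
    exact goodGap_nonneg _ _ _ _

/-- For large `k` the smoothness alone controls the increments of the median field. -/
lemma exists_sum_flip_le_of_large {α : ℝ} (hα : 0 < α) :
    ∃ (k₀ : ℕ) (C : ℝ), 0 < C ∧ ∀ n k : ℕ, k₀ ≤ k → k ≤ n →
      ∀ (good : Vertex n → Prop) (f F : Vertex n → ℝ),
      IsMedianField k good (α * numNeighbors n k) f F →
      k * numNeighbors n k * ∑ v, ∑ i, (F v - F (flip {i} v)) ^ 2 ≤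
        C * n ^ 2 * edgeEnergy k good f := by
  set e : ℝ := (α / 4 / 4) ^ 4 / 2 with he
  have he0 : 0 < e := by positivity
  -- The entry `α / 4` is the density in `exists_le_linkAvg`; the entry `1` yields the condition `2
  -- q ≤ h²` of `mul_numNeighbors_le_sum_parity`. Taking half of `(α / 4 / 4) ^ 4` for the error
  -- leaves `e` itself as the gain.
  obtain ⟨q₀, hq₀⟩ := exists_window_parameters (β := min (α / 4) 1) (e := e)
    (lt_min (by positivity) one_pos) he0
  refine ⟨3 * q₀ + 3, 288 / e, by positivity, fun n k hk hkn good f F hF => ?_⟩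
  obtain ⟨m, rfl⟩ : ∃ m, n = m + 1 := ⟨n - 1, by omega⟩
  set q := min k ((m + 1) / 2) with hq
  obtain ⟨h, b, hh, hb, hbig, hβ, hbe⟩ := hq₀ q (by omega)
  have hβ1 : 4 * (q : ℝ) ≤ α / 4 * (h : ℝ) ^ 2 :=
    hβ.trans (mul_le_mul_of_nonneg_right (min_le_left _ _) (by positivity))
  have hβ2 : 4 * q ≤ h ^ 2 := by
    have : 4 * (q : ℝ) ≤ 1 * (h : ℝ) ^ 2 :=
      hβ.trans (mul_le_mul_of_nonneg_right (min_le_right _ _) (by positivity))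
    rw [one_mul] at this
    exact_mod_cast this
  have hN : 0 < numNeighbors (m + 1) k := numNeighbors_pos (by omega) hkn
  set T := Finset.Icc (q - 2 * h) q with hT
  have hTk : T ⊆ Finset.Icc 1 k := by
    intro t ht
    simp only [hT, Finset.mem_Icc] at ht ⊢
    omega
  set Φ := goodGap good f with hΦ
  have hΦ0 : ∀ x y, 0 ≤ Φ x y := goodGap_nonneg good f
  let δ : Bool → Bool → ℕ := fun c c' => if c = c' then 0 else 1
  -- The good sides and parity vary with `i` and `u`, so `L` sums over all of them. The factor `(m +
  -- 1).choose t` cancels the normalization in `sum_linkAvg_le`.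
  let L : Fin (m + 1) → Vertex m → ℝ := fun i u => ∑ t ∈ T, ((m + 1).choose t : ℝ) *
    ∑ c, ∑ c', linkAvg k q h (t - δ c c') c c' Φ i u
  have hloc : ∀ (i : Fin (m + 1)) (u : Vertex m), (k * numNeighbors (m + 1) k : ℝ) *
      (e * (F (i.insertNth (α := fun _ => Bool) false u) -
          F (i.insertNth (α := fun _ => Bool) true u)) ^ 2) ≤ 36 * (m + 1) * L i u := by
    intro i u
    obtain ⟨c, c', a, ha, hle⟩ := exists_le_linkAvg hkn hq hh hb hbig hα.le hβ1 hbe hF i u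
    set Δ := (F (i.insertNth (α := fun _ => Bool) false u) -
          F (i.insertNth (α := fun _ => Bool) true u)) ^ 2
    have hW := mul_numNeighbors_le_sum_parity hkn hq hh (by omega) (by omega) a ha
    have hWR : (k * numNeighbors (m + 1) k : ℝ) ≤ 36 * (m + 1) *
        ∑ t ∈ T.filter (fun t => t % 2 = a), ((m + 1).choose t : ℝ) := by exact_mod_cast hW
    have he2 : (α / 4 / 4) ^ 4 - e = e := by rw [he]; ring
    rw [he2] at hle
    have heΔ : 0 ≤ e * Δ := mul_nonneg he0.le (sq_nonneg _)
    refine (mul_le_mul_of_nonneg_right hWR heΔ).trans ?_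
    rw [mul_assoc]
    refine mul_le_mul_of_nonneg_left ?_ (by positivity)
    have hpos : ∀ (t : ℕ) (c c' : Bool), 0 ≤ linkAvg k q h (t - δ c c') c c' Φ i u :=
      fun t c c' => linkAvg_nonneg _ _ _ _ _ _ hΦ0 i u
    rw [Finset.sum_mul]
    refine (Finset.sum_le_sum fun t ht => ?_).trans (Finset.sum_le_sum_of_subset_of_nonneg
      (Finset.filter_subset _ _) fun t _ _ => mul_nonneg (by positivity)
        (Finset.sum_nonneg fun _ _ => Finset.sum_nonneg fun _ _ => hpos _ _ _))
    obtain ⟨ht1, ht2⟩ := Finset.mem_filter.1 ht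
    refine mul_le_mul_of_nonneg_left ((hle t ht1 ht2).trans ?_) (by positivity)
    exact (Finset.single_le_sum (f := fun c' => linkAvg k q h (t - δ c c') c c' Φ i u)
      (fun c' _ => hpos t c c') (Finset.mem_univ c')).trans
      (Finset.single_le_sum (f := fun c => ∑ c', linkAvg k q h (t - δ c c') c c' Φ i u)
      (fun c _ => Finset.sum_nonneg fun c' _ => hpos t c c') (Finset.mem_univ c))
  -- The `4` counts the pairs of sides. The distances in `T` lie between `1` and `k`, so all the
  -- links are edges.
  have hsumL : ∑ i, ∑ u, L i u ≤ 4 * (m + 1) * edgeEnergy k good f := by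
    have e1 : ∑ i, ∑ u, L i u = ∑ t ∈ T, ((m + 1).choose t : ℝ) *
        ∑ c, ∑ c', ∑ i : Fin (m + 1), ∑ u, linkAvg k q h (t - δ c c') c c' Φ i u := by
      have : ∀ i, ∑ u, L i u = ∑ t ∈ T, ((m + 1).choose t : ℝ) *
          ∑ c, ∑ c', ∑ u, linkAvg k q h (t - δ c c') c c' Φ i u := by
        intro i
        simp only [L]
        rw [Finset.sum_comm]
        refine Finset.sum_congr rfl fun t _ => ?_
        rw [← Finset.mul_sum, Finset.sum_comm]
        congr 1
        exact Finset.sum_congr rfl fun c _ => Finset.sum_comm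
      rw [Finset.sum_congr rfl fun i _ => this i, Finset.sum_comm]
      refine Finset.sum_congr rfl fun t _ => ?_
      rw [← Finset.mul_sum, Finset.sum_comm]
      congr 1
      exact Finset.sum_congr rfl fun c _ => Finset.sum_comm
    rw [e1]
    have e2 : ∀ t ∈ T, ((m + 1).choose t : ℝ) *
        ∑ c, ∑ c', ∑ i : Fin (m + 1), ∑ u, linkAvg k q h (t - δ c c') c c' Φ i u ≤
        4 * (m + 1) * ∑ x, ∑ E ∈ Finset.powersetCard t Finset.univ, Φ x (flip E x) := by
      intro t ht
      have ht' := Finset.mem_Icc.1 ht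
      set S := ∑ x, ∑ E ∈ Finset.powersetCard t Finset.univ, Φ x (flip E x)
      have hC : (0 : ℝ) < (m + 1).choose t := by
        exact_mod_cast Nat.choose_pos (by omega)
      have : ∀ c c', ∑ i : Fin (m + 1), ∑ u, linkAvg k q h (t - δ c c') c c' Φ i u ≤
          ((m : ℝ) + 1) / ((m + 1).choose t : ℝ) * S := by
        intro c c'
        refine sum_linkAvg_le (by omega) hN hΦ0 c c' ?_
        by_cases hc : c = c' <;> simp only [δ, hc, if_true, if_false] <;> omega
      calc _ ≤ ((m + 1).choose t : ℝ) *
            ∑ c : Bool, ∑ c' : Bool, ((m : ℝ) + 1) / ((m + 1).choose t : ℝ) * S :=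
            mul_le_mul_of_nonneg_left (Finset.sum_le_sum fun c _ => Finset.sum_le_sum
              fun c' _ => this c c') hC.le
        _ = _ := by
            simp only [Fintype.sum_bool]
            field_simp
            ring
    refine (Finset.sum_le_sum e2).trans ?_
    rw [← Finset.mul_sum]
    exact mul_le_mul_of_nonneg_left (sum_goodGap_le_edgeEnergy good f hTk) (by positivity)
  have hsplit : ∑ v, ∑ i, (F v - F (flip {i} v)) ^ 2 =
      2 * ∑ i : Fin (m + 1), ∑ u : Vertex m, (F (i.insertNth (α := fun _ => Bool) false u) -
          F (i.insertNth (α := fun _ => Bool) true u)) ^ 2 := by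
    rw [Finset.sum_comm, Finset.mul_sum]
    refine Finset.sum_congr rfl fun i _ => ?_
    rw [sum_insertNth i]
    simp only [flip_singleton_insertNth, Fintype.sum_bool, Bool.not_true, Bool.not_false]
    rw [← Finset.sum_add_distrib, Finset.mul_sum]
    exact Finset.sum_congr rfl fun u _ => by ring
  have htot := Finset.sum_le_sum fun i (_ : i ∈ Finset.univ) =>
    Finset.sum_le_sum fun u (_ : u ∈ Finset.univ) => hloc i u
  simp only [← Finset.mul_sum] at htot
  rw [hsplit]
  set D := ∑ i : Fin (m + 1), ∑ u : Vertex m, (F (i.insertNth (α := fun _ => Bool) false u) -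
          F (i.insertNth (α := fun _ => Bool) true u)) ^ 2
  have h36 : (36 * ((m : ℝ) + 1)) * ∑ i, ∑ u, L i u ≤
      (36 * ((m : ℝ) + 1)) * (4 * (m + 1) * edgeEnergy k good f) :=
    mul_le_mul_of_nonneg_left hsumL (by positivity)
  rw [div_mul_eq_mul_div, div_mul_eq_mul_div, le_div_iff₀ he0]
  push_cast
  nlinarith [htot.trans h36]

/-! ### Short paths -/

lemma symmDiff_diff {n : ℕ} (x a b : Vertex n) : symmDiff (diff x a) (diff x b) = diff a b := by
  ext i
  simp only [Finset.mem_symmDiff, mem_diff]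
  cases x i <;> cases a i <;> cases b i <;> simp

lemma sq_sub_le_of_walk {n k : ℕ} {x y : Vertex n} (p : (hypercubeGraph n k).Walk x y)
    (f : Vertex n → ℝ) :
    (f x - f y) ^ 2 ≤ p.length * ∑ j ∈ Finset.range p.length,
      (f (p.getVert j) - f (p.getVert (j + 1))) ^ 2 := by
  have h := Finset.sum_range_sub' (fun j => f (p.getVert j)) p.length
  rw [SimpleGraph.Walk.getVert_zero, SimpleGraph.Walk.getVert_length] at h
  rw [← h]
  have := sq_sum_le_card_mul_sum_sq (s := Finset.range p.length)
    (f := fun j => f (p.getVert j) - f (p.getVert (j + 1)))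
  simpa using this

lemma hammingDist_getVert_le {n k : ℕ} {x y : Vertex n} (p : (hypercubeGraph n k).Walk x y)
    (a d : ℕ) : hammingDist (p.getVert a) (p.getVert (a + d)) ≤ k * d := by
  induction d with
  | zero => simp
  | succ d ih =>
    have h1 : hammingDist (p.getVert (a + d)) (p.getVert (a + d + 1)) ≤ k := by
      rcases Nat.lt_or_ge (a + d) p.length with h | h
      · exact (p.adj_getVert_succ h).2
      · rw [p.getVert_of_length_le h, p.getVert_of_length_le (h.trans (Nat.le_succ _))]
        simp
    have := hammingDist_triangle (p.getVert a) (p.getVert (a + d)) (p.getVert (a + d + 1))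
    rw [← add_assoc, Nat.mul_succ]
    omega

lemma card_symmDiff_eq {n : ℕ} (A B : Finset (Fin n)) :
    (symmDiff A B).card = (A \ B).card + (B \ A).card := by
  have : symmDiff A B = (A \ B) ∪ (B \ A) := rfl
  rw [this, Finset.card_union_of_disjoint]
  exact disjoint_sdiff_sdiff

lemma notMem_of_card_le {n k : ℕ} {E D : Finset (Fin n)} (h0 : E.card ≤ k) (h1 : k ≤ (E \ D).card)
    {i : Fin n} (hi : i ∈ D) : i ∉ E := by
  intro h
  have c1 := Finset.card_sdiff_add_card_inter E D
  have : 0 < (E ∩ D).card := Finset.card_pos.2 ⟨i, Finset.mem_inter.2 ⟨h, hi⟩⟩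
  omega

lemma mem_of_card_symmDiff_le {n k : ℕ} {E D : Finset (Fin n)} (h0 : (symmDiff E D).card ≤ k)
    (h1 : k ≤ (E \ D).card) {i : Fin n} (hi : i ∈ D) : i ∈ E := by
  by_contra h
  have c1 := card_symmDiff_eq E D
  have : 0 < (D \ E).card := Finset.card_pos.2 ⟨i, Finset.mem_sdiff.2 ⟨hi, h⟩⟩
  omega

/-- Two sets of equal size have an even symmetric difference, while a total of one leftover flip
would make it odd. -/
lemma eq_empty_of_card_add_le_one {n : ℕ} {s t r O O' : Finset (Fin n)}
    (h : s.card + t.card + r.card ≤ 1) (hO : O.card = O'.card)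
    (hs : symmDiff O O' = symmDiff (symmDiff s t) r) : s = ∅ ∧ t = ∅ ∧ r = ∅ := by
  have h1 := card_symmDiff_add O O'
  have h2 := card_symmDiff_add s t
  have h3 := card_symmDiff_add (symmDiff s t) r
  rw [hs] at h1
  simp only [← Finset.card_eq_zero]
  have h4 : (s ∩ t).card ≤ s.card := Finset.card_le_card Finset.inter_subset_left
  have h5 : (s ∩ t).card ≤ t.card := Finset.card_le_card Finset.inter_subset_right
  have h6 : (symmDiff s t ∩ r).card ≤ r.card := Finset.card_le_card Finset.inter_subset_right
  have h7 : (symmDiff s t ∩ r).card ≤ (symmDiff s t).card :=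
    Finset.card_le_card Finset.inter_subset_left
  omega

lemma symmDiff_sdiff_eq {n : ℕ} {E E' s t r D : Finset (Fin n)}
    (h : symmDiff E E' = symmDiff (symmDiff s t) r) :
    symmDiff (E \ D) (E' \ D) = symmDiff (symmDiff (s \ D) (t \ D)) (r \ D) := by
  ext i
  have hi : i ∈ symmDiff E E' ↔ i ∈ symmDiff (symmDiff s t) r := by rw [h]
  simp only [Finset.mem_symmDiff, Finset.mem_sdiff] at hi ⊢
  by_cases hD : i ∈ D <;> simp only [hD, not_true, not_false_iff, and_true, and_false] <;> tauto

/-- A sequence of five small steps that stays away from `D` except at its ends makes a constant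
detour outside `D`. -/
lemma detour_structure {n : ℕ} {E1 E2 E3 E4 D : Finset (Fin n)} {k z : ℕ}
    (hz : k ≤ z + 1) (hD : D.card = 2 * k + z) (h0 : E1.card ≤ k)
    (h1 : (symmDiff E1 E2).card ≤ k) (h2 : (symmDiff E2 E3).card ≤ k)
    (h3 : (symmDiff E3 E4).card ≤ k) (h4 : (symmDiff E4 D).card ≤ k) (o1 : k ≤ (E1 \ D).card)
    (o4 : k ≤ (E4 \ D).card) :
    E1.card = k ∧ symmDiff E1 E2 ⊆ D ∧ symmDiff E2 E3 ⊆ D ∧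
      symmDiff E3 E4 = symmDiff D (symmDiff (symmDiff E1 E2) (symmDiff E2 E3)) ∧
      symmDiff E4 D = E1 ∧ z ≤ (symmDiff E1 E2).card ∧ z ≤ (symmDiff E2 E3).card ∧
      z ≤ (symmDiff E3 E4).card := by
  have mI : ∀ i, i ∈ D → i ∉ E1 := fun i hi => notMem_of_card_le h0 o1 hi
  have mD : ∀ i, i ∈ D → i ∈ E4 := fun i hi => mem_of_card_symmDiff_le h4 o4 hi
  have k1 : (E1 \ D).card ≤ E1.card := Finset.card_le_card Finset.sdiff_subset
  have k4 : (E4 \ D).card ≤ (symmDiff E4 D).card := by rw [card_symmDiff_eq]; omega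
  have hcomp : symmDiff E1 E4 =
      symmDiff (symmDiff (symmDiff E1 E2) (symmDiff E2 E3)) (symmDiff E3 E4) := by
    rw [symmDiff_assoc E1, symmDiff_symmDiff_cancel_left, symmDiff_assoc E1,
      symmDiff_symmDiff_cancel_left]
  -- `E1` uses its whole budget outside `D`, and `E4` must already contain `D`, so the three middle
  -- steps have to flip every bit of `D`.
  have hcov : D ⊆ (symmDiff E1 E2 ∩ D) ∪ (symmDiff E2 E3 ∩ D) ∪ (symmDiff E3 E4 ∩ D) := by
    intro i hi
    have h5 : i ∈ symmDiff E1 E4 := Finset.mem_symmDiff.2 (Or.inr ⟨mD i hi, mI i hi⟩)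
    rw [hcomp] at h5
    simp only [Finset.mem_union, Finset.mem_inter, hi, and_true]
    rcases Finset.mem_symmDiff.1 h5 with ⟨h6, -⟩ | ⟨h6, -⟩
    · rcases Finset.mem_symmDiff.1 h6 with ⟨h7, -⟩ | ⟨h7, -⟩
      · exact Or.inl (Or.inl h7)
      · exact Or.inl (Or.inr h7)
    · exact Or.inr h6
  have ccov := (Finset.card_le_card hcov).trans ((Finset.card_union_le _ _).trans
    (Nat.add_le_add_right (Finset.card_union_le _ _) _))
  have hout := symmDiff_sdiff_eq (D := D) hcomp
  generalize symmDiff E1 E2 = s1 at *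
  generalize symmDiff E2 E3 = s2 at *
  generalize symmDiff E3 E4 = s3 at *
  have d1 := Finset.card_sdiff_add_card_inter s1 D
  have d2 := Finset.card_sdiff_add_card_inter s2 D
  have d3 := Finset.card_sdiff_add_card_inter s3 D
  -- The budget of the three steps is `3 k` and `D` needs `2 k + z ≥ 3 k - 1` of it, so at most one
  -- flip remains outside `D`; parity excludes it.
  obtain ⟨q1, q2, q3⟩ := eq_empty_of_card_add_le_one (by omega) (by omega) hout
  rw [q1, Finset.card_empty] at d1
  rw [q2, Finset.card_empty] at d2
  rw [q3, Finset.card_empty] at d3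
  rw [Finset.sdiff_eq_empty_iff_subset] at q1 q2 q3
  have hE14 : symmDiff E1 E4 = D := by
    apply Finset.Subset.antisymm
    · intro i hi
      rw [hcomp] at hi
      rcases Finset.mem_symmDiff.1 hi with ⟨h6, -⟩ | ⟨h6, -⟩
      · rcases Finset.mem_symmDiff.1 h6 with ⟨h7, -⟩ | ⟨h7, -⟩
        · exact q1 h7
        · exact q2 h7
      · exact q3 h6
    · intro i hi
      exact Finset.mem_symmDiff.2 (Or.inr ⟨mD i hi, mI i hi⟩)
  refine ⟨by omega, q1, q2, ?_, ?_, by omega, by omega, by omega⟩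
  · rw [← hE14, hcomp, symmDiff_comm (symmDiff (symmDiff s1 s2) s3), symmDiff_symmDiff_cancel_left]
  · rw [← hE14, symmDiff_comm E1, symmDiff_symmDiff_cancel_left]

/-- The squared increment of `f` along the move `E` from `x`, if the size of the move is at
least `z` and at most `k` and both ends are good. -/
def stepGap {n : ℕ} (z k : ℕ) (good : Vertex n → Prop) (f : Vertex n → ℝ) (x : Vertex n)
    (E : Finset (Fin n)) : ℝ :=
  if z ≤ E.card ∧ E.card ≤ k then goodGap good f x (flip E x) else 0

lemma stepGap_nonneg {n : ℕ} (z k : ℕ) (good : Vertex n → Prop) (f : Vertex n → ℝ) (x : Vertex n)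
    (E : Finset (Fin n)) : 0 ≤ stepGap z k good f x E := by
  unfold stepGap; split_ifs
  · exact goodGap_nonneg _ _ _ _
  · exact le_rfl

/-- The sum of the squared increments along a detour `O` around the move `D` that is done in the
three steps `A`, `B` and `D - A - B`. -/
def detourGap {n : ℕ} (z k : ℕ) (good : Vertex n → Prop) (f : Vertex n → ℝ) (x : Vertex n)
    (D O A B : Finset (Fin n)) : ℝ :=
  stepGap z k good f x O + stepGap z k good f (flip O x) A +
    stepGap z k good f (flip A (flip O x)) B +
    stepGap z k good f (flip B (flip A (flip O x))) (symmDiff D (symmDiff A B)) +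
    stepGap z k good f (flip D x) O

lemma detourGap_nonneg {n : ℕ} (z k : ℕ) (good : Vertex n → Prop) (f : Vertex n → ℝ)
    (x : Vertex n) (D O A B : Finset (Fin n)) : 0 ≤ detourGap z k good f x D O A B := by
  unfold detourGap
  have := stepGap_nonneg z k good f
  exact add_nonneg (add_nonneg (add_nonneg (add_nonneg (this _ _) (this _ _)) (this _ _))
    (this _ _)) (this _ _)

lemma goodGap_comm {n : ℕ} (good : Vertex n → Prop) (f : Vertex n → ℝ) (x y : Vertex n) :
    goodGap good f x y = goodGap good f y x := by
  unfold goodGap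
  by_cases h : good x ∧ good y
  · rw [if_pos h, if_pos h.symm]; ring
  · rw [if_neg h, if_neg fun h' => h h'.symm]

/-- A path staying at distance `k` from the subcube over `D` is a detour of the rigid shape above.
Its middle steps are unknown, so the bound sums over all `A`, `B ⊆ D`; only the first step depends
on the path. -/
lemma sq_sub_le_detourGap {n k z : ℕ} (hz : k ≤ z + 1) (hz1 : 1 ≤ z) (hzk : z ≤ k)
    {good : Vertex n → Prop} (f : Vertex n → ℝ) {x : Vertex n} {D : Finset (Fin n)}
    (hD : D.card = 2 * k + z) (p : (hypercubeGraph n k).Walk x (flip D x)) (hp5 : p.length ≤ 5)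
    (hgood : ∀ v ∈ p.support, good v)
    (hfar : ∀ j, 1 ≤ j → j < p.length → k ≤ (diff x (p.getVert j) \ D).card) :
    (diff x (p.getVert 1)).card = k ∧
    (f x - f (flip D x)) ^ 2 ≤ 5 * ∑ A ∈ D.powerset, ∑ B ∈ D.powerset,
      detourGap z k good f x D (diff x (p.getVert 1)) A B := by
  set E : ℕ → Finset (Fin n) := fun j => diff x (p.getVert j) with hE
  have hv : ∀ j, p.getVert j = flip (E j) x := fun j => (flip_diff _ _).symm
  have hstep : ∀ a d, (symmDiff (E a) (E (a + d))).card ≤ k * d := by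
    intro a d
    rw [hE]
    simp only
    rw [symmDiff_diff, ← hammingDist_eq_card_diff]
    exact hammingDist_getVert_le p a d
  have hE0 : E 0 = ∅ := by
    rw [hE]; simp only; rw [SimpleGraph.Walk.getVert_zero]; ext i; simp [mem_diff]
  have hEl : E p.length = D := by
    rw [hE]; simp only; rw [SimpleGraph.Walk.getVert_length, diff_flip]
  have hl3 : 3 ≤ p.length := by
    by_contra hl
    have h1 := hstep 0 p.length
    rw [zero_add, hE0, hEl, ← Finset.bot_eq_empty, bot_symmDiff, hD] at h1
    have : k * p.length ≤ k * 2 := Nat.mul_le_mul_left _ (by omega)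
    omega
  have hE1c : (E 1).card ≤ k := by
    have := hstep 0 1
    rwa [zero_add, hE0, ← Finset.bot_eq_empty, bot_symmDiff, mul_one] at this
  have hlast : (symmDiff (E (p.length - 1)) D).card ≤ k := by
    have := hstep (p.length - 1) 1
    rwa [Nat.sub_add_cancel (by omega), hEl, mul_one] at this
  have o1 := hfar 1 le_rfl (by omega)
  have ol := hfar (p.length - 1) (by omega) (by omega)
  -- One step is spent on leaving and one on returning, and more than `2 k` bits are flipped in
  -- between, so four steps are too few.
  have hl5 : p.length = 5 := by
    by_contra hl
    have h1 := hstep 1 (p.length - 2)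
    have h2 : D ⊆ symmDiff (E 1) (E (1 + (p.length - 2))) := by
      have e : 1 + (p.length - 2) = p.length - 1 := by omega
      rw [e]
      intro i hi
      have c1 := Finset.card_sdiff_add_card_inter (E 1) D
      have hI : E 1 ∩ D = ∅ := by
        rw [← Finset.card_eq_zero]
        have : (E 1 \ D).card = (diff x (p.getVert 1) \ D).card := rfl
        omega
      have c4 : (symmDiff (E (p.length - 1)) D).card =
          (E (p.length - 1) \ D).card + (D \ E (p.length - 1)).card := by
        have : symmDiff (E (p.length - 1)) D =
          (E (p.length - 1) \ D) ∪ (D \ E (p.length - 1)) := rfl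
        rw [this, Finset.card_union_of_disjoint]
        exact disjoint_sdiff_sdiff
      have hDE : D \ E (p.length - 1) = ∅ := by
        rw [← Finset.card_eq_zero]
        have : (E (p.length - 1) \ D).card = (diff x (p.getVert (p.length - 1)) \ D).card := rfl
        omega
      refine Finset.mem_symmDiff.2 (Or.inr ⟨?_, fun h => ?_⟩)
      · by_contra h
        have : i ∈ D \ E (p.length - 1) := Finset.mem_sdiff.2 ⟨hi, h⟩
        rw [hDE] at this; simp at this
      · have : i ∈ E 1 ∩ D := Finset.mem_inter.2 ⟨h, hi⟩
        rw [hI] at this; simp at this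
    have h3 := Finset.card_le_card h2
    have : k * (p.length - 2) ≤ k * 2 := Nat.mul_le_mul_left _ (by omega)
    omega
  have hE5 : E 5 = D := by rw [← hl5, hEl]
  have s1 := hstep 1 1
  have s2 := hstep 2 1
  have s3 := hstep 3 1
  rw [mul_one] at s1 s2 s3
  rw [hl5] at hlast ol
  obtain ⟨t1, t2, t3, t4, t5, t6, t7, t8⟩ := detour_structure hz hD hE1c s1 s2 s3 hlast o1 ol
  refine ⟨t1, ?_⟩
  set A := symmDiff (E 1) (E 2) with hA
  set B := symmDiff (E 2) (E 3) with hB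
  have hg : ∀ j, good (p.getVert j) := fun j => hgood _ (p.getVert_mem_support j)
  have v1 : p.getVert 1 = flip (E 1) x := hv 1
  have v2 : p.getVert 2 = flip A (p.getVert 1) := by
    rw [hv 2, hv 1, flip_flip, hA, symmDiff_comm (E 1), symmDiff_symmDiff_cancel_right]
  have v3 : p.getVert 3 = flip B (p.getVert 2) := by
    rw [hv 3, hv 2, flip_flip, hB, symmDiff_comm (E 2), symmDiff_symmDiff_cancel_right]
  have v4 : p.getVert 4 = flip (symmDiff D (symmDiff A B)) (p.getVert 3) := by
    rw [hv 4, hv 3, flip_flip, ← t4, symmDiff_comm (E 3), symmDiff_symmDiff_cancel_right]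
  have v5 : p.getVert 4 = flip (E 1) (flip D x) := by
    rw [hv 4, flip_flip, ← t5, symmDiff_symmDiff_cancel_right]
  have v6 : p.getVert 5 = flip D x := by rw [hv 5, hE5]
  have hgap : ∀ j, (f (p.getVert j) - f (p.getVert (j + 1))) ^ 2 =
      goodGap good f (p.getVert j) (p.getVert (j + 1)) := fun j => by
    unfold goodGap; rw [if_pos ⟨hg _, hg _⟩]
  have hmain : (f x - f (flip D x)) ^ 2 ≤ 5 * detourGap z k good f x D (E 1) A B := by
    have h := sq_sub_le_of_walk p f
    rw [hl5] at h
    simp only [hgap, Finset.sum_range_succ, Finset.sum_range_zero, zero_add] at h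
    refine h.trans (le_of_eq ?_)
    unfold detourGap stepGap
    rw [if_pos ⟨by omega, by omega⟩, if_pos ⟨t6, s1⟩, if_pos ⟨t7, s2⟩, ← t4, if_pos ⟨t8, s3⟩,
      if_pos ⟨by omega, by omega⟩, t4, ← v5, ← v1, ← v2, ← v3, ← v4, SimpleGraph.Walk.getVert_zero,
      v6, goodGap_comm good f (p.getVert 4) (flip D x)]
    norm_num
  refine hmain.trans (mul_le_mul_of_nonneg_left ?_ (by norm_num))
  have hnn := detourGap_nonneg z k good f x D (E 1)
  exact (Finset.single_le_sum (f := fun B => detourGap z k good f x D (E 1) A B)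
    (fun B _ => hnn A B) (Finset.mem_powerset.2 t3)).trans
    (Finset.single_le_sum (f := fun A => ∑ B ∈ D.powerset, detourGap z k good f x D (E 1) A B)
      (fun A _ => Finset.sum_nonneg fun B _ => hnn A B) (Finset.mem_powerset.2 t2))

/-- Any two distinct good vertices at distance at most `3 k` are joined by at least `a` internally
disjoint paths of length at most `5` through good vertices. -/
def Expands {n : ℕ} (k : ℕ) (good : Vertex n → Prop) (a : ℝ) : Prop :=
  ∀ x y, x ≠ y → good x → good y → hammingDist x y ≤ 3 * k →
    ∃ S : Finset ((hypercubeGraph n k).Path x y),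
      a ≤ (S.card : ℝ) ∧
      (∀ p ∈ S, p.1.length ≤ 5 ∧ ∀ v ∈ p.1.support, v ≠ x → v ≠ y → good v) ∧
      (∀ p ∈ S, ∀ q ∈ S, p ≠ q →
        ∀ v, v ∈ p.1.support → v ∈ q.1.support → v = x ∨ v = y)

lemma getVert_ne_of_isPath {V : Type*} {G : SimpleGraph V} {x y : V} {p : G.Walk x y}
    (hp : p.IsPath) {j : ℕ} (h1 : 1 ≤ j) (h2 : j < p.length) :
    p.getVert j ≠ x ∧ p.getVert j ≠ y := by
  have hi := hp.getVert_injOn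
  constructor
  · intro h
    have := hi (x₁ := j) (x₂ := 0) h2.le (Nat.zero_le _) (by rw [h, p.getVert_zero])
    omega
  · intro h
    have := hi (x₁ := j) (x₂ := p.length) h2.le (show p.length ≤ p.length from le_rfl)
      (by rw [h, p.getVert_length])
    omega

lemma card_filter_card_sdiff_lt_le {n k : ℕ} (D : Finset (Fin n)) :
    (Finset.univ.filter fun E : Finset (Fin n) => (E \ D).card < k).card ≤
      2 ^ D.card * (Finset.univ.filter fun O : Finset (Fin n) => O.card < k).card := by
  rw [← Finset.card_powerset, ← Finset.card_product]
  refine Finset.card_le_card_of_injOn (fun E => (E ∩ D, E \ D)) ?_ ?_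
  · intro E hE
    simp only [Finset.coe_filter, Finset.mem_univ, true_and, Set.mem_ofPred_eq] at hE
    simp [hE]
  · intro E _ E' _ h
    simp only [Prod.mk.injEq] at h
    rw [← Finset.sdiff_union_inter E D, ← Finset.sdiff_union_inter E' D, h.1, h.2]

/-- At least `a / 2` of the disjoint paths stay far from the subcube over `D`. Disjointness makes
their first steps `O` distinct, so their bounds add up to a sum over distinct `O`. -/
lemma mul_goodGap_le_sum_detourGap {n k z : ℕ} (hz : k ≤ z + 1) (hz1 : 1 ≤ z) (hzk : z ≤ k)
    {good : Vertex n → Prop} {a : ℝ} (hexp : Expands k good a) (f : Vertex n → ℝ)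
    (ha : 2 ^ (3 * k) * ((Finset.univ.filter fun O : Finset (Fin n) => O.card < k).card : ℝ) ≤
      a / 2) (x : Vertex n) {D : Finset (Fin n)} (hD : D.card = 2 * k + z) :
    a / 2 * goodGap good f x (flip D x) ≤ 5 * ∑ O ∈ Finset.powersetCard k Finset.univ,
      ∑ A ∈ D.powerset, ∑ B ∈ D.powerset, detourGap z k good f x D O A B := by
  have hR : ∀ O, 0 ≤ ∑ A ∈ D.powerset, ∑ B ∈ D.powerset, detourGap z k good f x D O A B :=
    fun O => Finset.sum_nonneg fun _ _ => Finset.sum_nonneg fun _ _ =>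
      detourGap_nonneg _ _ _ _ _ _ _ _ _
  by_cases hg : good x ∧ good (flip D x)
  swap
  · unfold goodGap
    rw [if_neg hg, mul_zero]
    exact mul_nonneg (by norm_num) (Finset.sum_nonneg fun O _ => hR O)
  have hgap : goodGap good f x (flip D x) = (f x - f (flip D x)) ^ 2 := if_pos hg
  have hdist : hammingDist x (flip D x) = 2 * k + z := by rw [hammingDist_flip, hD]
  have hne : x ≠ flip D x := by
    intro h; rw [← h, hammingDist_self] at hdist; omega
  obtain ⟨S, hSa, hS, hdisj⟩ := hexp x (flip D x) hne hg.1 hg.2 (by omega)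
  set far : (hypercubeGraph n k).Path x (flip D x) → Prop := fun p =>
    ∀ j, 1 ≤ j → j < p.1.length → k ≤ (diff x (p.1.getVert j) \ D).card with hfar
  have hlen : ∀ p : (hypercubeGraph n k).Path x (flip D x), 2 ≤ p.1.length := by
    intro p
    have h := hammingDist_getVert_le p.1 0 p.1.length
    rw [zero_add, SimpleGraph.Walk.getVert_zero, SimpleGraph.Walk.getVert_length, hdist] at h
    by_contra hl
    have : k * p.1.length ≤ k * 1 := Nat.mul_le_mul_left _ (by omega)
    omega
  have hsame : ∀ p ∈ S, ∀ q ∈ S, ∀ i j, 1 ≤ i → i < p.1.length → p.1.getVert i = q.1.getVert j →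
      p = q := by
    intro p hp q hq i j hi hil h
    by_contra hpq
    have h1 := hdisj p hp q hq hpq (p.1.getVert i) (p.1.getVert_mem_support i)
      (by rw [h]; exact q.1.getVert_mem_support j)
    have h2 := getVert_ne_of_isPath p.2 hi hil
    tauto
  -- Each path that is not far owns an internal vertex with fewer than `k` flips outside `D`, and no
  -- two paths share one.
  have hbad : ((S.filter fun p => ¬ far p).card : ℝ) ≤ a / 2 := by
    refine le_trans ?_ ha
    have h1 : (S.filter fun p => ¬ far p).card ≤
        (Finset.univ.filter fun E : Finset (Fin n) => (E \ D).card < k).card := by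
      have hch : ∀ p : (hypercubeGraph n k).Path x (flip D x), ∃ j, ¬ far p →
          1 ≤ j ∧ j < p.1.length ∧ (diff x (p.1.getVert j) \ D).card < k := by
        intro p
        by_cases hp : far p
        · exact ⟨0, fun h => absurd hp h⟩
        · simp only [hfar] at hp
          push Not at hp
          obtain ⟨j, h1, h2, h3⟩ := hp
          exact ⟨j, fun _ => ⟨h1, h2, h3⟩⟩
      choose J hJ using hch
      refine Finset.card_le_card_of_injOn (fun p => diff x (p.1.getVert (J p))) ?_ ?_
      · intro p hp
        simpa using (hJ p (Finset.mem_filter.1 hp).2).2.2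
      · intro p hp q hq h
        have hp := Finset.mem_filter.1 hp
        have hq := Finset.mem_filter.1 hq
        refine hsame p hp.1 q hq.1 (J p) (J q) (hJ p hp.2).1 (hJ p hp.2).2.1 ?_
        simp only at h
        rw [← flip_diff x (p.1.getVert (J p)), h, flip_diff]
    have h2 := h1.trans (card_filter_card_sdiff_lt_le D)
    have h3 : 2 ^ D.card ≤ 2 ^ (3 * k) := Nat.pow_le_pow_right (by norm_num) (by omega)
    have h4 := h2.trans (Nat.mul_le_mul_right _ h3)
    exact_mod_cast h4
  have hfull : a / 2 ≤ ((S.filter far).card : ℝ) := by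
    have := Finset.card_filter_add_card_filter_not (s := S) far
    have : ((S.filter far).card : ℝ) + ((S.filter fun p => ¬ far p).card : ℝ) = S.card := by
      exact_mod_cast this
    linarith
  have hpt : ∀ p ∈ S.filter far, (diff x (p.1.getVert 1)).card = k ∧
      (f x - f (flip D x)) ^ 2 ≤ 5 * ∑ A ∈ D.powerset, ∑ B ∈ D.powerset,
        detourGap z k good f x D (diff x (p.1.getVert 1)) A B := by
    intro p hp
    obtain ⟨hp1, hp2⟩ := Finset.mem_filter.1 hp
    refine sq_sub_le_detourGap hz hz1 hzk f hD p.1 (hS p hp1).1 ?_ hp2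
    intro v hv
    by_cases h1 : v = x
    · rw [h1]; exact hg.1
    by_cases h2 : v = flip D x
    · rw [h2]; exact hg.2
    exact (hS p hp1).2 v hv h1 h2
  rw [hgap]
  calc a / 2 * (f x - f (flip D x)) ^ 2
      ≤ (S.filter far).card * (f x - f (flip D x)) ^ 2 :=
        mul_le_mul_of_nonneg_right hfull (sq_nonneg _)
    _ = ∑ p ∈ S.filter far, (f x - f (flip D x)) ^ 2 := by rw [Finset.sum_const, nsmul_eq_mul]
    _ ≤ ∑ p ∈ S.filter far, 5 * ∑ A ∈ D.powerset, ∑ B ∈ D.powerset,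
        detourGap z k good f x D (diff x (p.1.getVert 1)) A B :=
        Finset.sum_le_sum fun p hp => (hpt p hp).2
    _ = ∑ O ∈ (S.filter far).image fun p => diff x (p.1.getVert 1), 5 * ∑ A ∈ D.powerset,
        ∑ B ∈ D.powerset, detourGap z k good f x D O A B := by
        rw [Finset.sum_image]
        intro p hp q hq h
        refine hsame p (Finset.mem_filter.1 hp).1 q (Finset.mem_filter.1 hq).1 1 1 le_rfl
          (hlen p) ?_
        simp only at h
        rw [← flip_diff x (p.1.getVert 1), h, flip_diff]
    _ ≤ ∑ O ∈ Finset.powersetCard k Finset.univ, 5 * ∑ A ∈ D.powerset,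
        ∑ B ∈ D.powerset, detourGap z k good f x D O A B := by
        refine Finset.sum_le_sum_of_subset_of_nonneg ?_ fun O _ _ =>
          mul_nonneg (by norm_num) (hR O)
        intro O hO
        obtain ⟨p, hp, rfl⟩ := Finset.mem_image.1 hO
        exact Finset.mem_powersetCard.2 ⟨Finset.subset_univ _, (hpt p hp).1⟩
    _ = _ := by rw [Finset.mul_sum]

/-- The total squared increment over all moves `E`. -/
def totalStepGap {n : ℕ} (z k : ℕ) (good : Vertex n → Prop) (f : Vertex n → ℝ)
    (E : Finset (Fin n)) : ℝ := ∑ x, stepGap z k good f x E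

lemma totalStepGap_nonneg {n : ℕ} (z k : ℕ) (good : Vertex n → Prop) (f : Vertex n → ℝ)
    (E : Finset (Fin n)) : 0 ≤ totalStepGap z k good f E :=
  Finset.sum_nonneg fun _ _ => stepGap_nonneg _ _ _ _ _ _

lemma sum_totalStepGap_le {n z k : ℕ} (hz : 1 ≤ z) (good : Vertex n → Prop) (f : Vertex n → ℝ) :
    ∑ E, totalStepGap z k good f E ≤ edgeEnergy k good f := by
  unfold totalStepGap edgeEnergy
  rw [Finset.sum_comm]
  refine Finset.sum_le_sum fun x _ => ?_
  have h : ∀ y, (if (hypercubeGraph n k).Adj x y ∧ good x ∧ good y then (f x - f y) ^ 2 else 0) =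
      if (hypercubeGraph n k).Adj x y then goodGap good f x y else 0 := by
    intro y; unfold goodGap; by_cases h1 : (hypercubeGraph n k).Adj x y <;> simp [h1]
  rw [Finset.sum_congr rfl fun y _ => h y, sum_adj_eq_sum_moves x, moves, Finset.sum_filter]
  refine Finset.sum_le_sum fun E _ => ?_
  unfold stepGap
  have := goodGap_nonneg good f x (flip E x)
  split_ifs with h1 h2 h2
  · exact le_rfl
  · omega
  · exact this
  · exact le_rfl

lemma sum_detourGap {n : ℕ} (z k : ℕ) (good : Vertex n → Prop) (f : Vertex n → ℝ)
    (D O A B : Finset (Fin n)) : ∑ x, detourGap z k good f x D O A B =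
      2 * totalStepGap z k good f O + totalStepGap z k good f A + totalStepGap z k good f B +
        totalStepGap z k good f (symmDiff D (symmDiff A B)) := by
  unfold detourGap
  simp only [Finset.sum_add_distrib, flip_flip]
  have h : ∀ E E' : Finset (Fin n), ∑ x, stepGap z k good f (flip E x) E' =
      totalStepGap z k good f E' := fun E E' => sum_flip E fun x => stepGap z k good f x E'
  rw [h, h, h, h]
  unfold totalStepGap
  ring

/-- For fixed `A ⊆ D`, the third middle step `D ∆ (A ∆ B)` runs over the subsets of `D` once as `B`
does, so all three middle steps contribute the same sum. -/
lemma sum_powerset_detourGap_le {n : ℕ} (z k : ℕ) (good : Vertex n → Prop) (f : Vertex n → ℝ)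
    (D O : Finset (Fin n)) :
    ∑ A ∈ D.powerset, ∑ B ∈ D.powerset, ∑ x, detourGap z k good f x D O A B =
      2 * 4 ^ D.card * totalStepGap z k good f O +
        3 * 2 ^ D.card * ∑ A ∈ D.powerset, totalStepGap z k good f A := by
  simp only [sum_detourGap, Finset.sum_add_distrib]
  have h3 : ∀ A ∈ D.powerset, ∑ B ∈ D.powerset,
      totalStepGap z k good f (symmDiff D (symmDiff A B)) =
        ∑ B ∈ D.powerset, totalStepGap z k good f B := by
    intro A hA
    have hA := Finset.mem_powerset.1 hA
    refine Finset.sum_bij' (fun B _ => symmDiff D (symmDiff A B))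
      (fun B _ => symmDiff D (symmDiff A B)) ?_ ?_ ?_ ?_ ?_
    · intro B hB
      have hB := Finset.mem_powerset.1 hB
      refine Finset.mem_powerset.2 fun i hi => ?_
      simp only [Finset.mem_symmDiff] at hi
      have := @hA i; have := @hB i
      tauto
    · intro B hB
      have hB := Finset.mem_powerset.1 hB
      refine Finset.mem_powerset.2 fun i hi => ?_
      simp only [Finset.mem_symmDiff] at hi
      have := @hA i; have := @hB i
      tauto
    · intro B _
      rw [symmDiff_left_comm A, symmDiff_symmDiff_cancel_left, symmDiff_symmDiff_cancel_left]
    · intro B _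
      rw [symmDiff_left_comm A, symmDiff_symmDiff_cancel_left, symmDiff_symmDiff_cancel_left]
    · intro B _; rfl
  rw [Finset.sum_congr rfl h3]
  have h4 : (4 : ℝ) ^ D.card = 2 ^ D.card * 2 ^ D.card := by rw [← mul_pow]; norm_num
  simp only [Finset.sum_const, Finset.card_powerset, nsmul_eq_mul, ← Finset.mul_sum]
  push_cast
  rw [h4]
  ring

lemma card_superset_le {n s : ℕ} (A : Finset (Fin n)) :
    ((Finset.powersetCard s (Finset.univ : Finset (Fin n))).filter fun D => A ⊆ D).card ≤
      n ^ (s - A.card) := by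
  calc _ ≤ (Finset.powersetCard (s - A.card) (Finset.univ : Finset (Fin n))).card := by
        refine Finset.card_le_card_of_injOn (fun D => D \ A) ?_ ?_
        · intro D hD
          simp only [Finset.coe_filter, Finset.mem_powersetCard, Finset.subset_univ, true_and,
            Set.mem_ofPred_eq] at hD
          refine Finset.mem_coe.2 (Finset.mem_powersetCard.2 ⟨Finset.subset_univ _, ?_⟩)
          rw [Finset.card_sdiff_of_subset hD.2, hD.1]
        · intro D hD D' hD' h
          simp only [Finset.coe_filter, Finset.mem_powersetCard, Finset.subset_univ, true_and,
            Set.mem_ofPred_eq] at hD hD'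
          simp only at h
          rw [← Finset.sdiff_union_of_subset hD.2, h, Finset.sdiff_union_of_subset hD'.2]
    _ ≤ n ^ (s - A.card) := by
        rw [Finset.card_powersetCard, Finset.card_univ, Fintype.card_fin]
        exact Nat.choose_le_pow _ _

/-- Increments along the moves of size `2 k + z` are controlled by detours. -/
lemma sum_goodGap_le_of_expands {n k z : ℕ} (hn : 1 ≤ n) (hz : k ≤ z + 1) (hz1 : 1 ≤ z)
    (hzk : z ≤ k) {good : Vertex n → Prop} {a : ℝ} (hexp : Expands k good a) (f : Vertex n → ℝ)
    (ha : 2 ^ (3 * k) * ((Finset.univ.filter fun O : Finset (Fin n) => O.card < k).card : ℝ) ≤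
      a / 2) :
    a / 2 * ∑ x, ∑ D ∈ Finset.powersetCard (2 * k + z) Finset.univ, goodGap good f x (flip D x) ≤
      25 * 4 ^ (3 * k) * (n : ℝ) ^ (3 * k) * edgeEnergy k good f := by
  set 𝒟 := Finset.powersetCard (2 * k + z) (Finset.univ : Finset (Fin n)) with h𝒟
  set 𝒪 := Finset.powersetCard k (Finset.univ : Finset (Fin n)) with h𝒪
  set g := totalStepGap z k good f with hg
  have hg0 : ∀ E, 0 ≤ g E := totalStepGap_nonneg z k good f
  have hE := sum_totalStepGap_le (k := k) hz1 good f
  set En := edgeEnergy k good f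
  have hEn : 0 ≤ En := (Finset.sum_nonneg fun E _ => hg0 E).trans hE
  have hnR : (1 : ℝ) ≤ n := by exact_mod_cast hn
  have hc𝒟 : (𝒟.card : ℝ) ≤ (n : ℝ) ^ (3 * k) := by
    rw [h𝒟, Finset.card_powersetCard, Finset.card_univ, Fintype.card_fin]
    have h1 : n.choose (2 * k + z) ≤ n ^ (3 * k) := (Nat.choose_le_pow _ _).trans
      (Nat.pow_le_pow_right hn (by omega))
    exact_mod_cast h1
  have hc𝒪 : (𝒪.card : ℝ) ≤ (n : ℝ) ^ k := by
    rw [h𝒪, Finset.card_powersetCard, Finset.card_univ, Fintype.card_fin]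
    exact_mod_cast Nat.choose_le_pow _ _
  -- Only moves with at least `z` bits count, which leaves at most `2 k` free elements for a set `D`
  -- containing one. This is why `stepGap` has a lower cutoff.
  have hsub : ∑ D ∈ 𝒟, ∑ A ∈ D.powerset, g A ≤ (n : ℝ) ^ (2 * k) * En := by
    have e : ∑ D ∈ 𝒟, ∑ A ∈ D.powerset, g A =
        ∑ A, ((𝒟.filter fun D => A ⊆ D).card : ℝ) * g A := by
      have : ∀ D ∈ 𝒟, ∑ A ∈ D.powerset, g A = ∑ A, if A ⊆ D then g A else 0 := by
        intro D _
        rw [← Finset.sum_filter]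
        refine Finset.sum_congr ?_ fun _ _ => rfl
        ext A; simp
      rw [Finset.sum_congr rfl this, Finset.sum_comm]
      refine Finset.sum_congr rfl fun A _ => ?_
      rw [← Finset.sum_filter, Finset.sum_const, nsmul_eq_mul]
    rw [e]
    refine le_trans (Finset.sum_le_sum fun A _ => ?_ : _ ≤ ∑ A, (n : ℝ) ^ (2 * k) * g A) ?_
    · by_cases hA : z ≤ A.card ∧ A.card ≤ k
      · refine mul_le_mul_of_nonneg_right ?_ (hg0 A)
        have h1 := card_superset_le (s := 2 * k + z) A
        have h2 : n ^ (2 * k + z - A.card) ≤ n ^ (2 * k) := Nat.pow_le_pow_right hn (by omega)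
        exact_mod_cast h1.trans h2
      · have : g A = 0 := by
          rw [hg]; unfold totalStepGap stepGap; simp [hA]
        rw [this]; simp
    · rw [← Finset.mul_sum]
      exact mul_le_mul_of_nonneg_left hE (by positivity)
  have hsO : ∑ O ∈ 𝒪, g O ≤ En := (Finset.sum_le_sum_of_subset_of_nonneg (Finset.subset_univ _)
    fun _ _ _ => hg0 _).trans hE
  have hpow : ∀ c : ℝ, 1 ≤ c → c ^ (2 * k + z) ≤ c ^ (3 * k) := fun c hc =>
    pow_le_pow_right₀ hc (by omega)
  calc a / 2 * ∑ x, ∑ D ∈ 𝒟, goodGap good f x (flip D x)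
      = ∑ x, ∑ D ∈ 𝒟, a / 2 * goodGap good f x (flip D x) := by
        simp only [Finset.mul_sum]
    _ ≤ ∑ x, ∑ D ∈ 𝒟, 5 * ∑ O ∈ 𝒪, ∑ A ∈ D.powerset, ∑ B ∈ D.powerset,
          detourGap z k good f x D O A B :=
        Finset.sum_le_sum fun x _ => Finset.sum_le_sum fun D hD =>
          mul_goodGap_le_sum_detourGap hz hz1 hzk hexp f ha x (Finset.mem_powersetCard.1 hD).2
    _ = 5 * ∑ D ∈ 𝒟, ∑ O ∈ 𝒪, ∑ A ∈ D.powerset, ∑ B ∈ D.powerset,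
          ∑ x, detourGap z k good f x D O A B := by
        rw [Finset.sum_comm, Finset.mul_sum]
        refine Finset.sum_congr rfl fun D _ => ?_
        rw [← Finset.mul_sum, Finset.sum_comm]
        congr 1
        refine Finset.sum_congr rfl fun O _ => ?_
        rw [Finset.sum_comm]
        exact Finset.sum_congr rfl fun A _ => Finset.sum_comm
    _ = 5 * ∑ D ∈ 𝒟, ∑ O ∈ 𝒪, (2 * 4 ^ (2 * k + z) * g O +
          3 * 2 ^ (2 * k + z) * ∑ A ∈ D.powerset, g A) := by
        congr 1
        refine Finset.sum_congr rfl fun D hD => Finset.sum_congr rfl fun O _ => ?_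
        rw [sum_powerset_detourGap_le, (Finset.mem_powersetCard.1 hD).2]
    _ = 5 * (2 * 4 ^ (2 * k + z) * (𝒟.card * ∑ O ∈ 𝒪, g O) +
          3 * 2 ^ (2 * k + z) * (𝒪.card * ∑ D ∈ 𝒟, ∑ A ∈ D.powerset, g A)) := by
        simp only [Finset.sum_add_distrib, Finset.sum_const, nsmul_eq_mul, ← Finset.mul_sum]
        ring
    _ ≤ 5 * (2 * 4 ^ (3 * k) * ((n : ℝ) ^ (3 * k) * En) +
          3 * 4 ^ (3 * k) * ((n : ℝ) ^ k * ((n : ℝ) ^ (2 * k) * En))) := by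
        have h2 : (2 : ℝ) ^ (2 * k + z) ≤ 4 ^ (3 * k) :=
          (hpow 2 (by norm_num)).trans (pow_le_pow_left₀ (by norm_num) (by norm_num) _)
        have hs1 : 0 ≤ ∑ O ∈ 𝒪, g O := Finset.sum_nonneg fun _ _ => hg0 _
        have hs2 : 0 ≤ ∑ D ∈ 𝒟, ∑ A ∈ D.powerset, g A :=
          Finset.sum_nonneg fun _ _ => Finset.sum_nonneg fun _ _ => hg0 _
        have h4 := hpow 4 (by norm_num)
        gcongr
    _ = 25 * 4 ^ (3 * k) * (n : ℝ) ^ (3 * k) * En := by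
        have : (n : ℝ) ^ k * (n : ℝ) ^ (2 * k) = (n : ℝ) ^ (3 * k) := by
          rw [← pow_add]; congr 1; omega
        linear_combination (15 * 4 ^ (3 * k) * En) * this

/-! ### Generic moves and single flips for fixed `k`. -/

/-- The number of sets with fewer than `k` elements. -/
def smallCount (n k : ℕ) : ℕ := (Finset.univ.filter fun O : Finset (Fin n) => O.card < k).card

lemma card_moves_mem_le {n k : ℕ} (i : Fin n) :
    ((moves n k).filter fun X => i ∈ X).card ≤ smallCount n k := by
  refine Finset.card_le_card_of_injOn (fun X => X.erase i) ?_ ?_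
  · intro X hX
    have hX := Finset.mem_filter.1 hX
    have := (mem_moves X).1 hX.1
    simp only [Finset.coe_filter, Finset.mem_univ, true_and, Set.mem_ofPred_eq]
    rw [Finset.card_erase_of_mem hX.2]
    omega
  · intro X hX Y hY h
    have hX := Finset.mem_filter.1 hX
    have hY := Finset.mem_filter.1 hY
    simp only at h
    rw [← Finset.insert_erase hX.2, h, Finset.insert_erase hY.2]

lemma card_moves_not_disjoint_le {n k : ℕ} (Z : Finset (Fin n)) :
    ((moves n k).filter fun X => ¬ Disjoint X Z).card ≤ Z.card * smallCount n k := by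
  have : ((moves n k).filter fun X => ¬ Disjoint X Z) ⊆
      Z.biUnion fun i => (moves n k).filter fun X => i ∈ X := by
    intro X hX
    obtain ⟨h1, h2⟩ := Finset.mem_filter.1 hX
    obtain ⟨i, hi, hi'⟩ := Finset.not_disjoint_iff.1 h2
    exact Finset.mem_biUnion.2 ⟨i, hi', Finset.mem_filter.2 ⟨h1, hi⟩⟩
  refine (Finset.card_le_card this).trans (Finset.card_biUnion_le.trans ?_)
  calc _ ≤ ∑ i ∈ Z, smallCount n k := Finset.sum_le_sum fun i _ => card_moves_mem_le i
    _ = _ := by rw [Finset.sum_const, smul_eq_mul]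

lemma card_moves_card_ne_le (n k : ℕ) :
    ((moves n k).filter fun X => ¬ X.card = k).card ≤ smallCount n k := by
  refine Finset.card_le_card fun X hX => ?_
  obtain ⟨h1, h2⟩ := Finset.mem_filter.1 hX
  have := (mem_moves X).1 h1
  exact Finset.mem_filter.2 ⟨Finset.mem_univ _, by omega⟩

/-- Two moves of maximal size, disjoint from each other and from `Z`. -/
def IsGeneric {n : ℕ} (k : ℕ) (Z : Finset (Fin n)) (x : Finset (Fin n) × Finset (Fin n)) : Prop :=
  x.1.card = k ∧ x.2.card = k ∧ Disjoint x.1 Z ∧ Disjoint x.2 Z ∧ Disjoint x.1 x.2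

/-- There are five ways to fail: a move is too small, a move meets `Z`, or the moves meet each
other. Each leaves at most `k * smallCount n k` choices for one of the moves. -/
lemma card_not_isGeneric_le {n k : ℕ} (hk : 1 ≤ k) {Z : Finset (Fin n)} (hZ : Z.card ≤ k) :
    ((moves n k ×ˢ moves n k).filter fun x => ¬ IsGeneric k Z x).card ≤
      5 * k * smallCount n k * numNeighbors n k := by
  set s := smallCount n k with hs
  set N := numNeighbors n k with hN
  have hcN : (moves n k).card = N := card_moves n k
  have hsub : ((moves n k ×ˢ moves n k).filter fun x => ¬ IsGeneric k Z x) ⊆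
      ((moves n k).filter fun X => ¬ X.card = k) ×ˢ moves n k ∪
      (moves n k ×ˢ ((moves n k).filter fun X => ¬ X.card = k) ∪
      (((moves n k).filter fun X => ¬ Disjoint X Z) ×ˢ moves n k ∪
      (moves n k ×ˢ ((moves n k).filter fun X => ¬ Disjoint X Z) ∪
        (moves n k).biUnion fun X => {X} ×ˢ ((moves n k).filter fun Y => ¬ Disjoint Y X)))) := by
    rintro ⟨X, Y⟩ hx
    obtain ⟨h1, h2⟩ := Finset.mem_filter.1 hx
    obtain ⟨hX, hY⟩ := Finset.mem_product.1 h1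
    simp only at hX hY
    unfold IsGeneric at h2
    simp only [Finset.mem_union, Finset.mem_product, Finset.mem_filter, Finset.mem_biUnion,
      Finset.mem_singleton, hX, hY, true_and, and_true]
    by_contra hcon
    push Not at hcon
    obtain ⟨a, b, c, d, e⟩ := hcon
    exact h2 ⟨a, b, c, d, (e X hX rfl).symm⟩
  have b1 : (((moves n k).filter fun X => ¬ X.card = k) ×ˢ moves n k).card ≤ s * N := by
    rw [Finset.card_product, hcN]
    exact Nat.mul_le_mul_right _ (card_moves_card_ne_le n k)
  have b2 : (moves n k ×ˢ ((moves n k).filter fun X => ¬ X.card = k)).card ≤ s * N := by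
    rw [Finset.card_product, hcN, mul_comm]
    exact Nat.mul_le_mul_right _ (card_moves_card_ne_le n k)
  have hZs : Z.card * s ≤ k * s := Nat.mul_le_mul_right _ hZ
  have b3 : (((moves n k).filter fun X => ¬ Disjoint X Z) ×ˢ moves n k).card ≤ k * s * N := by
    rw [Finset.card_product, hcN]
    exact Nat.mul_le_mul_right _ ((card_moves_not_disjoint_le Z).trans hZs)
  have b4 : (moves n k ×ˢ ((moves n k).filter fun X => ¬ Disjoint X Z)).card ≤ k * s * N := by
    rw [Finset.card_product, hcN, mul_comm]
    exact Nat.mul_le_mul_right _ ((card_moves_not_disjoint_le Z).trans hZs)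
  have b5 : ((moves n k).biUnion fun X => {X} ×ˢ ((moves n k).filter fun Y => ¬ Disjoint Y X)).card
      ≤ k * s * N := by
    refine Finset.card_biUnion_le.trans ?_
    calc _ ≤ ∑ X ∈ moves n k, k * s := by
          refine Finset.sum_le_sum fun X hX => ?_
          rw [Finset.card_product, Finset.card_singleton, one_mul]
          exact (card_moves_not_disjoint_le X).trans
            (Nat.mul_le_mul_right _ ((mem_moves X).1 hX).2)
      _ = _ := by rw [Finset.sum_const, smul_eq_mul, hcN, mul_comm]
  have h := Finset.card_le_card hsub
  have u1 := Finset.card_union_le (((moves n k).filter fun X => ¬ X.card = k) ×ˢ moves n k)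
      (moves n k ×ˢ ((moves n k).filter fun X => ¬ X.card = k) ∪
      (((moves n k).filter fun X => ¬ Disjoint X Z) ×ˢ moves n k ∪
      (moves n k ×ˢ ((moves n k).filter fun X => ¬ Disjoint X Z) ∪
        (moves n k).biUnion fun X => {X} ×ˢ ((moves n k).filter fun Y => ¬ Disjoint Y X))))
  have u2 := Finset.card_union_le (moves n k ×ˢ ((moves n k).filter fun X => ¬ X.card = k))
      (((moves n k).filter fun X => ¬ Disjoint X Z) ×ˢ moves n k ∪
      (moves n k ×ˢ ((moves n k).filter fun X => ¬ Disjoint X Z) ∪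
        (moves n k).biUnion fun X => {X} ×ˢ ((moves n k).filter fun Y => ¬ Disjoint Y X)))
  have u3 := Finset.card_union_le (((moves n k).filter fun X => ¬ Disjoint X Z) ×ˢ moves n k)
      (moves n k ×ˢ ((moves n k).filter fun X => ¬ Disjoint X Z) ∪
        (moves n k).biUnion fun X => {X} ×ˢ ((moves n k).filter fun Y => ¬ Disjoint Y X))
  have u4 := Finset.card_union_le (moves n k ×ˢ ((moves n k).filter fun X => ¬ Disjoint X Z))
      ((moves n k).biUnion fun X => {X} ×ˢ ((moves n k).filter fun Y => ¬ Disjoint Y X))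
  have hks : s * N ≤ k * s * N := by
    rw [mul_assoc]; exact Nat.le_mul_of_pos_left _ hk
  have : 5 * k * s * N = 5 * (k * s * N) := by ring
  omega

lemma card_filter_flip_mem {n k : ℕ} {v : Vertex n} {S : Finset (Vertex n)}
    (hS : ∀ x ∈ S, (hypercubeGraph n k).Adj v x) :
    ((moves n k).filter fun X => flip X v ∈ S).card = S.card := by
  refine Finset.card_bij' (fun X _ => flip X v) (fun x _ => diff v x) ?_ ?_ ?_ ?_
  · intro X hX; exact (Finset.mem_filter.1 hX).2
  · intro x hx
    refine Finset.mem_filter.2 ⟨?_, by rw [flip_diff]; exact hx⟩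
    have := hS x hx
    rw [← flip_diff v x, adj_flip] at this
    exact (mem_moves _).2 this
  · intro X _; exact diff_flip v X
  · intro x _; exact flip_diff v x

/-- Among the `(α N / 2)²` pairs supplied by the medians, `hs` removes at most half as not generic.
Generic pairs have the full number of differing bits, as the detours require. -/
lemma IsMedianField.mul_sq_le_sum_isGeneric {n k : ℕ} (hk : 1 ≤ k) {good : Vertex n → Prop}
    {α : ℝ} (hα : 0 ≤ α) {f F : Vertex n → ℝ}
    (hF : IsMedianField k good (α * numNeighbors n k) f F) {Z : Finset (Fin n)} (hZ : Z.card ≤ k)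
    (hs : 5 * k * (smallCount n k : ℝ) ≤ α ^ 2 / 8 * numNeighbors n k) (v : Vertex n) :
    α ^ 2 / 8 * (numNeighbors n k : ℝ) ^ 2 * (F v - F (flip Z v)) ^ 2 ≤
      ∑ x ∈ (moves n k ×ˢ moves n k).filter (IsGeneric k Z),
        goodGap good f (flip x.1 v) (flip x.2 (flip Z v)) := by
  obtain ⟨S, S', hS, hS', hc, hc', hΔ⟩ := hF.exists_sets v (flip Z v)
  set N : ℝ := ((numNeighbors n k : ℕ) : ℝ) with hN
  have hN0 : 0 ≤ N := Nat.cast_nonneg _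
  set SX := (moves n k).filter fun X => flip X v ∈ S with hSX
  set SY := (moves n k).filter fun X => flip X (flip Z v) ∈ S' with hSY
  have cX : SX.card = S.card := card_filter_flip_mem fun x hx => (hS x hx).1
  have cY : SY.card = S'.card := card_filter_flip_mem fun x hx => (hS' x hx).1
  have hcount : α ^ 2 / 8 * N ^ 2 ≤ (((SX ×ˢ SY).filter (IsGeneric k Z)).card : ℝ) := by
    have h1 := Finset.card_filter_add_card_filter_not (s := SX ×ˢ SY) (IsGeneric k Z)
    have h2 : ((SX ×ˢ SY).filter fun x => ¬ IsGeneric k Z x).card ≤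
        5 * k * smallCount n k * numNeighbors n k := by
      refine (Finset.card_le_card (Finset.filter_subset_filter _ ?_)).trans
        (card_not_isGeneric_le hk hZ)
      exact Finset.product_subset_product (Finset.filter_subset _ _) (Finset.filter_subset _ _)
    have h3 : (((SX ×ˢ SY).filter (IsGeneric k Z)).card : ℝ) +
        ((SX ×ˢ SY).filter fun x => ¬ IsGeneric k Z x).card = S.card * S'.card := by
      rw [Finset.card_product, cX, cY] at h1
      exact_mod_cast h1
    have h4 : (((SX ×ˢ SY).filter fun x => ¬ IsGeneric k Z x).card : ℝ) ≤
        5 * k * smallCount n k * N := by rw [hN]; exact_mod_cast h2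
    have h5 : (α * N / 2) * (α * N / 2) ≤ S.card * S'.card :=
      mul_le_mul hc hc' (by positivity) (by positivity)
    have h6 := mul_le_mul_of_nonneg_right hs hN0
    nlinarith
  calc α ^ 2 / 8 * N ^ 2 * (F v - F (flip Z v)) ^ 2
      ≤ ((SX ×ˢ SY).filter (IsGeneric k Z)).card * (F v - F (flip Z v)) ^ 2 :=
        mul_le_mul_of_nonneg_right hcount (sq_nonneg _)
    _ = ∑ x ∈ (SX ×ˢ SY).filter (IsGeneric k Z), (F v - F (flip Z v)) ^ 2 := by
        rw [Finset.sum_const, nsmul_eq_mul]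
    _ ≤ ∑ x ∈ (SX ×ˢ SY).filter (IsGeneric k Z),
        goodGap good f (flip x.1 v) (flip x.2 (flip Z v)) := by
        refine Finset.sum_le_sum fun x hx => ?_
        obtain ⟨h1, h2⟩ := Finset.mem_product.1 (Finset.mem_filter.1 hx).1
        have h1 := (Finset.mem_filter.1 h1).2
        have h2 := (Finset.mem_filter.1 h2).2
        unfold goodGap
        rw [if_pos ⟨(hS _ h1).2, (hS' _ h2).2⟩]
        exact hΔ _ h1 _ h2
    _ ≤ _ := by
        refine Finset.sum_le_sum_of_subset_of_nonneg (Finset.filter_subset_filter _ ?_)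
          fun _ _ _ => goodGap_nonneg _ _ _ _
        exact Finset.product_subset_product (Finset.filter_subset _ _) (Finset.filter_subset _ _)

/-- The sum over all generic triples, grouped by the union. -/
lemma sum_isGeneric_le {n k z : ℕ} {G : Finset (Fin n) → ℝ} (hG : ∀ D, 0 ≤ G D) :
    ∑ Z ∈ Finset.powersetCard z Finset.univ,
      ∑ x ∈ (moves n k ×ˢ moves n k).filter (IsGeneric k Z), G (symmDiff (symmDiff x.2 Z) x.1) ≤
    2 ^ (3 * (2 * k + z)) * ∑ D ∈ Finset.powersetCard (2 * k + z) Finset.univ, G D := by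
  set I : Finset (Σ _ : Finset (Fin n), Finset (Fin n) × Finset (Fin n)) :=
    (Finset.powersetCard z Finset.univ).sigma fun Z =>
      (moves n k ×ˢ moves n k).filter (IsGeneric k Z) with hI
  set φ : (Σ _ : Finset (Fin n), Finset (Fin n) × Finset (Fin n)) → Finset (Fin n) :=
    fun t => symmDiff (symmDiff t.2.2 t.1) t.2.1 with hφ
  have hstr : ∀ t ∈ I, (φ t).card = 2 * k + z ∧ t.1 ⊆ φ t ∧ t.2.1 ⊆ φ t ∧ t.2.2 ⊆ φ t := by
    intro t ht
    obtain ⟨h1, h2⟩ := Finset.mem_sigma.1 ht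
    have hz := (Finset.mem_powersetCard.1 h1).2
    obtain ⟨c1, c2, d1, d2, d3⟩ := (Finset.mem_filter.1 h2).2
    have e1 : symmDiff t.2.2 t.1 = t.2.2 ∪ t.1 := d2.symmDiff_eq_sup
    have d4 : Disjoint (t.2.2 ∪ t.1) t.2.1 := Finset.disjoint_union_left.2 ⟨d3.symm, d1.symm⟩
    have e2 : φ t = t.2.2 ∪ t.1 ∪ t.2.1 := by
      rw [hφ]; simp only; rw [e1]; exact d4.symmDiff_eq_sup
    rw [e2]
    refine ⟨?_, ?_, ?_, ?_⟩
    · rw [Finset.card_union_of_disjoint d4, Finset.card_union_of_disjoint d2]; omega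
    · exact Finset.subset_union_right.trans Finset.subset_union_left
    · exact Finset.subset_union_right
    · exact Finset.subset_union_left.trans Finset.subset_union_left
  have e : ∑ Z ∈ Finset.powersetCard z Finset.univ,
      ∑ x ∈ (moves n k ×ˢ moves n k).filter (IsGeneric k Z), G (symmDiff (symmDiff x.2 Z) x.1) =
      ∑ t ∈ I, G (φ t) := by rw [hI, Finset.sum_sigma]
  rw [e, ← Finset.sum_fiberwise_of_maps_to (g := φ)
    (t := Finset.powersetCard (2 * k + z) Finset.univ) (fun t ht =>
      Finset.mem_powersetCard.2 ⟨Finset.subset_univ _, (hstr t ht).1⟩), Finset.mul_sum]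
  refine Finset.sum_le_sum fun D hD => ?_
  have hD := (Finset.mem_powersetCard.1 hD).2
  rw [Finset.sum_congr rfl fun t ht => by rw [(Finset.mem_filter.1 ht).2], Finset.sum_const,
    nsmul_eq_mul]
  refine mul_le_mul_of_nonneg_right ?_ (hG D)
  -- A generic triple is disjoint, so all three sets are subsets of their union `D`.
  have : (I.filter fun t => φ t = D).card ≤
      (D.powerset ×ˢ (D.powerset ×ˢ D.powerset)).card := by
    refine Finset.card_le_card_of_injOn (fun t => (t.1, t.2)) ?_ ?_
    · intro t ht
      obtain ⟨h1, h2⟩ := Finset.mem_filter.1 ht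
      have h3 := hstr t h1
      rw [h2] at h3
      simp [h3]
    · rintro ⟨a, b⟩ _ ⟨c, d⟩ _ h
      simpa using h
  rw [Finset.card_product, Finset.card_product, Finset.card_powerset, hD] at this
  have h2 : 2 ^ (3 * (2 * k + z)) = 2 ^ (2 * k + z) * (2 ^ (2 * k + z) * 2 ^ (2 * k + z)) := by
    rw [← pow_add, ← pow_add]; congr 1; ring
  rw [← h2] at this
  exact_mod_cast this

/-- The increments of a median field along the moves of size `z`. -/
def jumpSum {n : ℕ} (z : ℕ) (F : Vertex n → ℝ) : ℝ :=
  ∑ v, ∑ Z ∈ Finset.powersetCard z Finset.univ, (F v - F (flip Z v)) ^ 2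

/-- A jump of `F` along `Z` is replaced by increments of `f` between generic neighbours of its two
ends. Translation and grouping by `D` bound the number of repetitions. -/
lemma IsMedianField.mul_jumpSum_le {n k z : ℕ} (hk : 1 ≤ k) (hz : z ≤ k) {good : Vertex n → Prop}
    {α : ℝ} (hα : 0 ≤ α) {f F : Vertex n → ℝ}
    (hF : IsMedianField k good (α * numNeighbors n k) f F)
    (hs : 5 * k * (smallCount n k : ℝ) ≤ α ^ 2 / 8 * numNeighbors n k) :
    α ^ 2 / 8 * (numNeighbors n k : ℝ) ^ 2 * jumpSum z F ≤ 2 ^ (9 * k) *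
      ∑ x, ∑ D ∈ Finset.powersetCard (2 * k + z) Finset.univ, goodGap good f x (flip D x) := by
  set G : Finset (Fin n) → ℝ := fun D => ∑ x, goodGap good f x (flip D x) with hG
  have hG0 : ∀ D, 0 ≤ G D := fun D => Finset.sum_nonneg fun _ _ => goodGap_nonneg _ _ _ _
  have hsh : ∀ (Z : Finset (Fin n)) (x : Finset (Fin n) × Finset (Fin n)),
      ∑ v, goodGap good f (flip x.1 v) (flip x.2 (flip Z v)) =
        G (symmDiff (symmDiff x.2 Z) x.1) := by
    intro Z x
    rw [hG]
    simp only
    rw [← sum_flip x.1 fun v => goodGap good f v (flip (symmDiff (symmDiff x.2 Z) x.1) v)]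
    refine Finset.sum_congr rfl fun v _ => ?_
    rw [flip_flip, flip_flip, symmDiff_symmDiff_cancel_right]
  unfold jumpSum
  calc α ^ 2 / 8 * (numNeighbors n k : ℝ) ^ 2 *
        ∑ v, ∑ Z ∈ Finset.powersetCard z Finset.univ, (F v - F (flip Z v)) ^ 2
      = ∑ v, ∑ Z ∈ Finset.powersetCard z Finset.univ,
          α ^ 2 / 8 * (numNeighbors n k : ℝ) ^ 2 * (F v - F (flip Z v)) ^ 2 := by
        simp only [Finset.mul_sum]
    _ ≤ ∑ v, ∑ Z ∈ Finset.powersetCard z Finset.univ,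
          ∑ x ∈ (moves n k ×ˢ moves n k).filter (IsGeneric k Z),
            goodGap good f (flip x.1 v) (flip x.2 (flip Z v)) :=
        Finset.sum_le_sum fun v _ => Finset.sum_le_sum fun Z hZ =>
          hF.mul_sq_le_sum_isGeneric hk hα (by rw [(Finset.mem_powersetCard.1 hZ).2]; exact hz) hs v
    _ = ∑ Z ∈ Finset.powersetCard z Finset.univ,
          ∑ x ∈ (moves n k ×ˢ moves n k).filter (IsGeneric k Z),
            G (symmDiff (symmDiff x.2 Z) x.1) := by
        rw [Finset.sum_comm]
        refine Finset.sum_congr rfl fun Z _ => ?_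
        rw [Finset.sum_comm]
        exact Finset.sum_congr rfl fun x _ => hsh Z x
    _ ≤ 2 ^ (3 * (2 * k + z)) * ∑ D ∈ Finset.powersetCard (2 * k + z) Finset.univ, G D :=
        sum_isGeneric_le hG0
    _ ≤ 2 ^ (9 * k) * ∑ D ∈ Finset.powersetCard (2 * k + z) Finset.univ, G D := by
        refine mul_le_mul_of_nonneg_right (pow_le_pow_right₀ (by norm_num) (by omega))
          (Finset.sum_nonneg fun _ _ => hG0 _)
    _ = _ := by rw [hG, Finset.sum_comm]

lemma smallCount_le {n k : ℕ} (hn : 1 ≤ n) (hk : 1 ≤ k) : smallCount n k ≤ k * n ^ (k - 1) := by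
  have h : (Finset.univ.filter fun O : Finset (Fin n) => O.card < k) ⊆
      (Finset.range k).biUnion fun j => Finset.powersetCard j Finset.univ := by
    intro O hO
    simp only [Finset.mem_filter, Finset.mem_univ, true_and] at hO
    simp [Finset.mem_powersetCard, hO]
  refine (Finset.card_le_card h).trans (Finset.card_biUnion_le.trans ?_)
  calc _ ≤ ∑ j ∈ Finset.range k, n ^ (k - 1) := by
        refine Finset.sum_le_sum fun j hj => ?_
        have := Finset.mem_range.1 hj
        rw [Finset.card_powersetCard, Finset.card_univ, Fintype.card_fin]
        exact (Nat.choose_le_pow _ _).trans (Nat.pow_le_pow_right hn (by omega))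
    _ = _ := by simp

lemma pow_le_mul_choose {n k : ℕ} (hn : 2 * k ≤ n) : n ^ k ≤ 2 ^ k * k.factorial * n.choose k := by
  have h1 : n ^ k ≤ (2 * (n + 1 - k)) ^ k := Nat.pow_le_pow_left (by omega) k
  have h2 := Nat.pow_sub_le_descFactorial n k
  rw [Nat.descFactorial_eq_factorial_mul_choose] at h2
  rw [mul_pow] at h1
  rw [mul_assoc]
  exact h1.trans (Nat.mul_le_mul_left _ h2)

lemma choose_le_numNeighbors {n k : ℕ} (hk : 1 ≤ k) : n.choose k ≤ numNeighbors n k :=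
  Finset.single_le_sum (f := fun r => n.choose r) (fun _ _ => Nat.zero_le _)
    (Finset.mem_Icc.2 ⟨hk, le_rfl⟩)

lemma numNeighbors_le_choose_add {n k : ℕ} :
    numNeighbors n k ≤ n.choose k + smallCount n k := by
  have h1 : moves n k ⊆ Finset.powersetCard k Finset.univ ∪
      (Finset.univ.filter fun O : Finset (Fin n) => O.card < k) := by
    intro X hX
    have := (mem_moves X).1 hX
    simp only [Finset.mem_union, Finset.mem_powersetCard, Finset.subset_univ, true_and,
      Finset.mem_filter, Finset.mem_univ]
    omega
  have h2 := (Finset.card_le_card h1).trans (Finset.card_union_le _ _)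
  rwa [card_moves, Finset.card_powersetCard, Finset.card_univ, Fintype.card_fin] at h2

/-- For fixed `k` there are of order at most `n ^ (k - 1)` small sets, against `n.choose k`, which
is of order `n ^ k`. -/
lemma exists_smallCount_le {k : ℕ} (hk : 1 ≤ k) {η : ℝ} (hη : 0 < η) :
    ∃ n₀ : ℕ, 2 * k ≤ n₀ ∧ ∀ n, n₀ ≤ n → (smallCount n k : ℝ) ≤ η * numNeighbors n k := by
  obtain ⟨n₁, hn₁⟩ := exists_nat_ge (k * (2 ^ k * k.factorial) / η)
  refine ⟨max n₁ (2 * k), le_max_right _ _, fun n hn => ?_⟩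
  have hn1 : n₁ ≤ n := (le_max_left _ _).trans hn
  have hn2 : 2 * k ≤ n := (le_max_right _ _).trans hn
  have h1 := smallCount_le (n := n) (by omega) hk
  have h2 := (pow_le_mul_choose hn2).trans (Nat.mul_le_mul_left _ (choose_le_numNeighbors (n := n) hk))
  have h1R : (smallCount n k : ℝ) ≤ k * n ^ (k - 1) := by exact_mod_cast h1
  have h2R : (n : ℝ) ^ k ≤ 2 ^ k * k.factorial * numNeighbors n k := by exact_mod_cast h2
  have h3 : k * (2 ^ k * k.factorial) / η ≤ n := hn₁.trans (by exact_mod_cast hn1)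
  rw [div_le_iff₀ hη] at h3
  have hn0 : (0 : ℝ) < n := by exact_mod_cast (by omega : 0 < n)
  have h4 : (n : ℝ) ^ (k - 1) * n = n ^ k := by
    rw [← pow_succ, Nat.sub_add_cancel hk]
  have hkR : (0 : ℝ) ≤ k := Nat.cast_nonneg _
  have hNR : (0 : ℝ) ≤ numNeighbors n k := Nat.cast_nonneg _
  apply le_of_mul_le_mul_right _ hn0
  calc (smallCount n k : ℝ) * n ≤ k * n ^ (k - 1) * n := mul_le_mul_of_nonneg_right h1R hn0.le
    _ = k * n ^ k := by rw [mul_assoc, h4]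
    _ ≤ k * (2 ^ k * k.factorial * numNeighbors n k) := mul_le_mul_of_nonneg_left h2R hkR
    _ = k * (2 ^ k * k.factorial) * numNeighbors n k := by ring
    _ ≤ n * η * numNeighbors n k := mul_le_mul_of_nonneg_right h3 hNR
    _ = _ := by ring

lemma sum_flip_jump {n : ℕ} (A B : Finset (Fin n)) (F : Vertex n → ℝ) :
    ∑ v, (F (flip A v) - F (flip (symmDiff B A) v)) ^ 2 = ∑ v, (F v - F (flip B v)) ^ 2 := by
  rw [← sum_flip A fun v => (F v - F (flip B v)) ^ 2]
  simp only [flip_flip]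

/-- The increments along single flips from the increments along flips of `k` and `k - 1` bits. -/
lemma choose_mul_sum_flip_le {m k : ℕ} (F : Vertex (m + 1) → ℝ) :
    (m.choose k : ℝ) * ∑ v, ∑ i, (F v - F (flip {i} v)) ^ 2 ≤
      2 * (k + 1) * jumpSum (k + 1) F + 2 * (m + 1) * jumpSum k F := by
  set τ : Finset (Fin (m + 1)) → ℝ := fun B => ∑ v, (F v - F (flip B v)) ^ 2 with hτ
  have hτ0 : ∀ B, 0 ≤ τ B := fun B => Finset.sum_nonneg fun _ _ => sq_nonneg _
  have hJ : ∀ z, jumpSum z F = ∑ Z ∈ Finset.powersetCard z Finset.univ, τ Z := by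
    intro z; unfold jumpSum; rw [Finset.sum_comm]
  -- Flipping `i` amounts to a jump along `D ∪ {i}` followed by a jump back along `D`.
  have hpt : ∀ (i : Fin (m + 1)) (D : Finset (Fin m)), τ {i} ≤
      2 * τ (insert i (D.map i.succAboveEmb)) + 2 * τ (D.map i.succAboveEmb) := by
    intro i D
    have hdis : symmDiff (D.map i.succAboveEmb) {i} = insert i (D.map i.succAboveEmb) := by
      have : Disjoint (D.map i.succAboveEmb) {i} := by simp [Fin.succAbove_ne]
      rw [this.symmDiff_eq_sup]
      ext j; simp
    have hj := sum_flip_jump {i} (D.map i.succAboveEmb) F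
    rw [hdis] at hj
    simp only [hτ]
    rw [← hj, Finset.mul_sum, Finset.mul_sum, ← Finset.sum_add_distrib]
    refine Finset.sum_le_sum fun v _ => ?_
    nlinarith [sq_nonneg ((F v - F (flip (insert i (D.map i.succAboveEmb)) v)) +
      (F (flip {i} v) - F (flip (insert i (D.map i.succAboveEmb)) v)))]
  have h := Finset.sum_le_sum fun i (_ : i ∈ Finset.univ) =>
    Finset.sum_le_sum fun D (_ : D ∈ Finset.powersetCard k (Finset.univ : Finset (Fin m))) => hpt i D
  simp only [Finset.sum_const, Finset.card_powersetCard, Finset.card_univ, Fintype.card_fin,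
    nsmul_eq_mul, Finset.sum_add_distrib, ← Finset.mul_sum] at h
  rw [sum_insert_map_succAbove k τ, sum_map_succAbove k τ] at h
  rw [hJ, hJ, Finset.sum_comm]
  have h1 : 0 ≤ ∑ Z ∈ Finset.powersetCard k Finset.univ, τ Z := Finset.sum_nonneg fun _ _ => hτ0 _
  have h2 : (((m + 1 : ℕ) : ℝ) - k) * ∑ Z ∈ Finset.powersetCard k Finset.univ, τ Z ≤
      (m + 1) * ∑ Z ∈ Finset.powersetCard k Finset.univ, τ Z := by
    refine mul_le_mul_of_nonneg_right ?_ h1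
    push_cast
    have : (0 : ℝ) ≤ k := Nat.cast_nonneg _
    linarith
  linarith

lemma jumpSum_zero {n : ℕ} (F : Vertex n → ℝ) : jumpSum 0 F = 0 := by
  simp [jumpSum, flip_empty]

/-- For fixed `k` and large dimension, expansion controls the increments of the median field. -/
lemma exists_sum_flip_le_of_fixed {α : ℝ} (hα : 0 < α) {k : ℕ} (hk : 1 ≤ k) :
    ∃ (n₀ : ℕ) (C : ℝ), 0 < C ∧ ∀ n : ℕ, n₀ ≤ n → ∀ (good : Vertex n → Prop) (f F : Vertex n → ℝ),
      Expands k good (α * numNeighbors n k) → IsMedianField k good (α * numNeighbors n k) f F →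
      k * numNeighbors n k * ∑ v, ∑ i, (F v - F (flip {i} v)) ^ 2 ≤
        C * n ^ 2 * edgeEnergy k good f := by
  have hkR : (0 : ℝ) < k := by exact_mod_cast hk
  set κ : ℝ := 2 ^ k * k.factorial with hκ
  have hκ0 : 0 < κ := by positivity
  -- The three entries make the layer of size `k` carry half of `N`, the pairs that are not generic
  -- few, and the paths that are not far few.
  set η : ℝ := min (1 / 2) (min (α ^ 2 / 8 / (5 * k)) (α / 2 / 2 ^ (3 * k))) with hη
  have hη0 : 0 < η := by rw [hη]; positivity
  obtain ⟨n₀, hn₀, hsm⟩ := exists_smallCount_le hk hη0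
  set c : ℝ := 16 * (25 * 2 ^ (9 * k) * 4 ^ (3 * k)) * κ ^ 3 / α ^ 3 with hc
  refine ⟨n₀, 8 * c, by positivity, fun n hn good f F hexp hF => ?_⟩
  set N : ℝ := ((numNeighbors n k : ℕ) : ℝ) with hN
  have hN0 : 0 < N := by rw [hN]; exact_mod_cast numNeighbors_pos hk (by omega)
  have hs := hsm n hn
  rw [← hN] at hs
  have hs1 : (smallCount n k : ℝ) ≤ N / 2 := hs.trans (by
    have := mul_le_mul_of_nonneg_right (min_le_left _ _ : η ≤ 1 / 2) hN0.le
    linarith)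
  have hs2 : 5 * k * (smallCount n k : ℝ) ≤ α ^ 2 / 8 * N := by
    have h1 : η ≤ α ^ 2 / 8 / (5 * k) := (min_le_right _ _).trans (min_le_left _ _)
    rw [le_div_iff₀ (by positivity)] at h1
    have h2 := mul_le_mul_of_nonneg_right h1 hN0.le
    have h3 := mul_le_mul_of_nonneg_left hs (by positivity : (0 : ℝ) ≤ 5 * k)
    linarith
  have hs3 : 2 ^ (3 * k) * (smallCount n k : ℝ) ≤ α * N / 2 := by
    have h1 : η ≤ α / 2 / 2 ^ (3 * k) := (min_le_right _ _).trans (min_le_right _ _)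
    rw [le_div_iff₀ (by positivity)] at h1
    have h2 := mul_le_mul_of_nonneg_right h1 hN0.le
    have h3 := mul_le_mul_of_nonneg_left hs (by positivity : (0 : ℝ) ≤ 2 ^ (3 * k))
    linarith
  set En := edgeEnergy k good f with hEn
  have hEn0 : 0 ≤ En := edgeEnergy_nonneg _ _ _
  have hpow : (n : ℝ) ^ (3 * k) ≤ κ ^ 3 * N ^ 3 := by
    have h1 := (pow_le_mul_choose (n := n) (k := k) (by omega)).trans
      (Nat.mul_le_mul_left _ (choose_le_numNeighbors (n := n) hk))
    have h2 : (n : ℝ) ^ k ≤ κ * N := by rw [hκ, hN]; exact_mod_cast h1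
    calc (n : ℝ) ^ (3 * k) = ((n : ℝ) ^ k) ^ 3 := by rw [← pow_mul, mul_comm]
      _ ≤ (κ * N) ^ 3 := pow_le_pow_left₀ (by positivity) h2 3
      _ = _ := by ring
  -- The generic pairs supply `N²` and the disjoint paths a further `N`, against `n ^ (3 k)` for the
  -- detours; since `n ^ k ≤ κ N`, all powers of `n` cancel.
  have hJ : ∀ z, k ≤ z + 1 → 1 ≤ z → z ≤ k → jumpSum z F ≤ c * En := by
    intro z hz hz1 hzk
    have h1 := hF.mul_jumpSum_le hk hzk hα.le hs2
    have h2 := sum_goodGap_le_of_expands (by omega) hz hz1 hzk hexp f hs3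
    rw [← hEn] at h2
    set U := ∑ x, ∑ D ∈ Finset.powersetCard (2 * k + z) Finset.univ, goodGap good f x (flip D x)
    have h3 := mul_le_mul_of_nonneg_left h1 (by positivity : 0 ≤ α * N / 2)
    have h4 := mul_le_mul_of_nonneg_left h2 (by positivity : (0 : ℝ) ≤ 2 ^ (9 * k))
    have h5 := mul_le_mul_of_nonneg_right hpow hEn0
    have h6 := mul_le_mul_of_nonneg_left h5
      (by positivity : (0 : ℝ) ≤ 25 * 2 ^ (9 * k) * 4 ^ (3 * k))
    have h7 : N ^ 3 * (α ^ 3 * jumpSum z F) ≤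
        N ^ 3 * (16 * (25 * 2 ^ (9 * k) * 4 ^ (3 * k)) * κ ^ 3 * En) := by
      nlinarith
    have h8 := le_of_mul_le_mul_left h7 (by positivity)
    rw [hc, div_mul_eq_mul_div, le_div_iff₀ (by positivity)]
    linarith
  obtain ⟨m, rfl⟩ : ∃ m, n = m + 1 := ⟨n - 1, by omega⟩
  obtain ⟨l, rfl⟩ : ∃ l, k = l + 1 := ⟨k - 1, by omega⟩
  have hA := choose_mul_sum_flip_le (k := l) F
  set A := ∑ v, ∑ i, (F v - F (flip {i} v)) ^ 2 with hAdef
  have hA0 : 0 ≤ A := Finset.sum_nonneg fun _ _ => Finset.sum_nonneg fun _ _ => sq_nonneg _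
  have hc0 : 0 ≤ c * En := mul_nonneg (by positivity) hEn0
  have hJ1 := hJ (l + 1) (by omega) (by omega) le_rfl
  -- For `k = 1` the second jump is along the empty set and vanishes.
  have hJ2 : jumpSum l F ≤ c * En := by
    rcases Nat.eq_zero_or_pos l with h | h
    · rw [h, jumpSum_zero]; exact hc0
    · exact hJ l le_rfl h (Nat.le_succ l)
  have hlm : (l : ℝ) + 1 ≤ m + 1 := by
    have : l + 1 ≤ m + 1 := by omega
    exact_mod_cast this
  have hB : (m.choose l : ℝ) * A ≤ 4 * (m + 1) * (c * En) := by
    have h1 : 2 * ((l : ℝ) + 1) * jumpSum (l + 1) F ≤ 2 * (m + 1) * (c * En) :=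
      mul_le_mul (by linarith) hJ1 (Finset.sum_nonneg fun _ _ => Finset.sum_nonneg fun _ _ =>
        sq_nonneg _) (by positivity)
    have h2 : 2 * ((m : ℝ) + 1) * jumpSum l F ≤ 2 * (m + 1) * (c * En) :=
      mul_le_mul_of_nonneg_left hJ2 (by positivity)
    linarith
  have hch : ((m : ℝ) + 1) * m.choose l = (m + 1).choose (l + 1) * (l + 1) := by
    exact_mod_cast Nat.add_one_mul_choose_eq m l
  have hNc : N / 2 ≤ (m + 1).choose (l + 1) := by
    have h1 : N ≤ (m + 1).choose (l + 1) + smallCount (m + 1) (l + 1) := by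
      rw [hN]; exact_mod_cast numNeighbors_le_choose_add (n := m + 1) (k := l + 1)
    linarith
  push_cast
  -- `hch` is `k * n.choose k = n * (n - 1).choose (k - 1)`; with the factor `n` in `hB` this
  -- produces `n²`.
  calc ((l : ℝ) + 1) * N * A = 2 * (N / 2 * ((l + 1) * A)) := by ring
    _ ≤ 2 * ((m + 1).choose (l + 1) * ((l + 1) * A)) := by gcongr
    _ = 2 * ((m + 1) * ((m.choose l : ℝ) * A)) := by
        rw [← mul_assoc ((m : ℝ) + 1), hch]; ring
    _ ≤ 2 * ((m + 1) * (4 * (m + 1) * (c * En))) := by gcongr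
    _ = 8 * c * (m + 1) ^ 2 * En := by ring

/-! ### The Poincaré inequality on the good vertices. -/

lemma sq_sub_le_edgeEnergy {n k : ℕ} {good : Vertex n → Prop} (f : Vertex n → ℝ) {x y : Vertex n}
    (h : (hypercubeGraph n k).Adj x y) (hx : good x) (hy : good y) :
    (f x - f y) ^ 2 ≤ edgeEnergy k good f := by
  have hnn : ∀ x y, 0 ≤ (if (hypercubeGraph n k).Adj x y ∧ good x ∧ good y then (f x - f y) ^ 2
      else 0) := fun x y => by split_ifs <;> positivity
  calc (f x - f y) ^ 2 = if (hypercubeGraph n k).Adj x y ∧ good x ∧ good y then (f x - f y) ^ 2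
      else 0 := by rw [if_pos ⟨h, hx, hy⟩]
    _ ≤ ∑ y, if (hypercubeGraph n k).Adj x y ∧ good x ∧ good y then (f x - f y) ^ 2 else 0 :=
        Finset.single_le_sum (f := fun y => if (hypercubeGraph n k).Adj x y ∧ good x ∧ good y then
          (f x - f y) ^ 2 else 0) (fun y _ => hnn x y) (Finset.mem_univ y)
    _ ≤ _ := Finset.single_le_sum (f := fun x => ∑ y, if (hypercubeGraph n k).Adj x y ∧ good x ∧
          good y then (f x - f y) ^ 2 else 0) (fun x _ => Finset.sum_nonneg fun y _ => hnn x y)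
          (Finset.mem_univ x)

/-- One path suffices: it has at most five edges, each bounded by the whole energy, and
Cauchy-Schwarz contributes a second factor `5`. -/
lemma Expands.sq_sub_le {n k : ℕ} {good : Vertex n → Prop} {a : ℝ} (ha : 0 < a)
    (hexp : Expands k good a) (f : Vertex n → ℝ) {x y : Vertex n} (hx : good x) (hy : good y)
    (hd : hammingDist x y ≤ 3 * k) : (f x - f y) ^ 2 ≤ 25 * edgeEnergy k good f := by
  have hE := edgeEnergy_nonneg k good f
  by_cases hxy : x = y
  · rw [hxy, sub_self]; simpa using hE
  obtain ⟨S, hSa, hS, -⟩ := hexp x y hxy hx hy hd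
  have hSn : S.Nonempty := by
    rw [← Finset.card_pos]
    exact_mod_cast lt_of_lt_of_le ha hSa
  obtain ⟨p, hp⟩ := hSn
  obtain ⟨hl, hsup⟩ := hS p hp
  have hg : ∀ j, good (p.1.getVert j) := by
    intro j
    by_cases h1 : p.1.getVert j = x
    · rw [h1]; exact hx
    by_cases h2 : p.1.getVert j = y
    · rw [h2]; exact hy
    exact hsup _ (p.1.getVert_mem_support j) h1 h2
  have hlR : (p.1.length : ℝ) ≤ 5 := by exact_mod_cast hl
  have hl0 : (0 : ℝ) ≤ p.1.length := Nat.cast_nonneg _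
  calc (f x - f y) ^ 2 ≤ p.1.length * ∑ j ∈ Finset.range p.1.length,
        (f (p.1.getVert j) - f (p.1.getVert (j + 1))) ^ 2 := sq_sub_le_of_walk p.1 f
    _ ≤ p.1.length * ∑ j ∈ Finset.range p.1.length, edgeEnergy k good f :=
        mul_le_mul_of_nonneg_left (Finset.sum_le_sum fun j hj => sq_sub_le_edgeEnergy f
          (p.1.adj_getVert_succ (Finset.mem_range.1 hj)) (hg _) (hg _)) hl0
    _ = (p.1.length * p.1.length) * edgeEnergy k good f := by
        rw [Finset.sum_const, Finset.card_range, nsmul_eq_mul, mul_assoc]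
    _ ≤ 25 * edgeEnergy k good f := mul_le_mul_of_nonneg_right (by nlinarith) hE

lemma numNeighbors_le_two_pow (n k : ℕ) : numNeighbors n k ≤ 2 ^ n := by
  rw [← card_moves]
  simpa using Finset.card_le_univ (moves n k)

/-- A crude bound, exponential in `n`, for the finitely many small cases. One good neighbour on each
side is enough; these are at distance at most `2 k + 1 ≤ 3 k`. -/
lemma sum_flip_le_of_expands {α : ℝ} (hα : 0 < α) {n k : ℕ} (hk : 1 ≤ k) (hkn : k ≤ n)
    {good : Vertex n → Prop} {f F : Vertex n → ℝ} (hexp : Expands k good (α * numNeighbors n k))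
    (hF : IsMedianField k good (α * numNeighbors n k) f F) :
    k * numNeighbors n k * ∑ v, ∑ i, (F v - F (flip {i} v)) ^ 2 ≤
      25 * 4 ^ n * n ^ 2 * edgeEnergy k good f := by
  set N : ℝ := ((numNeighbors n k : ℕ) : ℝ) with hN
  have hN0 : 0 < N := by rw [hN]; exact_mod_cast numNeighbors_pos hk hkn
  have hE := edgeEnergy_nonneg k good f
  have hpt : ∀ v i, (F v - F (flip {i} v)) ^ 2 ≤ 25 * edgeEnergy k good f := by
    intro v i
    obtain ⟨S, S', hS, hS', hc, hc', hΔ⟩ := hF.exists_sets v (flip {i} v)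
    have hpos : 0 < α * N / 2 := by positivity
    have hn1 : S.Nonempty := by
      rw [← Finset.card_pos]; exact_mod_cast lt_of_lt_of_le hpos hc
    have hn2 : S'.Nonempty := by
      rw [← Finset.card_pos]; exact_mod_cast lt_of_lt_of_le hpos hc'
    obtain ⟨x, hx⟩ := hn1
    obtain ⟨y, hy⟩ := hn2
    refine (hΔ x hx y hy).trans (hexp.sq_sub_le (by positivity) f (hS x hx).2 (hS' y hy).2 ?_)
    have h1 := (hS x hx).1.2
    have h2 := (hS' y hy).1.2
    have h3 : hammingDist v (flip {i} v) = 1 := by rw [hammingDist_flip]; simp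
    have h4 := hammingDist_triangle x v y
    have h5 := hammingDist_triangle v (flip {i} v) y
    rw [hammingDist_comm x v] at h4
    omega
  have hsum : ∑ v, ∑ i, (F v - F (flip {i} v)) ^ 2 ≤ 2 ^ n * (n * (25 * edgeEnergy k good f)) := by
    calc _ ≤ ∑ v : Vertex n, ∑ i : Fin n, 25 * edgeEnergy k good f :=
          Finset.sum_le_sum fun v _ => Finset.sum_le_sum fun i _ => hpt v i
      _ = _ := by simp
  have hNle : N ≤ 2 ^ n := by rw [hN]; exact_mod_cast numNeighbors_le_two_pow n k
  have hknR : (k : ℝ) ≤ n := by exact_mod_cast hkn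
  calc _ ≤ (n : ℝ) * 2 ^ n * (2 ^ n * (n * (25 * edgeEnergy k good f))) := by
        refine mul_le_mul (mul_le_mul hknR hNle hN0.le (Nat.cast_nonneg _)) hsum
          (Finset.sum_nonneg fun _ _ => Finset.sum_nonneg fun _ _ => sq_nonneg _) (by positivity)
    _ = 25 * (2 ^ n * 2 ^ n) * n ^ 2 * edgeEnergy k good f := by ring
    _ = _ := by rw [← mul_pow]; norm_num

/-- The increments of the median field along single flips are controlled by the increments of
`f` along the edges between good vertices. -/
lemma exists_sum_flip_le {α : ℝ} (hα : 0 < α) :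
    ∃ C : ℝ, 0 < C ∧ ∀ n k : ℕ, 1 ≤ k → k ≤ n → ∀ (good : Vertex n → Prop) (f F : Vertex n → ℝ),
      Expands k good (α * numNeighbors n k) → IsMedianField k good (α * numNeighbors n k) f F →
      k * numNeighbors n k * ∑ v, ∑ i, (F v - F (flip {i} v)) ^ 2 ≤
        C * n ^ 2 * edgeEnergy k good f := by
  obtain ⟨k₀, C₁, hC₁, h₁⟩ := exists_sum_flip_le_of_large hα
  have h₂ : ∀ k : ℕ, ∃ (n₀ : ℕ) (C : ℝ), 0 < C ∧ (1 ≤ k → ∀ n : ℕ, n₀ ≤ n →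
      ∀ (good : Vertex n → Prop) (f F : Vertex n → ℝ),
      Expands k good (α * numNeighbors n k) → IsMedianField k good (α * numNeighbors n k) f F →
      k * numNeighbors n k * ∑ v, ∑ i, (F v - F (flip {i} v)) ^ 2 ≤
        C * n ^ 2 * edgeEnergy k good f) := by
    intro k
    by_cases hk : 1 ≤ k
    · obtain ⟨n₀, C, hC, h⟩ := exists_sum_flip_le_of_fixed hα hk
      exact ⟨n₀, C, hC, fun _ => h⟩
    · exact ⟨0, 1, one_pos, fun h => absurd h hk⟩
  choose n₀ C₂ hC₂ h₂ using h₂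
  set M := ∑ k ∈ Finset.range k₀, n₀ k with hM
  set D := ∑ k ∈ Finset.range k₀, C₂ k with hD
  have hD0 : 0 ≤ D := Finset.sum_nonneg fun k _ => (hC₂ k).le
  have hM0 : (0 : ℝ) < 25 * 4 ^ M := by positivity
  refine ⟨C₁ + D + 25 * 4 ^ M, by positivity, fun n k hk hkn good f F hexp hF => ?_⟩
  have hE := edgeEnergy_nonneg k good f
  have key : ∀ c : ℝ, c ≤ C₁ + D + 25 * 4 ^ M →
      k * numNeighbors n k * ∑ v, ∑ i, (F v - F (flip {i} v)) ^ 2 ≤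
        c * n ^ 2 * edgeEnergy k good f →
      k * numNeighbors n k * ∑ v, ∑ i, (F v - F (flip {i} v)) ^ 2 ≤
        (C₁ + D + 25 * 4 ^ M) * n ^ 2 * edgeEnergy k good f := by
    intro c hc h
    exact h.trans (mul_le_mul_of_nonneg_right (mul_le_mul_of_nonneg_right hc (by positivity)) hE)
  -- `k₀` is fixed first; below it finitely many `k` remain, each with its own threshold `n₀ k ≤ M`,
  -- so the constants can be summed.
  rcases Nat.lt_or_ge k k₀ with hkk | hkk
  · rcases Nat.lt_or_ge n (n₀ k) with hnn | hnn
    · refine key (25 * 4 ^ n) ?_ (sum_flip_le_of_expands hα hk hkn hexp hF)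
      have h3 : n₀ k ≤ M := Finset.single_le_sum (f := n₀) (fun _ _ => Nat.zero_le _)
        (Finset.mem_range.2 hkk)
      have h4 : (4 : ℝ) ^ n ≤ 4 ^ M := pow_le_pow_right₀ (by norm_num) (by omega)
      linarith
    · refine key (C₂ k) ?_ (h₂ k hk n hnn good f F hexp hF)
      have h3 : C₂ k ≤ D := Finset.single_le_sum (f := C₂) (fun k _ => (hC₂ k).le)
        (Finset.mem_range.2 hkk)
      linarith
  · exact key C₁ (by linarith) (h₁ n k hkk hkn good f F hF)

/-- Poincaré inequality for the graph of good vertices. -/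
lemma exists_poincare {α : ℝ} (hα : 0 < α) :
    ∃ C : ℝ, 0 < C ∧ ∀ n k : ℕ, 1 ≤ k → k ≤ n → ∀ (good : Vertex n → Prop) (f : Vertex n → ℝ),
      Expands k good (α * numNeighbors n k) →
      (∀ v, α * numNeighbors n k ≤
        ((Finset.univ.filter fun y => (hypercubeGraph n k).Adj v y ∧ good y).card : ℝ)) →
      k * numNeighbors n k * ∑ x ∈ Finset.univ.filter good, ∑ y ∈ Finset.univ.filter good,
        (f x - f y) ^ 2 ≤ C * 2 ^ n * n ^ 2 * edgeEnergy k good f := by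
  obtain ⟨C, hC, h⟩ := exists_sum_flip_le hα
  refine ⟨12 / α + 2 * C, by positivity, fun n k hk hkn good f hexp hsm => ?_⟩
  set N : ℝ := ((numNeighbors n k : ℕ) : ℝ) with hN
  have hN0 : 0 < N := by rw [hN]; exact_mod_cast numNeighbors_pos hk hkn
  set En := edgeEnergy k good f with hEn
  have hE : 0 ≤ En := edgeEnergy_nonneg _ _ _
  have hmed := fun v => exists_median
    (Finset.univ.filter fun y => (hypercubeGraph n k).Adj v y ∧ good y) f
  choose F hF1 hF2 using hmed
  have hF : IsMedianField k good (α * N) f F := by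
    intro v
    have e := hsm v
    constructor
    · refine le_trans (by linarith) ((hF1 v).trans (le_of_eq ?_))
      rw [Finset.filter_filter]; congr 2; ext y; simp [and_assoc]
    · refine le_trans (by linarith) ((hF2 v).trans (le_of_eq ?_))
      rw [Finset.filter_filter]; congr 2; ext y; simp [and_assoc]
  have hflip := h n k hk hkn good f F hexp hF
  rw [← hN, ← hEn] at hflip
  have hES := sum_sub_sq_le_sum_flip F
  set A := ∑ v, ∑ i, (F v - F (flip {i} v)) ^ 2
  set B := ∑ x ∈ Finset.univ.filter good, (f x - F x) ^ 2 with hB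
  have hB0 : 0 ≤ B := Finset.sum_nonneg fun _ _ => sq_nonneg _
  -- At a good `x`, at least `α N / 2` of its good neighbours lie on the far side of the median `F
  -- x`, and each of those edges has an increment of at least `|f x - F x|`.
  have hloc : α * N / 2 * B ≤ En := by
    rw [hB, Finset.mul_sum, hEn, edgeEnergy, Finset.sum_filter]
    refine Finset.sum_le_sum fun x _ => ?_
    have hnn : 0 ≤ ∑ y, if (hypercubeGraph n k).Adj x y ∧ good x ∧ good y then (f x - f y) ^ 2
        else 0 := Finset.sum_nonneg fun y _ => by split_ifs <;> positivity
    split_ifs with hx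
    · have key : ∀ T : Finset (Vertex n), (∀ y ∈ T, (hypercubeGraph n k).Adj x y ∧ good y ∧
          (f x - F x) ^ 2 ≤ (f x - f y) ^ 2) → α * N / 2 ≤ (T.card : ℝ) →
          α * N / 2 * (f x - F x) ^ 2 ≤
            ∑ y, if (hypercubeGraph n k).Adj x y ∧ good x ∧ good y then (f x - f y) ^ 2
              else 0 := by
        intro T hT hc
        calc _ ≤ (T.card : ℝ) * (f x - F x) ^ 2 := mul_le_mul_of_nonneg_right hc (sq_nonneg _)
          _ = ∑ y ∈ T, (f x - F x) ^ 2 := by rw [Finset.sum_const, nsmul_eq_mul]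
          _ ≤ ∑ y ∈ T, if (hypercubeGraph n k).Adj x y ∧ good x ∧ good y then (f x - f y) ^ 2
              else 0 := Finset.sum_le_sum fun y hy => by
                rw [if_pos ⟨(hT y hy).1, hx, (hT y hy).2.1⟩]; exact (hT y hy).2.2
          _ ≤ _ := Finset.sum_le_sum_of_subset_of_nonneg (Finset.subset_univ _)
                fun y _ _ => by split_ifs <;> positivity
      rcases le_total (f x) (F x) with hle | hle
      · refine key _ (fun y hy => ?_) (hF x).2
        simp only [Finset.mem_filter] at hy
        refine ⟨hy.2.1, hy.2.2.1, ?_⟩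
        have := hy.2.2.2
        nlinarith
      · refine key _ (fun y hy => ?_) (hF x).1
        simp only [Finset.mem_filter] at hy
        refine ⟨hy.2.1, hy.2.2.1, ?_⟩
        have := hy.2.2.2
        nlinarith
    · exact hnn
  set P := Finset.univ.filter good with hP
  have hPc : (P.card : ℝ) ≤ 2 ^ n := by
    have : P.card ≤ 2 ^ n := by simpa using Finset.card_le_univ P
    exact_mod_cast this
  -- `f x - f y` is split through `F x` and `F y`; the middle part is extended to all vertices,
  -- where Efron-Stein applies.
  have htri : ∑ x ∈ P, ∑ y ∈ P, (f x - f y) ^ 2 ≤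
      6 * (2 ^ n * B) + 3 * (2 ^ n / 2 * A) := by
    calc _ ≤ ∑ x ∈ P, ∑ y ∈ P, (3 * (f x - F x) ^ 2 + 3 * (F x - F y) ^ 2 +
          3 * (f y - F y) ^ 2) := by
          refine Finset.sum_le_sum fun x _ => Finset.sum_le_sum fun y _ => ?_
          nlinarith [sq_nonneg ((f x - F x) - (F x - F y)), sq_nonneg ((f x - F x) + (f y - F y)),
            sq_nonneg ((F x - F y) + (f y - F y))]
      _ = 6 * (P.card * B) + 3 * ∑ x ∈ P, ∑ y ∈ P, (F x - F y) ^ 2 := by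
          simp only [Finset.sum_add_distrib, Finset.sum_const, nsmul_eq_mul, ← Finset.mul_sum]
          rw [hB]
          ring
      _ ≤ _ := by
          have h1 : ∑ x ∈ P, ∑ y ∈ P, (F x - F y) ^ 2 ≤ ∑ x, ∑ y, (F x - F y) ^ 2 :=
            (Finset.sum_le_sum fun x _ => Finset.sum_le_sum_of_subset_of_nonneg
              (Finset.subset_univ _) fun _ _ _ => sq_nonneg _).trans
            (Finset.sum_le_sum_of_subset_of_nonneg (Finset.subset_univ _)
              fun _ _ _ => Finset.sum_nonneg fun _ _ => sq_nonneg _)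
          have h2 := mul_le_mul_of_nonneg_right hPc hB0
          linarith
  have hkn' : (k : ℝ) ≤ (n : ℝ) ^ 2 := by
    have : k ≤ n ^ 2 := hkn.trans (Nat.le_self_pow (by norm_num) n)
    exact_mod_cast this
  have hB' : N * B ≤ 2 / α * En := by
    rw [div_mul_eq_mul_div, le_div_iff₀ hα]
    linarith
  have h2n : (0 : ℝ) < 2 ^ n := by positivity
  calc k * N * ∑ x ∈ P, ∑ y ∈ P, (f x - f y) ^ 2
      ≤ k * N * (6 * (2 ^ n * B) + 3 * (2 ^ n / 2 * A)) := by
        refine mul_le_mul_of_nonneg_left htri (by positivity)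
    _ = 2 ^ n * (6 * (k * (N * B)) + 3 / 2 * (k * N * A)) := by ring
    _ ≤ 2 ^ n * (6 * (n ^ 2 * (2 / α * En)) + 3 / 2 * (C * n ^ 2 * En)) := by
        have h1 : (k : ℝ) * (N * B) ≤ n ^ 2 * (2 / α * En) :=
          mul_le_mul hkn' hB' (by positivity) (by positivity)
        refine mul_le_mul_of_nonneg_left ?_ h2n.le
        linarith
    _ ≤ (12 / α + 2 * C) * 2 ^ n * n ^ 2 * En := by
        have h1 : 0 ≤ C * 2 ^ n * n ^ 2 * En := by positivity
        have h2 : (12 : ℝ) / α = 6 * (2 / α) := by ring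
        rw [h2]
        nlinarith

/-! ### The second eigenvalue and the Dirichlet form. -/

lemma exists_eigenbasis {ι : Type*} [Fintype ι] [DecidableEq ι] {R : Matrix ι ι ℝ}
    (hR : R.IsHermitian) (hι : 2 ≤ Fintype.card ι) :
    ∃ (u : ι → ι → ℝ) (ev : ι → ℝ) (i₀ i₁ : ι), i₀ ≠ i₁ ∧ secondEigenvalue R = ev i₁ ∧
      ev i₁ ≤ ev i₀ ∧ (∀ j, j ≠ i₀ → ev j ≤ ev i₁) ∧
      (∀ i j, u i ⬝ᵥ u j = if i = j then 1 else 0) ∧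
      (∀ v : ι → ℝ, v ⬝ᵥ v = ∑ i, (u i ⬝ᵥ v) ^ 2) ∧
      (∀ v : ι → ℝ, v ⬝ᵥ R.mulVec v = ∑ i, ev i * (u i ⬝ᵥ v) ^ 2) := by
  let e := (Fintype.equivOfCardEq (Fintype.card_fin (Fintype.card ι)) : Fin (Fintype.card ι) ≃ ι)
  have hev : ∀ j, hR.eigenvalues (e j) = hR.eigenvalues₀ j := fun j => by
    simp [Matrix.IsHermitian.eigenvalues, e]
  have hdot : ∀ a b : EuclideanSpace ℝ ι, inner ℝ a b = (a : ι → ℝ) ⬝ᵥ (b : ι → ℝ) := fun a b => by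
    simp [PiLp.inner_apply, dotProduct, mul_comm]
  have horth : ∀ i j, (hR.eigenvectorBasis i : ι → ℝ) ⬝ᵥ (hR.eigenvectorBasis j : ι → ℝ) =
      if i = j then 1 else 0 := fun i j => by
    rw [← hdot, orthonormal_iff_ite.mp hR.eigenvectorBasis.orthonormal i j]
  have hpars : ∀ v w : ι → ℝ, v ⬝ᵥ w =
      ∑ i, ((hR.eigenvectorBasis i : ι → ℝ) ⬝ᵥ v) * ((hR.eigenvectorBasis i : ι → ℝ) ⬝ᵥ w) := by
    intro v w
    have := hR.eigenvectorBasis.sum_inner_mul_inner (WithLp.toLp 2 v) (WithLp.toLp 2 w)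
    simp only [hdot] at this
    rw [← this]
    refine Finset.sum_congr rfl fun i _ => ?_
    rw [dotProduct_comm]
  refine ⟨fun i => hR.eigenvectorBasis i, hR.eigenvalues, e ⟨0, by omega⟩, e ⟨1, by omega⟩,
    ?_, ?_, ?_, ?_, horth, ?_, ?_⟩
  · intro h
    have := e.injective h
    simp at this
  · rw [hev, secondEigenvalue]
    have h := hR.sort_roots_charpoly_eq_eigenvalues₀
    simp only [RCLike.re_to_real] at h
    rw [show R.charpoly.roots = R.charpoly.roots.map (fun x => x) from (Multiset.map_id _).symm]
    have h2 : (Multiset.map (fun x : ℝ => x) R.charpoly.roots).sort (fun a b => b ≤ a) =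
      List.ofFn hR.eigenvalues₀ := h
    rw [h2]
    rw [List.getD_eq_getElem _ _ (by simp; omega)]
    simp
  · rw [hev, hev]
    exact hR.eigenvalues₀_antitone (by simp [Fin.le_def])
  · intro j hj
    obtain ⟨j, rfl⟩ := e.surjective j
    rw [hev, hev]
    refine hR.eigenvalues₀_antitone ?_
    rw [Fin.le_def]
    have : (j : ℕ) ≠ 0 := fun h => hj (congrArg e (Fin.ext h))
    simp; omega
  · intro v
    rw [hpars v v]
    exact Finset.sum_congr rfl fun i _ => (sq _).symm
  · intro v
    rw [hpars]
    refine Finset.sum_congr rfl fun i _ => ?_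
    rw [Matrix.dotProduct_mulVec, ← Matrix.mulVec_transpose,
      (Matrix.conjTranspose_eq_transpose_of_trivial R).symm.trans hR,
      hR.mulVec_eigenvectorBasis]
    simp [smul_dotProduct]
    ring

/-- Courant–Fischer for the span of a fixed vector `e` and a vector orthogonal to it. -/
lemma dotProduct_mulVec_le {ι : Type*} [Fintype ι] [DecidableEq ι] {R : Matrix ι ι ℝ}
    (hR : R.IsHermitian) (hι : 2 ≤ Fintype.card ι) {e w : ι → ℝ} (he : e ⬝ᵥ e = 1)
    (hRe : R.mulVec e = e) (hew : e ⬝ᵥ w = 0) (hle : w ⬝ᵥ R.mulVec w ≤ w ⬝ᵥ w) :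
    w ⬝ᵥ R.mulVec w ≤ secondEigenvalue R * (w ⬝ᵥ w) := by
  obtain ⟨u, ev, i₀, i₁, hi, hsec, -, hmax, horth, hnorm, hquad⟩ := exists_eigenbasis hR hι
  rw [hsec]
  have key : ∀ v : ι → ℝ, u i₀ ⬝ᵥ v = 0 → v ⬝ᵥ R.mulVec v ≤ ev i₁ * (v ⬝ᵥ v) := by
    intro v hv
    rw [hquad, hnorm, Finset.mul_sum]
    refine Finset.sum_le_sum fun i _ => ?_
    by_cases h : i = i₀
    · rw [h, hv]; simp
    · exact mul_le_mul_of_nonneg_right (hmax i h) (sq_nonneg _)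
  by_cases h0 : u i₀ ⬝ᵥ w = 0
  · exact key w h0
  set a := u i₀ ⬝ᵥ w with ha
  set b := u i₀ ⬝ᵥ e with hb
  -- This combination is orthogonal to the top eigenvector. Its cross terms vanish, since `e` is a
  -- fixed vector of the symmetric matrix `R` and is orthogonal to `w`.
  have h1 := key (a • e - b • w) (by
    rw [dotProduct_sub, dotProduct_smul, dotProduct_smul, ← ha, ← hb]; simp [mul_comm])
  have hwe : w ⬝ᵥ e = 0 := by rw [dotProduct_comm]; exact hew
  have heR : e ⬝ᵥ R.mulVec w = 0 := by
    rw [Matrix.dotProduct_mulVec, ← Matrix.mulVec_transpose,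
      (Matrix.conjTranspose_eq_transpose_of_trivial R).symm.trans hR,
      hRe, hew]
  have hw0 : 0 ≤ w ⬝ᵥ w := Finset.sum_nonneg fun i _ => mul_self_nonneg _
  simp only [Matrix.mulVec_sub, Matrix.mulVec_smul, hRe, sub_dotProduct, dotProduct_sub,
    smul_dotProduct, dotProduct_smul, smul_eq_mul, he, hwe, hew, heR] at h1
  ring_nf at h1 
  have ha2 : 0 < a ^ 2 := by positivity
  set q := w ⬝ᵥ R.mulVec w
  set s := w ⬝ᵥ w
  have h2 : a ^ 2 + b ^ 2 * q ≤ ev i₁ * (a ^ 2 + b ^ 2 * s) := by linarith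
  -- The inequality `h2` is multiplied by `s`, and `a ^ 2 * s` is lowered to `a ^ 2 * q` by `hle`.
  have h3 : a ^ 2 * q + b ^ 2 * s * q ≤ ev i₁ * s * (a ^ 2 + b ^ 2 * s) := by
    have := mul_le_mul_of_nonneg_right h2 hw0
    nlinarith
  have h4 : 0 < a ^ 2 + b ^ 2 * s := by positivity
  refine le_of_mul_le_mul_right ?_ h4
  linarith

/-- The span of the first two eigenvectors contains a nonzero vector orthogonal to `e`, and its
Rayleigh quotient is at least the second eigenvalue. -/
lemma secondEigenvalue_le {ι : Type*} [Fintype ι] [DecidableEq ι] {R : Matrix ι ι ℝ}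
    (hR : R.IsHermitian) (hι : 2 ≤ Fintype.card ι) {e : ι → ℝ} {c : ℝ}
    (h : ∀ w : ι → ℝ, e ⬝ᵥ w = 0 → w ⬝ᵥ R.mulVec w ≤ c * (w ⬝ᵥ w)) :
    secondEigenvalue R ≤ c := by
  obtain ⟨u, ev, i₀, i₁, hi, hsec, hle, -, horth, hnorm, hquad⟩ := exists_eigenbasis hR hι
  rw [hsec]
  have hcomb : ∀ a b : ℝ, e ⬝ᵥ (a • u i₀ + b • u i₁) = 0 → 0 < a ^ 2 + b ^ 2 → ev i₁ ≤ c := by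
    intro a b hab hpos
    have h1 := h _ hab
    have hco : ∀ i, u i ⬝ᵥ (a • u i₀ + b • u i₁) =
        (if i = i₀ then a else 0) + if i = i₁ then b else 0 := by
      intro i
      simp [dotProduct_add, dotProduct_smul, horth]
    have hsq : ∀ i, ((if i = i₀ then a else 0) + if i = i₁ then b else 0) ^ 2 =
        (if i = i₀ then a ^ 2 else 0) + if i = i₁ then b ^ 2 else 0 := by
      intro i
      by_cases h0 : i = i₀
      · subst h0; simp [hi]
      · simp [h0]
    rw [hquad, hnorm] at h1
    simp only [hco, hsq, mul_add, Finset.sum_add_distrib, mul_ite, mul_zero,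
      Finset.sum_ite_eq', Finset.mem_univ, if_true] at h1
    refine le_of_mul_le_mul_right ?_ hpos
    nlinarith [mul_le_mul_of_nonneg_right hle (sq_nonneg a)]
  by_cases h0 : e ⬝ᵥ u i₁ = 0
  · exact hcomb 0 1 (by simp [h0]) (by norm_num)
  · refine hcomb (e ⬝ᵥ u i₁) (-(e ⬝ᵥ u i₀)) ?_ (by positivity)
    simp [dotProduct_add, dotProduct_smul, mul_comm]

/-- Where `s` has no zeros the matrices are conjugate by its diagonal matrix. To allow zeros, the
determinants are compared permutation by permutation: on the points moved by `σ`, the products of `s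
(σ x)` and of `s x` agree. -/
lemma charpoly_eq_of_weights {ι : Type*} [Fintype ι] [DecidableEq ι] {P R : Matrix ι ι ℝ}
    (g : ι → ι → ℝ) (s : ι → ℝ) (hd : ∀ x, P x x = R x x)
    (hP : ∀ x y, x ≠ y → P x y = g x y * (s y * s y))
    (hR : ∀ x y, x ≠ y → R x y = g x y * (s x * s y)) : P.charpoly = R.charpoly := by
  rw [Matrix.charpoly, Matrix.charpoly, Matrix.det_apply, Matrix.det_apply]
  refine Finset.sum_congr rfl fun σ _ => ?_
  congr 1
  rw [← Finset.prod_filter_mul_prod_filter_not Finset.univ (fun x => σ x = x),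
    ← Finset.prod_filter_mul_prod_filter_not Finset.univ (fun x => σ x = x)
      (fun i => R.charmatrix (σ i) i)]
  congr 1
  · refine Finset.prod_congr rfl fun x hx => ?_
    rw [(Finset.mem_filter.mp hx).2, Matrix.charmatrix_apply_eq, Matrix.charmatrix_apply_eq, hd]
  · have h1 : ∀ Q : Matrix ι ι ℝ, ∀ t : ι → ι → ℝ,
        (∀ x y, x ≠ y → Q x y = g x y * (t x y * s y)) →
        ∏ x ∈ Finset.univ.filter (fun x => ¬ σ x = x), Q.charmatrix (σ x) x =
          (∏ x ∈ Finset.univ.filter (fun x => ¬ σ x = x), -Polynomial.C (g (σ x) x * s x)) *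
            ∏ x ∈ Finset.univ.filter (fun x => ¬ σ x = x), Polynomial.C (t (σ x) x) := by
      intro Q t hQ
      rw [← Finset.prod_mul_distrib]
      refine Finset.prod_congr rfl fun x hx => ?_
      have hx' := (Finset.mem_filter.mp hx).2
      rw [Matrix.charmatrix_apply_ne _ _ _ hx', hQ _ _ hx', neg_mul, ← Polynomial.C_mul]
      congr 2; ring
    rw [h1 P (fun _ y => s y) hP, h1 R (fun x _ => s x) hR]
    congr 1
    refine (Finset.prod_equiv σ (fun i => ?_) fun i _ => rfl).symm
    simp

/-- The symmetrization of the transition matrix. -/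
def symmetrized {n : ℕ} (k : ℕ) (π : Vertex n → ℝ) : Matrix (Vertex n) (Vertex n) ℝ :=
  Matrix.of fun x y =>
    if x = y then 1 - ∑ z ∈ Finset.univ.erase x, moveProb k π x z
    else if (hypercubeGraph n k).Adj x y then
      1 / (numNeighbors n k : ℝ) * (√(π x) * √(π y) / (π x + π y)) else 0

/-- The Dirichlet form of the chain, in the coordinates of the symmetrized matrix. -/
def dirichlet {n : ℕ} (k : ℕ) (π w : Vertex n → ℝ) : ℝ :=
  1 / (2 * (numNeighbors n k : ℝ)) * ∑ x, ∑ y, if (hypercubeGraph n k).Adj x y then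
    (√(π y) * w x - √(π x) * w y) ^ 2 / (π x + π y) else 0

lemma dirichlet_nonneg {n : ℕ} (k : ℕ) {π : Vertex n → ℝ} (hπ : ∀ x, 0 ≤ π x) (w : Vertex n → ℝ) :
    0 ≤ dirichlet k π w := by
  refine mul_nonneg (by positivity) (Finset.sum_nonneg fun x _ => Finset.sum_nonneg fun y _ => ?_)
  have := hπ x
  have := hπ y
  split_ifs <;> positivity

lemma isHermitian_symmetrized {n : ℕ} (k : ℕ) (π : Vertex n → ℝ) :
    (symmetrized k π).IsHermitian := by
  ext x y
  simp only [Matrix.conjTranspose_apply, symmetrized, Matrix.of_apply, star_trivial]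
  by_cases h : x = y
  · subst h; rfl
  · rw [if_neg h, if_neg (Ne.symm h), SimpleGraph.adj_comm, mul_comm (√(π y)), add_comm (π y)]

lemma secondEigenvalue_transitionMatrix {n : ℕ} (k : ℕ) {π : Vertex n → ℝ} (hπ : ∀ x, 0 ≤ π x) :
    secondEigenvalue (transitionMatrix k π) = secondEigenvalue (symmetrized k π) := by
  have : (transitionMatrix k π).charpoly = (symmetrized k π).charpoly := by
    refine charpoly_eq_of_weights (fun x y => if (hypercubeGraph n k).Adj x y then
      1 / (numNeighbors n k : ℝ) / (π x + π y) else 0) (fun x => √(π x)) ?_ ?_ ?_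
    · intro x; simp [transitionMatrix, symmetrized]
    · intro x y h
      simp only [transitionMatrix, Matrix.of_apply, if_neg h, moveProb, Real.mul_self_sqrt (hπ y)]
      split_ifs
      · ring
      · ring
    · intro x y h
      simp only [symmetrized, Matrix.of_apply, if_neg h]
      split_ifs
      · ring
      · ring
  rw [secondEigenvalue, secondEigenvalue, this]

lemma symmetrized_mulVec {n : ℕ} (k : ℕ) (π w : Vertex n → ℝ) (x : Vertex n) :
    (symmetrized k π).mulVec w x = w x - ∑ y, if (hypercubeGraph n k).Adj x y then
      1 / (numNeighbors n k : ℝ) * ((π y * w x - √(π x) * √(π y) * w y) / (π x + π y)) else 0 := by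
  have h1 : ∀ y, symmetrized k π x y * w y = (if x = y then w x else 0) -
      (if x = y then (∑ z, moveProb k π x z) * w x else 0) +
      (if (hypercubeGraph n k).Adj x y then
      1 / (numNeighbors n k : ℝ) * (√(π x) * √(π y) * w y / (π x + π y)) else 0) := by
    intro y
    simp only [symmetrized, Matrix.of_apply]
    by_cases h : x = y
    · subst h
      have e : moveProb k π x x = 0 := by simp [moveProb]
      rw [← Finset.add_sum_erase Finset.univ (fun z => moveProb k π x z) (Finset.mem_univ x)]
      simp [e]
      ring
    · simp only [if_neg h]
      split_ifs <;> ring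
  simp only [Matrix.mulVec, dotProduct, h1, Finset.sum_add_distrib, Finset.sum_sub_distrib,
    Finset.sum_ite_eq, Finset.mem_univ, if_true]
  rw [Finset.sum_mul, sub_add, ← Finset.sum_sub_distrib]
  congr 1
  refine Finset.sum_congr rfl fun y _ => ?_
  simp only [moveProb]
  split_ifs <;> ring

lemma symmetrized_mulVec_sqrt {n : ℕ} (k : ℕ) {π : Vertex n → ℝ} (hπ : ∀ x, 0 ≤ π x) :
    (symmetrized k π).mulVec (fun x => √(π x)) = fun x => √(π x) := by
  ext x
  rw [symmetrized_mulVec, Finset.sum_eq_zero, sub_zero]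
  intro y _
  rw [mul_assoc, Real.mul_self_sqrt (hπ y), mul_comm (√(π x))]
  simp

/-- The form of the identity minus the matrix is `∑ T x y`; averaging it with `∑ T y x` completes
the squares. -/
lemma dotProduct_symmetrized {n : ℕ} (k : ℕ) {π : Vertex n → ℝ} (hπ : ∀ x, 0 ≤ π x)
    (w : Vertex n → ℝ) :
    w ⬝ᵥ (symmetrized k π).mulVec w = w ⬝ᵥ w - dirichlet k π w := by
  let T : Vertex n → Vertex n → ℝ := fun x y => if (hypercubeGraph n k).Adj x y then
      1 / (numNeighbors n k : ℝ) *
        ((π y * w x ^ 2 - √(π x) * √(π y) * w y * w x) / (π x + π y)) else 0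
  have h1 : w ⬝ᵥ (symmetrized k π).mulVec w = w ⬝ᵥ w - ∑ x, ∑ y, T x y := by
    simp only [dotProduct, symmetrized_mulVec, mul_sub, Finset.sum_sub_distrib, Finset.mul_sum]
    congr 1
    refine Finset.sum_congr rfl fun x _ => Finset.sum_congr rfl fun y _ => ?_
    simp only [T]
    split_ifs <;> ring
  have h2 : ∑ x, ∑ y, T x y = ∑ x, ∑ y, T y x := Finset.sum_comm
  have h3 : dirichlet k π w = 1 / 2 * ∑ x, ∑ y, (T x y + T y x) := by
    rw [dirichlet, Finset.mul_sum, Finset.mul_sum]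
    refine Finset.sum_congr rfl fun x _ => ?_
    rw [Finset.mul_sum, Finset.mul_sum]
    refine Finset.sum_congr rfl fun y _ => ?_
    simp only [T, (hypercubeGraph n k).adj_comm y x, add_comm (π y) (π x)]
    split_ifs
    · have e : (√(π y) * w x - √(π x) * w y) ^ 2 =
          π y * w x ^ 2 + π x * w y ^ 2 - 2 * √(π x) * √(π y) * w y * w x := by
        have h1 := Real.sq_sqrt (hπ x)
        have h2 := Real.sq_sqrt (hπ y)
        linear_combination (w x) ^ 2 * h2 + (w y) ^ 2 * h1
      rw [e]
      ring
    · simp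
  rw [h1, h3]
  simp only [Finset.sum_add_distrib, ← h2]
  ring

lemma two_le_card_vertex {n : ℕ} (hn : 1 ≤ n) : 2 ≤ Fintype.card (Vertex n) := by
  simp
  calc 2 = 2 ^ 1 := rfl
    _ ≤ 2 ^ n := Nat.pow_le_pow_right (by norm_num) hn

/-- `√π` is a unit fixed vector of the symmetrized matrix. This direction serves the bias bound. -/
lemma gap_mul_le_dirichlet {n : ℕ} (k : ℕ) (hn : 1 ≤ n) {π : Vertex n → ℝ} (hπ : ∀ x, 0 ≤ π x)
    (h1 : ∑ x, π x = 1) {w : Vertex n → ℝ} (hw : ∑ x, √(π x) * w x = 0) :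
    (1 - secondEigenvalue (transitionMatrix k π)) * ∑ x, w x ^ 2 ≤ dirichlet k π w := by
  have he : (fun x => √(π x)) ⬝ᵥ (fun x => √(π x)) = 1 := by
    simp only [dotProduct, Real.mul_self_sqrt (hπ _), h1]
  have h := dotProduct_mulVec_le (isHermitian_symmetrized k π) (two_le_card_vertex hn) he
    (symmetrized_mulVec_sqrt k hπ) (w := w) hw (by
      rw [dotProduct_symmetrized k hπ]
      linarith [dirichlet_nonneg k hπ w])
  rw [dotProduct_symmetrized k hπ, ← secondEigenvalue_transitionMatrix k hπ] at h
  have : w ⬝ᵥ w = ∑ x, w x ^ 2 := Finset.sum_congr rfl fun x _ => (sq _).symm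
  rw [this] at h
  linarith

/-- The converse direction, which turns a Poincaré inequality into a bound on the mixing time. -/
lemma secondEigenvalue_transitionMatrix_le {n : ℕ} (k : ℕ) (hn : 1 ≤ n) {π : Vertex n → ℝ}
    (hπ : ∀ x, 0 ≤ π x) {γ : ℝ}
    (h : ∀ w : Vertex n → ℝ, ∑ x, √(π x) * w x = 0 → γ * ∑ x, w x ^ 2 ≤ dirichlet k π w) :
    secondEigenvalue (transitionMatrix k π) ≤ 1 - γ := by
  rw [secondEigenvalue_transitionMatrix k hπ]
  refine secondEigenvalue_le (isHermitian_symmetrized k π) (two_le_card_vertex hn)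
    (e := fun x => √(π x)) fun w hw => ?_
  rw [dotProduct_symmetrized k hπ]
  have : w ⬝ᵥ w = ∑ x, w x ^ 2 := Finset.sum_congr rfl fun x _ => (sq _).symm
  rw [this]
  linarith [h w hw]

/-! ### From the Poincaré inequality to the mixing time. -/

lemma card_adj {n k : ℕ} (x : Vertex n) :
    (Finset.univ.filter fun y => (hypercubeGraph n k).Adj x y).card = numNeighbors n k := by
  have := card_filter_adj (k := k) x (fun _ => True)
  simpa [card_moves] using this

/-- If every vertex has at least `a` good neighbours, then the set of good vertices is large. -/
lemma mul_two_pow_le_card_good {n k : ℕ} {good : Vertex n → Prop} {a : ℝ}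
    (h : ∀ v, a ≤
      ((Finset.univ.filter fun y => (hypercubeGraph n k).Adj v y ∧ good y).card : ℝ)) :
    a * 2 ^ n ≤ numNeighbors n k * ((Finset.univ.filter good).card : ℝ) := by
  have h1 : ∑ v : Vertex n, a ≤ ∑ v : Vertex n,
      ((Finset.univ.filter fun y => (hypercubeGraph n k).Adj v y ∧ good y).card : ℝ) :=
    Finset.sum_le_sum fun v _ => h v
  have h2 : ∑ v : Vertex n,
      ((Finset.univ.filter fun y => (hypercubeGraph n k).Adj v y ∧ good y).card : ℝ) =
      ∑ y ∈ Finset.univ.filter good,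
        ((Finset.univ.filter fun v => (hypercubeGraph n k).Adj y v).card : ℝ) := by
    simp only [Finset.card_filter, Nat.cast_sum]
    rw [Finset.sum_comm, Finset.sum_filter]
    refine Finset.sum_congr rfl fun y _ => ?_
    split_ifs with hy
    · exact Finset.sum_congr rfl fun v _ => by simp [hy, SimpleGraph.adj_comm]
    · simp [hy]
  rw [h2] at h1
  simp only [card_adj, Finset.sum_const, nsmul_eq_mul] at h1
  simp at h1
  linarith

/-- Comparison of the norm of a vector orthogonal to `√π` with the energy on good vertices. -/
lemma norm_le_dirichlet_add {n k : ℕ} {π w f : Vertex n → ℝ} {good : Vertex n → Prop}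
    {a m : ℝ} (hπ : ∀ x, 0 ≤ π x) (hm : ∀ x, π x ≤ m) (ha : 0 ≤ a)
    (h : ∀ v, a ≤
      ((Finset.univ.filter fun y => (hypercubeGraph n k).Adj v y ∧ good y).card : ℝ))
    (hw : ∑ x, √(π x) * w x = 0) :
    a * ((Finset.univ.filter good).card * ∑ x, w x ^ 2) ≤
      2 * (Finset.univ.filter good).card * (∑ x, ∑ y, if (hypercubeGraph n k).Adj x y ∧ good y then
        (w x - √(π x) * f y) ^ 2 else 0) +
      2 * m * numNeighbors n k * ∑ y ∈ Finset.univ.filter good, ∑ g ∈ Finset.univ.filter good,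
        (f y - f g) ^ 2 := by
  set G := Finset.univ.filter good with hG
  -- By orthogonality, subtracting a multiple of `√π` cannot shorten `w`. It is applied with `c = f
  -- g` for every good `g`, and the results are summed.
  have h1 : ∀ c : ℝ, ∑ x, w x ^ 2 ≤ ∑ x, (w x - √(π x) * c) ^ 2 := by
    intro c
    have e : ∑ x, (w x - √(π x) * c) ^ 2 = ∑ x, w x ^ 2 - 2 * c * ∑ x, √(π x) * w x +
        ∑ x, (√(π x) * c) ^ 2 := by
      rw [Finset.mul_sum, ← Finset.sum_sub_distrib, ← Finset.sum_add_distrib]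
      exact Finset.sum_congr rfl fun x _ => by ring
    rw [e, hw]
    have : 0 ≤ ∑ x, (√(π x) * c) ^ 2 := Finset.sum_nonneg fun x _ => sq_nonneg _
    linarith
  have h2 : ∀ x g, a * (w x - √(π x) * f g) ^ 2 ≤
      ∑ y, if (hypercubeGraph n k).Adj x y ∧ good y then
        2 * (w x - √(π x) * f y) ^ 2 + 2 * m * (f y - f g) ^ 2 else 0 := by
    intro x g
    rw [← Finset.sum_filter]
    calc _ ≤ ((Finset.univ.filter fun y => (hypercubeGraph n k).Adj x y ∧ good y).card : ℝ) *
          (w x - √(π x) * f g) ^ 2 := mul_le_mul_of_nonneg_right (h x) (sq_nonneg _)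
      _ = ∑ y ∈ Finset.univ.filter fun y => (hypercubeGraph n k).Adj x y ∧ good y,
          (w x - √(π x) * f g) ^ 2 := by rw [Finset.sum_const, nsmul_eq_mul]
      _ ≤ _ := by
        refine Finset.sum_le_sum fun y _ => ?_
        have e1 := Real.sq_sqrt (hπ x)
        have e2 : (w x - √(π x) * f g) ^ 2 ≤
            2 * (w x - √(π x) * f y) ^ 2 + 2 * (√(π x) * (f y - f g)) ^ 2 := by
          nlinarith [sq_nonneg ((w x - √(π x) * f y) - √(π x) * (f y - f g))]
        have e3 : (√(π x) * (f y - f g)) ^ 2 ≤ m * (f y - f g) ^ 2 := by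
          rw [mul_pow, e1]
          exact mul_le_mul_of_nonneg_right (hm x) (sq_nonneg _)
        linarith
  have h3 : a * (G.card * ∑ x, w x ^ 2) ≤ ∑ x, ∑ g ∈ G,
      ∑ y, if (hypercubeGraph n k).Adj x y ∧ good y then
        2 * (w x - √(π x) * f y) ^ 2 + 2 * m * (f y - f g) ^ 2 else 0 := by
    calc _ ≤ a * ∑ g ∈ G, ∑ x, (w x - √(π x) * f g) ^ 2 := by
          refine mul_le_mul_of_nonneg_left ?_ ha
          rw [← nsmul_eq_mul, ← Finset.sum_const]
          exact Finset.sum_le_sum fun g _ => h1 (f g)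
      _ = ∑ x, ∑ g ∈ G, a * (w x - √(π x) * f g) ^ 2 := by
          rw [Finset.sum_comm, Finset.mul_sum]
          simp only [Finset.mul_sum]
      _ ≤ _ := Finset.sum_le_sum fun x _ => Finset.sum_le_sum fun g _ => h2 x g
  refine h3.trans (le_of_eq ?_)
  have h4 : ∀ x, ∑ g ∈ G, ∑ y, (if (hypercubeGraph n k).Adj x y ∧ good y then
        2 * (w x - √(π x) * f y) ^ 2 + 2 * m * (f y - f g) ^ 2 else 0) =
      2 * G.card * (∑ y, if (hypercubeGraph n k).Adj x y ∧ good y then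
        (w x - √(π x) * f y) ^ 2 else 0) +
      2 * m * ∑ y ∈ G, if (hypercubeGraph n k).Adj y x then ∑ g ∈ G, (f y - f g) ^ 2 else 0 := by
    intro x
    rw [Finset.sum_comm, hG, Finset.sum_filter _ (fun y => if (hypercubeGraph n k).Adj y x
      then _ else _), ← hG, Finset.mul_sum, Finset.mul_sum, ← Finset.sum_add_distrib]
    refine Finset.sum_congr rfl fun y _ => ?_
    rw [(hypercubeGraph n k).adj_comm y x]
    by_cases hxy : (hypercubeGraph n k).Adj x y <;> by_cases hy : good y <;>
      simp [hxy, hy, Finset.sum_add_distrib, Finset.mul_sum]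
    ring_nf
  rw [Finset.sum_congr rfl fun x _ => h4 x, Finset.sum_add_distrib, ← Finset.mul_sum,
    ← Finset.mul_sum, Finset.sum_comm (s := Finset.univ) (t := G)]
  congr 1
  rw [mul_assoc (2 * m)]
  congr 1
  rw [Finset.mul_sum]
  refine Finset.sum_congr rfl fun y _ => ?_
  rw [← Finset.sum_filter, Finset.sum_const, card_adj, nsmul_eq_mul]

/-- On the good vertices the Dirichlet form dominates the unweighted energies. -/
lemma sum_good_le_dirichlet {n k : ℕ} {π w f : Vertex n → ℝ} {good : Vertex n → Prop}
    {l m : ℝ} (hk : 1 ≤ k) (hkn : k ≤ n) (hl : 0 < l) (hπ : ∀ x, 0 ≤ π x) (hm : ∀ x, π x ≤ m)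
    (hgood : ∀ x, good x → l ≤ π x) (hf : ∀ x, good x → w x = √(π x) * f x) :
    (∑ x, ∑ y, if (hypercubeGraph n k).Adj x y ∧ good y then
        (w x - √(π x) * f y) ^ 2 else 0) ≤
      (m + l) / l * (2 * numNeighbors n k * dirichlet k π w) := by
  have hN : (0 : ℝ) < numNeighbors n k := by exact_mod_cast numNeighbors_pos hk hkn
  have e : 2 * numNeighbors n k * dirichlet k π w =
      ∑ x, ∑ y, if (hypercubeGraph n k).Adj x y then
    (√(π y) * w x - √(π x) * w y) ^ 2 / (π x + π y) else 0 := by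
    rw [dirichlet, ← mul_assoc]
    rw [mul_one_div_cancel (by positivity), one_mul]
  rw [e, Finset.mul_sum]
  refine Finset.sum_le_sum fun x _ => ?_
  rw [Finset.mul_sum]
  refine Finset.sum_le_sum fun y _ => ?_
  have hx := hπ x
  have hy := hπ y
  have hmx := hm x
  by_cases hxy : (hypercubeGraph n k).Adj x y
  · by_cases hgy : good y
    · rw [if_pos ⟨hxy, hgy⟩, if_pos hxy, hf y hgy]
      have hly := hgood y hgy
      have e2 : (√(π y) * w x - √(π x) * (√(π y) * f y)) ^ 2 =
          π y * (w x - √(π x) * f y) ^ 2 := by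
        have := Real.sq_sqrt hy
        linear_combination (w x - √(π x) * f y) ^ 2 * this
      have hy0 : 0 < π y := hl.trans_le hly
      rw [e2, div_mul_div_comm, le_div_iff₀ (by positivity)]
      -- With `π x ≤ m` and `l ≤ π y`, the ratio `π y / (π x + π y)` is at least `l / (m + l)`; `x`
      -- itself need not be good.
      have h3 : l * (π x + π y) ≤ (m + l) * π y := by nlinarith
      nlinarith [mul_le_mul_of_nonneg_right h3 (sq_nonneg (w x - √(π x) * f y))]
    · rw [if_neg (by tauto), if_pos hxy]
      have : 0 ≤ m := hx.trans hmx
      positivity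
  · simp [hxy]

/-- If `x` is good too, the increment on the right is `√(π x) * (f x - f y)`. -/
lemma mul_edgeEnergy_le {n k : ℕ} {π w f : Vertex n → ℝ} {good : Vertex n → Prop}
    {l : ℝ} (hπ : ∀ x, 0 ≤ π x)
    (hgood : ∀ x, good x → l ≤ π x) (hf : ∀ x, good x → w x = √(π x) * f x) :
    l * edgeEnergy k good f ≤ ∑ x, ∑ y, if (hypercubeGraph n k).Adj x y ∧ good y then
        (w x - √(π x) * f y) ^ 2 else 0 := by
  rw [edgeEnergy, Finset.mul_sum]
  refine Finset.sum_le_sum fun x _ => ?_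
  rw [Finset.mul_sum]
  refine Finset.sum_le_sum fun y _ => ?_
  by_cases h : (hypercubeGraph n k).Adj x y ∧ good y
  · by_cases hx : good x
    · rw [if_pos ⟨h.1, hx, h.2⟩, if_pos h, hf x hx, ← mul_sub, mul_pow, Real.sq_sqrt (hπ x)]
      exact mul_le_mul_of_nonneg_right (hgood x hx) (sq_nonneg _)
    · rw [if_neg (by tauto), if_pos h, mul_zero]
      positivity
  · rw [if_neg (by tauto), if_neg h, mul_zero]

/-- The scale `|supp π|` cancels: `π ≤ M / s` everywhere and `cl / s ≤ π` on good vertices enter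
only through the ratio `M / cl`. The upper bound in the definition of good is not needed. -/
theorem exists_mixingTime_le (cu' cu cl α : ℝ) (hcl : 0 < cl) (hα : 0 < α) :
    ∃ C : ℝ, 0 < C ∧ ∀ n k : ℕ, 1 ≤ k → k ≤ n → ∀ ψ : QVec n, ∑ x, distribution ψ x = 1 →
      HasGLEP cu' cu cl α k (distribution ψ) →
      chainLambda k ψ < 1 ∧ mixingTime k ψ ≤ C * ((n : ℝ) ^ 2 / (k : ℝ)) := by
  obtain ⟨Cp, hCp, hpoin⟩ := exists_poincare hα
  -- The maximum makes `M` positive without any assumption on the sign of `cu'`.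
  set M := max cu' cl with hM
  have hMcl : cl ≤ M := le_max_right _ _
  have hM0 : 0 < M := hcl.trans_le hMcl
  set κ := (M + cl) / cl with hκ
  have hκ0 : 0 < κ := by positivity
  refine ⟨(4 * κ + 4 * M * Cp * κ / (cl * α)) / α, by positivity, fun n k hk hkn ψ h1 hG => ?_⟩
  set π := distribution ψ with hπd
  have hπ : ∀ x, 0 ≤ π x := fun x => by rw [hπd, distribution]; positivity
  set s : ℝ := (suppCard π : ℝ) with hs
  have hs0 : 0 < s := by
    rw [hs]
    have : 0 < suppCard π := by
      refine Finset.card_pos.mpr ?_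
      by_contra hne
      rw [Finset.not_nonempty_iff_eq_empty, Finset.filter_eq_empty_iff] at hne
      have : ∑ x, π x = 0 := Finset.sum_eq_zero fun x hx => by simpa using hne hx
      linarith
    exact_mod_cast this
  set good : Vertex n → Prop := IsGood cu cl π with hgood
  have hm : ∀ x, π x ≤ M / s := fun x => (hG.weight_bound x).trans (by
    rw [← hs]; gcongr; exact le_max_left _ _)
  have hl : ∀ x, good x → cl / s ≤ π x := fun x hx => hx.1
  set N : ℝ := (numNeighbors n k : ℝ) with hN
  have hN0 : 0 < N := by rw [hN]; exact_mod_cast numNeighbors_pos hk hkn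
  have hn0 : (0 : ℝ) < n := by exact_mod_cast hk.trans hkn
  have hk0 : (0 : ℝ) < k := by exact_mod_cast hk
  have hkn' : (k : ℝ) ≤ n := by exact_mod_cast hkn
  have hn1 : (1 : ℝ) ≤ n := by exact_mod_cast hk.trans hkn
  set r : ℝ := (n : ℝ) ^ 2 / k with hr
  have hr1 : 1 ≤ r := by rw [hr, le_div_iff₀ hk0]; nlinarith
  set C := (4 * κ + 4 * M * Cp * κ / (cl * α)) / α with hC
  have hC0 : 0 < C := by positivity
  have hgap : ∀ w : Vertex n → ℝ, ∑ x, √(π x) * w x = 0 →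
      1 / (C * r) * ∑ x, w x ^ 2 ≤ dirichlet k π w := by
    intro w hw
    set f : Vertex n → ℝ := fun x => w x / √(π x) with hf
    have hfw : ∀ x, good x → w x = √(π x) * f x := by
      intro x hx
      have : 0 < √(π x) := Real.sqrt_pos.mpr (lt_of_lt_of_le (by positivity) (hl x hx))
      rw [hf]; field_simp
    have a1 := norm_le_dirichlet_add (f := f) (good := good) hπ hm (by positivity) hG.smoothness hw
    have a2 := sum_good_le_dirichlet hk hkn (by positivity) hπ hm hl hfw
    have a3 := mul_edgeEnergy_le (k := k) hπ hl hfw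
    have a4 := hpoin n k hk hkn good f hG.expansion hG.smoothness
    have a5 := mul_two_pow_le_card_good (good := good) hG.smoothness
    have hD := dirichlet_nonneg k hπ w
    set D := dirichlet k π w
    set Q := ∑ x, ∑ y, if (hypercubeGraph n k).Adj x y ∧ good y then
        (w x - √(π x) * f y) ^ 2 else 0
    set En := edgeEnergy k good f
    set V := ∑ x ∈ Finset.univ.filter good, ∑ y ∈ Finset.univ.filter good, (f x - f y) ^ 2
    set g : ℝ := ((Finset.univ.filter good).card : ℝ)
    set W := ∑ x, w x ^ 2
    have hκ' : (M / s + cl / s) / (cl / s) = κ := by rw [hκ]; field_simp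
    rw [hκ', ← hN] at a2
    rw [← hN] at a1 a4 a5
    have h2n : (0 : ℝ) < 2 ^ n := by positivity
    have a5' : α * 2 ^ n ≤ g := by
      refine le_of_mul_le_mul_left ?_ hN0
      linarith
    have hg0 : 0 < g := lt_of_lt_of_le (by positivity) a5'
    clear_value D Q En V g W
    have hEn : En ≤ s / cl * (κ * (2 * N * D)) := by
      rw [div_mul_eq_mul_div, le_div_iff₀ hcl]
      have := mul_le_mul_of_nonneg_left (a3.trans a2) hs0.le
      have e : s * (cl / s * En) = En * cl := by field_simp
      linarith
    -- The factor `2 ^ n` of the Poincaré inequality is traded for the number `g` of good vertices,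
    -- which then cancels against the left side of `a1`.
    have hV : N * V ≤ Cp * (g / α) * r * (s / cl * (κ * (2 * N * D))) := by
      have b1 : N * V ≤ Cp * 2 ^ n * r * En := by
        have e : Cp * 2 ^ n * r * En = Cp * 2 ^ n * n ^ 2 * En / k := by rw [hr]; ring
        rw [e, le_div_iff₀ hk0]
        linarith
      refine b1.trans ?_
      have b2 : (2 : ℝ) ^ n ≤ g / α := by rw [le_div_iff₀ hα]; linarith
      calc Cp * 2 ^ n * r * En ≤ Cp * 2 ^ n * r * (s / cl * (κ * (2 * N * D))) :=
            mul_le_mul_of_nonneg_left hEn (by positivity)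
        _ ≤ _ := by gcongr
    have hmain : α * N * (g * W) ≤ 2 * g * (κ * (2 * N * D)) +
        2 * (M / s) * (Cp * (g / α) * r * (s / cl * (κ * (2 * N * D)))) := by
      refine a1.trans (add_le_add (mul_le_mul_of_nonneg_left a2 (by positivity)) ?_)
      rw [mul_assoc (2 * (M / s))]
      exact mul_le_mul_of_nonneg_left hV (by positivity)
    have e1 : 2 * g * (κ * (2 * N * D)) +
        2 * (M / s) * (Cp * (g / α) * r * (s / cl * (κ * (2 * N * D)))) =
        (N * g) * ((4 * κ + 4 * M * Cp * κ / (cl * α) * r) * D) := by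
      field_simp
      ring
    rw [e1] at hmain
    have hW : α * W ≤ (4 * κ + 4 * M * Cp * κ / (cl * α) * r) * D := by
      refine le_of_mul_le_mul_left ?_ (mul_pos hN0 hg0)
      linarith
    rw [one_div_mul_eq_div, div_le_iff₀ (by positivity)]
    have e2 : D * (C * r) = (4 * κ * r + 4 * M * Cp * κ / (cl * α) * r) * D / α := by
      rw [hC]; ring
    rw [e2, le_div_iff₀ hα]
    have : 4 * κ ≤ 4 * κ * r := le_mul_of_one_le_right (by positivity) hr1
    have := mul_le_mul_of_nonneg_right this hD
    linarith
  have hlam := secondEigenvalue_transitionMatrix_le k (hk.trans hkn) hπ hgap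
  have hpos : 0 < 1 / (C * r) := by positivity
  have hlam' : 1 / (C * r) ≤ 1 - chainLambda k ψ := by rw [chainLambda]; linarith
  refine ⟨by linarith, ?_⟩
  rw [mixingTime]
  calc 1 / (1 - chainLambda k ψ) ≤ 1 / (1 / (C * r)) := one_div_le_one_div_of_le hpos hlam'
    _ = C * r := by rw [one_div_one_div]

/-! ### The mean of the local overlap. -/

/-- Two bitstrings agree off `A`. -/
def AgreeOff {n : ℕ} (A : Finset (Fin n)) (x y : Vertex n) : Prop := ∀ i, i ∉ A → x i = y i

lemma AgreeOff.refl {n : ℕ} {A : Finset (Fin n)} (x : Vertex n) : AgreeOff A x x := fun _ _ => rfl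

lemma AgreeOff.symm {n : ℕ} {A : Finset (Fin n)} {x y : Vertex n} (h : AgreeOff A x y) :
    AgreeOff A y x := fun i hi => (h i hi).symm

lemma agreeOff_comm {n : ℕ} {A : Finset (Fin n)} {x y : Vertex n} :
    AgreeOff A x y ↔ AgreeOff A y x := ⟨AgreeOff.symm, AgreeOff.symm⟩

lemma AgreeOff.trans {n : ℕ} {A : Finset (Fin n)} {x y z : Vertex n} (h : AgreeOff A x y)
    (h' : AgreeOff A y z) : AgreeOff A x z := fun i hi => (h i hi).trans (h' i hi)

lemma AgreeOff.congr_left {n : ℕ} {A : Finset (Fin n)} {x y z : Vertex n} (h : AgreeOff A x y) :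
    AgreeOff A x z ↔ AgreeOff A y z := ⟨h.symm.trans, h.trans⟩

/-- The sum of `g` over the strings that agree with `x` off `A`. -/
def blockSum {n : ℕ} {M : Type*} [AddCommMonoid M] (A : Finset (Fin n)) (g : Vertex n → M)
    (x : Vertex n) : M :=
  ∑ y, if AgreeOff A x y then g y else 0

lemma AgreeOff.blockSum_eq {n : ℕ} {M : Type*} [AddCommMonoid M] {A : Finset (Fin n)}
    {x y : Vertex n} (h : AgreeOff A x y) (g : Vertex n → M) : blockSum A g x = blockSum A g y :=
  Finset.sum_congr rfl fun z _ => by simp only [h.congr_left]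

lemma insertBits_apply {n : ℕ} {A : Finset (Fin n)} (z : Vertex n) (u : A → Bool) (i : A) :
    insertBits A z u i = u i := by simp [insertBits]

lemma agreeOff_insertBits {n : ℕ} {A : Finset (Fin n)} (z : Vertex n) (u : A → Bool) :
    AgreeOff A z (insertBits A z u) := fun i hi => by simp [insertBits, hi]

lemma sum_insertBits {n : ℕ} {M : Type*} [AddCommMonoid M] (A : Finset (Fin n)) (z : Vertex n)
    (g : Vertex n → M) : ∑ u : A → Bool, g (insertBits A z u) = blockSum A g z := by
  rw [blockSum, ← Finset.sum_filter]
  refine Finset.sum_bij (fun u _ => insertBits A z u) ?_ ?_ ?_ fun _ _ => rfl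
  · intro u _
    simpa using agreeOff_insertBits z u
  · intro u _ v _ h
    ext i
    rw [← insertBits_apply z u i, h, insertBits_apply]
  · intro y hy
    refine ⟨fun i => y i, Finset.mem_univ _, ?_⟩
    ext i
    by_cases h : i ∈ A
    · simp [insertBits, h]
    · simp [insertBits, h, (Finset.mem_filter.mp hy).2 i h]

lemma sum_pauli {M : Type*} [AddCommMonoid M] (f : Pauli → M) :
    ∑ b, f b = f Pauli.X + f Pauli.Y + f Pauli.Z := by
  have : (Finset.univ : Finset Pauli) = {Pauli.X, Pauli.Y, Pauli.Z} := rfl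
  rw [this, Finset.sum_insert (by simp), Finset.sum_insert (by simp), Finset.sum_singleton, add_assoc]

lemma ofReal_sqrt_two_mul_self : (Real.sqrt 2 : ℂ) * (Real.sqrt 2 : ℂ) = 2 := by
  rw [← Complex.ofReal_mul, Real.mul_self_sqrt (by norm_num)]; norm_num

/-- The classical shadow of a qubit is an unbiased estimator of its state. -/
lemma sum_shadowEntry (x y p q : Bool) :
    ∑ b, ∑ s, (starRingEnd ℂ) (basisVec b s x) * basisVec b s y *
      (1 / 3 * shadowEntry b s p q) = if x = p ∧ y = q then 1 else 0 := by
  have h2 := ofReal_sqrt_two_mul_self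
  have h0 : (Real.sqrt 2 : ℂ) ≠ 0 := fun h => by rw [h] at h2; norm_num at h2
  have h4 : (Real.sqrt 2 : ℂ)⁻¹ * (Real.sqrt 2 : ℂ)⁻¹ = 1 / 2 := by
    rw [← mul_inv, h2]; norm_num
  have hI2 := Complex.I_sq
  have hI4 := Complex.I_pow_four
  have hconj : (starRingEnd ℂ) (Real.sqrt 2 : ℂ)⁻¹ = (Real.sqrt 2 : ℂ)⁻¹ := by
    rw [map_inv₀, Complex.conj_ofReal]
  rw [sum_pauli]
  generalize hc : (Real.sqrt 2 : ℂ)⁻¹ = c at h4 hconj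
  have h2' : c ^ 2 = 1 / 2 := by rw [sq, h4]
  have h4' : c ^ 4 = 1 / 4 := by rw [show c ^ 4 = (c * c) * (c * c) by ring, h4]; norm_num
  cases x <;> cases y <;> cases p <;> cases q <;>
  · simp [shadowEntry, basisVec, div_eq_mul_inv, hc, hconj]
    try ring_nf
    try simp only [h2', h4', hI2, hI4]
    try norm_num

lemma conj_shadowEntry (b : Pauli) (s a a' : Bool) :
    (starRingEnd ℂ) (shadowEntry b s a a') = shadowEntry b s a' a := by
  simp only [shadowEntry, map_sub, map_mul, Complex.conj_conj, eq_comm (a := a')]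
  have : (starRingEnd ℂ) 3 = 3 := Complex.conj_ofNat 3
  rw [this]
  split_ifs <;> simp <;> ring


lemma prod_coe_eq_prod_ite {ι M : Type*} [Fintype ι] [CommMonoid M] (A : Finset ι) (f : ι → M) :
    ∏ i : A, f i = ∏ i, if i ∈ A then f i else 1 := by
  rw [Finset.prod_coe_sort A f, Finset.prod_ite_mem, Finset.univ_inter]

/-- The numerator of the local overlap, as a sum over full bitstrings. -/
def overlapNum {n : ℕ} (ψ : QVec n) (m : Round n) : ℂ :=
  ∑ p, ∑ q, if AgreeOff m.1 m.2.2 p ∧ AgreeOff m.1 m.2.2 q then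
    (starRingEnd ℂ) (ψ p) * (∏ i : m.1, shadowEntry (m.2.1 i) (m.2.2 i) (p i) (q i)) * ψ q else 0

lemma overlapNum_eq {n : ℕ} (ψ : QVec n) (m : Round n) :
    overlapNum ψ m = ∑ u : m.1 → Bool, ∑ v : m.1 → Bool,
      (starRingEnd ℂ) (ψ (insertBits m.1 m.2.2 u)) *
        (∏ i : m.1, shadowEntry (m.2.1 i) (m.2.2 i) (u i) (v i)) *
        ψ (insertBits m.1 m.2.2 v) := by
  have h : ∀ u v : m.1 → Bool, (starRingEnd ℂ) (ψ (insertBits m.1 m.2.2 u)) *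
        (∏ i : m.1, shadowEntry (m.2.1 i) (m.2.2 i) (u i) (v i)) *
        ψ (insertBits m.1 m.2.2 v) = (fun p q : Vertex n => (starRingEnd ℂ) (ψ p) *
        (∏ i : m.1, shadowEntry (m.2.1 i) (m.2.2 i) (p i) (q i)) * ψ q)
        (insertBits m.1 m.2.2 u) (insertBits m.1 m.2.2 v) := by
    intro u v
    simp only [insertBits_apply]
  simp only [h]
  rw [sum_insertBits m.1 m.2.2 (fun p => ∑ v : m.1 → Bool, (fun p q : Vertex n =>
    (starRingEnd ℂ) (ψ p) *
        (∏ i : m.1, shadowEntry (m.2.1 i) (m.2.2 i) (p i) (q i)) * ψ q)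
        p (insertBits m.1 m.2.2 v)), overlapNum, blockSum]
  refine Finset.sum_congr rfl fun p _ => ?_
  rw [sum_insertBits m.1 m.2.2 (fun q => (fun p q : Vertex n => (starRingEnd ℂ) (ψ p) *
        (∏ i : m.1, shadowEntry (m.2.1 i) (m.2.2 i) (p i) (q i)) * ψ q) p q), blockSum]
  split_ifs with hp
  · simp [hp]
  · simp [hp]

lemma localOverlap_eq {n : ℕ} (ψ : QVec n) (m : Round n) :
    localOverlap ψ m = (overlapNum ψ m).re / blockSum m.1 (distribution ψ) m.2.2 := by
  rw [localOverlap, overlapNum_eq,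
    ← sum_insertBits m.1 m.2.2 (distribution ψ)]
  rfl

lemma conj_overlapNum {n : ℕ} (ψ : QVec n) (m : Round n) :
    (starRingEnd ℂ) (overlapNum ψ m) = overlapNum ψ m := by
  rw [overlapNum, map_sum, Finset.sum_comm]
  refine Finset.sum_congr rfl fun q _ => ?_
  rw [map_sum]
  refine Finset.sum_congr rfl fun p _ => ?_
  by_cases h : AgreeOff m.1 m.2.2 p ∧ AgreeOff m.1 m.2.2 q
  · rw [if_pos h, if_pos h.symm]
    simp only [map_mul, map_prod, conj_shadowEntry, Complex.conj_conj]
    ring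
  · rw [if_neg h, if_neg (fun h' => h h'.symm), map_zero]

/-- The amplitude of the measured product vector. -/
def productVec {n : ℕ} (b : Fin n → Pauli) (s : Fin n → Bool) (x : Vertex n) : ℂ :=
  ∏ i, basisVec (b i) (s i) (x i)

/-- The contribution of one qubit to the expected overlap. -/
def qubitFactor {n : ℕ} (A : Finset (Fin n)) (x y p q : Vertex n) (i : Fin n) (b : Pauli)
    (s : Bool) : ℂ :=
  (starRingEnd ℂ) (basisVec b s (x i)) * basisVec b s (y i) *
    if i ∈ A then 1 / 3 * shadowEntry b s (p i) (q i)
    else if b = Pauli.Z ∧ s = p i ∧ s = q i then 1 else 0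

/-- On `A` this is the inversion formula of the classical shadow; off `A` the `Z` measurement reads
off the diagonal. -/
lemma sum_qubitFactor {n : ℕ} (A : Finset (Fin n)) (x y p q : Vertex n) (i : Fin n) :
    ∑ b, ∑ s, qubitFactor A x y p q i b s =
      if x i = p i ∧ y i = q i ∧ (i ∉ A → p i = q i) then 1 else 0 := by
  by_cases h : i ∈ A
  · simp only [qubitFactor, h, if_true, not_true_eq_false, false_imp_iff, and_true]
    exact sum_shadowEntry _ _ _ _
  · simp only [qubitFactor, sum_pauli, h, not_false_eq_true, true_imp_iff]
    cases x i <;> cases y i <;> cases p i <;> cases q i <;> simp [basisVec]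

lemma prod_qubitFactor {n : ℕ} (A : Finset (Fin n)) (x y p q : Vertex n) (b : Fin n → Pauli)
    (s : Fin n → Bool) :
    ∏ i, qubitFactor A x y p q i (b i) (s i) =
      (starRingEnd ℂ) (productVec b s x) * productVec b s y *
        if (∀ i, i ∉ A → b i = Pauli.Z) ∧ AgreeOff A s p ∧ AgreeOff A s q then
          (1 / 3) ^ A.card * ∏ i : A, shadowEntry (b i) (s i) (p i) (q i) else 0 := by
  simp only [qubitFactor, Finset.prod_mul_distrib, productVec, map_prod]
  congr 1
  split_ifs with h
  · obtain ⟨h1, h2, h3⟩ := h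
    rw [prod_coe_eq_prod_ite A (fun i => shadowEntry (b i) (s i) (p i) (q i)),
      show (1 / 3 : ℂ) ^ A.card = ∏ i, if i ∈ A then (1 / 3 : ℂ) else 1 by
        rw [Finset.prod_ite_mem, Finset.univ_inter, Finset.prod_const],
      ← Finset.prod_mul_distrib]
    refine Finset.prod_congr rfl fun i _ => ?_
    by_cases hi : i ∈ A
    · simp [hi]
    · simp [hi, h1 i hi, ← h2 i hi, ← h3 i hi]
  · have : ∃ i, i ∉ A ∧ ¬ (b i = Pauli.Z ∧ s i = p i ∧ s i = q i) := by
      by_contra hc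
      push Not at hc
      exact h ⟨fun i hi => (hc i hi).1, fun i hi => (hc i hi).2.1, fun i hi => (hc i hi).2.2⟩
    obtain ⟨i, hi, hne⟩ := this
    exact Finset.prod_eq_zero (Finset.mem_univ i) (by rw [if_neg hi, if_neg hne])

lemma sum_sum_prod {n : ℕ} (f : Fin n → Pauli → Bool → ℂ) :
    ∑ b : Fin n → Pauli, ∑ s : Fin n → Bool, ∏ i, f i (b i) (s i) = ∏ i, ∑ b, ∑ s, f i b s := by
  rw [Fintype.prod_sum]
  exact Finset.sum_congr rfl fun b _ => (Fintype.prod_sum _).symm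

lemma sum_prod_qubitFactor {n : ℕ} (A : Finset (Fin n)) (x y p q : Vertex n) :
    ∑ b : Fin n → Pauli, ∑ s : Fin n → Bool, ∏ i, qubitFactor A x y p q i (b i) (s i) =
      if x = p ∧ y = q ∧ AgreeOff A p q then 1 else 0 := by
  rw [sum_sum_prod]
  simp only [sum_qubitFactor]
  split_ifs with h
  · obtain ⟨rfl, rfl, h⟩ := h
    exact Finset.prod_eq_one fun i _ => if_pos ⟨rfl, rfl, h i⟩
  · have : ∃ i, ¬ (x i = p i ∧ y i = q i ∧ (i ∉ A → p i = q i)) := by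
      by_contra hc
      push Not at hc
      exact h ⟨funext fun i => (hc i).1, funext fun i => (hc i).2.1, fun i => (hc i).2.2⟩
    obtain ⟨i, hi⟩ := this
    exact Finset.prod_eq_zero (Finset.mem_univ i) (if_neg hi)

/-- The value of the overlap for the set `A`, averaged over bases and outcomes. -/
def overlapOn {n : ℕ} (A : Finset (Fin n)) (ψ : QVec n) (ρ : QOp n) : ℝ :=
  (∑ p, ∑ q, if AgreeOff A p q then
    (starRingEnd ℂ) (ψ p) * ρ p q * ψ q / ((blockSum A (distribution ψ) p : ℝ) : ℂ) else 0).re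

/-- The denominator of the overlap depends only on the bits off `A`, hence only on the block of `p`.
The remaining average over bases and outcomes factorizes over qubits and selects `x = p`, `y = q`.
-/
lemma sum_expectation_mul_localOverlap {n : ℕ} (A : Finset (Fin n)) (ψ : QVec n) (ρ : QOp n) :
    (∑ b : Fin n → Pauli, ∑ s : Fin n → Bool, if ∀ i, i ∉ A → b i = Pauli.Z then
      1 / 3 ^ A.card * expectation (productVec b s) ρ * localOverlap ψ (A, b, s) else 0) =
      overlapOn A ψ ρ := by
  let c : Vertex n × Vertex n × Vertex n × Vertex n → ℂ := fun z =>
    ρ z.1 z.2.1 * ((starRingEnd ℂ) (ψ z.2.2.1) * ψ z.2.2.2) /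
      ((blockSum A (distribution ψ) z.2.2.1 : ℝ) : ℂ)
  have h1 : ∀ b s, (if ∀ i, i ∉ A → b i = Pauli.Z then
      1 / 3 ^ A.card * expectation (productVec b s) ρ * localOverlap ψ (A, b, s) else 0) =
      (∑ z, c z * ∏ i, qubitFactor A z.1 z.2.1 z.2.2.1 z.2.2.2 i (b i) (s i)).re := by
    intro b s
    simp only [prod_qubitFactor]
    split_ifs with hZ
    · rw [localOverlap_eq, expectation]
      have him : (overlapNum ψ (A, b, s)).im = 0 :=
        Complex.conj_eq_iff_im.mp (conj_overlapNum ψ (A, b, s))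
      set S := ∑ x, ∑ y, (starRingEnd ℂ) (productVec b s x) * ρ x y * productVec b s y with hS
      set W := blockSum A (distribution ψ) s with hW
      have e : (∑ z, c z * ((starRingEnd ℂ) (productVec b s z.1) * productVec b s z.2.1 *
          if (∀ i, i ∉ A → b i = Pauli.Z) ∧ AgreeOff A s z.2.2.1 ∧ AgreeOff A s z.2.2.2 then
          (1 / 3) ^ A.card * ∏ i : A, shadowEntry (b i) (s i) (z.2.2.1 i) (z.2.2.2 i) else 0)) =
          ((1 / 3 ^ A.card / W : ℝ) : ℂ) * (S * overlapNum ψ (A, b, s)) := by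
        simp only [Fintype.sum_prod_type]
        rw [hS, Finset.sum_mul, Finset.mul_sum]
        refine Finset.sum_congr rfl fun x _ => ?_
        rw [Finset.sum_mul, Finset.mul_sum]
        refine Finset.sum_congr rfl fun y _ => ?_
        rw [overlapNum, Finset.mul_sum, Finset.mul_sum]
        refine Finset.sum_congr rfl fun p _ => ?_
        rw [Finset.mul_sum, Finset.mul_sum]
        refine Finset.sum_congr rfl fun q _ => ?_
        by_cases hp : AgreeOff A s p ∧ AgreeOff A s q
        · rw [if_pos ⟨hZ, hp⟩, if_pos hp]
          simp only [c]
          rw [← hp.1.blockSum_eq, ← hW, one_div_pow]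
          push_cast
          ring
        · rw [if_neg (by tauto), if_neg hp]
          simp
      rw [e, Complex.re_ofReal_mul, Complex.mul_re, him]
      ring
    · simp [hZ]
  simp only [h1, ← Complex.re_sum]
  rw [overlapOn]
  congr 1
  have h2 : ∀ b : Fin n → Pauli, ∑ s : Fin n → Bool, ∑ z, c z *
      ∏ i, qubitFactor A z.1 z.2.1 z.2.2.1 z.2.2.2 i (b i) (s i) =
      ∑ z, c z * ∑ s : Fin n → Bool,
        ∏ i, qubitFactor A z.1 z.2.1 z.2.2.1 z.2.2.2 i (b i) (s i) := fun b => by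
    rw [Finset.sum_comm]; simp only [Finset.mul_sum]
  simp only [h2]
  rw [Finset.sum_comm]
  simp only [← Finset.mul_sum, sum_prod_qubitFactor, Fintype.sum_prod_type, c]
  have h3 : ∀ x y p q : Vertex n, (if x = p ∧ y = q ∧ AgreeOff A p q then (1 : ℂ) else 0) =
      if p = x then (if q = y then (if AgreeOff A p q then 1 else 0) else 0) else 0 := by
    intro x y p q
    by_cases h1 : x = p
    · by_cases h2 : y = q
      · simp [h1, h2]
      · simp [h1, h2, Ne.symm h2]
    · simp [h1, Ne.symm h1]
  simp only [h3, mul_ite, mul_one, mul_zero]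
  refine Finset.sum_congr rfl fun x _ => Finset.sum_congr rfl fun y _ => ?_
  rw [Finset.sum_eq_single x (fun p _ hp => by simp [hp]) (by simp),
    Finset.sum_eq_single y (fun q _ hq => by simp [hq]) (by simp)]
  simp only [if_true]
  split_ifs
  · ring
  · rfl

lemma meanOverlap_eq {n : ℕ} (k : ℕ) (ψ : QVec n) (ρ : QOp n) :
    meanOverlap k ψ ρ = 1 / (n.choose k : ℝ) *
      ∑ A ∈ Finset.univ.powersetCard k, overlapOn A ψ ρ := by
  rw [meanOverlap, Fintype.sum_prod_type, Finset.mul_sum, ← Finset.univ_filter_card_eq,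
    Finset.sum_filter]
  refine Finset.sum_congr rfl fun A _ => ?_
  rw [Fintype.sum_prod_type]
  split_ifs with h
  · rw [← sum_expectation_mul_localOverlap, Finset.mul_sum]
    refine Finset.sum_congr rfl fun b _ => ?_
    rw [Finset.mul_sum]
    refine Finset.sum_congr rfl fun s _ => ?_
    simp only [roundProb, h, true_and]
    split_ifs
    · change 1 / (n.choose k : ℝ) * (1 / 3 ^ k) * expectation (productVec b s) ρ * _ = _
      ring
    · simp
  · exact Finset.sum_eq_zero fun b _ => Finset.sum_eq_zero fun s _ => by simp [roundProb, h]

open scoped MatrixOrder ComplexOrder Matrix.Norms.L2Operator in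
lemma exists_eq_conjTranspose_mul_self {n : ℕ} {ρ : QOp n} (hρ : ρ.PosSemidef) :
    ∃ B : QOp n, ρ = B.conjTranspose * B := by
  obtain ⟨B, hB⟩ := CStarAlgebra.nonneg_iff_eq_star_mul_self.mp hρ.nonneg
  exact ⟨B, hB⟩

/-- A positive semidefinite operator of trace one, tested against a state, is a sum of squares of
real vectors. -/
lemma IsDensity.exists_real_decomposition {n : ℕ} {ρ : QOp n} (hρ : IsDensity ρ) (ψ : QVec n) :
    ∃ w : Vertex n × Bool → Vertex n → ℝ, ∑ j, ∑ p, w j p ^ 2 = 1 ∧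
      ∀ g : Vertex n → Vertex n → ℝ,
        (∑ p, ∑ q, (starRingEnd ℂ) (ψ p) * ρ p q * ψ q * (g p q : ℂ)).re =
          ∑ j, ∑ p, ∑ q, √(distribution ψ p) * w j p * (√(distribution ψ q) * w j q) * g p q := by
  obtain ⟨B, hB⟩ := exists_eq_conjTranspose_mul_self hρ.1
  have hρe : ∀ p q, ρ p q = ∑ j, (starRingEnd ℂ) (B j p) * B j q := fun p q => by
    rw [hB, Matrix.mul_apply]; rfl
  -- The phases of `ψ` are moved into the vectors, leaving the real weights `√π`. Where `ψ p = 0` a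
  -- unit phase is still needed, so that the squared norms add up to the trace.
  let ph : Vertex n → ℂ := fun p => if ψ p = 0 then 1 else ψ p / (‖ψ p‖ : ℂ)
  let z : Vertex n → Vertex n → ℂ := fun j p => B j p * ph p
  have hsqrt : ∀ p, √(distribution ψ p) = ‖ψ p‖ := fun p => by
    rw [distribution, Real.sqrt_sq (norm_nonneg _)]
  have hph : ∀ p, ‖ph p‖ = 1 := by
    intro p
    simp only [ph]
    split_ifs with h
    · simp
    · rw [norm_div, Complex.norm_real, norm_norm, div_self (norm_ne_zero_iff.mpr h)]
  have hz : ∀ j p, B j p * ψ p = (‖ψ p‖ : ℂ) * z j p := by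
    intro j p
    simp only [z, ph]
    split_ifs with h
    · simp [h]
    · have : (‖ψ p‖ : ℂ) ≠ 0 := by simpa using h
      field_simp
  refine ⟨fun j p => if j.2 then (z j.1 p).im else (z j.1 p).re, ?_, fun g => ?_⟩
  · have htr := hρ.2
    have h1 : (ρ.trace).re = 1 := by rw [htr]; simp
    rw [← h1, Matrix.trace, Complex.re_sum, Fintype.sum_prod_type]
    simp only [Fintype.sum_bool, if_true, Matrix.diag_apply, hρe, Complex.re_sum]
    rw [Finset.sum_comm (s := Finset.univ) (t := Finset.univ) (f := fun p j =>
      ((starRingEnd ℂ) (B j p) * B j p).re)]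
    refine Finset.sum_congr rfl fun j _ => ?_
    rw [← Finset.sum_add_distrib]
    refine Finset.sum_congr rfl fun p _ => ?_
    have e1 : ((starRingEnd ℂ) (B j p) * B j p).re = Complex.normSq (B j p) := by
      rw [Complex.normSq_apply]; simp
    have e2 : Complex.normSq (z j p) = Complex.normSq (B j p) := by
      simp only [z, Complex.normSq_mul, Complex.normSq_eq_norm_sq (ph p), hph]; simp
    rw [e1, ← e2, Complex.normSq_apply]
    simp
    ring
  · have h1 : ∀ p q, (starRingEnd ℂ) (ψ p) * ρ p q * ψ q * (g p q : ℂ) =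
        ∑ j, (starRingEnd ℂ) ((‖ψ p‖ : ℂ) * z j p) * ((‖ψ q‖ : ℂ) * z j q) * (g p q : ℂ) := by
      intro p q
      rw [hρe, Finset.mul_sum, Finset.sum_mul, Finset.sum_mul]
      refine Finset.sum_congr rfl fun j _ => ?_
      rw [← hz, ← hz, map_mul]
      ring
    have h2 : ∀ j p q, ((starRingEnd ℂ) ((‖ψ p‖ : ℂ) * z j p) * ((‖ψ q‖ : ℂ) * z j q) *
        (g p q : ℂ)).re = ‖ψ p‖ * (z j p).re * (‖ψ q‖ * (z j q).re) * g p q +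
          ‖ψ p‖ * (z j p).im * (‖ψ q‖ * (z j q).im) * g p q := by
      intro j p q
      rw [Complex.re_mul_ofReal, Complex.mul_re]
      simp
      ring
    simp only [h1, Complex.re_sum, h2]
    rw [Fintype.sum_prod_type]
    simp only [Fintype.sum_bool, if_true, hsqrt]
    rw [Finset.sum_congr rfl fun p _ => Finset.sum_comm, Finset.sum_comm]
    refine Finset.sum_congr rfl fun j _ => ?_
    simp only [Finset.sum_add_distrib]
    simp
    ring

/-! ### Conditional means on blocks and the bias. -/

lemma sum_mul_blockSum {n : ℕ} (A : Finset (Fin n)) (a b : Vertex n → ℝ) :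
    ∑ p, a p * blockSum A b p = ∑ p, blockSum A a p * b p := by
  simp only [blockSum, Finset.mul_sum, Finset.sum_mul]
  rw [Finset.sum_comm]
  refine Finset.sum_congr rfl fun p _ => Finset.sum_congr rfl fun q _ => ?_
  rw [agreeOff_comm]
  split_ifs <;> simp

lemma blockSum_mul {n : ℕ} {A : Finset (Fin n)} {h : Vertex n → ℝ}
    (hh : ∀ p q, AgreeOff A p q → h p = h q) (a : Vertex n → ℝ) (p : Vertex n) :
    blockSum A (fun q => a q * h q) p = blockSum A a p * h p := by
  simp only [blockSum, Finset.sum_mul]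
  refine Finset.sum_congr rfl fun q _ => ?_
  split_ifs with hq
  · rw [hh p q hq]
  · simp

/-- The conditional mean of `w / √π` on the blocks of `A`. -/
def blockMean {n : ℕ} (A : Finset (Fin n)) (π w : Vertex n → ℝ) (p : Vertex n) : ℝ :=
  blockSum A (fun q => √(π q) * w q) p / blockSum A π p

/-- The squared norm of the projection of `w` to `√π` times functions that do not depend on the
coordinates in `A`. -/
def blockForm {n : ℕ} (A : Finset (Fin n)) (π w : Vertex n → ℝ) : ℝ :=
  ∑ p, √(π p) * w p * blockMean A π w p

lemma AgreeOff.blockMean_eq {n : ℕ} {A : Finset (Fin n)} {p q : Vertex n} (h : AgreeOff A p q)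
    (π w : Vertex n → ℝ) : blockMean A π w p = blockMean A π w q := by
  rw [blockMean, blockMean, h.blockSum_eq, h.blockSum_eq]

lemma le_blockSum {n : ℕ} (A : Finset (Fin n)) {π : Vertex n → ℝ} (hπ : ∀ x, 0 ≤ π x)
    (p : Vertex n) : π p ≤ blockSum A π p := by
  have := Finset.single_le_sum (f := fun q => if AgreeOff A p q then π q else 0) (s := Finset.univ)
    (fun q _ => by have := hπ q; split_ifs <;> simp [this]) (Finset.mem_univ p)
  simpa [AgreeOff.refl, blockSum] using this

lemma sum_mul_blockMean_sq {n : ℕ} (A : Finset (Fin n)) (π w : Vertex n → ℝ) :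
    ∑ p, π p * blockMean A π w p ^ 2 = blockForm A π w := by
  have h1 : ∀ p, π p * blockMean A π w p ^ 2 =
      (π p * (blockMean A π w p / blockSum A π p)) *
        blockSum A (fun q => √(π q) * w q) p := fun p => by
    rw [sq]; conv_lhs => rw [blockMean]
    rw [blockMean]; ring
  simp only [h1]
  rw [sum_mul_blockSum, blockForm]
  refine Finset.sum_congr rfl fun p _ => ?_
  rw [blockSum_mul (h := fun p => blockMean A π w p / blockSum A π p) (fun p q h => by
    rw [h.blockMean_eq, h.blockSum_eq])]
  by_cases h : blockSum A π p = 0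
  · simp [h, blockMean]
  · field_simp

lemma blockForm_nonneg {n : ℕ} (A : Finset (Fin n)) {π : Vertex n → ℝ} (hπ : ∀ x, 0 ≤ π x)
    (w : Vertex n → ℝ) : 0 ≤ blockForm A π w := by
  rw [← sum_mul_blockMean_sq]
  exact Finset.sum_nonneg fun p _ => mul_nonneg (hπ p) (sq_nonneg _)

/-- Splitting off the component of `w` along `√π`. -/
lemma blockForm_sub {n : ℕ} (A : Finset (Fin n)) {π : Vertex n → ℝ} (hπ : ∀ x, 0 ≤ π x)
    (h1 : ∑ x, π x = 1) (w : Vertex n → ℝ) {c : ℝ} (hc : ∑ x, √(π x) * w x = c) :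
    blockForm A π (fun x => w x - c * √(π x)) = blockForm A π w - c ^ 2 := by
  -- On a block without mass the conditional mean takes the default value of division by zero; there
  -- `√(π p) = 0`, so it does not matter.
  have hW : ∀ p, blockSum A π p = 0 → π p = 0 := fun p h =>
    le_antisymm (h ▸ le_blockSum A hπ p) (hπ p)
  have hm : ∀ p, √(π p) * blockMean A π (fun x => w x - c * √(π x)) p =
      √(π p) * (blockMean A π w p - c) := by
    intro p
    by_cases h : blockSum A π p = 0
    · simp [hW p h]
    · congr 1
      rw [blockMean, blockMean, eq_sub_iff_add_eq, div_add' _ _ _ h]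
      congr 1
      simp only [blockSum, Finset.mul_sum, ← Finset.sum_add_distrib]
      refine Finset.sum_congr rfl fun q _ => ?_
      have := Real.mul_self_sqrt (hπ q)
      split_ifs
      · linear_combination (-c) * this
      · simp
  have hmean : ∑ p, π p * blockMean A π w p = c := by
    have e : ∀ p, π p * blockMean A π w p = (π p * (1 / blockSum A π p)) *
        blockSum A (fun q => √(π q) * w q) p := fun p => by rw [blockMean]; ring
    simp only [e]
    rw [sum_mul_blockSum, ← hc]
    refine Finset.sum_congr rfl fun p _ => ?_
    rw [blockSum_mul (h := fun p => 1 / blockSum A π p) (fun p q h => by rw [h.blockSum_eq])]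
    by_cases h : blockSum A π p = 0
    · simp [hW p h]
    · field_simp
  have e : ∀ p, √(π p) * (w p - c * √(π p)) * blockMean A π (fun x => w x - c * √(π x)) p =
      √(π p) * w p * blockMean A π w p - c * (√(π p) * w p) - c * (π p * blockMean A π w p) +
        c ^ 2 * π p := by
    intro p
    have := Real.mul_self_sqrt (hπ p)
    linear_combination (w p - c * √(π p)) * hm p - c * (blockMean A π w p - c) * this
  rw [blockForm]
  simp only [e, Finset.sum_add_distrib, Finset.sum_sub_distrib, ← Finset.mul_sum, hc, hmean, h1]
  rw [← blockForm]
  ring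

/-- The energy of the moves that flip exactly the bits in `R`. -/
def moveEnergy {n : ℕ} (R : Finset (Fin n)) (π w : Vertex n → ℝ) : ℝ :=
  ∑ x, (√(π (flip R x)) * w x - √(π x) * w (flip R x)) ^ 2 / (π x + π (flip R x))

lemma agreeOff_flip {n : ℕ} {A R : Finset (Fin n)} (h : R ⊆ A) (x : Vertex n) :
    AgreeOff A x (flip R x) := fun i hi => by
  have : i ∉ R := fun h' => hi (h h')
  simp [flip, this]

/-- The block mean `m` agrees at `x` and at `flip R x`, as `R ⊆ A`. Completing the square in `m` on
each such two-point set leaves the squared norm there minus its component orthogonal to `√π`, which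
is the move energy. -/
lemma blockForm_le {n : ℕ} {A R : Finset (Fin n)} (h : R ⊆ A) {π : Vertex n → ℝ}
    (hπ : ∀ x, 0 ≤ π x) (w : Vertex n → ℝ) :
    blockForm A π w ≤ ∑ x, w x ^ 2 - 1 / 2 * moveEnergy R π w := by
  have key : ∀ x, 2 * (√(π x) * w x * blockMean A π w x +
      √(π (flip R x)) * w (flip R x) * blockMean A π w (flip R x)) -
      (π x * blockMean A π w x ^ 2 + π (flip R x) * blockMean A π w (flip R x) ^ 2) ≤
      w x ^ 2 + w (flip R x) ^ 2 -
        (√(π (flip R x)) * w x - √(π x) * w (flip R x)) ^ 2 / (π x + π (flip R x)) := by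
    intro x
    rw [← (agreeOff_flip h x).blockMean_eq]
    generalize blockMean A π w x = m
    have hx := hπ x
    have hy := hπ (flip R x)
    generalize w (flip R x) = wy
    generalize w x = wx
    generalize π (flip R x) = b at *
    generalize π x = a at *
    rcases (add_nonneg hx hy).eq_or_lt with h0 | h0
    · have ha : a = 0 := by linarith
      have hb : b = 0 := by linarith
      simp [ha, hb]
      positivity
    · have ea := Real.sq_sqrt hx
      have eb := Real.sq_sqrt hy
      rw [le_sub_iff_add_le, ← le_sub_iff_add_le', div_le_iff₀ h0]
      generalize √a = s at *
      generalize √b = t at *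
      subst ea eb
      nlinarith [sq_nonneg (s * wx + t * wy - (s ^ 2 + t ^ 2) * m)]
  have hs := Finset.sum_le_sum fun x (_ : x ∈ Finset.univ) => key x
  simp only [Finset.sum_sub_distrib, Finset.sum_add_distrib, ← Finset.mul_sum] at hs
  rw [sum_flip R (fun x => √(π x) * w x * blockMean A π w x),
    sum_flip R (fun x => π x * blockMean A π w x ^ 2), sum_flip R (fun x => w x ^ 2),
    sum_mul_blockMean_sq, ← blockForm, ← moveEnergy] at hs
  linarith

/-- The weight of the move `R` in the average over the subsets of a `k`-set. -/
def moveWeight (n k r : ℕ) : ℝ := (n.choose r : ℝ) / (numNeighbors n k * k.choose r)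

lemma sum_moveWeight {n k : ℕ} (hk : 1 ≤ k) (hkn : k ≤ n) {A : Finset (Fin n)} (hA : A.card = k) :
    ∑ R ∈ A.powerset.filter (fun R => 1 ≤ R.card), moveWeight n k R.card = 1 := by
  have hN : (numNeighbors n k : ℝ) ≠ 0 := by
    have := numNeighbors_pos hk hkn
    positivity
  rw [Finset.sum_filter, Finset.sum_powerset_apply_card
    (fun r => if 1 ≤ r then moveWeight n k r else 0), hA]
  have h : ∑ r ∈ Finset.range (k + 1), (k.choose r) • (if 1 ≤ r then moveWeight n k r else 0) =
      ∑ r ∈ Finset.Icc 1 k, (n.choose r : ℝ) / numNeighbors n k := by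
    rw [show Finset.Icc 1 k = (Finset.range (k + 1)).filter (fun r => 1 ≤ r) by
      ext r; simp; omega, Finset.sum_filter]
    refine Finset.sum_congr rfl fun r hr => ?_
    split_ifs
    · have : (k.choose r : ℝ) ≠ 0 := by
        have := Nat.choose_pos (Nat.lt_succ_iff.mp (Finset.mem_range.mp hr))
        positivity
      rw [moveWeight, nsmul_eq_mul]
      field_simp
    · simp
  rw [h, ← Finset.sum_div, div_eq_one_iff_eq hN, numNeighbors]
  push_cast
  rfl

/-- The second factor counts the `k`-sets containing a given move. After averaging over `A`, every
move has the same weight, as in the chain. -/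
lemma moveWeight_mul {n k r : ℕ} (hrk : r ≤ k) :
    moveWeight n k r * ((n - r).choose (k - r) : ℝ) = (n.choose k : ℝ) / numNeighbors n k := by
  have h : (n.choose k : ℝ) * k.choose r = n.choose r * (n - r).choose (k - r) := by
    exact_mod_cast Nat.choose_mul (n := n) hrk
  have h0 : (k.choose r : ℝ) ≠ 0 := by
    have := Nat.choose_pos hrk
    positivity
  rw [moveWeight, div_mul_eq_mul_div, ← h]
  by_cases hN : (numNeighbors n k : ℝ) = 0
  · simp [hN]
  · field_simp

lemma dirichlet_eq {n : ℕ} (k : ℕ) (π w : Vertex n → ℝ) :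
    dirichlet k π w = 1 / (2 * (numNeighbors n k : ℝ)) * ∑ R ∈ moves n k, moveEnergy R π w := by
  simp only [dirichlet, sum_adj_eq_sum_moves, moveEnergy]
  rw [Finset.sum_comm]

/-- For each `A`, the bounds from its nonempty subsets `R` are averaged with the weights
`moveWeight`; exchanging the sums over `A` and `R` reproduces the Dirichlet form exactly. -/
lemma sum_blockForm_le {n k : ℕ} (hk : 1 ≤ k) (hkn : k ≤ n) {π : Vertex n → ℝ}
    (hπ : ∀ x, 0 ≤ π x) (w : Vertex n → ℝ) :
    1 / (n.choose k : ℝ) * ∑ A ∈ Finset.univ.powersetCard k, blockForm A π w ≤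
      ∑ x, w x ^ 2 - dirichlet k π w := by
  have hC : (0 : ℝ) < n.choose k := by exact_mod_cast Nat.choose_pos hkn
  have hA : ∀ A ∈ (Finset.univ : Finset (Fin n)).powersetCard k, blockForm A π w ≤
      ∑ x, w x ^ 2 - 1 / 2 * ∑ R ∈ A.powerset.filter (fun R => 1 ≤ R.card),
        moveWeight n k R.card * moveEnergy R π w := by
    intro A hA
    have hcard := (Finset.mem_powersetCard.mp hA).2
    have h1 := sum_moveWeight hk hkn hcard
    calc blockForm A π w = ∑ R ∈ A.powerset.filter (fun R => 1 ≤ R.card),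
          moveWeight n k R.card * blockForm A π w := by rw [← Finset.sum_mul, h1, one_mul]
      _ ≤ ∑ R ∈ A.powerset.filter (fun R => 1 ≤ R.card),
          moveWeight n k R.card * (∑ x, w x ^ 2 - 1 / 2 * moveEnergy R π w) := by
          refine Finset.sum_le_sum fun R hR => mul_le_mul_of_nonneg_left ?_ ?_
          · exact blockForm_le (Finset.mem_powerset.mp (Finset.mem_filter.mp hR).1) hπ w
          · rw [moveWeight]; positivity
      _ = _ := by
          simp only [mul_sub, Finset.sum_sub_distrib]
          rw [← Finset.sum_mul, h1, one_mul, Finset.mul_sum]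
          congr 1
          exact Finset.sum_congr rfl fun R _ => by ring
  have hsum : ∑ A ∈ (Finset.univ : Finset (Fin n)).powersetCard k,
      ∑ R ∈ A.powerset.filter (fun R => 1 ≤ R.card), moveWeight n k R.card * moveEnergy R π w =
      n.choose k / numNeighbors n k * ∑ R ∈ moves n k, moveEnergy R π w := by
    have h1 : ∀ A ∈ (Finset.univ : Finset (Fin n)).powersetCard k,
        ∑ R ∈ A.powerset.filter (fun R => 1 ≤ R.card), moveWeight n k R.card * moveEnergy R π w =
        ∑ R ∈ moves n k, if R ⊆ A then moveWeight n k R.card * moveEnergy R π w else 0 := by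
      intro A hA
      rw [← Finset.sum_filter]
      refine Finset.sum_congr ?_ fun _ _ => rfl
      ext R
      simp only [Finset.mem_filter, Finset.mem_powerset, mem_moves]
      constructor
      · rintro ⟨h, h'⟩
        exact ⟨⟨h', (Finset.mem_powersetCard.mp hA).2 ▸ Finset.card_le_card h⟩, h⟩
      · rintro ⟨⟨h, -⟩, h'⟩
        exact ⟨h', h⟩
    rw [Finset.sum_congr rfl h1, Finset.sum_comm, Finset.mul_sum]
    refine Finset.sum_congr rfl fun R hR => ?_
    have hRk := ((mem_moves R).mp hR).2
    rw [← Finset.sum_filter, Finset.sum_const,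
      Finset.card_filter_powersetCard_subset R _ k (Finset.subset_univ _) hRk, nsmul_eq_mul,
      Finset.card_univ, Fintype.card_fin, ← moveWeight_mul hRk]
    ring
  have h := Finset.sum_le_sum hA
  rw [Finset.sum_sub_distrib, ← Finset.mul_sum, hsum, Finset.sum_const, Finset.card_powersetCard,
    Finset.card_univ, Fintype.card_fin, nsmul_eq_mul] at h
  rw [dirichlet_eq, one_div_mul_eq_div, div_le_iff₀ hC]
  refine h.trans (le_of_eq ?_)
  by_cases hN : (numNeighbors n k : ℝ) = 0
  · simp [hN]; ring
  · field_simp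

lemma sum_distribution {n : ℕ} (ψ : QVec n) : ∑ x, distribution ψ x = ‖ψ‖ ^ 2 := by
  rw [EuclideanSpace.norm_sq_eq]; rfl

/-- The bias of the local overlap is controlled by the spectral gap. -/
theorem bias_bounds {n k : ℕ} (hk : 1 ≤ k) (hkn : k ≤ n) {ψ : QVec n} (hψ : ‖ψ‖ = 1) {ρ : QOp n}
    (hρ : IsDensity ρ) :
    0 ≤ meanOverlap k ψ ρ - fidelity ψ ρ ∧
      meanOverlap k ψ ρ - fidelity ψ ρ ≤ chainLambda k ψ * (1 - fidelity ψ ρ) := by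
  obtain ⟨w, hw1, hw⟩ := hρ.exists_real_decomposition ψ
  set π := distribution ψ with hπd
  have hπ : ∀ x, 0 ≤ π x := fun x => by rw [hπd, distribution]; positivity
  have h1 : ∑ x, π x = 1 := by rw [hπd, sum_distribution, hψ, one_pow]
  set c : Vertex n × Bool → ℝ := fun j => ∑ x, √(π x) * w j x with hc
  have hF : fidelity ψ ρ = ∑ j, c j ^ 2 := by
    have := hw fun _ _ => 1
    simp only [Complex.ofReal_one, mul_one] at this
    rw [fidelity, expectation, this]
    refine Finset.sum_congr rfl fun j _ => ?_
    rw [sq, hc, Finset.sum_mul_sum]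
  have hL : ∀ A, overlapOn A ψ ρ = ∑ j, blockForm A π (w j) := by
    intro A
    have := hw fun p q => if AgreeOff A p q then 1 / blockSum A π p else 0
    rw [overlapOn]
    convert this using 2
    · refine Finset.sum_congr rfl fun p _ => Finset.sum_congr rfl fun q _ => ?_
      split_ifs
      · push_cast; ring
      · simp
    · rw [blockForm]
      refine Finset.sum_congr rfl fun p _ => ?_
      rw [blockMean, blockSum, Finset.sum_div, Finset.mul_sum]
      refine Finset.sum_congr rfl fun q _ => ?_
      split_ifs
      · ring
      · simp
  let v : Vertex n × Bool → Vertex n → ℝ := fun j x => w j x - c j * √(π x)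
  have hC : (0 : ℝ) < n.choose k := by exact_mod_cast Nat.choose_pos hkn
  -- The components along `√π` contribute `∑ c j ^ 2`, which is the fidelity, so only the orthogonal
  -- parts `v j` remain. They give both bounds.
  have hdiff : meanOverlap k ψ ρ - fidelity ψ ρ = ∑ j, 1 / (n.choose k : ℝ) *
      ∑ A ∈ Finset.univ.powersetCard k, blockForm A π (v j) := by
    have e : ∀ j A, blockForm A π (v j) = blockForm A π (w j) - c j ^ 2 :=
      fun j A => blockForm_sub A hπ h1 (w j) rfl
    simp only [e, Finset.sum_sub_distrib, Finset.sum_const, Finset.card_powersetCard,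
      Finset.card_univ, Fintype.card_fin, nsmul_eq_mul]
    have e2 : ∀ j, 1 / (n.choose k : ℝ) * (∑ A ∈ Finset.univ.powersetCard k, blockForm A π (w j) -
        n.choose k * c j ^ 2) = 1 / (n.choose k : ℝ) *
        (∑ A ∈ Finset.univ.powersetCard k, blockForm A π (w j)) - c j ^ 2 := fun j => by
      field_simp
    simp only [e2, Finset.sum_sub_distrib]
    rw [meanOverlap_eq, hF, ← Finset.mul_sum, Finset.sum_comm]
    simp only [hL]
  have hv0 : ∀ j, ∑ x, √(π x) * v j x = 0 := by
    intro j
    have : ∀ x, √(π x) * v j x = √(π x) * w j x - c j * π x := fun x => by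
      have := Real.mul_self_sqrt (hπ x)
      simp only [v]
      linear_combination (-c j) * this
    simp only [this, Finset.sum_sub_distrib, ← Finset.mul_sum, h1]
    simp [hc]
  have hvn : ∀ j, ∑ x, v j x ^ 2 = ∑ x, w j x ^ 2 - c j ^ 2 := by
    intro j
    have : ∀ x, v j x ^ 2 = w j x ^ 2 - 2 * c j * (√(π x) * w j x) + c j ^ 2 * π x := fun x => by
      have := Real.mul_self_sqrt (hπ x)
      simp only [v]
      linear_combination (c j ^ 2) * this
    simp only [this, Finset.sum_sub_distrib, Finset.sum_add_distrib, ← Finset.mul_sum, h1]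
    simp only [hc]
    ring
  constructor
  · rw [hdiff]
    exact Finset.sum_nonneg fun j _ => mul_nonneg (by positivity)
      (Finset.sum_nonneg fun A _ => blockForm_nonneg A hπ _)
  · rw [hdiff]
    calc _ ≤ ∑ j, (∑ x, v j x ^ 2 - dirichlet k π (v j)) :=
          Finset.sum_le_sum fun j _ => sum_blockForm_le hk hkn hπ (v j)
      _ ≤ ∑ j, chainLambda k ψ * ∑ x, v j x ^ 2 := Finset.sum_le_sum fun j _ => by
          have := gap_mul_le_dirichlet k (hk.trans hkn) hπ h1 (hv0 j)
          rw [chainLambda]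
          linarith
      _ = _ := by
          rw [← Finset.mul_sum]
          simp only [hvn, Finset.sum_sub_distrib, hw1, hF]

/-! ### The law of one round and the size of one overlap. -/

open scoped ComplexOrder in
lemma expectation_nonneg {n : ℕ} {ρ : QOp n} (hρ : ρ.PosSemidef) (v : Vertex n → ℂ) :
    0 ≤ expectation v ρ := by
  have h := (Complex.le_def.mp (hρ.dotProduct_mulVec_nonneg v)).1
  refine h.trans (le_of_eq ?_)
  rw [expectation]
  congr 1
  simp only [dotProduct, Matrix.mulVec, Finset.mul_sum, Pi.star_apply]
  refine Finset.sum_congr rfl fun x _ => Finset.sum_congr rfl fun y _ => ?_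
  rw [starRingEnd_apply]; ring

lemma roundProb_nonneg {n : ℕ} (k : ℕ) {ρ : QOp n} (hρ : IsDensity ρ) (m : Round n) :
    0 ≤ roundProb k ρ m := by
  rw [roundProb]
  split_ifs
  · exact mul_nonneg (by positivity) (expectation_nonneg hρ.1 _)
  · exact le_rfl

lemma sum_conj_basisVec_mul (b : Pauli) (x y : Bool) :
    ∑ s, (starRingEnd ℂ) (basisVec b s x) * basisVec b s y = if x = y then 1 else 0 := by
  have h2 := ofReal_sqrt_two_mul_self
  have h0 : (Real.sqrt 2 : ℂ) ≠ 0 := fun h => by rw [h] at h2; norm_num at h2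
  have h4 : (Real.sqrt 2 : ℂ)⁻¹ * (Real.sqrt 2 : ℂ)⁻¹ = 1 / 2 := by
    rw [← mul_inv, h2]; norm_num
  have hI2 := Complex.I_sq
  have hconj : (starRingEnd ℂ) (Real.sqrt 2 : ℂ)⁻¹ = (Real.sqrt 2 : ℂ)⁻¹ := by
    rw [map_inv₀, Complex.conj_ofReal]
  generalize hc : (Real.sqrt 2 : ℂ)⁻¹ = c at h4 hconj
  have h2' : c ^ 2 = 1 / 2 := by rw [sq, h4]
  cases b <;> cases x <;> cases y <;>
  · simp [basisVec, div_eq_mul_inv, hc, hconj]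
    try ring_nf
    try simp only [h2', hI2]
    try norm_num

lemma sum_expectation_productVec {n : ℕ} {ρ : QOp n} (hρ : ρ.trace = 1) (b : Fin n → Pauli) :
    ∑ s, expectation (productVec b s) ρ = 1 := by
  have h1 : ∀ x y : Vertex n, ∑ s : Fin n → Bool,
      (starRingEnd ℂ) (productVec b s x) * productVec b s y = if x = y then 1 else 0 := by
    intro x y
    simp only [productVec, map_prod, ← Finset.prod_mul_distrib]
    rw [← Fintype.prod_sum (fun i s => (starRingEnd ℂ) (basisVec (b i) s (x i)) *
      basisVec (b i) s (y i))]
    simp only [sum_conj_basisVec_mul]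
    split_ifs with h
    · subst h; simp
    · obtain ⟨i, hi⟩ := Function.ne_iff.mp h
      exact Finset.prod_eq_zero (Finset.mem_univ i) (if_neg hi)
  have h2 : ∑ s, expectation (productVec b s) ρ = (ρ.trace).re := by
    simp only [expectation, ← Complex.re_sum]
    congr 1
    rw [Finset.sum_comm, Matrix.trace]
    refine Finset.sum_congr rfl fun x _ => ?_
    rw [Finset.sum_comm]
    have : ∀ y, ∑ s, (starRingEnd ℂ) (productVec b s x) * ρ x y * productVec b s y =
        if x = y then ρ x y else 0 := by
      intro y
      rw [show (if x = y then ρ x y else 0) = ρ x y * if x = y then 1 else 0 by simp, ← h1,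
        Finset.mul_sum]
      exact Finset.sum_congr rfl fun s _ => by ring
    simp [this]
  rw [h2, hρ]; simp

lemma card_bases {n : ℕ} (A : Finset (Fin n)) :
    ∑ b : Fin n → Pauli, (if ∀ i, i ∉ A → b i = Pauli.Z then (1 : ℝ) else 0) = 3 ^ A.card := by
  have h1 : ∀ b : Fin n → Pauli, (if ∀ i, i ∉ A → b i = Pauli.Z then (1 : ℝ) else 0) =
      ∏ i, if i ∈ A ∨ b i = Pauli.Z then 1 else 0 := by
    intro b
    rw [Finset.prod_ite_zero]
    simp [or_iff_not_imp_left]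
  simp only [h1]
  rw [← Fintype.prod_sum (fun i b => if i ∈ A ∨ b = Pauli.Z then (1 : ℝ) else 0)]
  have h2 : ∀ i, ∑ b, (if i ∈ A ∨ b = Pauli.Z then (1 : ℝ) else 0) = if i ∈ A then 3 else 1 := by
    intro i
    rw [sum_pauli]
    by_cases h : i ∈ A
    · simp [h]; norm_num
    · simp [h]
  simp only [h2]
  rw [Finset.prod_ite_mem, Finset.univ_inter, Finset.prod_const]

lemma sum_roundProb {n k : ℕ} (hkn : k ≤ n) {ρ : QOp n} (hρ : IsDensity ρ) :
    ∑ m, roundProb k ρ m = 1 := by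
  have hC : (n.choose k : ℝ) ≠ 0 := by
    have := Nat.choose_pos hkn
    positivity
  rw [Fintype.sum_prod_type]
  have h1 : ∀ A : Finset (Fin n), ∑ m : (Fin n → Pauli) × (Fin n → Bool), roundProb k ρ (A, m) =
      if A.card = k then 1 / (n.choose k : ℝ) else 0 := by
    intro A
    rw [Fintype.sum_prod_type]
    split_ifs with h
    · have : ∀ b, ∑ s, roundProb k ρ (A, b, s) = 1 / (n.choose k : ℝ) * (1 / 3 ^ k) *
          if ∀ i, i ∉ A → b i = Pauli.Z then (1 : ℝ) else 0 := by
        intro b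
        simp only [roundProb, h, true_and]
        split_ifs
        · rw [← Finset.mul_sum]
          congr 1
          exact sum_expectation_productVec hρ.2 b
        · simp
      simp only [this]
      rw [← Finset.mul_sum, card_bases, h]
      field_simp
    · exact Finset.sum_eq_zero fun b _ => Finset.sum_eq_zero fun s _ => by simp [roundProb, h]
  simp only [h1]
  rw [← Finset.sum_filter, Finset.univ_filter_card_eq, Finset.sum_const, Finset.card_powersetCard,
    Finset.card_univ, Fintype.card_fin, nsmul_eq_mul]
  field_simp

lemma sum_norm_shadowEntry_le (b : Pauli) (s a : Bool) : ∑ a', ‖shadowEntry b s a a'‖ ≤ 2 := by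
  have h2 := ofReal_sqrt_two_mul_self
  have h0 : (Real.sqrt 2 : ℂ) ≠ 0 := fun h => by rw [h] at h2; norm_num at h2
  have h4 : (Real.sqrt 2 : ℂ)⁻¹ * (Real.sqrt 2 : ℂ)⁻¹ = 1 / 2 := by
    rw [← mul_inv, h2]; norm_num
  have h3 : (Real.sqrt 2 : ℝ)⁻¹ * (Real.sqrt 2 : ℝ)⁻¹ = 1 / 2 := by
    rw [← mul_inv, Real.mul_self_sqrt (by norm_num)]; norm_num
  have hconj : (starRingEnd ℂ) (Real.sqrt 2 : ℂ)⁻¹ = (Real.sqrt 2 : ℂ)⁻¹ := by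
    rw [map_inv₀, Complex.conj_ofReal]
  have hn : ‖(Real.sqrt 2 : ℂ)⁻¹‖ = (Real.sqrt 2)⁻¹ := by
    rw [norm_inv, Complex.norm_real, Real.norm_of_nonneg (Real.sqrt_nonneg _)]
  generalize (Real.sqrt 2 : ℝ)⁻¹ = r at h3 hn
  generalize hc : (Real.sqrt 2 : ℂ)⁻¹ = c at h4 hconj hn
  have hI := Complex.I_mul_I
  have e1 : ‖(3 * 2⁻¹ - 1 : ℂ)‖ = 1 / 2 := by
    rw [show (3 * 2⁻¹ - 1 : ℂ) = 1 / 2 by norm_num]; simp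
  have e2 : ‖-(3 * (Complex.I * (c * (Complex.I * c)))) - 1‖ = 1 / 2 := by
    rw [show -(3 * (Complex.I * (c * (Complex.I * c)))) - 1 = 1 / 2 by
      linear_combination (-3) * c * c * hI + 3 * h4]
    simp
  have e3 : ‖(3 - 1 : ℂ)‖ = 2 := by rw [show (3 - 1 : ℂ) = 2 by norm_num]; simp
  have hcc : ‖c‖ * ‖c‖ = 1 / 2 := by rw [hn, h3]
  cases b <;> cases s <;> cases a <;>
  · simp [shadowEntry, basisVec, div_eq_mul_inv, hc, hconj]
    try simp [mul_assoc, h4]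
    try simp only [e1, e2, e3, hcc]
    try norm_num

lemma norm_shadowEntry_comm (b : Pauli) (s a a' : Bool) :
    ‖shadowEntry b s a a'‖ = ‖shadowEntry b s a' a‖ := by
  rw [← conj_shadowEntry, RCLike.norm_conj]

/-- Schur's test: the absolute row sums of the tensor product are products of single-qubit row sums,
each at most `2`. -/
lemma abs_localOverlap_le {n : ℕ} (ψ : QVec n) (m : Round n) :
    |localOverlap ψ m| ≤ 2 ^ m.1.card := by
  set a : (m.1 → Bool) → ℝ := fun u => ‖ψ (insertBits m.1 m.2.2 u)‖ with ha
  set M : (m.1 → Bool) → (m.1 → Bool) → ℝ := fun u v =>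
    ∏ i : m.1, ‖shadowEntry (m.2.1 i) (m.2.2 i) (u i) (v i)‖ with hM
  have hM0 : ∀ u v, 0 ≤ M u v := fun u v => Finset.prod_nonneg fun i _ => norm_nonneg _
  have hsymm : ∀ u v, M u v = M v u := fun u v =>
    Finset.prod_congr rfl fun i _ => norm_shadowEntry_comm _ _ _ _
  have hrow : ∀ u, ∑ v, M u v ≤ 2 ^ m.1.card := by
    intro u
    simp only [hM]
    rw [← Fintype.prod_sum (fun (i : m.1) s => ‖shadowEntry (m.2.1 i) (m.2.2 i) (u i) s‖)]
    calc _ ≤ ∏ i : m.1, (2 : ℝ) := Finset.prod_le_prod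
          (fun i _ => Finset.sum_nonneg fun _ _ => norm_nonneg _)
          fun i _ => sum_norm_shadowEntry_le _ _ _
      _ = _ := by simp
  have hnum : |(∑ u : m.1 → Bool, ∑ v : m.1 → Bool,
      (starRingEnd ℂ) (ψ (insertBits m.1 m.2.2 u)) *
        (∏ i : m.1, shadowEntry (m.2.1 i) (m.2.2 i) (u i) (v i)) *
        ψ (insertBits m.1 m.2.2 v)).re| ≤ 2 ^ m.1.card * ∑ u, a u ^ 2 := by
    calc _ ≤ ∑ u, ∑ v, a u * M u v * a v := by
          refine (Complex.abs_re_le_norm _).trans ((norm_sum_le _ _).trans ?_)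
          refine Finset.sum_le_sum fun u _ => (norm_sum_le _ _).trans (le_of_eq ?_)
          refine Finset.sum_congr rfl fun v _ => ?_
          rw [norm_mul, norm_mul, norm_prod, RCLike.norm_conj]
      _ ≤ ∑ u, ∑ v, (1 / 2 * (M u v * a u ^ 2) + 1 / 2 * (M v u * a v ^ 2)) := by
          refine Finset.sum_le_sum fun u _ => Finset.sum_le_sum fun v _ => ?_
          rw [← hsymm u v]
          nlinarith [mul_nonneg (hM0 u v) (sq_nonneg (a u - a v))]
      _ = ∑ u, (∑ v, M u v) * a u ^ 2 := by
          simp only [Finset.sum_add_distrib]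
          rw [Finset.sum_comm (f := fun u v => 1 / 2 * (M v u * a v ^ 2)),
            ← Finset.sum_add_distrib]
          refine Finset.sum_congr rfl fun u _ => ?_
          rw [← Finset.sum_add_distrib, Finset.sum_mul]
          exact Finset.sum_congr rfl fun v _ => by ring
      _ ≤ _ := by
          rw [Finset.mul_sum]
          exact Finset.sum_le_sum fun u _ => mul_le_mul_of_nonneg_right (hrow u) (sq_nonneg _)
  have hden : 0 ≤ ∑ u, a u ^ 2 := Finset.sum_nonneg fun _ _ => sq_nonneg _
  rw [localOverlap, abs_div, abs_of_nonneg (a := ∑ u, _) hden]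
  exact div_le_of_le_mul₀ hden (by positivity) hnum

/-! ### Median of means. -/

lemma length_sub_le_countP {l : List ℝ} (hl : l.Pairwise (· ≤ ·)) {p : ℝ → Prop}
    (hp : ∀ a b, a ≤ b → p a → p b) {m : ℕ} (hm : m < l.length) (h : p l[m]) :
    l.length - m ≤ l.countP (fun a => decide (p a)) := by
  have h1 : (l.drop m).countP (fun a => decide (p a)) = (l.drop m).length := by
    rw [List.countP_eq_length]
    intro a ha
    obtain ⟨i, hi, rfl⟩ := List.mem_iff_getElem.mp ha
    rw [List.getElem_drop]
    rw [List.length_drop] at hi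
    simp only [decide_eq_true_eq]
    refine hp _ _ ?_ h
    rcases Nat.eq_zero_or_pos i with h0 | h0
    · subst h0; simp
    · exact List.pairwise_iff_getElem.mp hl m (m + i) hm (by omega) (by omega)
  have h2 : l.countP (fun a => decide (p a)) = (l.take m).countP (fun a => decide (p a)) +
      (l.drop m).countP (fun a => decide (p a)) := by
    rw [← List.countP_append, List.take_append_drop]
  rw [List.length_drop] at h1
  omega

lemma succ_le_countP {l : List ℝ} (hl : l.Pairwise (· ≤ ·)) {p : ℝ → Prop}
    (hp : ∀ a b, a ≤ b → p b → p a) {m : ℕ} (hm : m < l.length) (h : p l[m]) :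
    m + 1 ≤ l.countP (fun a => decide (p a)) := by
  have h1 : (l.take (m + 1)).countP (fun a => decide (p a)) = (l.take (m + 1)).length := by
    rw [List.countP_eq_length]
    intro a ha
    obtain ⟨i, hi, rfl⟩ := List.mem_iff_getElem.mp ha
    rw [List.getElem_take]
    rw [List.length_take] at hi
    simp only [decide_eq_true_eq]
    refine hp _ _ ?_ h
    rcases Nat.lt_or_ge i m with h0 | h0
    · exact List.pairwise_iff_getElem.mp hl i m (by omega) hm h0
    · have : i = m := by omega
      subst this; simp
  have h2 : l.countP (fun a => decide (p a)) = (l.take (m + 1)).countP (fun a => decide (p a)) +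
      (l.drop (m + 1)).countP (fun a => decide (p a)) := by
    rw [← List.countP_append, List.take_append_drop]
  rw [List.length_take] at h1
  omega

/-- The median is close to `μ` if more than half of the entries are. -/
lemma abs_median_sub_le {K : ℕ} {v : Fin K → ℝ} {μ t : ℝ}
    (h : 2 * (Finset.univ.filter fun j => t < |v j - μ|).card < K) : |median v - μ| ≤ t := by
  set l := (Finset.univ.val.map v).sort (fun a b => a ≤ b) with hl
  have hlen : l.length = K := by rw [hl, Multiset.length_sort]; simp
  have hsort : l.Pairwise (· ≤ ·) := Multiset.pairwise_sort _ _
  have hcount : ∀ p : ℝ → Prop, (∀ a, p a → t < |a - μ|) →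
      l.countP (fun a => decide (p a)) ≤ (Finset.univ.filter fun j => t < |v j - μ|).card := by
    intro p hp
    have e : l.countP (fun a => decide (p a)) = (Finset.univ.filter fun j => p (v j)).card := by
      rw [← Multiset.coe_countP, hl, Multiset.sort_eq, Multiset.countP_map]
      rfl
    rw [e]
    exact Finset.card_le_card fun j hj => by
      simp only [Finset.mem_filter, Finset.mem_univ, true_and] at hj ⊢
      exact hp _ hj
  -- If a middle entry were too large, it and all later entries would be bad, which is at least half
  -- of the `K`.
  have hup : ∀ m, m ≤ K / 2 → ∀ hm : m < l.length, l[m] ≤ μ + t := by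
    intro m hmK hm
    by_contra hc
    have h1 := length_sub_le_countP hsort (p := fun a => μ + t < a)
      (fun a b hab ha => lt_of_lt_of_le ha hab) hm (not_le.mp hc)
    have h2 := hcount (fun a => μ + t < a) fun a ha => lt_of_lt_of_le (by linarith) (le_abs_self _)
    omega
  have hlo : ∀ m, (K - 1) / 2 ≤ m → ∀ hm : m < l.length, μ - t ≤ l[m] := by
    intro m hmK hm
    by_contra hc
    have h1 := succ_le_countP hsort (p := fun a => a < μ - t)
      (fun a b hab hb => lt_of_le_of_lt hab hb) hm (not_le.mp hc)
    have h2 := hcount (fun a => a < μ - t) fun a ha => lt_of_lt_of_le (by linarith) (neg_le_abs _)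
    omega
  have hK : 0 < K := by omega
  have ha : (K - 1) / 2 < l.length := by omega
  have hb : K / 2 < l.length := by omega
  have e : median v = (l[(K - 1) / 2] + l[K / 2]) / 2 := by
    rw [median, ← hl, List.getD_eq_getElem _ _ ha, List.getD_eq_getElem _ _ hb]
  rw [e, abs_le]
  have h1 := hup _ (by omega) ha
  have h2 := hup _ le_rfl hb
  have h3 := hlo _ le_rfl ha
  have h4 := hlo _ (by omega) hb
  constructor <;> linarith

/-- Marginalization of independent variables along an injection of the index sets. -/
lemma sum_prod_weight_comp {Λ ι κ : Type*} [Fintype Λ] [Fintype ι] [Fintype κ] [DecidableEq ι]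
    [DecidableEq κ] {q : Λ → ℝ}
    (hq : ∑ a, q a = 1) {e : κ → ι} (he : Function.Injective e) (G : (κ → Λ) → ℝ) :
    ∑ ω : ι → Λ, (∏ i, q (ω i)) * G (ω ∘ e) = ∑ u : κ → Λ, (∏ i, q (u i)) * G u := by
  let E : κ ⊕ ((Set.range e)ᶜ : Set ι) ≃ ι :=
    (Equiv.sumCongr (Equiv.ofInjective e he) (Equiv.refl _)).trans (Equiv.Set.sumCompl _)
  have hE : ∀ j, E (Sum.inl j) = e j := fun j => by simp [E]
  have h1 : ∑ ω : ι → Λ, (∏ i, q (ω i)) * G (ω ∘ e) =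
      ∑ ω : κ ⊕ ((Set.range e)ᶜ : Set ι) → Λ, (∏ i, q (ω i)) * G (fun j => ω (Sum.inl j)) := by
    rw [← (Equiv.arrowCongr E (Equiv.refl Λ)).sum_comp]
    refine Finset.sum_congr rfl fun ω _ => ?_
    congr 1
    · rw [← E.prod_comp]; simp
    · congr 1; ext j; simp [← hE]
  rw [h1, ← (Equiv.sumArrowEquivProdArrow _ _ _).symm.sum_comp, Fintype.sum_prod_type]
  refine Finset.sum_congr rfl fun u _ => ?_
  have h2 : ∀ u' : ((Set.range e)ᶜ : Set ι) → Λ,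
      (∏ i, q ((Equiv.sumArrowEquivProdArrow κ ((Set.range e)ᶜ : Set ι) Λ).symm (u, u') i)) *
        G (fun j => (Equiv.sumArrowEquivProdArrow κ ((Set.range e)ᶜ : Set ι) Λ).symm (u, u')
          (Sum.inl j)) = (∏ i, q (u i)) * G u * ∏ i, q (u' i) := by
    intro u'
    rw [Fintype.prod_sum_type]
    simp only [Equiv.sumArrowEquivProdArrow_symm_apply_inl,
      Equiv.sumArrowEquivProdArrow_symm_apply_inr]
    ring
  simp only [h2]
  rw [← Finset.mul_sum, ← Fintype.prod_sum (fun (_ : ((Set.range e)ᶜ : Set ι)) a => q a)]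
  simp [hq]

lemma batchMean_eq {T K : ℕ} (w : Fin T → ℝ) (e : Fin K × Fin (T / K) → Fin T)
    (he : ∀ z, (e z : ℕ) = z.1 * (T / K) + z.2) (j : Fin K) :
    batchMean K w j = (∑ i, w (e (j, i))) / ((T / K : ℕ) : ℝ) := by
  rw [batchMean]
  congr 1
  symm
  refine Finset.sum_bij (fun i _ => e (j, i)) ?_ ?_ ?_ fun _ _ => rfl
  · intro i _
    simp only [Finset.mem_filter, Finset.mem_univ, true_and, he, add_mul, one_mul]
    omega
  · intro a _ b _ h
    have := congrArg Fin.val h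
    simp only [he] at this
    exact Fin.ext (by omega)
  · intro s hs
    simp only [Finset.mem_filter, Finset.mem_univ, true_and, add_mul, one_mul] at hs
    refine ⟨⟨s - j * (T / K), by omega⟩, Finset.mem_univ _, Fin.ext ?_⟩
    rw [he]
    simp only
    omega

/-- The failure probability of the median of means decays exponentially in the number of batches. -/
lemma median_of_means {Λ : Type*} [Fintype Λ] {q φ : Λ → ℝ} (hq0 : ∀ a, 0 ≤ q a)
    (hq : ∑ a, q a = 1) {μ v t : ℝ} (hμ : ∑ a, q a * φ a = μ)
    (hv : ∑ a, q a * φ a ^ 2 ≤ v) (ht : 0 < t) {T K : ℕ}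
    (hB : 16 * v ≤ ((T / K : ℕ) : ℝ) * t ^ 2) (hv0 : 0 < v) :
    1 - (1 / 2) ^ K ≤ ∑ ω ∈ Finset.univ.filter
      (fun ω : Fin T → Λ => |median (batchMean K fun s => φ (ω s)) - μ| ≤ t), ∏ s, q (ω s) := by
  set B := T / K with hBd
  have hB0 : (0 : ℝ) < (B : ℝ) := by
    by_contra hc
    have : (B : ℝ) * t ^ 2 ≤ 0 := mul_nonpos_of_nonpos_of_nonneg (not_lt.mp hc) (sq_nonneg _)
    linarith
  have hlt : ∀ z : Fin K × Fin B, (z.1 : ℕ) * B + z.2 < T := by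
    intro z
    have h1 := z.1.2
    have h2 := z.2.2
    have h3 : (z.1 + 1 : ℕ) * B ≤ K * B := Nat.mul_le_mul_right _ h1
    have h4 : K * B ≤ T := Nat.mul_div_le T K
    rw [add_mul, one_mul] at h3
    omega
  let e : Fin K × Fin B → Fin T := fun z => ⟨(z.1 : ℕ) * B + z.2, hlt z⟩
  have he : Function.Injective e := by
    rintro ⟨a, b⟩ ⟨c, d⟩ h
    have h' : (a : ℕ) * B + b = c * B + d := congrArg Fin.val h
    have hb := b.2
    have hd := d.2
    have h1 : (a : ℕ) = c := by
      rcases lt_trichotomy (a : ℕ) c with hlt' | heq | hlt'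
      · have := Nat.mul_le_mul_right B (Nat.succ_le_of_lt hlt')
        rw [Nat.succ_mul] at this
        omega
      · exact heq
      · have := Nat.mul_le_mul_right B (Nat.succ_le_of_lt hlt')
        rw [Nat.succ_mul] at this
        omega
    rw [h1] at h'
    ext1
    · exact Fin.ext h1
    · exact Fin.ext (by simpa using h')
  -- The squared batch error in units of `t`; a bad batch has `Z ≥ 1`.
  let Z : (Fin B → Λ) → ℝ := fun u => ((∑ i, (φ (u i) - μ)) / (B * t)) ^ 2
  have hbm : ∀ (ω : Fin T → Λ) j, ((batchMean K (fun s => φ (ω s)) j - μ) / t) ^ 2 =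
      Z fun i => ω (e (j, i)) := by
    intro ω j
    have hbe : batchMean K (fun s => φ (ω s)) j = (∑ i, φ (ω (e (j, i)))) / (B : ℝ) :=
      batchMean_eq (fun s => φ (ω s)) e (fun z => rfl) j
    rw [hbe]
    simp only [Z, Finset.sum_sub_distrib, Finset.sum_const, Finset.card_univ, Fintype.card_fin,
      nsmul_eq_mul]
    congr 1
    field_simp
  have hZ0 : ∀ u, 0 ≤ Z u := fun u => sq_nonneg _
  -- A Markov bound for the product of the factors `1 + 8 Z`: failure needs at least `K / 2` bad
  -- batches, each contributing a factor `9`, so the product is at least `3 ^ K`.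
  have hfail : ∀ ω : Fin T → Λ, ¬ |median (batchMean K fun s => φ (ω s)) - μ| ≤ t →
      1 ≤ (∏ j, (1 + 8 * Z fun i => ω (e (j, i)))) / 3 ^ K := by
    intro ω hω
    have hcard := mt abs_median_sub_le hω
    set S := Finset.univ.filter fun j => t < |batchMean K (fun s => φ (ω s)) j - μ|
    rw [one_le_div (by positivity)]
    have h1 : (9 : ℝ) ^ S.card ≤ ∏ j, (1 + 8 * Z fun i => ω (e (j, i))) := by
      have h2 : ∏ j ∈ S, (9 : ℝ) ≤ ∏ j ∈ S, (1 + 8 * Z fun i => ω (e (j, i))) := by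
        refine Finset.prod_le_prod (fun _ _ => by norm_num) fun j hj => ?_
        have hj' := (Finset.mem_filter.mp hj).2
        rw [← hbm, div_pow]
        have : 1 ≤ (batchMean K (fun s => φ (ω s)) j - μ) ^ 2 / t ^ 2 := by
          rw [one_le_div (by positivity), ← sq_abs (_ - μ)]
          exact pow_le_pow_left₀ ht.le hj'.le 2
        linarith
      rw [Finset.prod_const] at h2
      have h3 : ∀ j, 1 ≤ 1 + 8 * Z fun i => ω (e (j, i)) := fun j => by
        have := hZ0 fun i => ω (e (j, i))
        linarith
      rw [← Finset.prod_mul_prod_compl S]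
      refine h2.trans (le_mul_of_one_le_right
        (Finset.prod_nonneg fun j _ => zero_le_one.trans (h3 j)) ?_)
      exact (Finset.prod_const_one (s := Sᶜ)).symm.trans_le
        (Finset.prod_le_prod (fun _ _ => zero_le_one) fun j _ => h3 j)
    refine le_trans ?_ h1
    calc (3 : ℝ) ^ K ≤ 3 ^ (2 * S.card) := pow_le_pow_right₀ (by norm_num) (by omega)
      _ = 9 ^ S.card := by rw [pow_mul]; norm_num
  -- By `hB` the mean of `Z` is at most `1 / 16`. Independent batches then give `(3 / 2) ^ K`, and
  -- `(3 / 2) ^ K / 3 ^ K = (1 / 2) ^ K`.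
  have hEZ : ∑ u : Fin B → Λ, (∏ i, q (u i)) * (1 + 8 * Z u) ≤ 3 / 2 := by
    have h1 := sum_prod_weight_mul_sum_sq B q (fun a => φ a - μ) hq (by
      simp only [mul_sub, Finset.sum_sub_distrib, ← Finset.sum_mul, hμ, hq]; ring)
    have h2 : ∑ a, q a * (φ a - μ) ^ 2 ≤ v := by
      have : ∀ a, q a * (φ a - μ) ^ 2 = q a * φ a ^ 2 - 2 * μ * (q a * φ a) + μ ^ 2 * q a :=
        fun a => by ring
      simp only [this, Finset.sum_add_distrib, Finset.sum_sub_distrib, ← Finset.mul_sum, hμ, hq]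
      nlinarith [sq_nonneg μ]
    have h3 : ∀ u : Fin B → Λ, (∏ i, q (u i)) * (1 + 8 * Z u) = (∏ i, q (u i)) +
        8 / (B * t) ^ 2 * ((∏ i, q (u i)) * (∑ i, (φ (u i) - μ)) ^ 2) := fun u => by
      simp only [Z, div_pow]; ring
    simp only [h3, Finset.sum_add_distrib, ← Finset.mul_sum, sum_prod_weight B q hq, h1]
    have h4 : 8 / (B * t) ^ 2 * (B * ∑ a, q a * (φ a - μ) ^ 2) ≤ 1 / 2 := by
      rw [div_mul_eq_mul_div, div_le_iff₀ (by positivity)]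
      have h5 := mul_le_mul_of_nonneg_left h2 hB0.le
      have h6 := mul_le_mul_of_nonneg_left hB hB0.le
      nlinarith
    linarith
  have hprod : ∑ ω : Fin T → Λ, (∏ s, q (ω s)) * ∏ j, (1 + 8 * Z fun i => ω (e (j, i))) ≤
      (3 / 2) ^ K := by
    have h1 := sum_prod_weight_comp hq he
      (fun u : Fin K × Fin B → Λ => ∏ j, (1 + 8 * Z fun i => u (j, i)))
    simp only [Function.comp_apply] at h1
    rw [h1, ← (Equiv.curry (Fin K) (Fin B) Λ).symm.sum_comp]
    simp only [Equiv.curry_symm_apply, Function.uncurry, Fintype.prod_prod_type,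
      ← Finset.prod_mul_distrib]
    rw [← Fintype.prod_sum (fun (_ : Fin K) (u : Fin B → Λ) => (∏ i, q (u i)) * (1 + 8 * Z u)),
      Finset.prod_const, Finset.card_univ, Fintype.card_fin]
    refine pow_le_pow_left₀ (Finset.sum_nonneg fun u _ => mul_nonneg
      (Finset.prod_nonneg fun _ _ => hq0 _) ?_) hEZ K
    have := hZ0 u
    linarith
  have htot := Finset.sum_filter_add_sum_filter_not Finset.univ
    (fun ω : Fin T → Λ => |median (batchMean K fun s => φ (ω s)) - μ| ≤ t) fun ω => ∏ s, q (ω s)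
  rw [sum_prod_weight T q hq] at htot
  have hbad : ∑ ω ∈ Finset.univ.filter
      (fun ω : Fin T → Λ => ¬ |median (batchMean K fun s => φ (ω s)) - μ| ≤ t), ∏ s, q (ω s) ≤
      (1 / 2) ^ K := by
    calc _ ≤ ∑ ω ∈ Finset.univ.filter
          (fun ω : Fin T → Λ => ¬ |median (batchMean K fun s => φ (ω s)) - μ| ≤ t),
          (∏ s, q (ω s)) * ((∏ j, (1 + 8 * Z fun i => ω (e (j, i)))) / 3 ^ K) :=
          Finset.sum_le_sum fun ω hω => le_mul_of_one_le_right
            (Finset.prod_nonneg fun _ _ => hq0 _) (hfail ω (Finset.mem_filter.mp hω).2)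
      _ ≤ ∑ ω : Fin T → Λ,
          (∏ s, q (ω s)) * ((∏ j, (1 + 8 * Z fun i => ω (e (j, i)))) / 3 ^ K) :=
          Finset.sum_le_sum_of_subset_of_nonneg (Finset.filter_subset _ _) fun ω _ _ =>
            mul_nonneg (Finset.prod_nonneg fun _ _ => hq0 _) (div_nonneg
              (Finset.prod_nonneg fun j _ => by
                have := hZ0 fun i => ω (e (j, i))
                linarith) (by positivity))
      _ ≤ (3 / 2) ^ K / 3 ^ K := by
          simp only [mul_div_assoc']
          rw [← Finset.sum_div]
          gcongr
      _ = (1 / 2) ^ K := by rw [← div_pow]; norm_num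
  linarith

lemma sum_roundProb_mul_sq_le {n k : ℕ} (hkn : k ≤ n) {ρ : QOp n} (hρ : IsDensity ρ) (ψ : QVec n) :
    ∑ m, roundProb k ρ m * localOverlap ψ m ^ 2 ≤ 2 ^ (2 * k) := by
  calc _ ≤ ∑ m, roundProb k ρ m * 2 ^ (2 * k) := by
        refine Finset.sum_le_sum fun m _ => ?_
        by_cases h : m.1.card = k
        · refine mul_le_mul_of_nonneg_left ?_ (roundProb_nonneg k hρ m)
          have := abs_localOverlap_le ψ m
          rw [h] at this
          rw [mul_comm 2 k, pow_mul, ← sq_abs]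
          exact pow_le_pow_left₀ (abs_nonneg _) this 2
        · simp [roundProb, h]
    _ = _ := by rw [← Finset.sum_mul, sum_roundProb hkn hρ, one_mul]

/-- Concentration of the estimate around the mean of the local overlap. -/
lemma le_dataProb {n k T : ℕ} (hkn : k ≤ n) {ρ : QOp n} (hρ : IsDensity ρ) {ψ : QVec n}
    {τ r C ε δ cb : ℝ} (hτ : 0 < τ) (hτr : τ ≤ C * r) (hε : 0 < ε) (hε1 : ε < 1)
    (hδ : 0 < δ) (hδ1 : δ < 1) (hcb : 0 < cb) (hcbτ : cb / τ < 1)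
    (hT : 68 * C ^ 2 * (2 ^ (2 * k) * r ^ 2 / (cb * ε) ^ 2 * Real.log (2 / δ)) ≤ (T : ℝ)) :
    1 - δ ≤ dataProb k T ρ fun data =>
      |estimate ⌈2 * Real.log (2 / δ)⌉₊ ψ data - meanOverlap k ψ ρ| ≤ cb * ε / τ := by
  set L := Real.log (2 / δ) with hL
  set K := ⌈2 * L⌉₊ with hK
  have hlog2 : 0.6931471803 < Real.log 2 := Real.log_two_gt_d9
  have hL2 : Real.log 2 < L := Real.log_lt_log (by norm_num) (by rw [lt_div_iff₀ hδ]; linarith)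
  have hKL : 2 * L ≤ K := Nat.le_ceil _
  -- Rounding up adds less than one, and `2 * L` exceeds `2 * log 2 > 1`.
  have hKL' : (K : ℝ) ≤ 4 * L := by
    have := Nat.ceil_lt_add_one (show 0 ≤ 2 * L by linarith)
    linarith
  have hK0 : (0 : ℝ) < K := by linarith
  set Y := 2 ^ (2 * k) * τ ^ 2 / (cb * ε) ^ 2 with hY
  have hY1 : 1 ≤ Y := by
    rw [hY, one_le_div (by positivity)]
    have h1 : cb * ε ≤ τ := by
      rw [div_lt_one hτ] at hcbτ
      nlinarith
    have h2 : (cb * ε) ^ 2 ≤ τ ^ 2 := pow_le_pow_left₀ (by positivity) h1 2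
    have h3 : (1 : ℝ) ≤ 2 ^ (2 * k) := one_le_pow₀ (by norm_num)
    nlinarith [sq_nonneg τ]
  have hTY : 17 * Y * K ≤ T := by
    have h1 : Y ≤ C ^ 2 * (2 ^ (2 * k) * r ^ 2 / (cb * ε) ^ 2) := by
      rw [hY, mul_div_assoc', div_le_div_iff_of_pos_right (by positivity)]
      have : τ ^ 2 ≤ (C * r) ^ 2 := pow_le_pow_left₀ hτ.le hτr 2
      have h3 : (0 : ℝ) ≤ 2 ^ (2 * k) := by positivity
      nlinarith [mul_le_mul_of_nonneg_left this h3]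
    calc 17 * Y * K ≤ 17 * Y * (4 * L) := mul_le_mul_of_nonneg_left hKL' (by linarith)
      _ = 68 * L * Y := by ring
      _ ≤ 68 * L * (C ^ 2 * (2 ^ (2 * k) * r ^ 2 / (cb * ε) ^ 2)) :=
        mul_le_mul_of_nonneg_left h1 (by linarith)
      _ = 68 * C ^ 2 * (2 ^ (2 * k) * r ^ 2 / (cb * ε) ^ 2 * L) := by ring
      _ ≤ T := hT
  -- One of the `17` copies of `Y ≥ 1` pays for rounding the batch size down; together with `K ≤ 4
  -- L` this is the constant `68`.
  have hB : 16 * Y ≤ ((T / K : ℕ) : ℝ) := by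
    have h1 : (T : ℝ) / K < ((T / K : ℕ) : ℝ) + 1 := by
      rw [← Nat.floor_div_eq_div (K := ℝ)]
      exact Nat.lt_floor_add_one _
    have h2 : 17 * Y ≤ (T : ℝ) / K := by rwa [le_div_iff₀ hK0]
    linarith
  have h := median_of_means (q := roundProb k ρ) (φ := localOverlap ψ) (roundProb_nonneg k hρ)
    (sum_roundProb hkn hρ) rfl (sum_roundProb_mul_sq_le hkn hρ ψ) (t := cb * ε / τ) (by positivity)
    (T := T) (K := K) (by
      have : ((2 : ℝ) ^ (2 * k)) = Y * (cb * ε / τ) ^ 2 := by rw [hY]; field_simp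
      rw [this, ← mul_assoc]
      exact mul_le_mul_of_nonneg_right hB (sq_nonneg _)) (by positivity)
  have hpow : (1 / 2 : ℝ) ^ K ≤ δ := by
    have h1 : (1 / 2 : ℝ) ^ K = Real.exp (-(Real.log 2 * K)) := by
      rw [Real.exp_neg, mul_comm, Real.exp_nat_mul, Real.exp_log (by norm_num), one_div, inv_pow]
    have h2 : Real.exp (-L) = δ / 2 := by
      rw [Real.exp_neg, hL, Real.exp_log (by positivity), inv_div]
    have h3 : Real.exp (-(Real.log 2 * K)) ≤ Real.exp (-L) := by
      refine Real.exp_le_exp.mpr ?_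
      have : Real.log 2 * (2 * L) ≤ Real.log 2 * K :=
        mul_le_mul_of_nonneg_left hKL (by linarith)
      nlinarith
    rw [h1]
    linarith
  rw [dataProb]
  refine le_trans (by linarith) h

end GLEP

end

/-! ### The main theorem. -/

theorem theorem2 (cu' cu cl α : ℝ) (hcl : 0 < cl) (hα : 0 < α) :
    ∃ C : ℝ, 0 < C ∧
      ∀ (n k : ℕ), 1 ≤ k → k ≤ n →
      ∀ ψ : GLEP.QVec n, ‖ψ‖ = 1 →
        GLEP.HasGLEP cu' cu cl α k (GLEP.distribution ψ) →
        -- the mixing time is `O(n² / k)`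
        (GLEP.chainLambda k ψ < 1 ∧ GLEP.mixingTime k ψ ≤ C * ((n : ℝ) ^ 2 / (k : ℝ))) ∧
        ∀ ρ : GLEP.QOp n, GLEP.IsDensity ρ →
          -- the bias of the local overlap is between `0` and `(1 - 1/τ) (1 - F)`
          (0 ≤ GLEP.meanOverlap k ψ ρ - GLEP.fidelity ψ ρ ∧
            GLEP.meanOverlap k ψ ρ - GLEP.fidelity ψ ρ ≤
              (1 - 1 / GLEP.mixingTime k ψ) * (1 - GLEP.fidelity ψ ρ)) ∧
          -- the number of copies that suffices for accuracy `ε` and confidence `1 - δ`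
          ∀ ε δ cb : ℝ, 0 < ε → ε < 1 → 0 < δ → δ < 1 →
            0 < cb → cb / GLEP.mixingTime k ψ < 1 →
            GLEP.meanOverlap k ψ ρ - GLEP.fidelity ψ ρ ≤
              (1 - cb / GLEP.mixingTime k ψ) * ε →
            ∀ T : ℕ,
              C * (2 ^ (2 * k) * ((n : ℝ) ^ 2 / (k : ℝ)) ^ 2 / (cb * ε) ^ 2 *
                Real.log (2 / δ)) ≤ (T : ℝ) →
              1 - δ ≤ GLEP.dataProb k T ρ fun data =>
                |GLEP.estimate ⌈2 * Real.log (2 / δ)⌉₊ ψ data - GLEP.fidelity ψ ρ| ≤ ε := by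
  obtain ⟨C₁, hC₁, hmix⟩ := GLEP.exists_mixingTime_le cu' cu cl α hcl hα
  refine ⟨C₁ + 68 * C₁ ^ 2, by positivity, fun n k hk hkn ψ hψ hG => ?_⟩
  obtain ⟨hlam, hτ⟩ := hmix n k hk hkn ψ (by rw [GLEP.sum_distribution, hψ, one_pow]) hG
  have hr : (0 : ℝ) ≤ (n : ℝ) ^ 2 / k := by positivity
  refine ⟨⟨hlam, hτ.trans (mul_le_mul_of_nonneg_right (by nlinarith [sq_nonneg C₁]) hr)⟩,
    fun ρ hρ => ?_⟩
  obtain ⟨hb0, hb1⟩ := GLEP.bias_bounds hk hkn hψ hρ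
  have hτ0 : 0 < GLEP.mixingTime k ψ := one_div_pos.mpr (by linarith)
  refine ⟨⟨hb0, ?_⟩, fun ε δ cb hε hε1 hδ hδ1 hcb hcbτ hbias T hT => ?_⟩
  · rw [GLEP.mixingTime, one_div_one_div]
    linarith
  · have hfin := GLEP.le_dataProb hkn hρ (ψ := ψ) (k := k) (T := T) hτ0 hτ hε hε1 hδ hδ1 hcb
      hcbτ (le_trans (mul_le_mul_of_nonneg_right (by linarith) ?_) hT)
    · refine hfin.trans (Finset.sum_le_sum_of_subset_of_nonneg ?_ fun _ _ _ =>
        Finset.prod_nonneg fun _ _ => GLEP.roundProb_nonneg k hρ _)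
      intro data hdata
      simp only [Finset.mem_filter, Finset.mem_univ, true_and] at hdata ⊢
      rw [abs_le] at hdata ⊢
      -- The allowed bias and the statistical error `cb * ε / τ` add up to `ε`; from below, the bias
      -- only helps because it is nonnegative.
      have e : (1 - cb / GLEP.mixingTime k ψ) * ε = ε - cb * ε / GLEP.mixingTime k ψ := by ring
      rw [e] at hbias
      constructor <;> linarith
    · have := Real.log_nonneg (show (1 : ℝ) ≤ 2 / δ by rw [le_div_iff₀ hδ]; linarith)
      positivity
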